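/- **Setting.** Let $d\ge 1$, let $(\Omega,\mathcal F,P)$ be a probability space with expectation $\langle\cdot\rangle$, on which $\mathbf Z^d$ acts by measure preserving maps $\tau_x$ with $\tau_x\tau_y=\tau_{x+y}$, $\tau_0=\mathrm{id}$, and let $\mathbf a$ be a measurable function from $\Omega$ to the symmetric real $d\times d$ matrices with $\lambda I_d\le \mathbf a(\omega)\le\Lambda I_d$ for all $\omega$, where $\lambda,\Lambda>0$. Put $\nabla_i\phi(x)=\phi(x+\mathbf e_i)-\phi(x)$, $\nabla_i^*\phi(x)=\phi(x-\mathbf e_i)-\phi(x)$. For $\eta>0$ let $u(\cdot,\eta,\omega)\in\ell^2(\mathbf Z^d)$ solve $\eta u(x)+\nabla^*\mathbf a(\tau_x\omega)\nabla u(x)=\delta(x)$, and let $G_{\mathbf a,\eta}(x)=\langle u(x,\eta,\cdot)\rangle$ be the averaged Green's function. For $\xi\in\mathbf C^d$ put $\partial_{j,\xi}\psi(\omega)=e^{-i\xi_j}\psi(\tau_{\mathbf e_j}\omega)-\psi(\omega)$, $\partial^*_{j,\xi}\psi(\omega)=e^{i\xi_j}\psi(\tau_{-\mathbf e_j}\omega)-\psi(\omega)$,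 and $\mathsf P\psi=\psi-\langle\psi\rangle$. Let the row vector $\Phi(\xi,\eta,\cdot)$, with entries in $L^2(\Omega)$, solve $\eta\Phi+\mathsf P\,\partial_\xi^*\mathbf a\,\partial_\xi\Phi=-\mathsf P\,\partial_\xi^*\mathbf a$ and set $q(\xi,\eta)=\langle\mathbf a\rangle+\langle\mathbf a\,\partial_\xi\Phi(\xi,\eta,\cdot)\rangle$, a $d\times d$ matrix. (For real $\xi$, and for complex $\xi$ with $|\Im\xi|$ at most a small multiple of $\sqrt{\lambda\eta}/\Lambda$, the solution exists and is unique, and $q$ is analytic in $\xi$.) A function $f$ on $[-\pi,\pi]^d$ is in $L^p_w$ with norm at most $B$ if $\mathrm{meas}\{|f|>\mu\}\le B^p/\mu^p$ for all $\mu>0$ (and $|f|\le B$ almost everywhere if $p=\infty$). Below, $p=d/s$ means $p=\infty$ if $s\le 0$. **Hypothesis (improved Fourier-space estimates).** There are positive constants $\alpha_0\le 1$, $C_1,C_2,c,C_0$ and, for each $\delta\in(0,1]$, positive constants $\alpha_\delta,C_\delta$ such that: 1. $\|q(\xi',\eta')-q(\xi,\eta)\|\le C_1\Lambda\big[|\xi'-\xi|^{\alpha_0}+|(\eta'-\eta)/\Lambda|^{\alpha_0/2}\big]$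 whenever $0<\eta\le\eta'\le\Lambda$ and $\xi,\xi'\in\mathbf C^d$ satisfy $|\Im\xi|+|\Im\xi'|\le C_2\sqrt{\eta/\Lambda}$. 2. If $0<\eta\le\Lambda$, $b\in\mathbf R^d$, $|b|\le c\sqrt{\lambda\eta/\Lambda^2}$ and $1\le|m|<d$, then every partial derivative $\partial_\xi^m q_{k,k'}(\xi+ib,\eta)$ is in $L^p_w([-\pi,\pi]^d)$ with $p=d/(|m|-\alpha_0)$ and norm at most $C_0\Lambda$. 3. For $\eta,b$ as in 2, $|m|=d-1$, $0<\delta\le1$ and $\rho\in\mathbf R^d$ with $|\rho|\le1$, the function $\partial_\xi^m[q_{k,k'}(\xi+\rho+ib,\eta)-q_{k,k'}(\xi+ib,\eta)]/|\rho|^{1-\delta}$ is in $L^p_w([-\pi,\pi]^d)$ with $p=d/(d-\delta-\alpha_\delta)$ and norm at most $C_\delta\Lambda$. **Theorem 3.2.** Under this hypothesis the limit $q(0,0)=\lim q(\xi,\eta)$ as $(\xi,\eta)\to(0,0)$, $\xi\in\mathbf R^d$, $\eta>0$, exists. Let $e_j(\xi)=e^{-i\xi_j}-1$ and $$G_{\mathbf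 a_{\rm hom},\eta}(x)=\frac1{(2\pi)^d}\int_{[-\pi,\pi]^d}\frac{e^{-i\xi\cdot x}}{\eta+e(\xi)^*q(0,0)e(\xi)}\,d\xi .$$ There are positive constants $\alpha\le1$, $\gamma$, $C$ and, for each $\delta\in(0,1]$, constants $0<\alpha'_\delta<\delta$ and $C'_\delta>0$, all depending only on $d$, $\Lambda/\lambda$ and the constants in the hypothesis, such that for $0<\eta\le\Lambda$: * if $d\ge2$, then $\displaystyle |G_{\mathbf a,\eta}(x)-G_{\mathbf a_{\rm hom},\eta}(x)|\le\frac{C}{\Lambda(|x|+1)^{d-2+\alpha}}e^{-\gamma\sqrt{\eta/\Lambda}|x|}$ for $x\in\mathbf Z^d$; * if $d\ge1$, then $\displaystyle |\nabla G_{\mathbf a,\eta}(x)-\nabla G_{\mathbf a_{\rm hom},\eta}(x)|\le\frac{C}{\Lambda(|x|+1)^{d-1+\alpha}}e^{-\gamma\sqrt{\eta/\Lambda}|x|}$ for $x\in\mathbf Z^d$; * if $d\ge1$ and $0<\delta\le1$, then for $x,x'\in\mathbf Z^d$ with $1/2\le(|x'|+1)/(|x|+1)\le2$, $$\big|[\nabla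 G_{\mathbf a,\eta}(x')-\nabla G_{\mathbf a_{\rm hom},\eta}(x')]-[\nabla G_{\mathbf a,\eta}(x)-\nabla G_{\mathbf a_{\rm hom},\eta}(x)]\big|\le|x'-x|^{1-\delta}\frac{C'_\delta}{\Lambda(|x|+1)^{d-\delta+\alpha'_\delta}}e^{-\gamma\sqrt{\eta/\Lambda}|x|}.$$ -/

import Mathlib

open MeasureTheory Filter Topology
open scoped Matrix ENNReal

universe u

noncomputable section

namespace LatticeHomog

/-! ### The lattice `ℤ^d` and its difference operators -/

/-- The integer lattice `ℤ^d`. -/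
abbrev Lattice (d : ℕ) : Type := Fin d → ℤ

/-- The lattice unit vector `e_i`. -/
def unitVec {d : ℕ} (i : Fin d) : Lattice d := Pi.single i 1

/-- The Euclidean length `|x|` of a lattice point. -/
def latNorm {d : ℕ} (x : Lattice d) : ℝ := Real.sqrt (∑ i, (x i : ℝ) ^ 2)

/-- Forward difference `∇_i φ(x) = φ(x + e_i) - φ(x)`. -/
def fwdDiff {d : ℕ} {E : Type*} [AddCommGroup E] (i : Fin d) (φ : Lattice d → E)
    (x : Lattice d) : E :=
  φ (x + unitVec i) - φ x

/-- Its adjoint `∇_i^* φ(x) = φ(x - e_i) - φ(x)`. -/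
def bwdDiff {d : ℕ} {E : Type*} [AddCommGroup E] (i : Fin d) (φ : Lattice d → E)
    (x : Lattice d) : E :=
  φ (x - unitVec i) - φ x

/-- The discrete gradient of a complex-valued lattice function, as a Euclidean vector. -/
def latGrad {d : ℕ} (φ : Lattice d → ℂ) (x : Lattice d) : EuclideanSpace ℂ (Fin d) :=
  WithLp.toLp 2 fun i => fwdDiff i φ x

/-! ### Stationary random environments -/

/-- A probability space on which `ℤ^d` acts by measure preserving translations `τ_x`, together with
a bounded measurable field `a` of symmetric matrices with `lam I ≤ a(ω) ≤ Lam I`. -/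
structure Environment (d : ℕ) : Type (u + 1) where
  Ω : Type u
  [mΩ : MeasurableSpace Ω]
  P : Measure Ω
  [isProb : IsProbabilityMeasure P]
  τ : Lattice d → Ω → Ω
  τ_measurePreserving : ∀ x, MeasurePreserving (τ x) P P
  τ_zero : ∀ ω, τ 0 ω = ω
  τ_add : ∀ x y ω, τ (x + y) ω = τ x (τ y ω)
  lam : ℝ
  Lam : ℝ
  lam_pos : 0 < lam
  Lam_pos : 0 < Lam
  a : Ω → Matrix (Fin d) (Fin d) ℝ
  a_measurable : ∀ i j, Measurable fun ω => a ω i j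
  a_symm : ∀ ω, (a ω).IsSymm
  a_lower : ∀ ω (v : Fin d → ℝ), lam * (v ⬝ᵥ v) ≤ v ⬝ᵥ (a ω *ᵥ v)
  a_upper : ∀ ω (v : Fin d → ℝ), v ⬝ᵥ (a ω *ᵥ v) ≤ Lam * (v ⬝ᵥ v)

attribute [instance] Environment.mΩ Environment.isProb

/-! ### The averaged Green's function -/

/-- `u` is the Green's function with pole at `0` of `η + ∇^* A(x) ∇` on `ℤ^d`: the
square summable solution of `η u(x) + ∇^* A(x) ∇ u(x) = δ(x)`. -/
def IsLatticeGreen {d : ℕ} (A : Lattice d → Matrix (Fin d) (Fin d) ℝ) (η : ℝ)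
    (u : Lattice d → ℝ) : Prop :=
  (Summable fun x => u x ^ 2) ∧
    ∀ x, η * u x + ∑ i, bwdDiff i (fun y => ∑ j, A y i j * fwdDiff j u y) x
      = if x = 0 then 1 else 0

open Classical in
/-- The lattice Green's function; for uniformly elliptic symmetric `A` and `η > 0` it is
the unique `u` with `IsLatticeGreen A η u`. -/
def latticeGreen {d : ℕ} (A : Lattice d → Matrix (Fin d) (Fin d) ℝ) (η : ℝ) : Lattice d → ℝ :=
  if h : ∃ u, IsLatticeGreen A η u then h.choose else 0

/-- `G_{a,η}(x)`: the expectation of the Green's function of `η + ∇^* a(τ_x ω) ∇`. -/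
def Environment.greenAvg {d : ℕ} (E : Environment.{u} d) (η : ℝ) (x : Lattice d) : ℝ :=
  ∫ ω, latticeGreen (fun y => E.a (E.τ y ω)) η x ∂E.P

/-! ### The Fourier multiplier `q(ξ, η)` -/

namespace Environment

variable {d : ℕ} (E : Environment.{u} d)

/-- `∂_{j,ξ} ψ(ω) = e^{-i ξ_j} ψ(τ_{e_j} ω) - ψ(ω)`, for complex `ξ`. -/
def xiDeriv (ξ : EuclideanSpace ℂ (Fin d)) (j : Fin d) (ψ : E.Ω → ℂ) (ω : E.Ω) : ℂ :=
  Complex.exp (-Complex.I * ξ j) * ψ (E.τ (unitVec j) ω) - ψ ω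

/-- `∂^*_{j,ξ} ψ(ω) = e^{i ξ_j} ψ(τ_{-e_j} ω) - ψ(ω)`, for complex `ξ`; the formula is kept
without complex conjugation of `ξ`, so that it is analytic in `ξ`. -/
def xiDerivStar (ξ : EuclideanSpace ℂ (Fin d)) (j : Fin d) (ψ : E.Ω → ℂ) (ω : E.Ω) : ℂ :=
  Complex.exp (Complex.I * ξ j) * ψ (E.τ (-unitVec j) ω) - ψ ω

/-- The projection `P` orthogonal to the constant functions. -/
def proj (ψ : E.Ω → ℂ) (ω : E.Ω) : ℂ := ψ ω - ∫ ω', ψ ω' ∂E.P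

/-- `φ` is the `k`-th component of the square integrable solution `Φ(ξ,η,·)` of
`η Φ + P ∂_ξ^* a ∂_ξ Φ = -P ∂_ξ^* a`. -/
def IsCorrector (ξ : EuclideanSpace ℂ (Fin d)) (η : ℝ) (k : Fin d) (φ : E.Ω → ℂ) : Prop :=
  MemLp φ 2 E.P ∧
    ∀ᵐ ω ∂E.P,
      (η : ℂ) * φ ω
          + E.proj (fun ω' => ∑ i, E.xiDerivStar ξ i
              (fun ω'' => ∑ j, (E.a ω'' i j : ℂ) * E.xiDeriv ξ j φ ω'') ω') ω
        = -E.proj (fun ω' => ∑ i, E.xiDerivStar ξ i (fun ω'' => (E.a ω'' i k : ℂ)) ω') ω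

open Classical in
/-- `Φ_k(ξ,η,·)`. For `η > 0` and `|Im ξ|` at most a small multiple of `√(lam η) / Lam`, the equation
has exactly one solution up to null sets, and it depends analytically on `ξ`. -/
def corrector (ξ : EuclideanSpace ℂ (Fin d)) (η : ℝ) (k : Fin d) : E.Ω → ℂ :=
  if h : ∃ φ, E.IsCorrector ξ η k φ then h.choose else 0

/-- `q(ξ,η) = ⟨a⟩ + ⟨a ∂_ξ Φ(ξ,η,·)⟩`. On the strip of complex `ξ` where the equation for `Φ` is
uniquely solvable this is the analytic continuation of `q(·,η)` from real `ξ`. -/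
def q (ξ : EuclideanSpace ℂ (Fin d)) (η : ℝ) : Matrix (Fin d) (Fin d) ℂ :=
  fun k k' =>
    (∫ ω, (E.a ω k k' : ℂ) ∂E.P)
      + ∫ ω, ∑ j, (E.a ω k j : ℂ) * E.xiDeriv ξ j (E.corrector ξ η k') ω ∂E.P

end Environment

/-! ### Norms and function spaces in Fourier space -/

/-- The complex vector `ξ + i b` with real `ξ`, `b`. -/
def cplx {d : ℕ} (ξ b : EuclideanSpace ℝ (Fin d)) : EuclideanSpace ℂ (Fin d) :=
  WithLp.toLp 2 fun j => (ξ j : ℂ) + Complex.I * (b j : ℂ)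

/-- The Euclidean length of the imaginary part of `ξ ∈ ℂ^d`. -/
def imNorm {d : ℕ} (ξ : EuclideanSpace ℂ (Fin d)) : ℝ := Real.sqrt (∑ j, (ξ j).im ^ 2)

/-- The operator norm of a complex matrix with respect to Euclidean norms. -/
def matNorm {d : ℕ} (M : Matrix (Fin d) (Fin d) ℂ) : ℝ := ‖Matrix.toEuclideanCLM (𝕜 := ℂ) M‖

/-- The cube `[-π, π]^d`. -/
def cube (d : ℕ) : Set (EuclideanSpace ℝ (Fin d)) := {ξ | ∀ j, ξ j ∈ Set.Icc (-Real.pi) Real.pi}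

/-- `f` lies in weak `L^p` of the cube with weak norm at most `B`, i.e.
`meas {|f| > μ} ≤ B^p / μ^p` for `μ > 0`; for `p = ∞` this is the usual `L^∞` bound. -/
def WeakLpLE {d : ℕ} (p : ℝ≥0∞) (B : ℝ) (f : EuclideanSpace ℝ (Fin d) → ℂ) : Prop :=
  AEStronglyMeasurable f (volume.restrict (cube d)) ∧
    if p = ∞ then ∀ᵐ ξ ∂(volume.restrict (cube d)), ‖f ξ‖ ≤ B
    else ∀ μ : ℝ, 0 < μ →
      volume {ξ | ξ ∈ cube d ∧ μ < ‖f ξ‖} ≤ ENNReal.ofReal (B ^ p.toReal / μ ^ p.toReal)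

/-- The partial derivative `∂_{j_1} ⋯ ∂_{j_n} f` at `ξ`; as the sequence `j` varies these are, for
smooth `f`, all the derivatives `∏_j (∂/∂ξ_j)^{m_j} f` with `|m| = n`. -/
def partialDeriv {d n : ℕ} (j : Fin n → Fin d) (f : EuclideanSpace ℝ (Fin d) → ℂ)
    (ξ : EuclideanSpace ℝ (Fin d)) : ℂ :=
  iteratedFDeriv ℝ n f ξ fun i => EuclideanSpace.single (j i) (1 : ℝ)

/-- The improved Fourier-space estimates, with given constants: joint Hölder continuity of `q` with
exponent `α` (constants `C₁`, `C₂`), weak `L^p` bounds on the derivatives of `q` of order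
`1 ≤ n < d` with `p = d / (n - α)` (constant `C`), and weak `L^p` bounds on the Hölder quotients of
order `1 - δ` of the derivatives of order `d - 1`, with `p = d / (d - δ - αd δ)` (constant `Cd δ`),
along `ξ + i b`, `|b| ≤ c √(lam η / Lam²)`. A denominator which is not positive means `p = ∞`. -/
structure FourierEstimates {d : ℕ} (E : Environment.{u} d) (α C₁ C₂ c C : ℝ) (αd Cd : ℝ → ℝ) :
    Prop where
  holder : ∀ η η' : ℝ, 0 < η → η ≤ η' → η' ≤ E.Lam →
    ∀ ξ ξ' : EuclideanSpace ℂ (Fin d), imNorm ξ + imNorm ξ' ≤ C₂ * Real.sqrt (η / E.Lam) →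
      matNorm (E.q ξ' η' - E.q ξ η)
        ≤ C₁ * E.Lam * (‖ξ' - ξ‖ ^ α + |(η' - η) / E.Lam| ^ (α / 2))
  deriv : ∀ η : ℝ, 0 < η → η ≤ E.Lam → ∀ k k' : Fin d,
    ∀ b : EuclideanSpace ℝ (Fin d), ‖b‖ ≤ c * Real.sqrt (E.lam * η / E.Lam ^ 2) →
      ∀ n : ℕ, 1 ≤ n → n < d → ∀ j : Fin n → Fin d,
        WeakLpLE ((d : ℝ≥0∞) / ENNReal.ofReal ((n : ℝ) - α)) (C * E.Lam)
          (partialDeriv j fun ξ => E.q (cplx ξ b) η k k')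
  diff : ∀ η : ℝ, 0 < η → η ≤ E.Lam → ∀ k k' : Fin d,
    ∀ b : EuclideanSpace ℝ (Fin d), ‖b‖ ≤ c * Real.sqrt (E.lam * η / E.Lam ^ 2) →
      ∀ δ : ℝ, 0 < δ → δ ≤ 1 → ∀ ρ : EuclideanSpace ℝ (Fin d), ‖ρ‖ ≤ 1 →
        ∀ j : Fin (d - 1) → Fin d,
          WeakLpLE ((d : ℝ≥0∞) / ENNReal.ofReal ((d : ℝ) - δ - αd δ)) (Cd δ * E.Lam)
            fun ξ => partialDeriv j
                (fun ζ => E.q (cplx (ζ + ρ) b) η k k' - E.q (cplx ζ b) η k k') ξ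
              / ((‖ρ‖ ^ (1 - δ) : ℝ) : ℂ)

/-! ### The homogenized Green's function -/

/-- `e_j(ξ) = e^{-i ξ_j} - 1` for real `ξ`. -/
def eVec {d : ℕ} (ξ : EuclideanSpace ℝ (Fin d)) (j : Fin d) : ℂ :=
  Complex.exp (-Complex.I * (ξ j : ℂ)) - 1

/-- The Green's function on `ℤ^d` with constant matrix `A`:
`(2π)^{-d} ∫_{[-π,π]^d} e^{-i ξ·x} / (η + e(ξ)^* A e(ξ)) dξ`. -/
def constGreen {d : ℕ} (A : Matrix (Fin d) (Fin d) ℂ) (η : ℝ) (x : Lattice d) : ℂ :=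
  (1 / (2 * (Real.pi : ℂ)) ^ d) *
    ∫ ξ in cube d, Complex.exp (-Complex.I * ∑ j, (ξ j : ℂ) * (x j : ℂ))
      / ((η : ℂ) + star (eVec ξ) ⬝ᵥ (A *ᵥ eVec ξ))

/-- The discrepancy `G_{a,η}(x) - G_{A,η}(x)`. -/
def discrepancy {d : ℕ} (E : Environment.{u} d) (A : Matrix (Fin d) (Fin d) ℂ) (η : ℝ)
    (x : Lattice d) : ℂ :=
  (E.greenAvg η x : ℂ) - constGreen A η x

end LatticeHomog

end

/-! Put κ = √(η/Λ) and write both Green's functions as Fourier integrals along ξ + i b with |b| ≤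
γκ. Their difference is then Λ⁻¹(2π)^{-d} times the integral of e^{-i(ξ+ib)·x} against the
difference of two inverse symbols, `resolventDiff`. Taking b of length γκ opposite to x makes the
plane wave contribute e^{-γκ|x|} (`exists_shift`), so only power decay of an oscillatory integral
remains to be shown.

The representation (`StationaryField.integral_green`) rests on two facts. The mean of the solution
of η v + ∂_ξ^* a ∂_ξ v = 1 is the inverse of η + e^* q e, because the fluctuation of v is its mean
times a combination of correctors (`Medium.inner_mul_symbol_eq_one`). Moreover the twisted Fourier
transform along an orbit carries the operator on Ω to the operator on the lattice, and the constant
1 to the point mass at 0, for every b. Both equations are solved by the same explicit Richardson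
iteration, convergent at a uniform geometric rate, so the identity passes to the limit by dominated
convergence. No contour is deformed: the formula is proved for each b separately. The homogenized
Green's function is the case of a one-point probability space.

For the decay, cut the torus into dyadic shells |e(ξ)| ~ r and set s = r + κ. Measure the n-th
derivative in L^{d/n} of the shell. These norms are scale invariant, and since the inverse exponents
n/d add, Leibniz and Hölder turn functions with such bounds into an algebra closed under inversion
(`Good.mul`, `Good.inv`). At order d - 1 a difference over ρ, with weight |ρ|^{1-δ} r^δ, replaces
the missing d-th derivative. The hypothesis bounds derivatives of q in weak L^{d/(n-α₀)}, slightly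
better than L^{d/n}; on a shell of volume r^d this yields a gain r^α (`WeakLpLE.eLpNorm_le`,
`goodAt_coeff`). Hence the symbols differ by s^{2+α}, and the resolvents, each of size s^{-2}, by
s^{α-2} (`exists_goodAt_resolventDiff`).

A shell of strength B contributes at most B r^d by its volume. After d - 1 integrations by parts and
a translation by half a period of the character it also contributes at most B r^δ |x|^{-(d-δ)}
(`shell_bounds`). The sum over dyadic r is dominated by r ~ 1/|x| (`exists_dyadic_sum_le`), and
gives |x|^{-(d-2+α)}. A gradient multiplies the symbol by e^{-iζ_j} - 1 of size s and improves this
to |x|^{-(d-1+α)}. A second difference over y brings a factor |y| s when |y| r ≤ 1; for larger r its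
two terms are estimated separately. If κ|y| ≥ 1, part of the exponential decay pays for the missing
regularity. -/

namespace LatticeHomog

/-! ### Integration of periodic functions over the cube -/

/-- The space of real frequencies. -/
abbrev Freq (d : ℕ) : Type := EuclideanSpace ℝ (Fin d)

/-- `f` is `2π`-periodic in every coordinate. -/
def IsPeriodic {d : ℕ} {β : Type*} (f : Freq d → β) : Prop :=
  ∀ (j : Fin d) (ξ : Freq d), f (ξ + EuclideanSpace.single j (2 * Real.pi)) = f ξ

/-- The basis of the period lattice. -/
noncomputable def periodBasis (d : ℕ) : Module.Basis (Fin d) ℝ (Freq d) :=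
  (EuclideanSpace.basisFun (Fin d) ℝ).toBasis.unitsSMul
    (fun _ => Units.mk0 (2 * Real.pi) (by positivity))

lemma periodBasis_apply {d : ℕ} (j : Fin d) :
    periodBasis d j = EuclideanSpace.single j (2 * Real.pi) := by
  rw [periodBasis, Module.Basis.unitsSMul_apply]
  ext k
  by_cases h : k = j <;> simp [Units.smul_def, h]

lemma periodBasis_repr {d : ℕ} (j : Fin d) (ξ : Freq d) :
    (periodBasis d).repr ξ j = ξ j / (2 * Real.pi) := by
  rw [periodBasis, Module.Basis.repr_unitsSMul]
  simp [Units.smul_def, div_eq_inv_mul]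

/-- Periodicity is given only for the generators of the period lattice. Span induction extends it to
the whole lattice, the form of invariance used for fundamental domains. -/
lemma IsPeriodic.vadd {d : ℕ} {β : Type*} {f : Freq d → β} (hf : IsPeriodic f)
    (g : Submodule.span ℤ (Set.range (periodBasis d))) (ξ : Freq d) : f (g +ᵥ ξ) = f ξ := by
  obtain ⟨g, hg⟩ := g
  change f (g + ξ) = f ξ
  have key : ∀ ξ, f (ξ + g) = f ξ := by
    induction hg using Submodule.span_induction with
    | mem x hx =>
      obtain ⟨j, rfl⟩ := hx
      intro ξ; rw [periodBasis_apply]; exact hf j ξ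
    | zero => simp
    | add x y _ _ hx hy => intro ξ; rw [← add_assoc, hy, hx]
    | smul a x _ hx =>
      have hn : ∀ (n : ℕ) ξ, f (ξ + (n : ℤ) • x) = f ξ := by
        intro n
        induction n with
        | zero => simp
        | succ n ih =>
          intro ξ
          rw [Nat.cast_succ, add_smul, one_smul, ← add_assoc, hx, ih]
      intro ξ
      obtain ⟨n, rfl | rfl⟩ := a.eq_nat_or_neg
      · exact hn n ξ
      · have := hn n (ξ + (-(n : ℤ)) • x)
        rw [← this]; congr 1; simp
  rw [add_comm]; exact key ξ

/-! ### Integrals over one period do not depend on the period chosen. -/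

section Translation

open scoped Pointwise

/-- The closed cube and the half-open fundamental domain started at (-π, …, -π) differ only by
faces, which are null. -/
lemma cube_ae_eq (d : ℕ) :
    (cube d : Set (Freq d)) =ᵐ[volume]
      ((WithLp.toLp 2 fun _ => -Real.pi : Freq d) +ᵥ ZSpan.fundamentalDomain (periodBasis d)) := by
  have h1 := Measure.univ_pi_Ico_ae_eq_Icc (μ := fun _ : Fin d => (volume : Measure ℝ))
    (f := fun _ => -Real.pi) (g := fun _ => Real.pi)
  have h2 := (EuclideanSpace.volume_preserving_symm_measurableEquiv_toLp
    (Fin d)).quasiMeasurePreserving.preimage_ae_eq h1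
  have e1 : (cube d : Set (Freq d)) = (MeasurableEquiv.toLp 2 (Fin d → ℝ)).symm ⁻¹'
      (Set.Icc (fun _ => -Real.pi) (fun _ => Real.pi)) := by
    ext ξ
    simp only [cube, Set.mem_ofPred_eq, Set.mem_preimage, Set.mem_Icc, Pi.le_def]
    exact forall_and
  have e2 : ((WithLp.toLp 2 fun _ => -Real.pi : Freq d) +ᵥ
      ZSpan.fundamentalDomain (periodBasis d)) = (MeasurableEquiv.toLp 2 (Fin d → ℝ)).symm ⁻¹'
      (Set.univ.pi fun _ => Set.Ico (-Real.pi) Real.pi) := by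
    ext ξ
    rw [Set.mem_vadd_set_iff_neg_vadd_mem, ZSpan.mem_fundamentalDomain]
    simp only [periodBasis_repr, Set.mem_preimage, Set.mem_pi, Set.mem_univ, true_implies]
    refine forall_congr' fun j => ?_
    have hp := Real.pi_pos
    change (((-(WithLp.toLp 2 fun _ => -Real.pi : Freq d)) + ξ) j) / _ ∈ _ ↔ ξ j ∈ _
    simp only [PiLp.add_apply, PiLp.neg_apply, neg_neg, Set.mem_Ico]
    rw [le_div_iff₀ (by positivity), div_lt_iff₀ (by positivity)]
    constructor <;> rintro ⟨h, h'⟩ <;> constructor <;> linarith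
  rw [e1, e2]
  exact h2.symm

lemma vadd_fundamental (d : ℕ) (p : Freq d) :
    IsAddFundamentalDomain (Submodule.span ℤ (Set.range (periodBasis d)))
      (p +ᵥ ZSpan.fundamentalDomain (periodBasis d)) volume :=
  (ZSpan.isAddFundamentalDomain (periodBasis d) volume).vadd_of_comm p

lemma preimage_add_vadd {d : ℕ} (ρ : Freq d) (s : Set (Freq d)) :
    (fun ξ => ξ + ρ) ⁻¹' (ρ +ᵥ s) = s := by
  ext ξ
  simp [Set.mem_vadd_set_iff_neg_vadd_mem, add_comm]

instance vaddInvariantMeasure_period (d : ℕ) : VAddInvariantMeasure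
    (Submodule.span ℤ (Set.range (periodBasis d))) (Freq d) volume :=
  ⟨fun g s _ => measure_preimage_add volume (g : Freq d) s⟩

/-- A translate of the cube is again a fundamental domain for the period lattice, and an invariant
function has the same integral over all of them. -/
theorem setLIntegral_cube_add {d : ℕ} {f : Freq d → ℝ≥0∞} (hf : IsPeriodic f) (ρ : Freq d) :
    ∫⁻ ξ in cube d, f (ξ + ρ) = ∫⁻ ξ in cube d, f ξ := by
  rw [setLIntegral_congr (cube_ae_eq d), setLIntegral_congr (cube_ae_eq d)]
  have := (measurePreserving_add_right (volume : Measure (Freq d)) ρ).setLIntegral_comp_preimage_emb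
    (MeasurableEquiv.addRight ρ).measurableEmbedding f
    (ρ +ᵥ ((WithLp.toLp 2 fun _ => -Real.pi : Freq d) +ᵥ ZSpan.fundamentalDomain (periodBasis d)))
  rw [preimage_add_vadd] at this
  rw [this, vadd_vadd]
  exact (vadd_fundamental d _).setLIntegral_eq (vadd_fundamental d _) f hf.vadd

theorem setIntegral_cube_add {d : ℕ} {E : Type*} [NormedAddCommGroup E] [NormedSpace ℝ E]
    {f : Freq d → E} (hf : IsPeriodic f) (ρ : Freq d) :
    ∫ ξ in cube d, f (ξ + ρ) = ∫ ξ in cube d, f ξ := by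
  rw [setIntegral_congr_set (cube_ae_eq d), setIntegral_congr_set (cube_ae_eq d)]
  have := (measurePreserving_add_right (volume : Measure (Freq d)) ρ).setIntegral_preimage_emb
    (MeasurableEquiv.addRight ρ).measurableEmbedding f
    (ρ +ᵥ ((WithLp.toLp 2 fun _ => -Real.pi : Freq d) +ᵥ ZSpan.fundamentalDomain (periodBasis d)))
  rw [preimage_add_vadd] at this
  rw [this, vadd_vadd]
  exact (vadd_fundamental d _).setIntegral_eq (vadd_fundamental d _) hf.vadd

end Translation

lemma isClosed_cube (d : ℕ) : IsClosed (cube d) := by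
  have : cube d = ⋂ j, (fun ξ : Freq d => ξ j) ⁻¹' Set.Icc (-Real.pi) Real.pi := by
    ext ξ; simp [cube]
  rw [this]
  exact isClosed_iInter fun j => isClosed_Icc.preimage (by fun_prop)

lemma measurableSet_cube (d : ℕ) : MeasurableSet (cube d) := (isClosed_cube d).measurableSet

lemma isCompact_cube (d : ℕ) : IsCompact (cube d) := by
  refine Metric.isCompact_of_isClosed_isBounded (isClosed_cube d) ?_
  refine (Metric.isBounded_closedBall (x := (0 : Freq d)) (r := Real.sqrt (d * Real.pi ^ 2))).subset ?_
  intro ξ hξ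
  rw [mem_closedBall_zero_iff, EuclideanSpace.norm_eq]
  refine Real.sqrt_le_sqrt ?_
  calc ∑ i, ‖ξ i‖ ^ 2 ≤ ∑ _i : Fin d, Real.pi ^ 2 := by
        refine Finset.sum_le_sum fun i _ => ?_
        have := abs_le.2 (Set.mem_Icc.1 (hξ i))
        rw [Real.norm_eq_abs]
        gcongr
    _ = _ := by simp

lemma volume_cube (d : ℕ) : volume (cube d) = ENNReal.ofReal ((2 * Real.pi) ^ d) := by
  have e1 : (cube d : Set (Freq d)) = (MeasurableEquiv.toLp 2 (Fin d → ℝ)).symm ⁻¹'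
      (Set.Icc (fun _ => -Real.pi) (fun _ => Real.pi)) := by
    ext ξ
    simp only [cube, Set.mem_ofPred_eq, Set.mem_preimage, Set.mem_Icc, Pi.le_def]
    exact forall_and
  rw [e1, (EuclideanSpace.volume_preserving_symm_measurableEquiv_toLp
    (Fin d)).measure_preimage measurableSet_Icc.nullMeasurableSet, Real.volume_Icc_pi]
  simp only [sub_neg_eq_add, ← two_mul, Finset.prod_const, Finset.card_univ, Fintype.card_fin]
  rw [ENNReal.ofReal_pow (by positivity)]

instance isFiniteMeasure_cube (d : ℕ) : IsFiniteMeasure (volume.restrict (cube d)) :=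
  ⟨by rw [Measure.restrict_apply_univ, volume_cube]; exact ENNReal.ofReal_lt_top⟩

lemma integrableOn_cube {d : ℕ} {E : Type*} [NormedAddCommGroup E] {f : Freq d → E}
    (hf : Continuous f) : IntegrableOn f (cube d) :=
  hf.continuousOn.integrableOn_compact (isCompact_cube d)

lemma IsPeriodic.iteratedFDeriv {d : ℕ} {E : Type*} [NormedAddCommGroup E] [NormedSpace ℝ E]
    {f : Freq d → E} (hf : IsPeriodic f) (n : ℕ) : IsPeriodic (iteratedFDeriv ℝ n f) := by
  intro j ξ
  rw [← iteratedFDeriv_comp_add_right]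
  congr 1
  funext z; exact hf j z

lemma IsPeriodic.fderiv {d : ℕ} {E : Type*} [NormedAddCommGroup E] [NormedSpace ℝ E]
    {f : Freq d → E} (hf : IsPeriodic f) : IsPeriodic (fderiv ℝ f) := by
  intro j ξ
  rw [← fderiv_comp_add_right]
  congr 1
  funext z; exact hf j z

lemma IsPeriodic.comp {d : ℕ} {β γ : Type*} {f : Freq d → β} (hf : IsPeriodic f) (g : β → γ) :
    IsPeriodic (fun ξ => g (f ξ)) := fun j ξ => by simp only [hf j ξ]

lemma IsPeriodic.comp₂ {d : ℕ} {β γ δ : Type*} {f : Freq d → β} {f' : Freq d → γ}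
    (hf : IsPeriodic f) (hf' : IsPeriodic f') (g : β → γ → δ) :
    IsPeriodic (fun ξ => g (f ξ) (f' ξ)) := fun j ξ => by simp only [hf j ξ, hf' j ξ]

/-- The integral of a derivative of a periodic function vanishes. -/
theorem setIntegral_cube_fderiv {d : ℕ} {f : Freq d → ℂ} (hf : ContDiff ℝ 1 f)
    (hp : IsPeriodic f) (v : Freq d) : ∫ ξ in cube d, fderiv ℝ f ξ v = 0 := by
  have hc : Continuous (fun ξ => fderiv ℝ f ξ v) :=
    (hf.continuous_fderiv one_ne_zero).clm_apply continuous_const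
  -- The difference f(ξ+v) - f(ξ) integrates to zero by translation invariance. It is also the
  -- average over t of the derivative at ξ + t v, whose integral over the cube does not depend on t,
  -- so Fubini finishes the proof.
  have h1 : ∀ ξ, f (ξ + v) - f ξ = ∫ t in (0:ℝ)..1, fderiv ℝ f (ξ + t • v) v := by
    intro ξ
    have hd : ∀ t ∈ Set.uIcc (0:ℝ) 1,
        HasDerivAt (fun t : ℝ => f (ξ + t • v)) (fderiv ℝ f (ξ + t • v) v) t := by
      intro t _
      have h2 : HasDerivAt (fun t : ℝ => ξ + t • v) v t := by
        simpa using ((hasDerivAt_id t).smul_const v).const_add ξ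
      exact ((hf.differentiable one_ne_zero).differentiableAt.hasFDerivAt).comp_hasDerivAt t h2
    have := intervalIntegral.integral_eq_sub_of_hasDerivAt hd
      ((hc.comp (by fun_prop)).intervalIntegrable _ _)
    rw [this]; simp
  have h3 : ∫ ξ in cube d, (f (ξ + v) - f ξ) = 0 := by
    have hfc := hf.continuous
    rw [integral_sub (integrableOn_cube (by fun_prop)) (integrableOn_cube hfc), setIntegral_cube_add hp, sub_self]
  simp_rw [h1, intervalIntegral.integral_of_le (zero_le_one' ℝ)] at h3
  rw [integral_integral_swap] at h3
  · have h4 : ∀ t : ℝ, ∫ ξ in cube d, fderiv ℝ f (ξ + t • v) v = ∫ ξ in cube d, fderiv ℝ f ξ v :=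
      fun t => setIntegral_cube_add (hp.fderiv.comp fun L => L v) (t • v)
    simp_rw [h4] at h3
    simpa using h3
  · rw [Measure.prod_restrict]
    have : Continuous (Function.uncurry fun (ξ : Freq d) (t : ℝ) => fderiv ℝ f (ξ + t • v) v) :=
      hc.comp (by fun_prop)
    exact (this.continuousOn.integrableOn_compact ((isCompact_cube d).prod
      (isCompact_Icc (a := (0:ℝ)) (b := 1)))).mono_set (Set.prod_mono le_rfl Set.Ioc_subset_Icc_self)

/-! ### Characters and integration by parts -/

/-- The character `e^{-i ξ·x}`. -/
noncomputable def character {d : ℕ} (x : Lattice d) (ξ : Freq d) : ℂ :=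
  Complex.exp (-Complex.I * ∑ j, (ξ j : ℂ) * (x j : ℂ))

lemma norm_character {d : ℕ} (x : Lattice d) (ξ : Freq d) : ‖character x ξ‖ = 1 := by
  have : -Complex.I * ∑ j, (ξ j : ℂ) * (x j : ℂ) = ((-∑ j, ξ j * (x j : ℝ) : ℝ) : ℂ) * Complex.I := by
    push_cast; ring
  rw [character, this, Complex.norm_exp_ofReal_mul_I]

lemma character_add {d : ℕ} (x : Lattice d) (ξ ρ : Freq d) :
    character x (ξ + ρ) = character x ξ * character x ρ := by
  rw [character, character, character, ← Complex.exp_add]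
  congr 1
  rw [← mul_add, ← Finset.sum_add_distrib]
  congr 1
  refine Finset.sum_congr rfl fun j _ => ?_
  simp [add_mul]

lemma character_single {d : ℕ} (x : Lattice d) (j : Fin d) (t : ℝ) :
    character x (EuclideanSpace.single j t) = Complex.exp (-Complex.I * (t * (x j : ℂ))) := by
  rw [character, Finset.sum_eq_single j]
  · simp
  · intro k _ hk; simp [hk]
  · simp

lemma isPeriodic_character {d : ℕ} (x : Lattice d) : IsPeriodic (character x) := by
  intro j ξ
  rw [character_add, character_single]
  have : Complex.exp (-Complex.I * (((2 * Real.pi : ℝ) : ℂ) * (x j : ℂ))) = 1 := by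
    rw [Complex.exp_eq_one_iff]
    exact ⟨-(x j), by push_cast; ring⟩
  rw [this, mul_one]

lemma contDiff_character {d : ℕ} (x : Lattice d) {n : WithTop ℕ∞} :
    ContDiff ℝ n (character x) := by
  unfold character
  have : ContDiff ℝ n (fun ξ : Freq d => -Complex.I * ∑ j, (ξ j : ℂ) * (x j : ℂ)) := by
    refine contDiff_const.mul (ContDiff.sum fun j _ => ContDiff.mul ?_ contDiff_const)
    exact Complex.ofRealCLM.contDiff.comp (by fun_prop)
  exact this.cexp

/-- Translating by half a period of the character turns an integral into one of a difference. -/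
lemma setIntegral_character_half_period {d : ℕ} (x : Lattice d) (j : Fin d) (hx : x j ≠ 0)
    {g : Freq d → ℂ} (hg : Continuous g) (hp : IsPeriodic g) :
    2 * ∫ ξ in cube d, character x ξ * g ξ =
      -∫ ξ in cube d, character x ξ *
        (g (ξ + EuclideanSpace.single j (Real.pi / x j)) - g ξ) := by
  set ρ : Freq d := EuclideanSpace.single j (Real.pi / x j)
  have h1 : character x ρ = -1 := by
    rw [character_single, ← Complex.exp_neg_pi_mul_I]
    congr 1
    have : (x j : ℂ) ≠ 0 := by exact_mod_cast hx
    push_cast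
    field_simp
  have h2 := setIntegral_cube_add ((isPeriodic_character x).comp₂ hp (· * ·)) ρ
  simp only [character_add, h1] at h2
  have hc : Continuous (character x) := (contDiff_character x (n := 0)).continuous
  have h3 : ∫ ξ in cube d, character x ξ * (g (ξ + ρ) - g ξ) =
      (∫ ξ in cube d, character x ξ * g (ξ + ρ)) - ∫ ξ in cube d, character x ξ * g ξ := by
    rw [← integral_sub (integrableOn_cube (by fun_prop)) (integrableOn_cube (by fun_prop))]
    simp only [mul_sub]
  rw [h3]
  have h4 : ∫ ξ in cube d, character x ξ * -1 * g (ξ + ρ) =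
      -∫ ξ in cube d, character x ξ * g (ξ + ρ) := by
    rw [← integral_neg]; congr 1; funext ξ; ring
  rw [h4] at h2
  linear_combination -h2

/-- Orthogonality of characters. -/
lemma setIntegral_character {d : ℕ} (x : Lattice d) :
    ∫ ξ in cube d, character x ξ = if x = 0 then ((2 * Real.pi : ℝ) ^ d : ℂ) else 0 := by
  split_ifs with h
  · subst h
    have : character (0 : Lattice d) = fun _ => 1 := by funext ξ; simp [character]
    rw [this, setIntegral_const, measureReal_def, volume_cube, ENNReal.toReal_ofReal (by positivity)]
    simp
  · obtain ⟨j, hj⟩ := Function.ne_iff.1 h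
    -- For the constant function the difference vanishes identically.
    have := setIntegral_character_half_period x j hj (g := fun _ => 1) continuous_const
      (fun _ _ => rfl)
    simpa using this

lemma fderiv_character {d : ℕ} (x : Lattice d) (j : Fin d) (ξ : Freq d) :
    fderiv ℝ (character x) ξ (EuclideanSpace.single j 1) = -Complex.I * x j * character x ξ := by
  have h1 : HasDerivAt (fun t : ℝ => character x (ξ + t • EuclideanSpace.single j 1))
      (fderiv ℝ (character x) (ξ + (0:ℝ) • EuclideanSpace.single j 1) (EuclideanSpace.single j 1)) 0 := by
    have h2 : HasDerivAt (fun t : ℝ => ξ + t • (EuclideanSpace.single j 1 : Freq d))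
        (EuclideanSpace.single j 1) 0 := by
      simpa using ((hasDerivAt_id (0:ℝ)).smul_const (EuclideanSpace.single j 1 : Freq d)).const_add ξ
    exact (((contDiff_character x (n := 1)).differentiable one_ne_zero).differentiableAt.hasFDerivAt
      ).comp_hasDerivAt 0 h2
  have h3 : HasDerivAt (fun t : ℝ => character x (ξ + t • EuclideanSpace.single j 1))
      (character x ξ * (-Complex.I * x j)) 0 := by
    have e : (fun t : ℝ => character x (ξ + t • EuclideanSpace.single j 1)) =
        fun t : ℝ => character x ξ * Complex.exp (-Complex.I * ((t : ℂ) * (x j : ℂ))) := by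
      funext t
      rw [character_add, ← character_single]
      congr 2
      ext k
      by_cases h : k = j <;> simp [h]
    rw [e]
    refine HasDerivAt.const_mul _ ?_
    have h4 : HasDerivAt (fun t : ℝ => -Complex.I * ((t : ℂ) * (x j : ℂ))) (-Complex.I * x j) 0 := by
      simpa using ((Complex.ofRealCLM.hasDerivAt (x := (0:ℝ))).mul_const (x j : ℂ)).const_mul (-Complex.I)
    simpa using h4.cexp
  have := h1.unique h3
  rw [zero_smul, add_zero] at this
  rw [this]; ring

/-- Repeated integration by parts against a character. -/
theorem setIntegral_character_mul_iteratedFDeriv {d : ℕ} (x : Lattice d) (j : Fin d)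
    {f : Freq d → ℂ} (hf : ContDiff ℝ (⊤ : ℕ∞) f) (hp : IsPeriodic f) (n : ℕ) :
    ∫ ξ in cube d, character x ξ * iteratedFDeriv ℝ n f ξ (fun _ => EuclideanSpace.single j 1) =
      (Complex.I * x j) ^ n * ∫ ξ in cube d, character x ξ * f ξ := by
  induction n with
  | zero => simp
  | succ n ih =>
    set v : Freq d := EuclideanSpace.single j 1
    set g : Freq d → ℂ := fun ξ => iteratedFDeriv ℝ n f ξ (fun _ => v) with hg
    have hD : ContDiff ℝ 1 (iteratedFDeriv ℝ n f) :=
      hf.iteratedFDeriv_right (m := 1) (by exact_mod_cast le_top)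
    have hgc : ContDiff ℝ 1 g := (ContinuousMultilinearMap.apply ℝ (fun _ : Fin n => Freq d) ℂ (fun _ => v)).contDiff.comp hD
    have hgp : IsPeriodic g := (hp.iteratedFDeriv n).comp fun L => L fun _ => v
    have hgd : ∀ ξ, fderiv ℝ g ξ v = iteratedFDeriv ℝ (n+1) f ξ (fun _ => v) := by
      intro ξ
      rw [iteratedFDeriv_succ_apply_left, hg,
        fderiv_continuousMultilinear_apply_const_apply
          ((hD.differentiable one_ne_zero).differentiableAt)]
      rfl
    have hχ := contDiff_character x (n := 1)
    have h0 := setIntegral_cube_fderiv (hχ.mul hgc) ((isPeriodic_character x).comp₂ hgp (· * ·)) v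
    have h1 : ∀ ξ, fderiv ℝ (character x * g) ξ v =
        character x ξ * fderiv ℝ g ξ v + -Complex.I * x j * (character x ξ * g ξ) := by
      intro ξ
      rw [fderiv_mul (hχ.differentiable one_ne_zero).differentiableAt
        (hgc.differentiable one_ne_zero).differentiableAt]
      simp only [add_apply, smul_apply, smul_eq_mul]
      rw [fderiv_character]; ring
    have hcc : Continuous (fun ξ => fderiv ℝ g ξ v) :=
      (hgc.continuous_fderiv one_ne_zero).clm_apply continuous_const
    have hχc := hχ.continuous
    have hgcc := hgc.continuous
    change ∫ ξ in cube d, fderiv ℝ (character x * g) ξ v = 0 at h0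
    simp_rw [h1] at h0
    rw [integral_add (integrableOn_cube (by fun_prop)) (integrableOn_cube (by fun_prop)),
      integral_const_mul, ih] at h0
    simp_rw [hgd] at h0
    rw [pow_succ]
    linear_combination h0

/-! ### Scale invariant norms of derivatives -/

section DerivNorm

variable {d : ℕ} {F : Type*} [NormedAddCommGroup F] [NormedSpace ℝ F]

/-- The `L^{d/(n+m)}` norm of the `n`-th derivative of `f` over the part of the cube in `S`. -/
noncomputable def derivNorm (S : Set (Freq d)) (n m : ℕ) (f : Freq d → F) : ℝ≥0∞ :=
  eLpNorm (iteratedFDeriv ℝ n f) ((d : ℝ≥0∞) / ((n + m : ℕ) : ℝ≥0∞)) (volume.restrict (cube d ∩ S))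

/-- The inverse exponents a/d and b/d add up, so Hölder's inequality distributes derivatives between
factors exactly as the Leibniz rule does. -/
lemma holderTriple_div (hd : d ≠ 0) (a b : ℕ) :
    ENNReal.HolderTriple ((d : ℝ≥0∞) / (a : ℝ≥0∞)) ((d : ℝ≥0∞) / (b : ℝ≥0∞))
      ((d : ℝ≥0∞) / ((a + b : ℕ) : ℝ≥0∞)) := by
  have h : ∀ n : ℕ, ((d : ℝ≥0∞) / (n : ℝ≥0∞))⁻¹ = (n : ℝ≥0∞) / d := fun n =>
    ENNReal.inv_div (Or.inl (ENNReal.natCast_ne_top n)) (Or.inr (by exact_mod_cast hd))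
  refine ⟨?_⟩
  rw [h, h, h, Nat.cast_add, ENNReal.add_div]

/-- Minkowski's inequality needs exponents at least one; this is why at most d derivatives are ever
counted. -/
lemma one_le_div_of_le {a : ℕ} (h : a ≤ d) (hd : d ≠ 0) : 1 ≤ (d : ℝ≥0∞) / (a : ℝ≥0∞) := by
  rcases Nat.eq_zero_or_pos a with rfl | ha
  · rw [Nat.cast_zero, ENNReal.div_zero (by exact_mod_cast hd)]; exact le_top
  · rw [ENNReal.le_div_iff_mul_le (Or.inl (by exact_mod_cast ha.ne'))
      (Or.inl (ENNReal.natCast_ne_top a)), one_mul]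
    exact_mod_cast h

lemma contDiff_iteratedFDeriv_top {f : Freq d → F} (hf : ContDiff ℝ (⊤ : ℕ∞) f) (n : ℕ) :
    ContDiff ℝ (⊤ : ℕ∞) (iteratedFDeriv ℝ n f) :=
  hf.iteratedFDeriv_right (by exact_mod_cast le_top)

lemma continuous_iteratedFDeriv_top {f : Freq d → F} (hf : ContDiff ℝ (⊤ : ℕ∞) f) (n : ℕ) :
    Continuous (iteratedFDeriv ℝ n f) := (contDiff_iteratedFDeriv_top hf n).continuous

lemma derivNorm_mono {S T : Set (Freq d)} (h : S ⊆ T) (n m : ℕ) (f : Freq d → F) :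
    derivNorm S n m f ≤ derivNorm T n m f :=
  eLpNorm_mono_measure _ (Measure.restrict_mono (Set.inter_subset_inter_right _ h) le_rfl)

lemma derivNorm_add {S : Set (Freq d)} {n m : ℕ} (hd : d ≠ 0) (hn : n + m ≤ d) {f g : Freq d → F}
    (hf : ContDiff ℝ (⊤ : ℕ∞) f) (hg : ContDiff ℝ (⊤ : ℕ∞) g) :
    derivNorm S n m (fun ξ => f ξ + g ξ) ≤ derivNorm S n m f + derivNorm S n m g := by
  have e : iteratedFDeriv ℝ n (fun ξ => f ξ + g ξ) =
      iteratedFDeriv ℝ n f + iteratedFDeriv ℝ n g := by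
    funext ξ
    exact iteratedFDeriv_add_apply (hf.of_le (by exact_mod_cast le_top)).contDiffAt
      (hg.of_le (by exact_mod_cast le_top)).contDiffAt
  rw [derivNorm, e]
  exact eLpNorm_add_le (continuous_iteratedFDeriv_top hf n).aestronglyMeasurable
    (continuous_iteratedFDeriv_top hg n).aestronglyMeasurable (one_le_div_of_le hn hd)

/-- Leibniz rule combined with Hölder's inequality. -/
lemma derivNorm_smul_le [NormedSpace ℂ F] [IsScalarTower ℝ ℂ F] {S : Set (Freq d)}
    {n m m' : ℕ} (hd : d ≠ 0) (hn : n + (m + m') ≤ d) {f : Freq d → ℂ} {g : Freq d → F}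
    (hf : ContDiff ℝ (⊤ : ℕ∞) f) (hg : ContDiff ℝ (⊤ : ℕ∞) g) {A B : ℝ≥0∞}
    (hA : ∀ i ≤ n, derivNorm S i m f ≤ A) (hB : ∀ i ≤ n, derivNorm S i m' g ≤ B) :
    derivNorm S n (m + m') (fun ξ => f ξ • g ξ) ≤ 2 ^ n * A * B := by
  set μ := volume.restrict (cube d ∩ S)
  set p : ℝ≥0∞ := (d : ℝ≥0∞) / ((n + (m + m') : ℕ) : ℝ≥0∞) with hp
  have hfc := continuous_iteratedFDeriv_top hf
  have hgc := continuous_iteratedFDeriv_top hg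
  have h1 : derivNorm S n (m + m') (fun ξ => f ξ • g ξ) ≤
      eLpNorm (∑ i ∈ Finset.range (n + 1), fun ξ => (n.choose i : ℝ) *
        (‖iteratedFDeriv ℝ i f ξ‖ * ‖iteratedFDeriv ℝ (n - i) g ξ‖)) p μ := by
    refine eLpNorm_mono_real fun ξ => ?_
    rw [Finset.sum_apply]
    simp_rw [← mul_assoc]
    exact norm_iteratedFDeriv_smul_le hf hg ξ (by exact_mod_cast le_top)
  refine h1.trans ((eLpNorm_sum_le (fun i _ => ?_) (one_le_div_of_le hn hd)).trans ?_)
  · have := hfc i; have := hgc (n - i)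
    exact Continuous.aestronglyMeasurable (by fun_prop)
  · have h2 : ∀ i ∈ Finset.range (n + 1), eLpNorm (fun ξ => (n.choose i : ℝ) *
        (‖iteratedFDeriv ℝ i f ξ‖ * ‖iteratedFDeriv ℝ (n - i) g ξ‖)) p μ ≤
        (n.choose i : ℝ≥0∞) * (A * B) := by
      intro i hi
      have hi' : i ≤ n := Nat.lt_succ_iff.1 (Finset.mem_range.1 hi)
      -- The i-th Leibniz term carries weight i + m on one factor and (n - i) + m' on the other. The
      -- total does not depend on i, so all terms live in the same L^p.
      have e : p = (d : ℝ≥0∞) / (((i + m) + ((n - i) + m') : ℕ) : ℝ≥0∞) := by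
        rw [hp]; congr 2; omega
      have := holderTriple_div hd (i + m) ((n - i) + m')
      rw [← e] at this
      have h3 := eLpNorm_le_eLpNorm_mul_eLpNorm'_of_norm (μ := μ) (r := p)
        (p := (d : ℝ≥0∞) / ((i + m : ℕ) : ℝ≥0∞)) (q := (d : ℝ≥0∞) / (((n - i) + m' : ℕ) : ℝ≥0∞))
        (hfc i).aestronglyMeasurable
        (hgc (n - i)).aestronglyMeasurable (fun x y => (n.choose i : ℝ) * (‖x‖ * ‖y‖))
        (n.choose i : NNReal) (Eventually.of_forall fun ξ => by
          rw [Real.norm_of_nonneg (by positivity)]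
          simp [mul_assoc])
      refine h3.trans ?_
      rw [mul_assoc]
      simp only [ENNReal.coe_natCast]
      gcongr
      · exact hA i hi'
      · exact hB (n - i) (by omega)
    refine (Finset.sum_le_sum h2).trans (le_of_eq ?_)
    rw [← Finset.sum_mul, ← Nat.cast_sum, Nat.sum_range_choose, mul_assoc]
    push_cast; rfl

/-- The index m records derivatives or differences already taken: passing to `fderiv` moves one unit
from n to m and keeps the exponent. -/
lemma derivNorm_fderiv {S : Set (Freq d)} (n : ℕ) (f : Freq d → F) :
    derivNorm S n 1 (fderiv ℝ f) = derivNorm S (n + 1) 0 f := by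
  unfold derivNorm
  exact eLpNorm_congr_norm_ae (Eventually.of_forall fun ξ => norm_iteratedFDeriv_fderiv)

/-- The difference `f(ξ + ρ) - f(ξ)`. -/
def shiftDiff (ρ : Freq d) (f : Freq d → F) (ξ : Freq d) : F := f (ξ + ρ) - f ξ

lemma contDiff_translate {f : Freq d → F} (hf : ContDiff ℝ (⊤ : ℕ∞) f) (ρ : Freq d) :
    ContDiff ℝ (⊤ : ℕ∞) (fun ξ => f (ξ + ρ)) := hf.comp (by fun_prop)

lemma contDiff_shiftDiff {f : Freq d → F} (hf : ContDiff ℝ (⊤ : ℕ∞) f) (ρ : Freq d) :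
    ContDiff ℝ (⊤ : ℕ∞) (shiftDiff ρ f) := (contDiff_translate hf ρ).sub hf

lemma iteratedFDeriv_shiftDiff {f : Freq d → F} (hf : ContDiff ℝ (⊤ : ℕ∞) f) (ρ : Freq d) (n : ℕ) :
    iteratedFDeriv ℝ n (shiftDiff ρ f) = shiftDiff ρ (iteratedFDeriv ℝ n f) := by
  funext ξ
  have h : ContDiff ℝ n f := hf.of_le (by exact_mod_cast le_top)
  have h' : ContDiff ℝ n (fun ξ => f (ξ + ρ)) := h.comp (by fun_prop)
  have := iteratedFDeriv_sub_apply (x := ξ) h'.contDiffAt h.contDiffAt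
  rw [iteratedFDeriv_comp_add_right] at this
  exact this

end DerivNorm

/-- Translation into a larger periodic set does not increase norms. -/
lemma eLpNorm_translate_le {d : ℕ} {F : Type*} [NormedAddCommGroup F] {S S' : Set (Freq d)}
    (hS' : MeasurableSet S') (hS : MeasurableSet S) (hper : IsPeriodic (· ∈ S')) {ρ : Freq d}
    (hsub : ∀ ξ ∈ S, ξ + ρ ∈ S') {g : Freq d → F} (hg : IsPeriodic g) (hgm : Continuous g)
    (p : ℝ≥0∞) :
    eLpNorm (fun ξ => g (ξ + ρ)) p (volume.restrict (cube d ∩ S)) ≤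
      eLpNorm g p (volume.restrict (cube d ∩ S')) := by
  have hperI : ∀ G : Freq d → ℝ≥0∞, IsPeriodic G → IsPeriodic (S'.indicator G) := by
    intro G hG j ξ
    have h1 := hper j ξ
    simp only [eq_iff_iff] at h1
    by_cases h : ξ ∈ S'
    · rw [Set.indicator_of_mem h, Set.indicator_of_mem (h1.2 h), hG j ξ]
    · rw [Set.indicator_of_notMem h, Set.indicator_of_notMem (fun hc => h (h1.1 hc))]
  have key : ∀ G : Freq d → ℝ≥0∞, IsPeriodic G →
      ∫⁻ ξ in cube d ∩ S, G (ξ + ρ) ≤ ∫⁻ ξ in cube d ∩ S', G ξ := by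
    intro G hG
    have h1 : ∫⁻ ξ in cube d ∩ S', G ξ = ∫⁻ ξ in cube d, S'.indicator G (ξ + ρ) := by
      rw [setLIntegral_cube_add (hperI G hG), lintegral_indicator hS',
        Measure.restrict_restrict hS', Set.inter_comm]
    have h2 : ∫⁻ ξ in cube d ∩ S, G (ξ + ρ) = ∫⁻ ξ in cube d, S.indicator (fun ξ => G (ξ + ρ)) ξ := by
      rw [lintegral_indicator hS, Measure.restrict_restrict hS, Set.inter_comm]
    rw [h1, h2]
    refine lintegral_mono fun ξ => ?_
    by_cases h : ξ ∈ S
    · simp [h, hsub ξ h]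
    · simp [h]
  rcases eq_or_ne p 0 with rfl | hp0
  · simp
  rcases eq_or_ne p ∞ with rfl | hpt
  · rw [eLpNorm_exponent_top, eLpNorm_exponent_top]
    have h1 := ae_le_eLpNormEssSup (f := g) (μ := volume.restrict (cube d ∩ S'))
    set M := eLpNormEssSup g (volume.restrict (cube d ∩ S'))
    refine eLpNormEssSup_le_of_ae_enorm_bound ?_
    have hmeas : MeasurableSet {ξ : Freq d | M < ‖g ξ‖ₑ} :=
      measurableSet_lt measurable_const hgm.enorm.measurable
    -- For p = ∞ the integral inequality is applied to the indicator of a superlevel set, so that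
    -- null sets are transported by the translation.
    have h2 := key ({ξ : Freq d | M < ‖g ξ‖ₑ}.indicator 1) (by
      have : ({ξ : Freq d | M < ‖g ξ‖ₑ}.indicator 1 : Freq d → ℝ≥0∞) =
          fun ξ => (Set.Ioi M).indicator 1 ‖g ξ‖ₑ := by
        funext ξ; simp [Set.indicator]
      rw [this]
      exact hg.comp fun y => (Set.Ioi M).indicator 1 ‖y‖ₑ)
    rw [lintegral_indicator_one hmeas] at h2
    have h3 : (volume.restrict (cube d ∩ S')) {ξ : Freq d | M < ‖g ξ‖ₑ} = 0 := by
      have := ae_iff.1 h1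
      simpa only [not_le] using this
    rw [h3, nonpos_iff_eq_zero, lintegral_eq_zero_iff] at h2
    · filter_upwards [h2] with ξ hξ
      by_contra hc
      simp [Set.indicator, not_le.1 hc] at hξ
    · exact (measurable_const.indicator hmeas).comp (by fun_prop)
  · rw [eLpNorm_eq_lintegral_rpow_enorm_toReal hp0 hpt,
      eLpNorm_eq_lintegral_rpow_enorm_toReal hp0 hpt]
    gcongr ?_ ^ _
    exact key (fun ξ => ‖g ξ‖ₑ ^ p.toReal) (hg.comp fun y => ‖y‖ₑ ^ p.toReal)

/-- The norm of a difference is controlled by that of the derivative. -/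
lemma eLpNorm_shiftDiff_le {d : ℕ} {F : Type*} [NormedAddCommGroup F] [NormedSpace ℝ F]
    [CompleteSpace F] {S S' : Set (Freq d)}
    (hS' : MeasurableSet S') (hS : MeasurableSet S) (hper : IsPeriodic (· ∈ S')) {ρ : Freq d}
    (hsub : ∀ ξ ∈ S, ∀ t ∈ Set.Icc (0:ℝ) 1, ξ + t • ρ ∈ S')
    {g : Freq d → F} (hg : IsPeriodic g) (hgc : ContDiff ℝ 1 g)
    {p : ℝ≥0∞} (hp1 : 1 ≤ p) (hpt : p ≠ ∞) :
    eLpNorm (shiftDiff ρ g) p (volume.restrict (cube d ∩ S)) ≤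
      ENNReal.ofReal ‖ρ‖ * eLpNorm (fderiv ℝ g) p (volume.restrict (cube d ∩ S')) := by
  have hp0 : p ≠ 0 := (zero_lt_one.trans_le hp1).ne'
  have hr1 : 1 ≤ p.toReal := by
    rw [← ENNReal.toReal_one]; exact ENNReal.toReal_mono hpt hp1
  have hr0 : 0 < p.toReal := by linarith
  have hfc : Continuous (fderiv ℝ g) := hgc.continuous_fderiv one_ne_zero
  have h1 : ∀ ξ, ‖shiftDiff ρ g ξ‖ₑ ≤ ‖ρ‖ₑ * ∫⁻ t in Set.Icc (0:ℝ) 1, ‖fderiv ℝ g (ξ + t • ρ)‖ₑ := by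
    intro ξ
    have hd : ∀ t ∈ Set.uIcc (0:ℝ) 1,
        HasDerivAt (fun t : ℝ => g (ξ + t • ρ)) (fderiv ℝ g (ξ + t • ρ) ρ) t := by
      intro t _
      have h2 : HasDerivAt (fun t : ℝ => ξ + t • ρ) ρ t := by
        simpa using ((hasDerivAt_id t).smul_const ρ).const_add ξ
      exact ((hgc.differentiable one_ne_zero).differentiableAt.hasFDerivAt).comp_hasDerivAt t h2
    have hint : Continuous fun t : ℝ => fderiv ℝ g (ξ + t • ρ) ρ :=
      (hfc.comp (by fun_prop)).clm_apply continuous_const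
    have := intervalIntegral.integral_eq_sub_of_hasDerivAt hd (hint.intervalIntegrable _ _)
    rw [intervalIntegral.integral_of_le (zero_le_one' ℝ), ← integral_Icc_eq_integral_Ioc] at this
    simp only [one_smul, zero_smul, add_zero] at this
    rw [shiftDiff, ← this, ← lintegral_const_mul' _ _ enorm_ne_top]
    refine (enorm_integral_le_lintegral_enorm _).trans (lintegral_mono fun t => ?_)
    rw [mul_comm]
    exact ContinuousLinearMap.le_opENorm _ _
  have h2 : ∀ ξ, ‖shiftDiff ρ g ξ‖ₑ ^ p.toReal ≤
      ‖ρ‖ₑ ^ p.toReal * ∫⁻ t in Set.Icc (0:ℝ) 1, ‖fderiv ℝ g (ξ + t • ρ)‖ₑ ^ p.toReal := by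
    intro ξ
    refine (ENNReal.rpow_le_rpow (h1 ξ) hr0.le).trans ?_
    rw [ENNReal.mul_rpow_of_nonneg _ _ hr0.le]
    gcongr
    have hm : AEStronglyMeasurable (fun t : ℝ => fderiv ℝ g (ξ + t • ρ))
      (volume.restrict (Set.Icc (0:ℝ) 1)) := (hfc.comp (by fun_prop)).aestronglyMeasurable
    -- Jensen's inequality on the unit interval moves the power p inside the average over t.
    have h3 := eLpNorm_le_eLpNorm_mul_rpow_measure_univ hp1 hm
    simp only [Measure.restrict_apply_univ, Real.volume_Icc, sub_zero, ENNReal.ofReal_one,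
      ENNReal.one_rpow, mul_one] at h3
    rw [eLpNorm_one_eq_lintegral_enorm, eLpNorm_eq_lintegral_rpow_enorm_toReal hp0 hpt] at h3
    refine (ENNReal.rpow_le_rpow h3 hr0.le).trans ?_
    rw [← ENNReal.rpow_mul, one_div, inv_mul_cancel₀ hr0.ne', ENNReal.rpow_one]
  have hgp := hg.fderiv
  rw [eLpNorm_eq_lintegral_rpow_enorm_toReal hp0 hpt,
    eLpNorm_eq_lintegral_rpow_enorm_toReal hp0 hpt]
  have h4 : ∫⁻ ξ in cube d ∩ S, ‖shiftDiff ρ g ξ‖ₑ ^ p.toReal ≤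
      ‖ρ‖ₑ ^ p.toReal * ∫⁻ ξ in cube d ∩ S', ‖fderiv ℝ g ξ‖ₑ ^ p.toReal := by
    calc ∫⁻ ξ in cube d ∩ S, ‖shiftDiff ρ g ξ‖ₑ ^ p.toReal
        ≤ ∫⁻ ξ in cube d ∩ S, ‖ρ‖ₑ ^ p.toReal *
            ∫⁻ t in Set.Icc (0:ℝ) 1, ‖fderiv ℝ g (ξ + t • ρ)‖ₑ ^ p.toReal := lintegral_mono h2
      _ = ‖ρ‖ₑ ^ p.toReal * ∫⁻ ξ in cube d ∩ S,
            ∫⁻ t in Set.Icc (0:ℝ) 1, ‖fderiv ℝ g (ξ + t • ρ)‖ₑ ^ p.toReal :=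
          lintegral_const_mul' _ _ (ENNReal.rpow_ne_top_of_nonneg hr0.le enorm_ne_top)
      _ = ‖ρ‖ₑ ^ p.toReal * ∫⁻ t in Set.Icc (0:ℝ) 1,
            ∫⁻ ξ in cube d ∩ S, ‖fderiv ℝ g (ξ + t • ρ)‖ₑ ^ p.toReal := by
          rw [lintegral_lintegral_swap]
          have : Continuous (Function.uncurry fun (ξ : Freq d) (t : ℝ) =>
            fderiv ℝ g (ξ + t • ρ)) := hfc.comp (by fun_prop)
          exact (this.enorm.measurable.pow_const _).aemeasurable
      _ ≤ ‖ρ‖ₑ ^ p.toReal * ∫⁻ _t in Set.Icc (0:ℝ) 1,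
            ∫⁻ ξ in cube d ∩ S', ‖fderiv ℝ g ξ‖ₑ ^ p.toReal := by
          refine mul_le_mul' le_rfl (setLIntegral_mono'
            (measurableSet_Icc : MeasurableSet (Set.Icc (0:ℝ) 1)) fun t ht => ?_)
          have := eLpNorm_translate_le hS' hS hper (fun ξ hξ => hsub ξ hξ t ht) hgp hfc p
          rw [eLpNorm_eq_lintegral_rpow_enorm_toReal hp0 hpt,
            eLpNorm_eq_lintegral_rpow_enorm_toReal hp0 hpt] at this
          exact (ENNReal.rpow_le_rpow_iff (z := 1 / p.toReal) (by positivity)).1 this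
      _ = _ := by simp
  have hq : 0 ≤ 1 / p.toReal := by positivity
  refine (ENNReal.rpow_le_rpow h4 hq).trans ?_
  rw [ENNReal.mul_rpow_of_nonneg _ _ hq, ← ENNReal.rpow_mul, one_div,
    mul_inv_cancel₀ hr0.ne', ENNReal.rpow_one, ofReal_norm]

/-! ### An algebra of functions with controlled derivatives on a shell -/

/-- `S` and its translates by `t ρ`, `0 ≤ t ≤ 1`, lie in the periodic set `S'`. -/
structure ShellPair {d : ℕ} (S S' : Set (Freq d)) (ρ : Freq d) (β : ℝ≥0∞) : Prop where
  dim_ne_zero : d ≠ 0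
  measurableSet : MeasurableSet S
  measurableSet' : MeasurableSet S'
  periodic' : IsPeriodic (· ∈ S')
  shift_mem : ∀ ξ ∈ S, ∀ t ∈ Set.Icc (0:ℝ) 1, ξ + t • ρ ∈ S'
  norm_le : ENNReal.ofReal ‖ρ‖ ≤ β

lemma ShellPair.subset {d : ℕ} {S S' : Set (Freq d)} {ρ : Freq d} {β : ℝ≥0∞}
    (h : ShellPair S S' ρ β) : S ⊆ S' := fun ξ hξ => by
  simpa using h.shift_mem ξ hξ 0 (by simp)

/-- Smooth periodic functions with scale invariant bounds on the derivatives of order less than `d`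
on `S'` and on the difference of the derivatives of order `d - 1` on `S`. -/
structure Good {d : ℕ} (S S' : Set (Freq d)) (ρ : Freq d) (β B : ℝ≥0∞) (f : Freq d → ℂ) :
    Prop where
  smooth : ContDiff ℝ (⊤ : ℕ∞) f
  periodic : IsPeriodic f
  low : ∀ n < d, derivNorm S' n 0 f ≤ B
  top : derivNorm S (d - 1) 1 (shiftDiff ρ f) ≤ β * B

section

variable {d : ℕ} {S S' : Set (Freq d)} {ρ : Freq d} {β A B : ℝ≥0∞} {f g : Freq d → ℂ}

lemma Good.mono (hf : Good S S' ρ β A f) (h : A ≤ B) : Good S S' ρ β B f :=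
  ⟨hf.smooth, hf.periodic, fun n hn => (hf.low n hn).trans h, hf.top.trans (by gcongr)⟩

/-- A difference is the average of the derivative along the segment. It therefore costs ‖ρ‖ and one
derivative, and with m = 1 both sides use the exponent d/(n+1), which is finite for every n. -/
lemma derivNorm_shiftDiff_le (hS : ShellPair S S' ρ β) (hf : ContDiff ℝ (⊤ : ℕ∞) f)
    (hp : IsPeriodic f) (n : ℕ) (hn : n + 1 ≤ d) :
    derivNorm S n 1 (shiftDiff ρ f) ≤ ENNReal.ofReal ‖ρ‖ * derivNorm S' (n + 1) 0 f := by
  rw [derivNorm, iteratedFDeriv_shiftDiff hf]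
  have hpt : (d : ℝ≥0∞) / ((n + 1 : ℕ) : ℝ≥0∞) ≠ ∞ :=
    ENNReal.div_ne_top (ENNReal.natCast_ne_top d) (by exact_mod_cast Nat.succ_ne_zero n)
  refine (eLpNorm_shiftDiff_le hS.measurableSet' hS.measurableSet hS.periodic' hS.shift_mem
    (hp.iteratedFDeriv n) ((contDiff_iteratedFDeriv_top hf n).of_le (by exact_mod_cast le_top))
    (one_le_div_of_le hn hS.dim_ne_zero) hpt).trans ?_
  gcongr
  rw [derivNorm]
  exact (eLpNorm_congr_norm_ae (Eventually.of_forall fun ξ => norm_fderiv_iteratedFDeriv)).le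

/-- Only order d - 1 needs the Hölder-type assumption; below it a difference is controlled by the
next derivative and ‖ρ‖ ≤ β. -/
lemma Good.diff (hf : Good S S' ρ β B f) (hS : ShellPair S S' ρ β) (n : ℕ) (hn : n < d) :
    derivNorm S n 1 (shiftDiff ρ f) ≤ β * B := by
  rcases eq_or_ne n (d - 1) with rfl | h
  · exact hf.top
  · refine (derivNorm_shiftDiff_le hS hf.smooth hf.periodic n (by omega)).trans ?_
    gcongr
    · exact hS.norm_le
    · exact hf.low _ (by omega)

lemma derivNorm_translate_le (hS : ShellPair S S' ρ β) (hf : ContDiff ℝ (⊤ : ℕ∞) f)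
    (hp : IsPeriodic f) (n : ℕ) :
    derivNorm S n 0 (fun ξ => f (ξ + ρ)) ≤ derivNorm S' n 0 f := by
  rw [derivNorm]
  have : iteratedFDeriv ℝ n (fun ξ => f (ξ + ρ)) = fun ξ => iteratedFDeriv ℝ n f (ξ + ρ) := by
    funext ξ; exact iteratedFDeriv_comp_add_right n ρ ξ
  rw [this]
  exact eLpNorm_translate_le hS.measurableSet' hS.measurableSet hS.periodic'
    (fun ξ hξ => by simpa using hS.shift_mem ξ hξ 1 (by simp)) (hp.iteratedFDeriv n)
    (continuous_iteratedFDeriv_top hf n) _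

lemma two_pow_le {n : ℕ} (hn : n ≤ d) : (2 : ℝ≥0∞) ^ n ≤ 2 ^ d :=
  pow_le_pow_right₀ (by norm_num) hn

lemma two_pow_mul_le {n : ℕ} (hn : n ≤ d) (A B : ℝ≥0∞) : 2 ^ n * A * B ≤ 2 ^ d * A * B :=
  mul_le_mul' (mul_le_mul' (two_pow_le hn) le_rfl) le_rfl

/-- The difference of a product is Δf · g(· + ρ) + f · Δg. Each term contains one difference and
costs 2^{d-1}, so both together cost the same 2^d that suffices at lower orders. -/
lemma Good.mul (hS : ShellPair S S' ρ β) (hf : Good S S' ρ β A f) (hg : Good S S' ρ β B g) :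
    Good S S' ρ β (2 ^ d * A * B) (fun ξ => f ξ * g ξ) where
  smooth := hf.smooth.mul hg.smooth
  periodic := hf.periodic.comp₂ hg.periodic (· * ·)
  low n hn := by
    refine (derivNorm_smul_le (m := 0) (m' := 0) hS.dim_ne_zero (by omega) hf.smooth hg.smooth
      (fun i hi => hf.low i (by omega)) (fun i hi => hg.low i (by omega))).trans ?_
    exact two_pow_mul_le hn.le _ _
  top := by
    have hd := hS.dim_ne_zero
    have e : shiftDiff ρ (fun ξ => f ξ * g ξ) = fun ξ =>
        shiftDiff ρ f ξ • g (ξ + ρ) + f ξ • shiftDiff ρ g ξ := by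
      funext ξ; simp only [shiftDiff, smul_eq_mul]; ring
    rw [e]
    have hfs := contDiff_shiftDiff hf.smooth ρ
    have hgs := contDiff_shiftDiff hg.smooth ρ
    have hgt := contDiff_translate hg.smooth ρ
    refine (derivNorm_add hd (by omega) (hfs.smul hgt) (hf.smooth.smul hgs)).trans ?_
    have h1 := derivNorm_smul_le (S := S) (n := d - 1) (m := 1) (m' := 0) hd (by omega) hfs hgt
      (fun i hi => hf.diff hS i (by omega))
      (fun i hi => (derivNorm_translate_le hS hg.smooth hg.periodic i).trans (hg.low i (by omega)))
    have h2 := derivNorm_smul_le (S := S) (n := d - 1) (m := 0) (m' := 1) hd (by omega) hf.smooth hgs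
      (fun i hi => (derivNorm_mono hS.subset i 0 f).trans (hf.low i (by omega)))
      (fun i hi => hg.diff hS i (by omega))
    refine (add_le_add h1 h2).trans (le_of_eq ?_)
    have : (2 : ℝ≥0∞) ^ d = 2 * 2 ^ (d - 1) := by
      rw [← pow_succ']; congr 1; omega
    rw [this]; ring

lemma Good.add (hS : ShellPair S S' ρ β) (hf : Good S S' ρ β A f) (hg : Good S S' ρ β B g) :
    Good S S' ρ β (A + B) (fun ξ => f ξ + g ξ) where
  smooth := hf.smooth.add hg.smooth
  periodic := hf.periodic.comp₂ hg.periodic (· + ·)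
  low n hn := (derivNorm_add hS.dim_ne_zero (by omega) hf.smooth hg.smooth).trans
    (add_le_add (hf.low n hn) (hg.low n hn))
  top := by
    have hd := hS.dim_ne_zero
    have e : shiftDiff ρ (fun ξ => f ξ + g ξ) = fun ξ => shiftDiff ρ f ξ + shiftDiff ρ g ξ := by
      funext ξ; simp only [shiftDiff]; ring
    rw [e, mul_add]
    exact (derivNorm_add hd (by omega) (contDiff_shiftDiff hf.smooth ρ)
      (contDiff_shiftDiff hg.smooth ρ)).trans (add_le_add hf.top hg.top)

lemma derivNorm_zero_fun (S : Set (Freq d)) (n m : ℕ) :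
    derivNorm S n m (fun _ => (0:ℂ)) = 0 := by
  have : iteratedFDeriv ℝ n (fun _ : Freq d => (0:ℂ)) = 0 := iteratedFDeriv_fun_zero
  rw [derivNorm, this, eLpNorm_zero]

lemma derivNorm_const_le (hd : d ≠ 0) (S : Set (Freq d)) (n : ℕ) (c : ℂ) :
    derivNorm S n 0 (fun _ => c) ≤ ‖c‖ₑ := by
  rcases Nat.eq_zero_or_pos n with rfl | hn
  · rw [derivNorm]
    simp only [add_zero, Nat.cast_zero]
    rw [ENNReal.div_zero (by exact_mod_cast hd), eLpNorm_exponent_top]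
    refine eLpNormEssSup_le_of_ae_enorm_bound (Eventually.of_forall fun ξ => ?_)
    rw [← ofReal_norm, ← ofReal_norm, norm_iteratedFDeriv_zero]
  · have : iteratedFDeriv ℝ n (fun _ : Freq d => c) = 0 := by
      rw [iteratedFDeriv_const_of_ne hn.ne']
    rw [derivNorm, this, eLpNorm_zero]; exact zero_le

lemma Good.const (hS : ShellPair S S' ρ β) (c : ℂ) : Good S S' ρ β ‖c‖ₑ (fun _ => c) where
  smooth := contDiff_const
  periodic _ _ := rfl
  low n _ := derivNorm_const_le hS.dim_ne_zero S' n c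
  top := by
    have : shiftDiff ρ (fun _ => c) = fun _ => 0 := by funext ξ; simp [shiftDiff]
    rw [this, derivNorm_zero_fun]; exact zero_le

lemma Good.const_mul (hS : ShellPair S S' ρ β) (c : ℂ) (hf : Good S S' ρ β A f) :
    Good S S' ρ β (2 ^ d * ‖c‖ₑ * A) (fun ξ => c * f ξ) := (Good.const hS c).mul hS hf

lemma Good.sum (hS : ShellPair S S' ρ β) {ι : Type*} (s : Finset ι) {F : ι → Freq d → ℂ}
    (hF : ∀ i ∈ s, Good S S' ρ β A (F i)) : Good S S' ρ β (s.card * A) (fun ξ => ∑ i ∈ s, F i ξ) := by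
  classical
  induction s using Finset.induction_on with
  | empty => simpa using (Good.const hS (0:ℂ))
  | insert i s hi ih =>
    have := (hF i (Finset.mem_insert_self i s)).add hS
      (ih fun j hj => hF j (Finset.mem_insert_of_mem hj))
    simp only [Finset.sum_insert hi, Finset.card_insert_of_notMem hi]
    refine this.mono (le_of_eq ?_)
    push_cast; ring

lemma norm_iteratedFDeriv_fun_neg (n : ℕ) (f : Freq d → ℂ) (ξ : Freq d) :
    ‖iteratedFDeriv ℝ n (fun ξ => -f ξ) ξ‖ = ‖iteratedFDeriv ℝ n f ξ‖ := by
  change ‖iteratedFDeriv ℝ n (-f) ξ‖ = _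
  rw [iteratedFDeriv_neg_apply, norm_neg]

/-- Bounds for the derivatives of an inverse. -/
noncomputable def invBound (d : ℕ) (A : ℝ≥0∞) : ℕ → ℝ≥0∞
  | 0 => 1
  | n + 1 => 4 ^ d * A * invBound d A n ^ 2

lemma one_le_invBound (hA : 1 ≤ A) (n : ℕ) : 1 ≤ invBound d A n := by
  induction n with
  | zero => exact le_rfl
  | succ n ih =>
    rw [invBound]
    exact one_le_mul_of_one_le_of_one_le (one_le_mul_of_one_le_of_one_le (one_le_pow₀ (by norm_num)) hA) (one_le_pow₀ ih)

lemma invBound_mono (hA : 1 ≤ A) : Monotone (invBound d A) := by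
  refine monotone_nat_of_le_succ fun n => ?_
  rw [invBound]
  calc invBound d A n = 1 * 1 * invBound d A n := by ring
    _ ≤ 4 ^ d * A * invBound d A n ^ 2 := by
      gcongr
      · exact one_le_pow₀ (by norm_num)
      · exact le_self_pow₀ (one_le_invBound hA n) two_ne_zero

/-- Strong induction on the identity D(1/f) = f^{-2} D(-f): order n + 1 of the inverse involves only
orders up to n of the inverse and up to n + 1 of f. Each step squares the previous bound, hence the
recursion of `invBound`. -/
lemma derivNorm_inv_le (hd : d ≠ 0) (hA : 1 ≤ A) (hf : ContDiff ℝ (⊤ : ℕ∞) f)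
    (hS' : MeasurableSet S')
    (hlow : ∀ n < d, derivNorm S' n 0 f ≤ A) (h0 : ∀ ξ, f ξ ≠ 0) (h1 : ∀ ξ ∈ S', 1 ≤ ‖f ξ‖)
    (n : ℕ) (hn : n < d) : derivNorm S' n 0 (fun ξ => (f ξ)⁻¹) ≤ invBound d A n := by
  have hinv : ContDiff ℝ (⊤ : ℕ∞) (fun ξ => (f ξ)⁻¹) := hf.inv h0
  induction n using Nat.strong_induction_on with
  | _ n ih =>
    cases n with
    | zero =>
      rw [derivNorm, invBound]
      simp only [add_zero, Nat.cast_zero]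
      rw [ENNReal.div_zero (by exact_mod_cast hd), eLpNorm_exponent_top]
      refine eLpNormEssSup_le_of_ae_enorm_bound ?_
      refine (ae_restrict_iff' ((measurableSet_cube d).inter hS')).2 (Eventually.of_forall fun ξ hξ => ?_)
      rw [← ofReal_norm, norm_iteratedFDeriv_zero, norm_inv, ← ENNReal.ofReal_one]
      exact ENNReal.ofReal_le_ofReal (inv_le_one_of_one_le₀ (h1 ξ hξ.2))
    | succ n =>
      have hfd : fderiv ℝ (fun ξ => (f ξ)⁻¹) =
          fun ξ => ((f ξ)⁻¹ • (f ξ)⁻¹) • fderiv ℝ (fun ξ => -f ξ) ξ := by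
        funext ξ
        have hdiff : DifferentiableAt ℝ f ξ := (hf.differentiable (by simp)).differentiableAt
        have := ((hasDerivAt_inv (h0 ξ)).comp_hasFDerivAt ξ hdiff.hasFDerivAt).fderiv
        change fderiv ℝ (Inv.inv ∘ f) ξ = _
        rw [this, fderiv_fun_neg]
        ext v
        simp [pow_two]
      have hneg : ∀ i < d, derivNorm S' i 0 (fun ξ => -f ξ) = derivNorm S' i 0 f := by
        intro i _
        rw [derivNorm, derivNorm]
        refine eLpNorm_congr_norm_ae (Eventually.of_forall fun ξ => ?_)
        exact norm_iteratedFDeriv_fun_neg _ _ _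
      have hinv2 : ∀ i ≤ n, derivNorm S' i 0 (fun ξ => (f ξ)⁻¹ • (f ξ)⁻¹) ≤
          2 ^ d * invBound d A n * invBound d A n := by
        intro i hi
        refine (derivNorm_smul_le (m := 0) (m' := 0) hd (by omega) hinv hinv
          (A := invBound d A n) (B := invBound d A n) ?_ ?_).trans ?_
        · exact fun k hk => (ih k (by omega) (by omega)).trans (invBound_mono hA (by omega))
        · exact fun k hk => (ih k (by omega) (by omega)).trans (invBound_mono hA (by omega))
        · exact two_pow_mul_le (by omega) _ _
      rw [← derivNorm_fderiv, hfd]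
      have hng : ContDiff ℝ (⊤ : ℕ∞) (fun ξ => -f ξ) := hf.neg
      have := derivNorm_smul_le (S := S') (n := n) (m := 0) (m' := 1) hd (by omega)
        (hinv.smul hinv) (hng.fderiv_right (m := (⊤ : ℕ∞)) (by exact_mod_cast le_top)) hinv2
        (B := A) (fun i hi => by
          rw [derivNorm_fderiv, hneg _ (by omega)]; exact hlow _ (by omega))
      refine this.trans ?_
      rw [invBound]
      calc 2 ^ n * (2 ^ d * invBound d A n * invBound d A n) * A
          ≤ 2 ^ d * (2 ^ d * invBound d A n * invBound d A n) * A := by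
            exact two_pow_mul_le (by omega) _ _
        _ = _ := by
          rw [show (4:ℝ≥0∞) = 2 * 2 by norm_num, mul_pow]; ring

/-- At top order use 1/f(ξ+ρ) - 1/f(ξ) = (f(ξ) - f(ξ+ρ)) / (f(ξ) f(ξ+ρ)), which is linear in the
difference of f, the remaining factors being controlled below order d. -/
lemma Good.inv_of_one_le (hS : ShellPair S S' ρ β) (hf : Good S S' ρ β A f) (hA : 1 ≤ A)
    (h0 : ∀ ξ, f ξ ≠ 0) (h1 : ∀ ξ ∈ S', 1 ≤ ‖f ξ‖) :
    Good S S' ρ β (4 ^ d * A * invBound d A d ^ 2) (fun ξ => (f ξ)⁻¹) := by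
  have hd := hS.dim_ne_zero
  have hinv : ContDiff ℝ (⊤ : ℕ∞) (fun ξ => (f ξ)⁻¹) := hf.smooth.inv h0
  have hlow : ∀ n < d, derivNorm S' n 0 (fun ξ => (f ξ)⁻¹) ≤ invBound d A d := fun n hn =>
    (derivNorm_inv_le hd hA hf.smooth hS.measurableSet' hf.low h0 h1 n hn).trans
      (invBound_mono hA hn.le)
  have hper : IsPeriodic (fun ξ => (f ξ)⁻¹) := hf.periodic.comp _
  refine ⟨hinv, hper, fun n hn => (hlow n hn).trans ?_, ?_⟩
  · exact invBound_mono (d := d) hA (Nat.le_succ d)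
  · have e : shiftDiff ρ (fun ξ => (f ξ)⁻¹) = fun ξ =>
        ((f ξ)⁻¹ • (f (ξ + ρ))⁻¹) • (shiftDiff ρ (fun ξ => -f ξ) ξ) := by
      funext ξ
      have := h0 ξ; have := h0 (ξ + ρ)
      simp only [shiftDiff, smul_eq_mul]
      field_simp
      ring
    have hng : Good S S' ρ β A (fun ξ => -f ξ) := by
      refine ⟨hf.smooth.neg, hf.periodic.comp _, fun n hn => ?_, ?_⟩
      · refine le_trans (le_of_eq ?_) (hf.low n hn)
        refine eLpNorm_congr_norm_ae (Eventually.of_forall fun ξ => ?_)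
        exact norm_iteratedFDeriv_fun_neg _ _ _
      · refine le_trans (le_of_eq ?_) hf.top
        refine eLpNorm_congr_norm_ae (Eventually.of_forall fun ξ => ?_)
        have : shiftDiff ρ (fun ξ => -f ξ) = fun ξ => -shiftDiff ρ f ξ := by
          funext ξ; simp only [shiftDiff]; ring
        rw [this, norm_iteratedFDeriv_fun_neg]
    have htr := contDiff_translate hinv ρ
    rw [e]
    have h2 : ∀ i ≤ d - 1, derivNorm S i 0 (fun ξ => (f ξ)⁻¹ • (f (ξ + ρ))⁻¹) ≤
        2 ^ d * invBound d A d * invBound d A d := by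
      intro i hi
      refine (derivNorm_smul_le (m := 0) (m' := 0) hd (by omega) hinv htr
        (A := invBound d A d) (B := invBound d A d) ?_ ?_).trans ?_
      · exact fun k hk => (derivNorm_mono hS.subset _ _ _).trans (hlow k (by omega))
      · exact fun k hk => (derivNorm_translate_le hS hinv hper k).trans (hlow k (by omega))
      · exact two_pow_mul_le (by omega) _ _
    refine (derivNorm_smul_le (S := S) (n := d - 1) (m := 0) (m' := 1) hd (by omega)
      (hinv.smul htr) (contDiff_shiftDiff hng.smooth ρ) h2
      (fun i hi => hng.diff hS i (by omega))).trans ?_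
    calc 2 ^ (d - 1) * (2 ^ d * invBound d A d * invBound d A d) * (β * A)
        ≤ 2 ^ d * (2 ^ d * invBound d A d * invBound d A d) * (β * A) := by
          exact two_pow_mul_le (by omega) _ _
      _ = _ := by
        rw [show (4:ℝ≥0∞) = 2 * 2 by norm_num, mul_pow]; ring

/-- Constant in `Good.inv`. -/
noncomputable def invConst (d : ℕ) (R : ℝ≥0∞) : ℝ≥0∞ :=
  2 ^ d * (4 ^ d * (2 ^ d * R) * invBound d (2 ^ d * R) d ^ 2)

lemma invBound_ne_top (hA : A ≠ ∞) (n : ℕ) : invBound d A n ≠ ∞ := by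
  induction n with
  | zero => exact ENNReal.one_ne_top
  | succ n ih =>
    rw [invBound]
    exact ENNReal.mul_ne_top (ENNReal.mul_ne_top (by finiteness) hA) (ENNReal.pow_ne_top ih)

lemma invConst_ne_top (hA : A ≠ ∞) : invConst d A ≠ ∞ := by
  unfold invConst
  have : (2:ℝ≥0∞) ^ d * A ≠ ∞ := ENNReal.mul_ne_top (by finiteness) hA
  exact ENNReal.mul_ne_top (by finiteness) (ENNReal.mul_ne_top (ENNReal.mul_ne_top (by finiteness)
    this) (ENNReal.pow_ne_top (invBound_ne_top this d)))

/-- Dividing f by its lower bound c reduces to lower bound one. The resulting constant depends only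
on R, the ratio of the upper to the lower bound, and not on the scale. -/
lemma Good.inv (hS : ShellPair S S' ρ β) {R : ℝ≥0∞} (hR : 1 ≤ R) {c : ℝ} (hc : 0 < c)
    (hf : Good S S' ρ β (R * ENNReal.ofReal c) f)
    (h0 : ∀ ξ, f ξ ≠ 0) (h1 : ∀ ξ ∈ S', c ≤ ‖f ξ‖) :
    Good S S' ρ β (invConst d R * ENNReal.ofReal c⁻¹) (fun ξ => (f ξ)⁻¹) := by
  have hcc : (c : ℂ) ≠ 0 := by exact_mod_cast hc.ne'
  have hnc : ‖((c⁻¹ : ℝ) : ℂ)‖ₑ = ENNReal.ofReal c⁻¹ := by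
    rw [← ofReal_norm, Complex.norm_real, Real.norm_of_nonneg (by positivity)]
  have hcc' : ENNReal.ofReal c⁻¹ * ENNReal.ofReal c = 1 := by
    rw [← ENNReal.ofReal_mul (by positivity), inv_mul_cancel₀ hc.ne', ENNReal.ofReal_one]
  have h2 : Good S S' ρ β (2 ^ d * R) (fun ξ => ((c⁻¹ : ℝ) : ℂ) * f ξ) := by
    refine (Good.const_mul hS ((c⁻¹ : ℝ) : ℂ) hf).mono (le_of_eq ?_)
    rw [hnc]
    calc _ = 2 ^ d * R * (ENNReal.ofReal c⁻¹ * ENNReal.ofReal c) := by ring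
      _ = _ := by rw [hcc', mul_one]
  have h3 := h2.inv_of_one_le hS (one_le_mul_of_one_le_of_one_le (one_le_pow₀ (by norm_num)) hR)
    (fun ξ => mul_ne_zero (by exact_mod_cast (inv_pos.2 hc).ne') (h0 ξ)) (fun ξ hξ => by
      rw [norm_mul, Complex.norm_real, Real.norm_of_nonneg (by positivity), ← div_eq_inv_mul,
        le_div_iff₀ hc, one_mul]
      exact h1 ξ hξ)
  have h4 := Good.const_mul hS ((c⁻¹ : ℝ) : ℂ) h3
  have e : (fun ξ => ((c⁻¹ : ℝ) : ℂ) * (((c⁻¹ : ℝ) : ℂ) * f ξ)⁻¹) = fun ξ => (f ξ)⁻¹ := by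
    funext ξ
    have := h0 ξ
    push_cast
    field_simp
  rw [e] at h4
  refine h4.mono (le_of_eq ?_)
  rw [hnc, invConst]; ring

end

/-! ### Weak Lebesgue spaces on small sets -/

lemma setLIntegral_Ioc_rpow {p t : ℝ} (hp : 0 < p) (ht : 0 < t) :
    ∫⁻ s in Set.Ioc 0 t, ENNReal.ofReal (s ^ (p - 1)) = ENNReal.ofReal (t ^ p / p) := by
  have hint : IntegrableOn (fun s : ℝ => s ^ (p - 1)) (Set.Ioc 0 t) := by
    rw [← intervalIntegrable_iff_integrableOn_Ioc_of_le ht.le]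
    exact intervalIntegral.intervalIntegrable_rpow' (by linarith)
  rw [← ofReal_integral_eq_lintegral_ofReal hint
    ((ae_restrict_iff' measurableSet_Ioc).2 (Eventually.of_forall fun s hs => by
      have := hs.1; positivity)),
    ← intervalIntegral.integral_of_le ht.le, integral_rpow (Or.inl (by linarith))]
  congr 1
  rw [sub_add_cancel, Real.zero_rpow hp.ne', sub_zero]

lemma setLIntegral_Ioi_rpow {a t : ℝ} (ha : a < -1) (ht : 0 < t) :
    ∫⁻ s in Set.Ioi t, ENNReal.ofReal (s ^ a) = ENNReal.ofReal (-t ^ (a + 1) / (a + 1)) := by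
  rw [← ofReal_integral_eq_lintegral_ofReal (integrableOn_Ioi_rpow_of_lt ha ht)
    ((ae_restrict_iff' measurableSet_Ioi).2 (Eventually.of_forall fun s hs => by
      have : 0 < s := ht.trans hs
      positivity)),
    integral_Ioi_rpow_of_lt ha ht]

/-- A weak `L^P` bound gives an `L^p` bound, `p < P`, with a gain from the size of the domain. -/
lemma lintegral_rpow_le_of_weak {X : Type*} [MeasurableSpace X] (μ : Measure X) {f : X → ℝ}
    (hf : AEMeasurable f μ) (hf0 : ∀ x, 0 ≤ f x) {p P A B v : ℝ} (hp : 0 < p) (hpP : p < P)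
    (hB : 0 < B) (hA : 0 ≤ A) (hv : 0 < v) (hμ : μ Set.univ ≤ ENNReal.ofReal v)
    (hw : ∀ t, 0 < t → μ {x | t < f x} ≤ ENNReal.ofReal (A * (B / t) ^ P)) :
    ∫⁻ x, ENNReal.ofReal (f x ^ p) ∂μ ≤
      ENNReal.ofReal ((1 + p * A / (P - p)) * (B ^ p * v ^ (1 - p / P))) := by
  have hP : 0 < P := hp.trans hpP
  rw [lintegral_rpow_eq_lintegral_meas_lt_mul μ (Eventually.of_forall hf0) hf hp]
  -- The height at which the trivial bound v and the factor (B/t)^P of the weak bound coincide; the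
  -- layer-cake integral is split there.
  set t₀ : ℝ := B * v ^ (-(1 / P)) with ht₀
  have ht₀p : 0 < t₀ := by positivity
  have hU : Set.Ioi (0:ℝ) = Set.Ioc 0 t₀ ∪ Set.Ioi t₀ := (Set.Ioc_union_Ioi_eq_Ioi ht₀p.le).symm
  rw [hU]
  have h1 : ∫⁻ t in Set.Ioc 0 t₀, μ {a | t < f a} * ENNReal.ofReal (t ^ (p - 1)) ≤
      ENNReal.ofReal (v * (t₀ ^ p / p)) := by
    calc _ ≤ ∫⁻ t in Set.Ioc 0 t₀, ENNReal.ofReal v * ENNReal.ofReal (t ^ (p - 1)) := by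
          refine lintegral_mono fun t => ?_
          gcongr
          exact (measure_mono (Set.subset_univ _)).trans hμ
      _ = _ := by
          rw [lintegral_const_mul' _ _ ENNReal.ofReal_ne_top, setLIntegral_Ioc_rpow hp ht₀p,
            ← ENNReal.ofReal_mul hv.le]
  have h2 : ∫⁻ t in Set.Ioi t₀, μ {a | t < f a} * ENNReal.ofReal (t ^ (p - 1)) ≤
      ENNReal.ofReal (A * B ^ P * (t₀ ^ (p - P) / (P - p))) := by
    calc _ ≤ ∫⁻ t in Set.Ioi t₀, ENNReal.ofReal (A * B ^ P) * ENNReal.ofReal (t ^ (p - 1 - P)) := by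
          refine setLIntegral_mono' measurableSet_Ioi fun t ht => ?_
          have ht : 0 < t := ht₀p.trans ht
          refine (mul_le_mul' (hw t ht) le_rfl).trans (le_of_eq ?_)
          rw [← ENNReal.ofReal_mul (by positivity), ← ENNReal.ofReal_mul (by positivity),
            Real.div_rpow hB.le ht.le, Real.rpow_sub ht (p - 1) P]
          congr 1
          field_simp
      _ = _ := by
          rw [lintegral_const_mul' _ _ ENNReal.ofReal_ne_top,
            setLIntegral_Ioi_rpow (by linarith) ht₀p, ← ENNReal.ofReal_mul (by positivity)]
          congr 2
          rw [show p - 1 - P + 1 = -(P - p) by ring, show p - P = -(P - p) by ring, neg_div_neg_eq]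
  refine (mul_le_mul' le_rfl ((lintegral_union_le _ _ _).trans (add_le_add h1 h2))).trans ?_
  have hPp : 0 < P - p := by linarith
  rw [← ENNReal.ofReal_add (by positivity) (by positivity), ← ENNReal.ofReal_mul hp.le]
  refine ENNReal.ofReal_le_ofReal (le_of_eq ?_)
  have e1 : v * t₀ ^ p = B ^ p * v ^ (1 - p / P) := by
    rw [ht₀, Real.mul_rpow hB.le (by positivity), ← Real.rpow_mul hv.le,
      sub_eq_add_neg, Real.rpow_add hv, Real.rpow_one]
    rw [show -(1 / P) * p = -(p / P) by ring]; ring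
  have e2 : B ^ P * t₀ ^ (p - P) = B ^ p * v ^ (1 - p / P) := by
    rw [ht₀, Real.mul_rpow hB.le (by positivity), ← Real.rpow_mul hv.le, Real.rpow_sub hB,
      show -(1 / P) * (p - P) = 1 - p / P by field_simp; ring]
    field_simp
  calc p * (v * (t₀ ^ p / p) + A * B ^ P * (t₀ ^ (p - P) / (P - p)))
      = v * t₀ ^ p + p * A / (P - p) * (B ^ P * t₀ ^ (p - P)) := by field_simp
    _ = _ := by rw [e1, e2]; ring

/-- The level set bound contained in `WeakLpLE`, with a possibly smaller exponent. -/
lemma WeakLpLE.meas_le {d : ℕ} (hd : d ≠ 0) {σ σ₁ B : ℝ} {f : Freq d → ℂ} (hB : 0 < B)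
    (hσ : σ ≤ σ₁) (hσ₁ : 0 < σ₁)
    (hf : WeakLpLE ((d : ℝ≥0∞) / ENNReal.ofReal σ) B f) {t : ℝ} (ht : 0 < t) :
    (volume.restrict (cube d)) {ξ | t < ‖f ξ‖} ≤
      ENNReal.ofReal ((2 * Real.pi) ^ d * (B / t) ^ ((d : ℝ) / σ₁)) := by
  have hdpos : (0:ℝ) < d := by positivity
  have h2pi : (1:ℝ) ≤ (2 * Real.pi) ^ d := one_le_pow₀ (by linarith [Real.pi_gt_three])
  -- Below height B the volume of the cube already suffices. Above it B/t ≤ 1, so lowering the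
  -- exponent from d/σ to d/σ₁ only weakens the bound; if σ ≤ 0 then p = ∞ and the level set is
  -- null.
  by_cases htB : t < B
  · refine (measure_mono (Set.subset_univ _)).trans ?_
    rw [Measure.restrict_apply_univ, volume_cube]
    refine ENNReal.ofReal_le_ofReal (le_mul_of_one_le_right (by positivity) ?_)
    exact Real.one_le_rpow ((one_le_div ht).2 htB.le) (by positivity)
  · push Not at htB
    obtain ⟨_, hf⟩ := hf
    by_cases hσ0 : σ ≤ 0
    · rw [ENNReal.ofReal_of_nonpos hσ0, ENNReal.div_zero (by exact_mod_cast hd), if_pos rfl] at hf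
      have : (volume.restrict (cube d)) {ξ | t < ‖f ξ‖} = 0 := by
        refine measure_mono_null (fun ξ hξ => ?_) (ae_iff.1 hf)
        exact not_le.2 (htB.trans_lt hξ)
      rw [this]; exact zero_le
    · push Not at hσ0
      have hne : ((d : ℝ≥0∞) / ENNReal.ofReal σ) ≠ ∞ :=
        ENNReal.div_ne_top (ENNReal.natCast_ne_top d) (by simpa using hσ0)
      rw [if_neg hne] at hf
      have h1 := hf t ht
      have h2 : (volume.restrict (cube d)) {ξ | t < ‖f ξ‖} ≤ volume {ξ | ξ ∈ cube d ∧ t < ‖f ξ‖} := by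
        rw [Measure.restrict_apply' (measurableSet_cube d)]
        exact measure_mono fun ξ hξ => ⟨hξ.2, hξ.1⟩
      refine h2.trans (h1.trans (ENNReal.ofReal_le_ofReal ?_))
      rw [ENNReal.toReal_div, ENNReal.toReal_natCast, ENNReal.toReal_ofReal hσ0.le,
        ← Real.div_rpow hB.le ht.le]
      refine le_trans ?_ (le_mul_of_one_le_left (by positivity) h2pi)
      exact Real.rpow_le_rpow_of_exponent_ge (by positivity) ((div_le_one ht).2 htB)
        (div_le_div_of_nonneg_left hdpos.le hσ0 hσ)

/-- The constant in `WeakLpLE.eLpNorm_le`. -/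
noncomputable def weakConst (d : ℕ) (τ a : ℝ) : ℝ :=
  (1 + (d / τ) * (2 * Real.pi) ^ d / (d / (τ - a) - d / τ)) ^ (τ / d)

/-- The weak exponent d/(τ-a) exceeds d/τ. Interpolating with the measure v of the set gains
v^{a/d}, and on a shell with v ~ r^d this is the factor r^a from which all extra decay originates.
-/
lemma WeakLpLE.eLpNorm_le {d : ℕ} (hd : d ≠ 0) {σ B v a : ℝ} {τ : ℕ} {f : Freq d → ℂ}
    (hfm : Continuous f) (hB : 0 < B) (ha : 0 < a) (haτ : a < τ) (hσ : σ ≤ τ - a) (hv : 0 < v)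
    (hf : WeakLpLE ((d : ℝ≥0∞) / ENNReal.ofReal σ) B f) {S : Set (Freq d)}
    (hS : volume (cube d ∩ S) ≤ ENNReal.ofReal v) :
    eLpNorm f ((d : ℝ≥0∞) / (τ : ℝ≥0∞)) (volume.restrict (cube d ∩ S)) ≤
      ENNReal.ofReal (weakConst d τ a * B * v ^ (a / d)) := by
  have hdpos : (0:ℝ) < d := by positivity
  have hτ : (0:ℝ) < τ := ha.trans haτ
  have hτ' : τ ≠ 0 := by rintro rfl; simp at hτ
  have hσ₁ : 0 < (τ:ℝ) - a := by linarith
  have hp : (0:ℝ) < d / τ := by positivity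
  have hpP : (d:ℝ) / τ < d / (τ - a) := div_lt_div_of_pos_left hdpos hσ₁ (by linarith)
  have h1 := lintegral_rpow_le_of_weak (volume.restrict (cube d ∩ S)) (f := fun ξ => ‖f ξ‖)
    hfm.norm.measurable.aemeasurable (fun _ => norm_nonneg _) hp hpP hB
    (A := (2 * Real.pi) ^ d) (by positivity) hv
    (by rwa [Measure.restrict_apply_univ]) (fun t ht =>
      (Measure.restrict_mono Set.inter_subset_left le_rfl _).trans (hf.meas_le hd hB hσ hσ₁ ht))
  have hp0 : (d : ℝ≥0∞) / (τ : ℝ≥0∞) ≠ 0 :=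
    (ENNReal.div_pos (by exact_mod_cast hd) (ENNReal.natCast_ne_top τ)).ne'
  have hpt : (d : ℝ≥0∞) / (τ : ℝ≥0∞) ≠ ∞ :=
    ENNReal.div_ne_top (ENNReal.natCast_ne_top d) (by exact_mod_cast hτ')
  have htr : ((d : ℝ≥0∞) / (τ : ℝ≥0∞)).toReal = d / τ := by
    rw [ENNReal.toReal_div, ENNReal.toReal_natCast, ENNReal.toReal_natCast]
  rw [eLpNorm_eq_lintegral_rpow_enorm_toReal hp0 hpt, htr]
  have e : ∀ ξ, ‖f ξ‖ₑ ^ ((d:ℝ) / τ) = ENNReal.ofReal (‖f ξ‖ ^ ((d:ℝ) / τ)) := fun ξ => by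
    rw [← ofReal_norm, ENNReal.ofReal_rpow_of_nonneg (norm_nonneg _) hp.le]
  simp_rw [e]
  have hq : 0 ≤ 1 / ((d:ℝ) / τ) := by positivity
  refine (ENNReal.rpow_le_rpow h1 hq).trans ?_
  have hPp : 0 < (d:ℝ) / (τ - a) - d / τ := by linarith
  rw [ENNReal.ofReal_rpow_of_nonneg (by positivity) hq]
  refine ENNReal.ofReal_le_ofReal (le_of_eq ?_)
  rw [Real.mul_rpow (by positivity) (by positivity), Real.mul_rpow (by positivity) (by positivity),
    ← Real.rpow_mul hB.le, ← Real.rpow_mul hv.le, weakConst, mul_assoc,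
    show (d:ℝ) / τ * (1 / (d / τ)) = 1 by field_simp, Real.rpow_one,
    show (1:ℝ) / (d / τ) = τ / d by field_simp,
    show (1 - (d:ℝ) / τ / (d / (τ - a))) * (τ / d) = a / d by field_simp; ring]

/-- The norm of a derivative is bounded by the sum of the partial derivatives. -/
lemma norm_iteratedFDeriv_le_sum_partialDeriv {d n : ℕ} (f : Freq d → ℂ) (ξ : Freq d) :
    ‖iteratedFDeriv ℝ n f ξ‖ ≤ ∑ j : Fin n → Fin d, ‖partialDeriv j f ξ‖ := by
  refine ContinuousMultilinearMap.opNorm_le_bound (by positivity) fun m => ?_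
  have hm : ∀ i, m i = ∑ k, (m i k) • EuclideanSpace.single k (1:ℝ) := by
    intro i
    have := ((EuclideanSpace.basisFun (Fin d) ℝ).sum_repr (m i)).symm
    simpa using this
  have : iteratedFDeriv ℝ n f ξ m = ∑ j : Fin n → Fin d, (∏ i, m i (j i)) • partialDeriv j f ξ := by
    conv_lhs => rw [show m = fun i => ∑ k, (m i k) • EuclideanSpace.single k (1:ℝ) from funext hm]
    rw [ContinuousMultilinearMap.map_sum]
    refine Finset.sum_congr rfl fun j _ => ?_
    rw [ContinuousMultilinearMap.map_smul_univ]
    rfl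
  rw [this, Finset.sum_mul]
  refine (norm_sum_le _ _).trans (Finset.sum_le_sum fun j _ => ?_)
  rw [norm_smul, mul_comm, norm_prod]
  gcongr with i
  exact PiLp.norm_apply_le (m i) (j i)

lemma continuous_partialDeriv {d n : ℕ} {f : Freq d → ℂ} (hf : ContDiff ℝ (⊤ : ℕ∞) f)
    (j : Fin n → Fin d) : Continuous (partialDeriv j f) :=
  (ContinuousMultilinearMap.apply ℝ (fun _ : Fin n => Freq d) ℂ _).continuous.comp
    (continuous_iteratedFDeriv_top hf n)

lemma derivNorm_le_of_partialDeriv {d n m : ℕ} (hd : d ≠ 0) (hn : n + m ≤ d) {S : Set (Freq d)}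
    {f : Freq d → ℂ} (hf : ContDiff ℝ (⊤ : ℕ∞) f) {B : ℝ≥0∞}
    (h : ∀ j : Fin n → Fin d, eLpNorm (partialDeriv j f) ((d : ℝ≥0∞) / ((n + m : ℕ) : ℝ≥0∞))
      (volume.restrict (cube d ∩ S)) ≤ B) :
    derivNorm S n m f ≤ d ^ n * B := by
  have h1 : derivNorm S n m f ≤ eLpNorm (∑ j : Fin n → Fin d, fun ξ => ‖partialDeriv j f ξ‖)
      ((d : ℝ≥0∞) / ((n + m : ℕ) : ℝ≥0∞)) (volume.restrict (cube d ∩ S)) := by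
    refine eLpNorm_mono_real fun ξ => ?_
    rw [Finset.sum_apply]
    exact norm_iteratedFDeriv_le_sum_partialDeriv f ξ
  refine h1.trans ((eLpNorm_sum_le (fun j _ =>
    (continuous_partialDeriv hf j).norm.aestronglyMeasurable) (one_le_div_of_le hn hd)).trans ?_)
  refine (Finset.sum_le_sum fun j _ => (eLpNorm_norm _).le.trans (h j)).trans (le_of_eq ?_)
  rw [Finset.sum_const, nsmul_eq_mul]
  simp

/-! ### Dyadic shells of the torus -/

section Shells

variable {d : ℕ}

/-- The Euclidean vector `e(ξ)`. -/
noncomputable def eVecL (ξ : Freq d) : EuclideanSpace ℂ (Fin d) := WithLp.toLp 2 (eVec ξ)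

lemma norm_exp_sub_exp_le (a b : ℝ) :
    ‖Complex.exp (-Complex.I * a) - Complex.exp (-Complex.I * b)‖ ≤ |a - b| := by
  have h : Complex.exp (-Complex.I * a) - Complex.exp (-Complex.I * b) =
      Complex.exp (((-b : ℝ) : ℂ) * Complex.I) * (Complex.exp (Complex.I * ((b - a : ℝ) : ℂ)) - 1) := by
    rw [mul_sub, ← Complex.exp_add, mul_one]
    congr 2 <;> (push_cast; ring)
  rw [h, norm_mul, Complex.norm_exp_ofReal_mul_I, one_mul, abs_sub_comm]
  exact Real.norm_exp_I_mul_ofReal_sub_one_le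

lemma norm_eVecL_sub_le (ξ ζ : Freq d) : ‖eVecL ξ - eVecL ζ‖ ≤ ‖ξ - ζ‖ := by
  rw [EuclideanSpace.norm_eq, EuclideanSpace.norm_eq]
  refine Real.sqrt_le_sqrt (Finset.sum_le_sum fun j _ => ?_)
  have : (eVecL ξ - eVecL ζ) j =
      Complex.exp (-Complex.I * (ξ j : ℂ)) - Complex.exp (-Complex.I * (ζ j : ℂ)) := by
    simp [eVecL, eVec]
  rw [this, PiLp.sub_apply, Real.norm_eq_abs]
  gcongr
  exact norm_exp_sub_exp_le _ _

lemma continuous_eVecL : Continuous (eVecL (d := d)) := by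
  refine (LipschitzWith.of_dist_le_mul (K := 1) fun ξ ζ => ?_).continuous
  rw [dist_eq_norm, dist_eq_norm, NNReal.coe_one, one_mul]
  exact norm_eVecL_sub_le ξ ζ

/-- Here |e_j(ξ)| = 2|sin(ξ_j/2)|, and sin t ≥ 2t/π on [0, π/2]. On the cube |e(ξ)| is therefore
comparable to |ξ|, while being periodic. -/
lemma norm_le_of_mem_cube {ξ : Freq d} (hξ : ξ ∈ cube d) :
    ‖ξ‖ ≤ Real.pi / 2 * ‖eVecL ξ‖ := by
  have hpi := Real.pi_pos
  rw [EuclideanSpace.norm_eq, EuclideanSpace.norm_eq]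
  rw [show Real.pi / 2 = Real.sqrt ((Real.pi / 2) ^ 2) by rw [Real.sqrt_sq (by positivity)],
    ← Real.sqrt_mul (by positivity), Finset.mul_sum]
  refine Real.sqrt_le_sqrt (Finset.sum_le_sum fun j _ => ?_)
  rw [← mul_pow]
  have h1 : ‖eVecL ξ j‖ = 2 * |Real.sin (ξ j / 2)| := by
    have : eVecL ξ j = Complex.exp (Complex.I * ((-ξ j : ℝ) : ℂ)) - 1 := by
      simp [eVecL, eVec]
    rw [this, Complex.norm_exp_I_mul_ofReal_sub_one, norm_mul, neg_div, Real.sin_neg]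
    simp
  have h2 : |ξ j| ≤ Real.pi := abs_le.2 (hξ j)
  have h3 : 2 / Real.pi * |ξ j / 2| ≤ |Real.sin (ξ j / 2)| := by
    have h4 : |ξ j / 2| ≤ Real.pi / 2 := by rw [abs_div, abs_two]; linarith
    have := Real.mul_le_sin (abs_nonneg (ξ j / 2)) h4
    refine this.trans ?_
    rcases abs_cases (ξ j / 2) with ⟨h, _⟩ | ⟨h, _⟩ <;> rw [h]
    · exact le_abs_self _
    · rw [Real.sin_neg]; exact neg_le_abs _
  gcongr
  rw [h1, Real.norm_eq_abs]
  rw [abs_div, abs_two] at h3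
  have h5 := mul_le_mul_of_nonneg_left h3 hpi.le
  have h6 : Real.pi * (2 / Real.pi * (|ξ j| / 2)) = |ξ j| := by field_simp
  rw [h6] at h5
  linarith

lemma isPeriodic_eVecL : IsPeriodic (eVecL (d := d)) := by
  intro j ξ
  ext k
  simp only [eVecL, eVec, PiLp.add_apply]
  congr 1
  by_cases h : k = j
  · subst h
    rw [PiLp.single_apply, if_pos rfl, Complex.exp_eq_exp_iff_exists_int]
    exact ⟨-1, by push_cast; ring⟩
  · rw [PiLp.single_apply, if_neg h, add_zero]

lemma norm_eVecL_le (ξ : Freq d) : ‖eVecL ξ‖ ≤ 2 * d := by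
  rw [EuclideanSpace.norm_eq]
  refine Real.sqrt_le_iff.2 ⟨by positivity, ?_⟩
  calc ∑ i, ‖eVecL ξ i‖ ^ 2 ≤ ∑ _i : Fin d, (2:ℝ) ^ 2 := by
        refine Finset.sum_le_sum fun i _ => ?_
        gcongr
        refine (norm_sub_le _ _).trans ?_
        have : -Complex.I * (ξ i : ℂ) = ((-ξ i : ℝ) : ℂ) * Complex.I := by push_cast; ring
        rw [this, Complex.norm_exp_ofReal_mul_I]
        norm_num
    _ = d * 4 := by
        rw [Finset.sum_const, Finset.card_univ, Fintype.card_fin, nsmul_eq_mul]; norm_num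
    _ ≤ (2 * d) ^ 2 := by
      rcases Nat.eq_zero_or_pos d with h | h
      · simp [h]
      · have : (1:ℝ) ≤ d := by exact_mod_cast h
        nlinarith

/-- The shell `r/4 ≤ |e(ξ)| ≤ 4r`. -/
def innerShell (d : ℕ) (r : ℝ) : Set (Freq d) := {ξ | r / 4 ≤ ‖eVecL ξ‖ ∧ ‖eVecL ξ‖ ≤ 4 * r}

/-- The shell `r/8 ≤ |e(ξ)| ≤ 8r`. -/
def outerShell (d : ℕ) (r : ℝ) : Set (Freq d) := {ξ | r / 8 ≤ ‖eVecL ξ‖ ∧ ‖eVecL ξ‖ ≤ 8 * r}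

lemma measurableSet_shell (a b : ℝ) :
    MeasurableSet {ξ : Freq d | a ≤ ‖eVecL ξ‖ ∧ ‖eVecL ξ‖ ≤ b} :=
  ((isClosed_le continuous_const continuous_eVecL.norm).inter
    (isClosed_le continuous_eVecL.norm continuous_const)).measurableSet

/-- The volume of a shell is at most this constant times `r ^ d`. -/
noncomputable def shellVol (d : ℕ) : ℝ :=
  max 1 ((4 * Real.pi) ^ d * (volume (Metric.closedBall (0 : Freq d) 1)).toReal)

lemma one_le_shellVol : 1 ≤ shellVol d := le_max_left _ _

/-- Since |ξ| ≤ (π/2)|e(ξ)| on the cube, the set lies in the ball of radius 4πr. -/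
lemma volume_eVecL_le (r : ℝ) (hr : 0 ≤ r) :
    volume (cube d ∩ {ξ | ‖eVecL ξ‖ ≤ 8 * r}) ≤ ENNReal.ofReal (shellVol d * r ^ d) := by
  have hpi := Real.pi_pos
  have h1 : cube d ∩ {ξ | ‖eVecL ξ‖ ≤ 8 * r} ⊆ Metric.closedBall (0 : Freq d) (4 * Real.pi * r) := by
    rintro ξ ⟨h1, h2⟩
    rw [mem_closedBall_zero_iff]
    refine (norm_le_of_mem_cube h1).trans ?_
    have h2 : ‖eVecL ξ‖ ≤ 8 * r := h2
    calc Real.pi / 2 * ‖eVecL ξ‖ ≤ Real.pi / 2 * (8 * r) := by gcongr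
      _ = _ := by ring
  refine (measure_mono h1).trans ?_
  rw [Measure.addHaar_closedBall' _ _ (by positivity)]
  have hfin : volume (Metric.closedBall (0 : Freq d) 1) ≠ ∞ := measure_closedBall_lt_top.ne
  rw [← ENNReal.ofReal_toReal hfin, ← ENNReal.ofReal_mul (by positivity)]
  refine ENNReal.ofReal_le_ofReal ?_
  rw [finrank_euclideanSpace_fin, mul_pow, mul_right_comm]
  gcongr
  exact le_max_right _ _

lemma volume_outerShell_le (r : ℝ) (hr : 0 ≤ r) :
    volume (cube d ∩ outerShell d r) ≤ ENNReal.ofReal (shellVol d * r ^ d) :=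
  (measure_mono (Set.inter_subset_inter_right _ fun _ h => h.2)).trans (volume_eVecL_le r hr)

/-- A scale `r`, a small translation `ρ` and a Hölder exponent `1 - δ`. -/
structure IsScale (d : ℕ) (r : ℝ) (ρ : Freq d) (δ : ℝ) : Prop where
  dim_ne_zero : d ≠ 0
  pos : 0 < r
  le : r ≤ 4 * d
  norm_le : ‖ρ‖ ≤ r / 8
  nonneg : 0 ≤ δ
  le_one : δ ≤ 1

/-- The Hölder weight `|ρ|^{1-δ} r^δ`. -/
noncomputable def holderWeight (r : ℝ) (ρ : Freq d) (δ : ℝ) : ℝ := ‖ρ‖ ^ (1 - δ) * r ^ δ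

/-- The map e is 1-Lipschitz, so a displacement of at most r/8 keeps the inner shell inside the
outer one. The weight dominates ‖ρ‖ because ‖ρ‖ = ‖ρ‖^{1-δ}‖ρ‖^δ and ‖ρ‖ ≤ r. -/
lemma IsScale.shellPair {r δ : ℝ} {ρ : Freq d} (h : IsScale d r ρ δ) :
    ShellPair (innerShell d r) (outerShell d r) ρ (ENNReal.ofReal (holderWeight r ρ δ)) where
  dim_ne_zero := h.dim_ne_zero
  measurableSet := measurableSet_shell _ _
  measurableSet' := measurableSet_shell _ _
  periodic' := isPeriodic_eVecL.comp fun z => r / 8 ≤ ‖z‖ ∧ ‖z‖ ≤ 8 * r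
  shift_mem ξ hξ t ht := by
    have h1 := norm_eVecL_sub_le (ξ + t • ρ) ξ
    rw [add_sub_cancel_left, norm_smul, Real.norm_of_nonneg ht.1] at h1
    have h2 : t * ‖ρ‖ ≤ r / 8 :=
      (mul_le_of_le_one_left (norm_nonneg _) ht.2).trans h.norm_le
    have h3 := norm_sub_norm_le (eVecL (ξ + t • ρ)) (eVecL ξ)
    have h4 := norm_sub_norm_le (eVecL ξ) (eVecL (ξ + t • ρ))
    rw [norm_sub_rev] at h4
    have h5 := h.pos
    obtain ⟨h6, h7⟩ := hξ
    exact ⟨by linarith, by linarith⟩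
  norm_le := by
    refine ENNReal.ofReal_le_ofReal ?_
    rw [holderWeight]
    have hr := h.pos
    rcases eq_or_lt_of_le (norm_nonneg ρ) with h0 | h0
    · rw [← h0]; positivity
    · calc ‖ρ‖ = ‖ρ‖ ^ (1 - δ) * ‖ρ‖ ^ δ := by rw [← Real.rpow_add h0]; simp
        _ ≤ _ := by
          gcongr
          · exact h.nonneg
          · linarith [h.norm_le]

/-- `Good` on the shells of size `r`. -/
def GoodAt (r : ℝ) (ρ : Freq d) (δ B : ℝ) (f : Freq d → ℂ) : Prop :=
  Good (innerShell d r) (outerShell d r) ρ (ENNReal.ofReal (holderWeight r ρ δ)) (ENNReal.ofReal B) f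

section

variable {r δ A B : ℝ} {ρ : Freq d} {f g : Freq d → ℂ}

lemma GoodAt.mono (hf : GoodAt r ρ δ A f) (h : A ≤ B) : GoodAt r ρ δ B f :=
  Good.mono hf (ENNReal.ofReal_le_ofReal h)

lemma GoodAt.mul (h : IsScale d r ρ δ) (hf : GoodAt r ρ δ A f) (hg : GoodAt r ρ δ B g)
    (hA : 0 ≤ A) : GoodAt r ρ δ (2 ^ d * A * B) (fun ξ => f ξ * g ξ) := by
  refine Good.mono (Good.mul h.shellPair hf hg) (le_of_eq ?_)
  rw [ENNReal.ofReal_mul (by positivity), ENNReal.ofReal_mul (by positivity),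
    ENNReal.ofReal_pow (by norm_num), ENNReal.ofReal_ofNat]

lemma GoodAt.add (h : IsScale d r ρ δ) (hf : GoodAt r ρ δ A f) (hg : GoodAt r ρ δ B g)
    (hA : 0 ≤ A) (hB : 0 ≤ B) : GoodAt r ρ δ (A + B) (fun ξ => f ξ + g ξ) := by
  refine Good.mono (Good.add h.shellPair hf hg) (le_of_eq ?_)
  rw [ENNReal.ofReal_add hA hB]

lemma GoodAt.const (h : IsScale d r ρ δ) (c : ℂ) : GoodAt r ρ δ ‖c‖ (fun _ => c) := by
  refine Good.mono (Good.const h.shellPair c) (le_of_eq ?_)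
  rw [ofReal_norm]

lemma GoodAt.sum (h : IsScale d r ρ δ) {ι : Type*} (s : Finset ι) {F : ι → Freq d → ℂ}
    (hF : ∀ i ∈ s, GoodAt r ρ δ A (F i)) :
    GoodAt r ρ δ (s.card * A) (fun ξ => ∑ i ∈ s, F i ξ) := by
  refine Good.mono (Good.sum h.shellPair s hF) (le_of_eq ?_)
  rw [ENNReal.ofReal_mul (by positivity), ENNReal.ofReal_natCast]

lemma GoodAt.inv (h : IsScale d r ρ δ) {R c : ℝ} (hR : 1 ≤ R) (hc : 0 < c)
    (hf : GoodAt r ρ δ (R * c) f) (h0 : ∀ ξ, f ξ ≠ 0) (h1 : ∀ ξ ∈ outerShell d r, c ≤ ‖f ξ‖) :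
    GoodAt r ρ δ ((invConst d (ENNReal.ofReal R)).toReal * c⁻¹) (fun ξ => (f ξ)⁻¹) := by
  have := Good.inv h.shellPair (R := ENNReal.ofReal R) (by simpa using hR) hc
    (Good.mono hf (by rw [ENNReal.ofReal_mul (by positivity)])) h0 h1
  refine Good.mono this (le_of_eq ?_)
  rw [ENNReal.ofReal_mul ENNReal.toReal_nonneg,
    ENNReal.ofReal_toReal (invConst_ne_top ENNReal.ofReal_ne_top)]

/-- A pointwise bound M r^{-n} on a set of volume of order r^d has L^{d/n} norm of order M: the
powers of r cancel. -/
lemma derivNorm_le_of_pointwise (hd : d ≠ 0) (hr : 0 < r) {S : Set (Freq d)}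
    (hSm : MeasurableSet S)
    (hS : volume (cube d ∩ S) ≤ ENNReal.ofReal (shellVol d * r ^ d)) {n : ℕ} (hn : n ≤ d) {M : ℝ}
    (hM : 0 ≤ M)
    (h : ∀ ξ ∈ cube d ∩ S, ‖iteratedFDeriv ℝ n f ξ‖ * r ^ n ≤ M) :
    derivNorm S n 0 f ≤ ENNReal.ofReal (shellVol d * M) := by
  have hV := one_le_shellVol (d := d)
  have h1 : ∀ᵐ ξ ∂volume.restrict (cube d ∩ S), ‖iteratedFDeriv ℝ n f ξ‖ ≤ M / r ^ n := by
    refine (ae_restrict_iff' ((measurableSet_cube d).inter hSm)).2 (Eventually.of_forall fun ξ hξ => ?_)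
    rw [le_div_iff₀ (by positivity)]; exact h ξ hξ
  refine (eLpNorm_le_of_ae_bound h1).trans ?_
  rw [Measure.restrict_apply_univ]
  have e : ((d : ℝ≥0∞) / ((n + 0 : ℕ) : ℝ≥0∞)).toReal⁻¹ = (n : ℝ) / d := by
    rw [ENNReal.toReal_div, ENNReal.toReal_natCast, ENNReal.toReal_natCast, inv_div, add_zero]
  rw [e]
  have hnd : 0 ≤ (n : ℝ) / d := by positivity
  refine (mul_le_mul' (ENNReal.rpow_le_rpow hS hnd) le_rfl).trans ?_
  rw [ENNReal.ofReal_rpow_of_nonneg (by positivity) hnd, ← ENNReal.ofReal_mul (by positivity)]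
  refine ENNReal.ofReal_le_ofReal ?_
  have hd' : (0:ℝ) < d := by positivity
  rw [Real.mul_rpow (by positivity) (by positivity), ← Real.rpow_natCast r d, ← Real.rpow_mul hr.le,
    mul_div_cancel₀ _ hd'.ne', Real.rpow_natCast]
  have h2 : shellVol d ^ ((n:ℝ) / d) ≤ shellVol d := by
    conv_rhs => rw [← Real.rpow_one (shellVol d)]
    refine Real.rpow_le_rpow_of_exponent_le hV ?_
    rw [div_le_one hd']; exact_mod_cast hn
  calc shellVol d ^ ((n:ℝ) / d) * r ^ n * (M / r ^ n) = shellVol d ^ ((n:ℝ) / d) * M := by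
        field_simp
    _ ≤ _ := by gcongr

/-- Bounds are needed up to order d, one more than in `low`, since the d-th derivative supplies the
difference at order d - 1. -/
lemma GoodAt.of_pointwise (h : IsScale d r ρ δ) (hf : ContDiff ℝ (⊤ : ℕ∞) f) (hp : IsPeriodic f)
    {M : ℝ} (hM : 0 ≤ M)
    (hb : ∀ n ≤ d, ∀ ξ ∈ cube d ∩ outerShell d r, ‖iteratedFDeriv ℝ n f ξ‖ * r ^ n ≤ M) :
    GoodAt r ρ δ (shellVol d * M) f := by
  have hd := h.dim_ne_zero
  have key := fun n (hn : n ≤ d) => derivNorm_le_of_pointwise hd h.pos (measurableSet_shell _ _)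
    (volume_outerShell_le r h.pos.le) hn hM (hb n hn)
  refine ⟨hf, hp, fun n hn => key n hn.le, ?_⟩
  refine (derivNorm_shiftDiff_le h.shellPair hf hp (d - 1) (by omega)).trans ?_
  rw [show d - 1 + 1 = d by omega]
  exact mul_le_mul' h.shellPair.norm_le (key d le_rfl)

end

/-! ### Exponentials and cutoffs -/

/-- The derivative of exp(ℓ)•v is exp(ℓ) times the constant operator ℓ ⊗ v, a function of the same
form with values in another space. The induction therefore quantifies over all target spaces. -/
lemma norm_iteratedFDeriv_exp_smul_le (ℓ : Freq d →L[ℝ] ℂ) (n : ℕ) :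
    ∀ {F : Type} [NormedAddCommGroup F] [NormedSpace ℝ F] [NormedSpace ℂ F] [IsScalarTower ℝ ℂ F]
      (v : F) (ξ : Freq d),
    ‖iteratedFDeriv ℝ n (fun ξ => Complex.exp (ℓ ξ) • v) ξ‖ ≤ ‖ℓ‖ ^ n * (‖Complex.exp (ℓ ξ)‖ * ‖v‖) := by
  induction n with
  | zero => intro F _ _ _ _ v ξ; simp [norm_smul]
  | succ n ih =>
    intro F _ _ _ _ v ξ
    have hfd : fderiv ℝ (fun ξ => Complex.exp (ℓ ξ) • v) =
        fun ξ => Complex.exp (ℓ ξ) • (ℓ.smulRight v) := by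
      funext ξ
      have h1 : HasFDerivAt (fun ξ => Complex.exp (ℓ ξ)) (Complex.exp (ℓ ξ) • ℓ) ξ :=
        (Complex.hasDerivAt_exp (ℓ ξ)).comp_hasFDerivAt ξ ℓ.hasFDerivAt
      rw [(h1.smul_const v).fderiv]
      ext w
      simp [smul_smul]
    rw [← norm_iteratedFDeriv_fderiv, hfd]
    refine (ih (ℓ.smulRight v) ξ).trans ?_
    have : ‖ℓ.smulRight v‖ ≤ ‖ℓ‖ * ‖v‖ := by
      refine ContinuousLinearMap.opNorm_le_bound _ (by positivity) fun w => ?_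
      rw [ContinuousLinearMap.smulRight_apply, norm_smul, mul_right_comm]
      gcongr
      exact ℓ.le_opNorm w
    calc _ ≤ ‖ℓ‖ ^ n * (‖Complex.exp (ℓ ξ)‖ * (‖ℓ‖ * ‖v‖)) := by gcongr
      _ = _ := by ring

end Shells

/-! ### Plane waves, cutoffs and coefficients as multipliers on a shell. -/

section Multipliers

variable {d : ℕ}

/-- A lattice point as a real vector. -/
noncomputable def latVec (y : Lattice d) : Freq d := WithLp.toLp 2 fun j => (y j : ℝ)

lemma norm_latVec (y : Lattice d) : ‖latVec y‖ = latNorm y := by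
  rw [EuclideanSpace.norm_eq, latNorm]
  congr 1
  refine Finset.sum_congr rfl fun j _ => ?_
  simp [latVec]

lemma inner_latVec (y : Lattice d) (ξ : Freq d) : inner ℝ (latVec y) ξ = ∑ j, ξ j * y j := by
  simp [latVec, PiLp.inner_apply]

/-- The linear form `-i y·ξ`. -/
noncomputable def phaseForm (y : Lattice d) : Freq d →L[ℝ] ℂ :=
  (-Complex.I) • Complex.ofRealCLM.comp (innerSL ℝ (latVec y))

lemma phaseForm_apply (y : Lattice d) (ξ : Freq d) :
    phaseForm y ξ = -Complex.I * ((inner ℝ (latVec y) ξ : ℝ) : ℂ) := by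
  simp [phaseForm]

lemma norm_phaseForm_le (y : Lattice d) : ‖phaseForm y‖ ≤ latNorm y := by
  refine ContinuousLinearMap.opNorm_le_bound _ (Real.sqrt_nonneg _) fun ξ => ?_
  rw [phaseForm_apply, norm_mul, norm_neg, Complex.norm_I, one_mul, Complex.norm_real,
    ← norm_latVec]
  exact abs_real_inner_le_norm _ _

lemma character_eq_exp (y : Lattice d) (ξ : Freq d) : character y ξ = Complex.exp (phaseForm y ξ) := by
  rw [character, phaseForm_apply, inner_latVec]
  push_cast; rfl

/-- The plane wave `e^{-i (ξ + i b)·y}`. -/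
noncomputable def planeWave (b : Freq d) (y : Lattice d) (ξ : Freq d) : ℂ :=
  Complex.exp (-Complex.I * ∑ j, (cplx ξ b) j * (y j : ℂ))

/-- An imaginary shift multiplies the character by a constant e^{y·b}, the sole source of
exponential decay in x. -/
lemma planeWave_eq (b : Freq d) (y : Lattice d) (ξ : Freq d) :
    planeWave b y ξ = Complex.exp ((inner ℝ (latVec y) b : ℝ) : ℂ) * character y ξ := by
  rw [planeWave, character, ← Complex.exp_add, inner_latVec]
  congr 1
  push_cast
  rw [Finset.mul_sum, Finset.mul_sum, ← Finset.sum_add_distrib]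
  refine Finset.sum_congr rfl fun j _ => ?_
  simp only [cplx]
  linear_combination (-(b j : ℂ) * (y j : ℂ)) * Complex.I_sq

lemma norm_planeWave (b : Freq d) (y : Lattice d) (ξ : Freq d) :
    ‖planeWave b y ξ‖ = Real.exp (inner ℝ (latVec y) b) := by
  rw [planeWave_eq, norm_mul, norm_character, mul_one, Complex.norm_exp_ofReal]

lemma isPeriodic_planeWave (b : Freq d) (y : Lattice d) : IsPeriodic (planeWave b y) := by
  have : planeWave b y =
      fun ξ => Complex.exp ((inner ℝ (latVec y) b : ℝ) : ℂ) * character y ξ := by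
    funext ξ; exact planeWave_eq b y ξ
  rw [this]
  exact (isPeriodic_character y).comp _

lemma contDiff_planeWave (b : Freq d) (y : Lattice d) {n : WithTop ℕ∞} :
    ContDiff ℝ n (planeWave b y) := by
  have : planeWave b y =
      fun ξ => Complex.exp ((inner ℝ (latVec y) b : ℝ) : ℂ) * character y ξ := by
    funext ξ; exact planeWave_eq b y ξ
  rw [this]
  exact contDiff_const.mul (contDiff_character y)

lemma planeWave_add (b : Freq d) (x y : Lattice d) (ξ : Freq d) :
    planeWave b (x + y) ξ = planeWave b x ξ * planeWave b y ξ := by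
  rw [planeWave, planeWave, planeWave, ← Complex.exp_add, ← mul_add, ← Finset.sum_add_distrib]
  congr 2
  refine Finset.sum_congr rfl fun j _ => ?_
  simp [mul_add]

lemma norm_planeWave_sub_one_le {b : Freq d} {y : Lattice d} (hb : ‖b‖ * latNorm y ≤ 1) (ξ : Freq d) :
    ‖planeWave b y ξ - 1‖ ≤ 2 * (‖b‖ * latNorm y) + latNorm y * ‖ξ‖ := by
  set t : ℝ := inner ℝ (latVec y) b with ht
  have ht1 : |t| ≤ ‖b‖ * latNorm y := by
    rw [← norm_latVec, mul_comm]; exact abs_real_inner_le_norm _ _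
  have h1 : ‖Complex.exp (t : ℂ) - 1‖ ≤ 2 * (‖b‖ * latNorm y) := by
    refine (Complex.norm_exp_sub_one_le (by rw [Complex.norm_real]; exact ht1.trans hb)).trans ?_
    rw [Complex.norm_real]; gcongr; exact ht1
  have h2 : ‖character y ξ - 1‖ ≤ latNorm y * ‖ξ‖ := by
    have : character y ξ = Complex.exp (Complex.I * ((-(inner ℝ (latVec y) ξ) : ℝ) : ℂ)) := by
      rw [character_eq_exp, phaseForm_apply]; congr 1; push_cast; ring
    rw [this]
    refine Real.norm_exp_I_mul_ofReal_sub_one_le.trans ?_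
    rw [norm_neg, ← norm_latVec]; exact abs_real_inner_le_norm _ _
  rw [planeWave_eq]
  calc _ = ‖(Complex.exp (t : ℂ) - 1) * character y ξ + (character y ξ - 1)‖ := by congr 1; ring
    _ ≤ _ := by
      refine (norm_add_le _ _).trans ?_
      rw [norm_mul, norm_character, mul_one]
      exact add_le_add h1 h2

lemma norm_iteratedFDeriv_planeWave_sub_one_le {b : Freq d} {y : Lattice d}
    (hb : ‖b‖ * latNorm y ≤ 1) {n : ℕ} (hn : n ≠ 0) (ξ : Freq d) :
    ‖iteratedFDeriv ℝ n (fun ξ => planeWave b y ξ - 1) ξ‖ ≤ 3 * latNorm y ^ n := by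
  set c : ℂ := Complex.exp ((inner ℝ (latVec y) b : ℝ) : ℂ) with hc
  have e : (fun ξ => planeWave b y ξ) = fun ξ => Complex.exp (phaseForm y ξ) • c := by
    funext ξ; rw [planeWave_eq, character_eq_exp, smul_eq_mul, mul_comm]
  have hs : iteratedFDeriv ℝ n (fun ξ => planeWave b y ξ - 1) ξ =
      iteratedFDeriv ℝ n (planeWave b y) ξ := by
    have := iteratedFDeriv_sub_apply (i := n) (x := ξ) (f := planeWave b y) (g := fun _ => (1:ℂ))
      (contDiff_planeWave b y).contDiffAt contDiff_const.contDiffAt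
    rw [iteratedFDeriv_const_of_ne hn, Pi.zero_apply, sub_zero] at this
    exact this
  rw [hs]
  change ‖iteratedFDeriv ℝ n (fun ξ => planeWave b y ξ) ξ‖ ≤ _
  rw [e]
  refine (norm_iteratedFDeriv_exp_smul_le (phaseForm y) n c ξ).trans ?_
  rw [← character_eq_exp, norm_character, one_mul, mul_comm]
  gcongr
  · rw [hc, Complex.norm_exp_ofReal]
    refine (Real.exp_le_exp.2 ?_).trans Real.exp_one_lt_three.le
    refine (le_abs_self _).trans ((abs_real_inner_le_norm _ _).trans ?_)
    rw [norm_latVec, mul_comm]; exact hb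
  · exact norm_phaseForm_le y

/-- The function vanishes to first order at the origin, where it is bounded by |y|(|ξ| + 2|b|). Its
n-th derivative times r^n is of order (|y| r)^n, so one factor |y|(r + κ) can be extracted as long
as |y| r ≤ R. -/
lemma goodAt_planeWave_sub_one {r δ κ R : ℝ} {ρ b : Freq d} (h : IsScale d r ρ δ) {y : Lattice d}
    (hκ : ‖b‖ ≤ κ) (hb : ‖b‖ * latNorm y ≤ 1) (hR : 1 ≤ R) (hyr : latNorm y * r ≤ R) :
    GoodAt r ρ δ (shellVol d * (13 * R ^ d * (latNorm y * (r + κ))))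
      (fun ξ => planeWave b y ξ - 1) := by
  have hr := h.pos
  have hy : 0 ≤ latNorm y := Real.sqrt_nonneg _
  have hκ0 : 0 ≤ κ := (norm_nonneg _).trans hκ
  have hRd : 1 ≤ R ^ d := one_le_pow₀ hR
  refine GoodAt.of_pointwise h ((contDiff_planeWave b y).sub contDiff_const)
    ((isPeriodic_planeWave b y).comp (· - 1)) (by positivity) fun n hn ξ hξ => ?_
  rcases eq_or_ne n 0 with rfl | hn0
  · rw [norm_iteratedFDeriv_zero, pow_zero, mul_one]
    have h1 := norm_planeWave_sub_one_le hb ξ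
    have h2 := norm_le_of_mem_cube hξ.1
    have h3 : ‖eVecL ξ‖ ≤ 8 * r := hξ.2.2
    -- The outer shell has |e(ξ)| ≤ 8r, and 8π/2 is below 13.
    have h4 : ‖ξ‖ ≤ 13 * r := by
      refine h2.trans ?_
      calc Real.pi / 2 * ‖eVecL ξ‖ ≤ 3.15 / 2 * (8 * r) := by
            gcongr; exact Real.pi_lt_d2.le
        _ ≤ _ := by linarith
    calc _ ≤ 2 * (κ * latNorm y) + latNorm y * (13 * r) := h1.trans (by gcongr)
      _ ≤ 1 * (13 * (latNorm y * (r + κ))) := by nlinarith [mul_nonneg hy hκ0]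
      _ ≤ R ^ d * (13 * (latNorm y * (r + κ))) := by gcongr
      _ = _ := by ring
  · have h1 := norm_iteratedFDeriv_planeWave_sub_one_le hb hn0 ξ
    obtain ⟨m, rfl⟩ := Nat.exists_eq_succ_of_ne_zero hn0
    calc _ ≤ 3 * latNorm y ^ (m + 1) * r ^ (m + 1) := by gcongr
      _ = 3 * ((latNorm y * r) ^ m * (latNorm y * r)) := by ring
      _ ≤ 13 * (R ^ d * (latNorm y * (r + κ))) := by
        gcongr
        · norm_num
        · calc (latNorm y * r) ^ m ≤ R ^ m := by gcongr
            _ ≤ R ^ d := pow_le_pow_right₀ hR (by omega)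
        · linarith
      _ = _ := by ring

/-! Smooth cutoffs to shells. -/

/-- A smooth bump function on `ℂ^d`. -/
noncomputable def bump (d : ℕ) : ContDiffBump (0 : EuclideanSpace ℂ (Fin d)) :=
  ⟨1 / 2, 1, by norm_num, by norm_num⟩

/-- The cutoff to `|e(ξ)| < R`. -/
noncomputable def ballCutoff (d : ℕ) (R : ℝ) (ξ : Freq d) : ℂ := ((bump d (R⁻¹ • eVecL ξ) : ℝ) : ℂ)

/-- The cutoff to the dyadic shell `r/2 < |e(ξ)| < 2r`. -/
noncomputable def shellCutoff (d : ℕ) (r : ℝ) (ξ : Freq d) : ℂ :=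
  ballCutoff d (2 * r) ξ - ballCutoff d r ξ

lemma ballCutoff_eq_one {R : ℝ} (hR : 0 < R) {ξ : Freq d} (h : ‖eVecL ξ‖ ≤ R / 2) :
    ballCutoff d R ξ = 1 := by
  rw [ballCutoff, (bump d).one_of_mem_closedBall, Complex.ofReal_one]
  rw [mem_closedBall_zero_iff, norm_smul, Real.norm_of_nonneg (by positivity)]
  change R⁻¹ * _ ≤ 1 / 2
  rw [inv_mul_le_iff₀ hR]; linarith

lemma ballCutoff_eq_zero {R : ℝ} (hR : 0 < R) {ξ : Freq d} (h : R ≤ ‖eVecL ξ‖) :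
    ballCutoff d R ξ = 0 := by
  rw [ballCutoff, (bump d).zero_of_le_dist, Complex.ofReal_zero]
  rw [dist_zero_right, norm_smul, Real.norm_of_nonneg (by positivity)]
  change 1 ≤ R⁻¹ * _
  rw [le_inv_mul_iff₀ hR]; linarith

lemma norm_ballCutoff_le (R : ℝ) (ξ : Freq d) : ‖ballCutoff d R ξ‖ ≤ 1 := by
  rw [ballCutoff, Complex.norm_real, Real.norm_of_nonneg (bump d).nonneg]
  exact (bump d).le_one

lemma isPeriodic_ballCutoff (R : ℝ) : IsPeriodic (ballCutoff d R) :=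
  isPeriodic_eVecL.comp fun z => ((bump d (R⁻¹ • z) : ℝ) : ℂ)

lemma eVecL_eq (ξ : Freq d) : eVecL ξ =
    (∑ j, Complex.exp (phaseForm (unitVec j) ξ) • (EuclideanSpace.single j (1:ℂ)))
      - ∑ j, EuclideanSpace.single j (1:ℂ) := by
  ext k
  rw [← Finset.sum_sub_distrib]
  simp only [WithLp.ofLp_sum, Finset.sum_apply, PiLp.sub_apply, PiLp.smul_apply]
  rw [Finset.sum_eq_single k]
  · rw [phaseForm_apply, inner_latVec]
    simp [eVecL, eVec, unitVec, Pi.single_apply]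
  · intro j _ hj; simp [hj.symm]
  · simp

lemma contDiff_eVecL {n : WithTop ℕ∞} : ContDiff ℝ n (eVecL (d := d)) := by
  have : eVecL (d := d) = fun ξ =>
    (∑ j, Complex.exp (phaseForm (unitVec j) ξ) • (EuclideanSpace.single j (1:ℂ)))
      - ∑ j, EuclideanSpace.single j (1:ℂ) := funext eVecL_eq
  rw [this]
  refine ContDiff.sub (ContDiff.sum fun j _ => ContDiff.fun_smul ?_ contDiff_const) contDiff_const
  exact (phaseForm (unitVec j)).contDiff.cexp

lemma latNorm_unitVec (j : Fin d) : latNorm (unitVec j) = 1 := by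
  rw [latNorm, Finset.sum_eq_single j]
  · simp [unitVec]
  · intro k _ hk; simp [unitVec, hk]
  · simp

lemma norm_iteratedFDeriv_eVecL_le {n : ℕ} (hn : n ≠ 0) (ξ : Freq d) :
    ‖iteratedFDeriv ℝ n (eVecL (d := d)) ξ‖ ≤ d := by
  have e : eVecL (d := d) = (fun ξ =>
    (∑ j, Complex.exp (phaseForm (unitVec j) ξ) • (EuclideanSpace.single j (1:ℂ)))) -
      (fun _ => ∑ j, EuclideanSpace.single j (1:ℂ)) := funext eVecL_eq
  have hc : ∀ j : Fin d, ContDiff ℝ n fun ξ : Freq d =>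
      Complex.exp (phaseForm (unitVec j) ξ) • (EuclideanSpace.single j (1:ℂ)) := fun j =>
    ((phaseForm (unitVec j)).contDiff.cexp).fun_smul contDiff_const
  rw [e, iteratedFDeriv_sub_apply (ContDiff.sum fun j _ => hc j).contDiffAt
    contDiff_const.contDiffAt, iteratedFDeriv_const_of_ne hn, Pi.zero_apply, sub_zero,
    iteratedFDeriv_sum (fun j _ => hc j), Finset.sum_apply]
  refine (norm_sum_le _ _).trans ?_
  calc _ ≤ ∑ _j : Fin d, (1:ℝ) := by
        refine Finset.sum_le_sum fun j _ => ?_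
        refine (norm_iteratedFDeriv_exp_smul_le _ n _ ξ).trans ?_
        rw [← character_eq_exp, norm_character, PiLp.norm_single, norm_one, mul_one, mul_one]
        exact pow_le_one₀ (norm_nonneg _) ((norm_phaseForm_le _).trans (latNorm_unitVec j).le)
    _ = d := by simp

lemma contDiff_ballCutoff (R : ℝ) : ContDiff ℝ (⊤ : ℕ∞) (ballCutoff d R) :=
  Complex.ofRealCLM.contDiff.comp ((bump d).contDiff.comp (contDiff_eVecL.const_smul R⁻¹))

/-- The cutoff is a fixed bump composed with e/R. Derivatives of e/R of any order i ≥ 1 are bounded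
by d/R, which for R ≤ 8d is at most (K/R)^i with K = 8d². The chain rule for higher derivatives then
yields the scaling R^{-n}. -/
lemma exists_bound_iteratedFDeriv_ballCutoff (d : ℕ) (hd : d ≠ 0) :
    ∃ C : ℝ, 0 ≤ C ∧ ∀ R : ℝ, 0 < R → R ≤ 8 * d → ∀ n ≤ d, ∀ ξ : Freq d,
      ‖iteratedFDeriv ℝ n (ballCutoff d R) ξ‖ * R ^ n ≤ C := by
  set g : EuclideanSpace ℂ (Fin d) → ℂ := fun z => ((bump d z : ℝ) : ℂ) with hg
  have hgs : ContDiff ℝ (⊤ : ℕ∞) g := Complex.ofRealCLM.contDiff.comp (bump d).contDiff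
  have hgc : HasCompactSupport g := (bump d).hasCompactSupport.comp_left Complex.ofReal_zero
  have hbd : ∀ n : ℕ, ∃ C, ∀ z, ‖iteratedFDeriv ℝ n g z‖ ≤ C := fun n =>
    (hgc.iteratedFDeriv n).exists_bound_of_continuous
      (hgs.continuous_iteratedFDeriv (by exact_mod_cast le_top))
  choose Cg hCg using hbd
  set C₀ := ∑ n ∈ Finset.range (d + 1), |Cg n|
  have hC₀ : ∀ n ≤ d, ∀ z, ‖iteratedFDeriv ℝ n g z‖ ≤ C₀ := fun n hn z =>
    (hCg n z).trans ((le_abs_self _).trans (Finset.single_le_sum (f := fun n => |Cg n|)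
      (fun _ _ => abs_nonneg _) (Finset.mem_range.2 (by omega))))
  have hC₀0 : 0 ≤ C₀ := Finset.sum_nonneg fun _ _ => abs_nonneg _
  set K : ℝ := 8 * d * d
  have hd1 : (1:ℝ) ≤ d := by exact_mod_cast Nat.one_le_iff_ne_zero.2 hd
  have hK : 1 ≤ K := by nlinarith
  refine ⟨d.factorial * C₀ * K ^ d, by positivity, fun R hR hR8 n hn ξ => ?_⟩
  have h1 := norm_iteratedFDeriv_comp_le (𝕜 := ℝ) (g := g) (f := fun ξ : Freq d => R⁻¹ • eVecL ξ)
    (n := n) (N := (⊤ : ℕ∞)) hgs (contDiff_eVecL.const_smul R⁻¹) (by exact_mod_cast le_top) ξ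
    (C := C₀) (D := K / R) (fun i hi => hC₀ i (hi.trans hn) _) (fun i hi1 hi => by
      have : iteratedFDeriv ℝ i (fun ξ : Freq d => R⁻¹ • eVecL ξ) ξ =
          R⁻¹ • iteratedFDeriv ℝ i eVecL ξ :=
        iteratedFDeriv_const_smul_apply' contDiff_eVecL.contDiffAt
      rw [this, norm_smul, Real.norm_of_nonneg (by positivity)]
      refine (mul_le_mul_of_nonneg_left (norm_iteratedFDeriv_eVecL_le (by omega) ξ)
        (by positivity)).trans ?_
      obtain ⟨m, rfl⟩ : ∃ m, i = m + 1 := ⟨i - 1, by omega⟩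
      rw [div_pow, le_div_iff₀ (by positivity)]
      calc R⁻¹ * d * R ^ (m + 1) = d * R ^ m := by rw [pow_succ]; field_simp
        _ ≤ d * (8 * d) ^ m := by gcongr
        _ ≤ d * (8 * d * d) ^ m := by
          gcongr
          nlinarith
        _ ≤ K * K ^ m := by gcongr; nlinarith
        _ = _ := by ring)
  calc ‖iteratedFDeriv ℝ n (ballCutoff d R) ξ‖ * R ^ n
      ≤ (n.factorial * C₀ * (K / R) ^ n) * R ^ n := by gcongr; exact h1
    _ = n.factorial * C₀ * K ^ n := by rw [div_pow]; field_simp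
    _ ≤ _ := by
      gcongr

lemma exists_goodAt_shellCutoff (d : ℕ) (hd : d ≠ 0) :
    ∃ C : ℝ, 0 ≤ C ∧ ∀ (r δ : ℝ) (ρ : Freq d), IsScale d r ρ δ →
      GoodAt r ρ δ C (shellCutoff d r) := by
  obtain ⟨C, hC, h⟩ := exists_bound_iteratedFDeriv_ballCutoff d hd
  have hV : 1 ≤ shellVol d := one_le_shellVol
  refine ⟨shellVol d * (C + C), by positivity, fun r δ ρ hs => ?_⟩
  have hr := hs.pos
  refine GoodAt.of_pointwise hs ((contDiff_ballCutoff _).sub (contDiff_ballCutoff _))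
    ((isPeriodic_ballCutoff _).comp₂ (isPeriodic_ballCutoff _) (· - ·)) (by positivity)
    fun n hn ξ _ => ?_
  have hc : ∀ R : ℝ, ContDiff ℝ n (ballCutoff d R) := fun R =>
    (contDiff_ballCutoff R).of_le (by exact_mod_cast le_top)
  have e : iteratedFDeriv ℝ n (shellCutoff d r) ξ =
      iteratedFDeriv ℝ n (ballCutoff d (2 * r)) ξ - iteratedFDeriv ℝ n (ballCutoff d r) ξ :=
    iteratedFDeriv_sub_apply (hc _).contDiffAt (hc _).contDiffAt
  change ‖iteratedFDeriv ℝ n (shellCutoff d r) ξ‖ * r ^ n ≤ _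
  rw [e]
  have h1 := h (2 * r) (by positivity) (by linarith [hs.le]) n hn ξ
  have h2 := h r hr (by linarith [hs.le]) n hn ξ
  calc _ ≤ (‖iteratedFDeriv ℝ n (ballCutoff d (2 * r)) ξ‖ + ‖iteratedFDeriv ℝ n (ballCutoff d r) ξ‖)
        * r ^ n := by gcongr; exact norm_sub_le _ _
    _ ≤ ‖iteratedFDeriv ℝ n (ballCutoff d (2 * r)) ξ‖ * (2 * r) ^ n +
        ‖iteratedFDeriv ℝ n (ballCutoff d r) ξ‖ * r ^ n := by
      rw [add_mul]; gcongr; linarith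
    _ ≤ _ := add_le_add h1 h2

lemma shellCutoff_eq_zero {r : ℝ} (hr : 0 < r) {ξ : Freq d}
    (h : ¬ (r / 2 ≤ ‖eVecL ξ‖ ∧ ‖eVecL ξ‖ ≤ 2 * r)) : shellCutoff d r ξ = 0 := by
  rw [shellCutoff]
  by_cases h1 : ‖eVecL ξ‖ ≤ r / 2
  · rw [ballCutoff_eq_one hr h1, ballCutoff_eq_one (by positivity) (by linarith), sub_self]
  · have h2 : 2 * r ≤ ‖eVecL ξ‖ := by
      by_contra hc; exact h ⟨(not_le.1 h1).le, (not_le.1 hc).le⟩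
    rw [ballCutoff_eq_zero hr (by linarith), ballCutoff_eq_zero (by positivity) h2, sub_self]

/-! Coefficients in weak spaces. -/

/-- The constant in `goodAt_coeff`. -/
noncomputable def coeffConst (d : ℕ) (α δ C₀ C₁ Cd : ℝ) : ℝ :=
  8 * C₁ + ∑ n ∈ Finset.range d, d ^ n * (|weakConst d n α| * C₀ * shellVol d)
    + d ^ (d - 1) * (|weakConst d d (δ + α)| * Cd * shellVol d)

lemma volume_rpow_le {r a : ℝ} (hd : d ≠ 0) (hr : 0 < r) (had : a ≤ d) :
    (shellVol d * r ^ d) ^ (a / d) ≤ shellVol d * r ^ a := by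
  have hd' : (0:ℝ) < d := by positivity
  have hV := one_le_shellVol (d := d)
  rw [Real.mul_rpow (by positivity) (by positivity), ← Real.rpow_natCast r d, ← Real.rpow_mul hr.le,
    mul_div_cancel₀ _ hd'.ne']
  gcongr
  conv_rhs => rw [← Real.rpow_one (shellVol d)]
  refine Real.rpow_le_rpow_of_exponent_le hV ?_
  rw [div_le_one hd']; exact had

/-- Order zero uses the Hölder bound near the origin. Orders 1 to d - 1 use weak exponents d/(n-α₀),
which beat d/n by a gain r^α. At the top the improvement δ + αd over the exponent one produces
r^{δ+α}, whose part r^δ belongs to the weight. -/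
lemma goodAt_coeff {r δ κ α α₀ αd C₀ C₁ Cd : ℝ} {ρ : Freq d} (h : IsScale d r ρ δ) (hρ : ρ ≠ 0)
    {Q : Freq d → ℂ} {a : ℂ} (hQ : ContDiff ℝ (⊤ : ℕ∞) Q) (hp : IsPeriodic Q) (hκ : 0 ≤ κ)
    (hα : 0 < α) (hα₀ : α ≤ α₀) (hαd : α ≤ αd) (hδα : δ + α < 1)
    (hC₀ : 0 < C₀) (hC₁ : 0 < C₁) (hCd : 0 < Cd)
    (hhol : ∀ ξ, ‖Q ξ - a‖ ≤ C₁ * (‖eVecL ξ‖ + κ) ^ α)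
    (hder : ∀ n : ℕ, 1 ≤ n → n < d → ∀ j : Fin n → Fin d,
      WeakLpLE ((d : ℝ≥0∞) / ENNReal.ofReal ((n : ℝ) - α₀)) C₀ (partialDeriv j Q))
    (hdiff : ∀ j : Fin (d - 1) → Fin d,
      WeakLpLE ((d : ℝ≥0∞) / ENNReal.ofReal ((d : ℝ) - δ - αd)) Cd
        fun ξ => partialDeriv j (fun ζ => Q (ζ + ρ) - Q ζ) ξ / ((‖ρ‖ ^ (1 - δ) : ℝ) : ℂ)) :
    GoodAt r ρ δ (coeffConst d α δ C₀ C₁ Cd * (r + κ) ^ α) (fun ξ => Q ξ - a) := by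
  have hd := h.dim_ne_zero
  have hd1 : (1:ℝ) ≤ d := by exact_mod_cast Nat.one_le_iff_ne_zero.2 hd
  have hr := h.pos
  have hV := one_le_shellVol (d := d)
  have hδ := h.nonneg
  have hf : ContDiff ℝ (⊤ : ℕ∞) (fun ξ => Q ξ - a) := hQ.sub contDiff_const
  have hrs : r ^ α ≤ (r + κ) ^ α := by gcongr; linarith
  have hvol : 0 < shellVol d * r ^ d := by positivity
  have hpartsum : ∀ n < d, d ^ n * (|weakConst d n α| * C₀ * shellVol d) ≤
      coeffConst d α δ C₀ C₁ Cd := by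
    intro n hn
    have := Finset.single_le_sum (f := fun n : ℕ => (d:ℝ) ^ n * (|weakConst d n α| * C₀ * shellVol d))
      (fun _ _ => by positivity) (Finset.mem_range.2 hn)
    have h2 : 0 ≤ (d:ℝ) ^ (d - 1) * (|weakConst d d (δ + α)| * Cd * shellVol d) := by positivity
    rw [coeffConst]
    linarith
  have hsum0 : 0 ≤ ∑ n ∈ Finset.range d, (d:ℝ) ^ n * (|weakConst d n α| * C₀ * shellVol d) :=
    Finset.sum_nonneg fun _ _ => by positivity
  have htop0 : 0 ≤ (d:ℝ) ^ (d - 1) * (|weakConst d d (δ + α)| * Cd * shellVol d) := by positivity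
  have hcc : 0 ≤ coeffConst d α δ C₀ C₁ Cd := by unfold coeffConst; positivity
  refine ⟨hf, hp.comp (· - a), fun n hn => ?_, ?_⟩
  · rcases Nat.eq_zero_or_pos n with rfl | hn1
    · rw [derivNorm]
      simp only [add_zero, Nat.cast_zero]
      rw [ENNReal.div_zero (by exact_mod_cast hd), eLpNorm_exponent_top]
      refine eLpNormEssSup_le_of_ae_enorm_bound ?_
      refine (ae_restrict_iff' ((measurableSet_cube d).inter (measurableSet_shell _ _))).2
        (Eventually.of_forall fun ξ hξ => ?_)
      rw [← ofReal_norm, norm_iteratedFDeriv_zero]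
      refine ENNReal.ofReal_le_ofReal ((hhol ξ).trans ?_)
      have h3 : ‖eVecL ξ‖ ≤ 8 * r := hξ.2.2
      calc C₁ * (‖eVecL ξ‖ + κ) ^ α ≤ C₁ * (8 * (r + κ)) ^ α := by gcongr; linarith
        _ = C₁ * (8 ^ α * (r + κ) ^ α) := by rw [Real.mul_rpow (by norm_num) (by positivity)]
        _ ≤ C₁ * (8 * (r + κ) ^ α) := by
          gcongr
          conv_rhs => rw [← Real.rpow_one 8]
          exact Real.rpow_le_rpow_of_exponent_le (by norm_num) (by linarith)
        _ = 8 * C₁ * (r + κ) ^ α := by ring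
        _ ≤ _ := by
          gcongr
          rw [coeffConst]
          linarith
    · have e : derivNorm (outerShell d r) n 0 (fun ξ => Q ξ - a) =
          derivNorm (outerShell d r) n 0 Q := by
        have : iteratedFDeriv ℝ n (fun ξ => Q ξ - a) = iteratedFDeriv ℝ n Q := by
          funext ξ
          have := iteratedFDeriv_sub_apply (i := n) (x := ξ) (f := Q) (g := fun _ => a)
            (hQ.of_le (by exact_mod_cast le_top)).contDiffAt contDiff_const.contDiffAt
          rw [iteratedFDeriv_const_of_ne hn1.ne', Pi.zero_apply, sub_zero] at this
          exact this
        rw [derivNorm, derivNorm, this]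
      rw [e]
      have hn1' : (1:ℝ) ≤ n := by exact_mod_cast hn1
      refine (derivNorm_le_of_partialDeriv (m := 0) hd (by omega) hQ (fun j => by
        rw [add_zero]
        exact (hder n hn1 hn j).eLpNorm_le hd (continuous_partialDeriv hQ j) hC₀ hα
          (by linarith) (by linarith) hvol (volume_outerShell_le r hr.le))).trans ?_
      rw [← ENNReal.ofReal_natCast, ← ENNReal.ofReal_pow (by positivity),
        ← ENNReal.ofReal_mul (by positivity)]
      refine ENNReal.ofReal_le_ofReal ?_
      calc (d:ℝ) ^ n * (weakConst d n α * C₀ * (shellVol d * r ^ d) ^ (α / d))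
          ≤ (d:ℝ) ^ n * (|weakConst d n α| * C₀ * (shellVol d * r ^ α)) := by
            gcongr
            · exact le_abs_self _
            · exact volume_rpow_le hd hr (by linarith)
        _ = (d:ℝ) ^ n * (|weakConst d n α| * C₀ * shellVol d) * r ^ α := by ring
        _ ≤ _ := by
          gcongr
          exact hpartsum n hn
  · have e : shiftDiff ρ (fun ξ => Q ξ - a) = fun ζ => Q (ζ + ρ) - Q ζ := by
      funext ξ; simp [shiftDiff]
    rw [e]
    have hρ0 : 0 < ‖ρ‖ := norm_pos_iff.2 hρ
    set w : ℝ := ‖ρ‖ ^ (1 - δ) with hw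
    have hw0 : 0 < w := by positivity
    have hg := contDiff_shiftDiff hQ ρ
    have hd1' : d - 1 + 1 = d := by omega
    refine (derivNorm_le_of_partialDeriv (m := 1) hd (by omega) hg
      (B := ENNReal.ofReal (w * (|weakConst d d (δ + α)| * Cd * (shellVol d * r ^ (δ + α)))))
      (fun j => ?_)).trans ?_
    · rw [hd1']
      -- With τ = d the target is L^1, and all of δ + α is gained from the volume of the shell.
      have h1 := (hdiff j).eLpNorm_le (a := δ + α) (τ := d) hd
        ((continuous_partialDeriv hg j).div_const _) hCd (by linarith) (by linarith) (by linarith)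
        hvol ((measure_mono (Set.inter_subset_inter_right _ h.shellPair.subset)).trans
          (volume_outerShell_le r hr.le))
      have e2 : partialDeriv j (shiftDiff ρ Q) = (w : ℂ) • fun ξ =>
          partialDeriv j (fun ζ => Q (ζ + ρ) - Q ζ) ξ / ((w : ℝ) : ℂ) := by
        funext ξ
        have : (w:ℂ) ≠ 0 := by exact_mod_cast hw0.ne'
        simp only [Pi.smul_apply, smul_eq_mul]
        field_simp
        rfl
      rw [e2, eLpNorm_const_smul]
      have hwe : ‖(w:ℂ)‖ₑ = ENNReal.ofReal w := by
        rw [← ofReal_norm, Complex.norm_real, Real.norm_of_nonneg hw0.le]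
      rw [hwe, ENNReal.ofReal_mul hw0.le]
      refine mul_le_mul' le_rfl (h1.trans (ENNReal.ofReal_le_ofReal ?_))
      gcongr
      · exact le_abs_self _
      · exact volume_rpow_le hd hr (by linarith)
    · have hW : 0 ≤ holderWeight r ρ δ := by unfold holderWeight; positivity
      rw [← ENNReal.ofReal_natCast, ← ENNReal.ofReal_pow (by positivity),
        ← ENNReal.ofReal_mul (by positivity), ← ENNReal.ofReal_mul hW]
      refine ENNReal.ofReal_le_ofReal ?_
      rw [Real.rpow_add hr]
      calc (d:ℝ) ^ (d - 1) * (w * (|weakConst d d (δ + α)| * Cd * (shellVol d * (r ^ δ * r ^ α))))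
          = (w * r ^ δ) * ((d:ℝ) ^ (d - 1) * (|weakConst d d (δ + α)| * Cd * shellVol d) * r ^ α) := by
            ring
        _ ≤ (w * r ^ δ) * (coeffConst d α δ C₀ C₁ Cd * (r + κ) ^ α) := by
          gcongr
          rw [coeffConst]
          linarith

end Multipliers

/-! ### The difference of the two symbols -/

section Symbol

variable {d : ℕ}

/-- The symbol `κ² + e(-ζ) M(ξ) e(ζ)`, `ζ = ξ + i b`. -/
noncomputable def symbol (κ : ℝ) (b : Freq d) (M : Freq d → Matrix (Fin d) (Fin d) ℂ) (ξ : Freq d) : ℂ :=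
  ((κ ^ 2 : ℝ) : ℂ) + ∑ k, ∑ k', (planeWave b (-unitVec k) ξ - 1) *
    (M ξ k k' * (planeWave b (unitVec k') ξ - 1))

/-- The difference of the inverses of two symbols. -/
noncomputable def resolventDiff (κ : ℝ) (b : Freq d) (Q : Freq d → Matrix (Fin d) (Fin d) ℂ)
    (A : Matrix (Fin d) (Fin d) ℂ) (ξ : Freq d) : ℂ :=
  (symbol κ b Q ξ)⁻¹ - (symbol κ b (fun _ => A) ξ)⁻¹

/-- Quantitative hypotheses on a matrix symbol `Q` close to the constant `A` near the origin. -/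
structure SymbolData (α α₀ δ αd C₀ C₁ Cd c₁ B κ : ℝ) (b : Freq d)
    (Q : Freq d → Matrix (Fin d) (Fin d) ℂ) (A : Matrix (Fin d) (Fin d) ℂ) : Prop where
  κ_pos : 0 < κ
  κ_le : κ ≤ 1
  norm_b : ‖b‖ ≤ κ
  smooth : ∀ k k', ContDiff ℝ (⊤ : ℕ∞) fun ξ => Q ξ k k'
  periodic : ∀ k k', IsPeriodic fun ξ => Q ξ k k'
  holder : ∀ k k' ξ, ‖Q ξ k k' - A k k'‖ ≤ C₁ * (‖eVecL ξ‖ + κ) ^ α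
  deriv : ∀ k k', ∀ n : ℕ, 1 ≤ n → n < d → ∀ j : Fin n → Fin d,
    WeakLpLE ((d : ℝ≥0∞) / ENNReal.ofReal ((n : ℝ) - α₀)) C₀ (partialDeriv j fun ξ => Q ξ k k')
  diff : ∀ k k', ∀ ρ : Freq d, ‖ρ‖ ≤ 1 → ∀ j : Fin (d - 1) → Fin d,
    WeakLpLE ((d : ℝ≥0∞) / ENNReal.ofReal ((d : ℝ) - δ - αd)) Cd
      fun ξ => partialDeriv j (fun ζ => Q (ζ + ρ) k k' - Q ζ k k') ξ / ((‖ρ‖ ^ (1 - δ) : ℝ) : ℂ)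
  lower : ∀ ξ, c₁ * (‖eVecL ξ‖ + κ) ^ 2 ≤ ‖symbol κ b Q ξ‖
  lower_const : ∀ ξ, c₁ * (‖eVecL ξ‖ + κ) ^ 2 ≤ ‖symbol κ b (fun _ => A) ξ‖
  bound : ∀ k k', ‖A k k'‖ ≤ B

lemma latNorm_neg (y : Lattice d) : latNorm (-y) = latNorm y := by simp [latNorm]

/-- The difference of the resolvents scales like `r^{α-2}`, with its derivatives. -/
theorem exists_goodAt_resolventDiff (hd : d ≠ 0) {α α₀ δ αd C₀ C₁ Cd c₁ B : ℝ}
    (hα : 0 < α) (hα₀ : α ≤ α₀) (hαd : α ≤ αd) (hδα : δ + α < 1) (hδ : 0 ≤ δ)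
    (hC₀ : 0 < C₀) (hC₁ : 0 < C₁) (hCd : 0 < Cd) (hc₁ : 0 < c₁) (hB : 0 ≤ B) :
    ∃ C : ℝ, 0 ≤ C ∧ ∀ (κ r : ℝ) (ρ b : Freq d) (Q : Freq d → Matrix (Fin d) (Fin d) ℂ)
      (A : Matrix (Fin d) (Fin d) ℂ), SymbolData α α₀ δ αd C₀ C₁ Cd c₁ B κ b Q A →
      IsScale d r ρ δ → ρ ≠ 0 → ‖ρ‖ ≤ 1 →
      GoodAt r ρ δ (C * (r + κ) ^ (α - 2)) (resolventDiff κ b Q A) := by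
  have hd1 : (1:ℝ) ≤ d := by exact_mod_cast Nat.one_le_iff_ne_zero.2 hd
  have hV := one_le_shellVol (d := d)
  set Ke : ℝ := shellVol d * (13 * (4 * d) ^ d) with hKe
  have hKe0 : 0 ≤ Ke := by positivity
  set Kq : ℝ := coeffConst d α δ C₀ C₁ Cd
  have hKq0 : 0 ≤ Kq := by
    have : 0 ≤ ∑ n ∈ Finset.range d, (d:ℝ) ^ n * (|weakConst d n α| * C₀ * shellVol d) :=
      Finset.sum_nonneg fun _ _ => by positivity
    change 0 ≤ coeffConst d α δ C₀ C₁ Cd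
    unfold coeffConst; positivity
  set s₀ : ℝ := 4 * d + 1
  have hs₀ : 1 ≤ s₀ := by simp only [s₀]; linarith
  set K1 : ℝ := d * (d * (2 ^ d * Ke * (2 ^ d * Kq * Ke)))
  set K0 : ℝ := 1 + d * (d * (2 ^ d * Ke * (2 ^ d * B * Ke)))
  have hK1 : 0 ≤ K1 := by positivity
  have hK0 : 1 ≤ K0 := by simp only [K0]; linarith [show 0 ≤ d * (d * (2 ^ d * Ke * (2 ^ d * B * Ke))) by positivity]
  set KD : ℝ := K0 + K1 * s₀
  have hKD : K0 ≤ KD := by simp only [KD]; linarith [show 0 ≤ K1 * s₀ by positivity]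
  -- On the outer shell |e(ξ)| ≥ r/8, hence (|e(ξ)| + κ)² ≥ (s/8)².
  set c : ℝ := c₁ / 64 with hc
  have hc0 : 0 < c := by positivity
  -- Both symbols are bounded above and below by multiples of s². The ratio R of these multiples is
  -- the only input that `GoodAt.inv` needs, so the constant is uniform in r and κ.
  set R : ℝ := max 1 (KD / c)
  have hR : KD ≤ R * c := by rw [← div_le_iff₀ hc0]; exact le_max_right _ _
  set I : ℝ := (invConst d (ENNReal.ofReal R)).toReal
  have hI : 0 ≤ I := ENNReal.toReal_nonneg
  refine ⟨2 ^ d * 1 * (2 ^ d * K1 * (2 ^ d * (I * c⁻¹) * (I * c⁻¹))), by positivity,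
    fun κ r ρ b Q A hQ hs hρ hρ1 => ?_⟩
  have hr := hs.pos
  have hκ := hQ.κ_pos
  set s : ℝ := r + κ with hsdef
  have hs0 : 0 < s := by positivity
  have hss₀ : s ≤ s₀ := by simp only [hsdef, s₀]; linarith [hs.le, hQ.κ_le]
  have h4d : (1:ℝ) ≤ 4 * d := by linarith
  have he : ∀ y : Lattice d, latNorm y = 1 →
      GoodAt r ρ δ (Ke * s) (fun ξ => planeWave b y ξ - 1) := by
    intro y hy
    refine (goodAt_planeWave_sub_one (R := 4 * d) hs hQ.norm_b
      (by rw [hy, mul_one]; exact hQ.norm_b.trans hQ.κ_le) h4d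
      (by rw [hy, one_mul]; exact hs.le)).mono (le_of_eq ?_)
    rw [hy, hKe]; ring
  have he1 := fun k : Fin d => he (unitVec k) (latNorm_unitVec k)
  have he2 := fun k : Fin d => he (-unitVec k) ((latNorm_neg _).trans (latNorm_unitVec k))
  have hq : ∀ k k', GoodAt r ρ δ (Kq * s ^ α) (fun ξ => Q ξ k k' - A k k') := fun k k' =>
    goodAt_coeff hs hρ (hQ.smooth k k') (hQ.periodic k k') hκ.le hα hα₀ hαd hδα hC₀ hC₁ hCd
      (hQ.holder k k') (hQ.deriv k k') (hQ.diff k k' ρ hρ1)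
  have hdiff : GoodAt r ρ δ (K1 * (s ^ α * s ^ 2))
      (fun ξ => symbol κ b Q ξ - symbol κ b (fun _ => A) ξ) := by
    have h1 : GoodAt r ρ δ ((Finset.univ : Finset (Fin d)).card * ((Finset.univ : Finset (Fin d)).card *
        (2 ^ d * (Ke * s) * (2 ^ d * (Kq * s ^ α) * (Ke * s)))))
        (fun ξ => ∑ k, ∑ k', (planeWave b (-unitVec k) ξ - 1) *
          ((Q ξ k k' - A k k') * (planeWave b (unitVec k') ξ - 1))) :=
      GoodAt.sum hs _ fun k _ => GoodAt.sum hs _ fun k' _ =>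
        (he2 k).mul hs ((hq k k').mul hs (he1 k') (by positivity)) (by positivity)
    have e : (fun ξ => symbol κ b Q ξ - symbol κ b (fun _ => A) ξ) =
        fun ξ => ∑ k, ∑ k', (planeWave b (-unitVec k) ξ - 1) *
          ((Q ξ k k' - A k k') * (planeWave b (unitVec k') ξ - 1)) := by
      funext ξ
      simp only [symbol, add_sub_add_left_eq_sub, ← Finset.sum_sub_distrib]
      refine Finset.sum_congr rfl fun k _ => Finset.sum_congr rfl fun k' _ => ?_
      ring
    rw [e]
    refine h1.mono (le_of_eq ?_)
    rw [Finset.card_univ, Fintype.card_fin]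
    simp only [K1]; ring
  have hD0 : GoodAt r ρ δ (K0 * s ^ 2) (symbol κ b (fun _ => A)) := by
    have h1 : GoodAt r ρ δ ((Finset.univ : Finset (Fin d)).card * ((Finset.univ : Finset (Fin d)).card *
        (2 ^ d * (Ke * s) * (2 ^ d * B * (Ke * s)))))
        (fun ξ => ∑ k, ∑ k', (planeWave b (-unitVec k) ξ - 1) *
          (A k k' * (planeWave b (unitVec k') ξ - 1))) :=
      GoodAt.sum hs _ fun k _ => GoodAt.sum hs _ fun k' _ =>
        (he2 k).mul hs (((GoodAt.const hs (A k k')).mono (hQ.bound k k')).mul hs (he1 k') hB)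
          (by positivity)
    have h2 : GoodAt r ρ δ (s ^ 2) (fun _ => ((κ ^ 2 : ℝ) : ℂ)) := by
      refine (GoodAt.const hs _).mono ?_
      rw [Complex.norm_real, Real.norm_of_nonneg (by positivity)]
      gcongr; linarith
    refine (h2.add hs h1 (by positivity) (by positivity)).mono (le_of_eq ?_)
    rw [Finset.card_univ, Fintype.card_fin]
    simp only [K0]; ring
  -- Scales are bounded, so the gain s^α may be discarded when bounding the full symbol.
  have hsα : s ^ α ≤ s₀ := by
    calc s ^ α ≤ s₀ ^ α := by gcongr
      _ ≤ s₀ ^ (1:ℝ) := Real.rpow_le_rpow_of_exponent_le hs₀ (by linarith)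
      _ = s₀ := Real.rpow_one _
  have hD : GoodAt r ρ δ (KD * s ^ 2) (symbol κ b Q) := by
    have e : symbol κ b Q = fun ξ => symbol κ b (fun _ => A) ξ +
        (symbol κ b Q ξ - symbol κ b (fun _ => A) ξ) := by funext ξ; ring
    rw [e]
    refine (hD0.add hs hdiff (by positivity) (by positivity)).mono ?_
    simp only [KD]
    have : K1 * (s ^ α * s ^ 2) ≤ K1 * (s₀ * s ^ 2) := by gcongr
    linarith
  have hlow : ∀ ξ ∈ outerShell d r, c * s ^ 2 ≤ c₁ * (‖eVecL ξ‖ + κ) ^ 2 := by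
    intro ξ hξ
    have h1 : r / 8 ≤ ‖eVecL ξ‖ := hξ.1
    calc c * s ^ 2 = c₁ * (s / 8) ^ 2 := by rw [hc]; ring
      _ ≤ _ := by gcongr; simp only [hsdef]; linarith
  have hne : ∀ M : Freq d → Matrix (Fin d) (Fin d) ℂ,
      (∀ ξ, c₁ * (‖eVecL ξ‖ + κ) ^ 2 ≤ ‖symbol κ b M ξ‖) → ∀ ξ, symbol κ b M ξ ≠ 0 := by
    intro M hM ξ
    refine norm_pos_iff.1 (lt_of_lt_of_le ?_ (hM ξ))
    positivity
  have hiD : GoodAt r ρ δ (I * (c * s ^ 2)⁻¹) (fun ξ => (symbol κ b Q ξ)⁻¹) :=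
    GoodAt.inv hs (le_max_left _ _) (by positivity) (hD.mono (by
      calc KD * s ^ 2 ≤ R * c * s ^ 2 := by gcongr
        _ = _ := by ring)) (hne Q hQ.lower) fun ξ hξ => (hlow ξ hξ).trans (hQ.lower ξ)
  have hiD0 : GoodAt r ρ δ (I * (c * s ^ 2)⁻¹) (fun ξ => (symbol κ b (fun _ => A) ξ)⁻¹) :=
    GoodAt.inv hs (le_max_left _ _) (by positivity) (hD0.mono (by
      calc K0 * s ^ 2 ≤ R * c * s ^ 2 := by gcongr; exact hKD.trans hR
        _ = _ := by ring)) (hne _ hQ.lower_const) fun ξ hξ => (hlow ξ hξ).trans (hQ.lower_const ξ)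
  -- Second resolvent identity: a factor of size s^{2+α} times two inverses of size s^{-2}.
  have e : resolventDiff κ b Q A = fun ξ => (-1 : ℂ) *
      ((symbol κ b Q ξ - symbol κ b (fun _ => A) ξ) *
        ((symbol κ b Q ξ)⁻¹ * (symbol κ b (fun _ => A) ξ)⁻¹)) := by
    funext ξ
    have h1 := hne Q hQ.lower ξ
    have h2 := hne _ hQ.lower_const ξ
    simp only [resolventDiff]
    field_simp
    ring
  rw [e]
  have h1 : GoodAt r ρ δ 1 (fun _ => (-1 : ℂ)) := (GoodAt.const hs (-1)).mono (by simp)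
  refine (h1.mul hs (hdiff.mul hs (hiD.mul hs hiD0 (by positivity)) (by positivity))
    (by positivity)).mono (le_of_eq ?_)
  rw [Real.rpow_sub hs0, Real.rpow_two]
  field_simp

/-! ### Oscillatory integrals over a shell -/

/-- Crude bound for the integral of a function supported in a shell. -/
lemma norm_setIntegral_shell_le {r δ B : ℝ} {ρ : Freq d} (h : IsScale d r ρ δ) (hB : 0 ≤ B)
    {f : Freq d → ℂ} (hf : GoodAt r ρ δ B f) (hsupp : ∀ ξ ∉ outerShell d r, f ξ = 0) (x : Lattice d) :
    ‖∫ ξ in cube d, character x ξ * f ξ‖ ≤ shellVol d * (B * r ^ d) := by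
  have hd := h.dim_ne_zero
  have hr := h.pos
  have hV := one_le_shellVol (d := d)
  have h0 := hf.low 0 (Nat.pos_of_ne_zero hd)
  rw [derivNorm] at h0
  simp only [add_zero, Nat.cast_zero] at h0
  rw [ENNReal.div_zero (by exact_mod_cast hd), eLpNorm_exponent_top] at h0
  have hae : ∀ᵐ ξ ∂volume.restrict (cube d ∩ outerShell d r), ‖character x ξ * f ξ‖ ≤ B := by
    filter_upwards [ae_le_eLpNormEssSup (f := iteratedFDeriv ℝ 0 f)
      (μ := volume.restrict (cube d ∩ outerShell d r))] with ξ hξ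
    have := hξ.trans h0
    rw [← ofReal_norm, norm_iteratedFDeriv_zero, ENNReal.ofReal_le_ofReal_iff hB] at this
    rwa [norm_mul, norm_character, one_mul]
  have e : ∫ ξ in cube d, character x ξ * f ξ = ∫ ξ in cube d ∩ outerShell d r, character x ξ * f ξ := by
    have := setIntegral_eq_of_subset_of_forall_sdiff_eq_zero (μ := volume)
      (f := fun ξ => character x ξ * f ξ) (measurableSet_cube d)
      (Set.inter_subset_left (t := outerShell d r)) fun ξ hξ => by
        rw [hsupp ξ fun hc => hξ.2 ⟨hξ.1, hc⟩, mul_zero]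
    exact this
  rw [e]
  have hvol := volume_outerShell_le (d := d) r hr.le
  refine (norm_setIntegral_le_of_norm_le_const_ae (hvol.trans_lt ENNReal.ofReal_lt_top) hae).trans ?_
  have : volume.real (cube d ∩ outerShell d r) ≤ shellVol d * r ^ d := by
    rw [measureReal_def]
    exact ENNReal.toReal_le_of_le_ofReal (by positivity) hvol
  calc B * volume.real (cube d ∩ outerShell d r) ≤ B * (shellVol d * r ^ d) := by gcongr
    _ = _ := by ring

/-- Bound from `d - 1` integrations by parts and one half period translation. -/
lemma norm_setIntegral_shell_le_of_shift {r δ B : ℝ} {x : Lattice d} {j : Fin d} (hx : x j ≠ 0)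
    (h : IsScale d r (EuclideanSpace.single j (Real.pi / x j)) δ) (hB : 0 ≤ B)
    {f : Freq d → ℂ} (hf : GoodAt r (EuclideanSpace.single j (Real.pi / x j)) δ B f)
    (hsupp : ∀ ξ, ¬ (r / 2 ≤ ‖eVecL ξ‖ ∧ ‖eVecL ξ‖ ≤ 2 * r) → f ξ = 0) :
    ‖∫ ξ in cube d, character x ξ * f ξ‖ ≤
      4 * (B * (r ^ δ * |(x j : ℝ)| ^ (-((d : ℝ) - δ)))) := by
  set ρ : Freq d := EuclideanSpace.single j (Real.pi / x j) with hρ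
  have hd := h.dim_ne_zero
  have hr := h.pos
  have hxj : 0 < |(x j : ℝ)| := abs_pos.2 (by exact_mod_cast hx)
  have hnρ : ‖ρ‖ = Real.pi / |(x j : ℝ)| := by
    rw [hρ, PiLp.norm_single, Real.norm_eq_abs, abs_div, abs_of_pos Real.pi_pos]
  set v : Freq d := EuclideanSpace.single j 1
  set g : Freq d → ℂ := fun ξ => iteratedFDeriv ℝ (d - 1) f ξ fun _ => v with hg
  have hgc : Continuous g :=
    (ContinuousMultilinearMap.apply ℝ (fun _ : Fin (d - 1) => Freq d) ℂ (fun _ => v)).continuous.comp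
      (continuous_iteratedFDeriv_top hf.smooth _)
  have hgp : IsPeriodic g := (hf.periodic.iteratedFDeriv _).comp fun L => L fun _ => v
  have h1 := setIntegral_character_mul_iteratedFDeriv x j hf.smooth hf.periodic (d - 1)
  have h2 := setIntegral_character_half_period x j hx hgc hgp
  change ∫ ξ in cube d, character x ξ * g ξ = _ at h1
  have hgd : ∀ ξ, ‖g (ξ + ρ) - g ξ‖ ≤ ‖iteratedFDeriv ℝ (d - 1) (shiftDiff ρ f) ξ‖ := by
    intro ξ
    rw [iteratedFDeriv_shiftDiff hf.smooth, hg]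
    simp only [shiftDiff]
    rw [← sub_apply]
    refine (ContinuousMultilinearMap.le_opNorm _ _).trans (le_of_eq ?_)
    simp [v]
  -- The translation changes |e| by at most r/8, so the difference is supported in the inner shell,
  -- the only place where the top-order bound is available.
  have hsub : Function.support (iteratedFDeriv ℝ (d - 1) (shiftDiff ρ f)) ⊆ innerShell d r := by
    refine (support_iteratedFDeriv_subset _).trans ?_
    refine closure_minimal (fun ξ hξ => ?_) ((isClosed_le continuous_const continuous_eVecL.norm).inter
      (isClosed_le continuous_eVecL.norm continuous_const))
    have h3 := norm_eVecL_sub_le (ξ + ρ) ξ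
    rw [add_sub_cancel_left] at h3
    have h4 := norm_sub_norm_le (eVecL (ξ + ρ)) (eVecL ξ)
    have h5 := norm_sub_norm_le (eVecL ξ) (eVecL (ξ + ρ))
    rw [norm_sub_rev] at h5
    have h6 := h.norm_le
    by_contra hc
    refine hξ ?_
    rw [shiftDiff, hsupp ξ, hsupp (ξ + ρ), sub_zero]
    · rintro ⟨h7, h8⟩
      exact hc ⟨by change r / 4 ≤ _; linarith, by change _ ≤ 4 * r; linarith⟩
    · rintro ⟨h7, h8⟩
      exact hc ⟨by change r / 4 ≤ _; linarith, by change _ ≤ 4 * r; linarith⟩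
  have htop := hf.top
  -- With n = d - 1 and m = 1 the exponent is d/d = 1: the bound is exactly the L^1 norm needed for
  -- the integral.
  rw [derivNorm, show d - 1 + 1 = d by omega,
    ENNReal.div_self (by exact_mod_cast hd) (ENNReal.natCast_ne_top d),
    eLpNorm_one_eq_lintegral_enorm] at htop
  have hW : 0 ≤ holderWeight r ρ δ := by unfold holderWeight; positivity
  have h3 : ‖∫ ξ in cube d, character x ξ * (g (ξ + ρ) - g ξ)‖ ≤ holderWeight r ρ δ * B := by
    rw [← ENNReal.ofReal_mul hW] at htop
    refine (ENNReal.ofReal_le_ofReal_iff (by positivity)).1 (le_trans ?_ htop)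
    rw [ofReal_norm]
    refine (enorm_integral_le_lintegral_enorm _).trans ?_
    have h4 : ∫⁻ ξ in cube d ∩ innerShell d r, ‖iteratedFDeriv ℝ (d - 1) (shiftDiff ρ f) ξ‖ₑ =
        ∫⁻ ξ in cube d, ‖iteratedFDeriv ℝ (d - 1) (shiftDiff ρ f) ξ‖ₑ := by
      have hm : MeasurableSet (innerShell d r) := measurableSet_shell _ _
      rw [Set.inter_comm, ← Measure.restrict_restrict hm, ← lintegral_indicator hm]
      refine lintegral_congr fun ξ => ?_
      by_cases hξ : ξ ∈ innerShell d r
      · exact Set.indicator_of_mem hξ _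
      · rw [Set.indicator_of_notMem hξ]
        have : iteratedFDeriv ℝ (d - 1) (shiftDiff ρ f) ξ = 0 := by
          by_contra hc; exact hξ (hsub hc)
        rw [this, enorm_zero]
    rw [h4]
    refine lintegral_mono fun ξ => ?_
    rw [← ofReal_norm, ← ofReal_norm, norm_mul, norm_character, one_mul]
    exact ENNReal.ofReal_le_ofReal (hgd ξ)
  set J := ∫ ξ in cube d, character x ξ * f ξ
  -- Integration by parts produces the d - 1 powers of x_j. The half-period translation ρ = π/x_j
  -- contributes the remaining 1 - δ through ‖ρ‖^{1-δ} in the weight.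
  have h5 : 2 * (|(x j : ℝ)| ^ (d - 1) * ‖J‖) ≤ holderWeight r ρ δ * B := by
    have : ‖2 * ∫ ξ in cube d, character x ξ * g ξ‖ = 2 * (|(x j : ℝ)| ^ (d - 1) * ‖J‖) := by
      rw [h1]
      simp [mul_pow]
    rw [← this, h2, norm_neg]
    exact h3
  have hδ1 : 0 ≤ 1 - δ := by linarith [h.le_one]
  have hpi : Real.pi ^ (1 - δ) ≤ 4 := by
    calc Real.pi ^ (1 - δ) ≤ Real.pi ^ (1:ℝ) :=
          Real.rpow_le_rpow_of_exponent_le (by linarith [Real.pi_gt_three]) (by linarith [h.nonneg])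
      _ ≤ 4 := by rw [Real.rpow_one]; exact Real.pi_le_four
  have h6 : |(x j : ℝ)| ^ (-((d : ℝ) - δ)) * |(x j : ℝ)| ^ (d - 1) = (|(x j : ℝ)| ^ (1 - δ))⁻¹ := by
    rw [← Real.rpow_natCast _ (d - 1), ← Real.rpow_add hxj, ← Real.rpow_neg hxj.le,
      Nat.cast_sub (Nat.one_le_iff_ne_zero.2 hd)]
    congr 1; push_cast; ring
  have h7 : holderWeight r ρ δ ≤ 4 * r ^ δ * (|(x j : ℝ)| ^ (1 - δ))⁻¹ := by
    rw [holderWeight, hnρ, Real.div_rpow Real.pi_pos.le hxj.le, div_eq_mul_inv]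
    calc _ = Real.pi ^ (1 - δ) * r ^ δ * (|(x j : ℝ)| ^ (1 - δ))⁻¹ := by ring
      _ ≤ _ := by gcongr
  have hpow : 0 < |(x j : ℝ)| ^ (d - 1) := by positivity
  refine le_of_mul_le_mul_right ?_ hpow
  calc ‖J‖ * |(x j : ℝ)| ^ (d - 1) ≤ 2 * (|(x j : ℝ)| ^ (d - 1) * ‖J‖) := by
        have : 0 ≤ |(x j : ℝ)| ^ (d - 1) * ‖J‖ := by positivity
        linarith
    _ ≤ holderWeight r ρ δ * B := h5
    _ ≤ 4 * r ^ δ * (|(x j : ℝ)| ^ (1 - δ))⁻¹ * B := by gcongr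
    _ = _ := by rw [← h6]; ring

/-- The threshold above which integration by parts on the shell `r` is possible. -/
noncomputable def threshold (d : ℕ) : ℝ := 64 * d ^ 2

lemma exists_large_coordinate (hd : d ≠ 0) (x : Lattice d) :
    ∃ j, latNorm x ≤ d * |(x j : ℝ)| := by
  have : Nonempty (Fin d) := ⟨⟨0, Nat.pos_of_ne_zero hd⟩⟩
  obtain ⟨j, hj⟩ := Finite.exists_max fun j : Fin d => |(x j : ℝ)|
  refine ⟨j, ?_⟩
  have hd1 : (1:ℝ) ≤ d := by exact_mod_cast Nat.one_le_iff_ne_zero.2 hd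
  refine Real.sqrt_le_iff.2 ⟨by positivity, ?_⟩
  calc ∑ i, (x i : ℝ) ^ 2 ≤ ∑ _i : Fin d, |(x j : ℝ)| ^ 2 := by
        refine Finset.sum_le_sum fun i _ => ?_
        rw [← sq_abs]
        exact pow_le_pow_left₀ (abs_nonneg _) (hj i) 2
    _ = d * |(x j : ℝ)| ^ 2 := by simp
    _ ≤ (d * |(x j : ℝ)|) ^ 2 := by
      rw [mul_pow]; gcongr; nlinarith

/-- Both bounds for a shell integral, in terms of `|x| + 1`. -/
theorem shell_bounds (hd : d ≠ 0) {r δ B : ℝ} (hr : 0 < r) (hr4 : r ≤ 4 * d) (hδ : 0 ≤ δ)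
    (hδ1 : δ ≤ 1) (hB : 0 ≤ B) {f : Freq d → ℂ}
    (hf : ∀ ρ : Freq d, IsScale d r ρ δ → ρ ≠ 0 → ‖ρ‖ ≤ 1 → GoodAt r ρ δ B f)
    (hsupp : ∀ ξ, ¬ (r / 2 ≤ ‖eVecL ξ‖ ∧ ‖eVecL ξ‖ ≤ 2 * r) → f ξ = 0) (x : Lattice d) :
    ‖∫ ξ in cube d, character x ξ * f ξ‖ ≤ (shellVol d + 4 * (2 * d) ^ d) * (B * r ^ (d : ℝ)) ∧
    (threshold d ≤ r * (latNorm x + 1) → ‖∫ ξ in cube d, character x ξ * f ξ‖ ≤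
      (shellVol d + 4 * (2 * d) ^ d) * (B * (r ^ δ * (latNorm x + 1) ^ (-((d : ℝ) - δ))))) := by
  have hd1 : (1:ℝ) ≤ d := by exact_mod_cast Nat.one_le_iff_ne_zero.2 hd
  have hV := one_le_shellVol (d := d)
  constructor
  -- Oscillation plays no role here: ρ is an arbitrary admissible translation, used only to extract
  -- the sup bound contained in the hypothesis on f.
  · set t : ℝ := min 1 (r / 8)
    have ht : 0 < t := lt_min one_pos (by positivity)
    set ρ : Freq d := EuclideanSpace.single ⟨0, Nat.pos_of_ne_zero hd⟩ t
    have hρ : ‖ρ‖ = t := by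
      simp only [ρ]; rw [PiLp.norm_single, Real.norm_of_nonneg ht.le]
    have hs : IsScale d r ρ δ := ⟨hd, hr, hr4, by rw [hρ]; exact min_le_right _ _, hδ, hδ1⟩
    refine (norm_setIntegral_shell_le hs hB (hf ρ hs (norm_pos_iff.1 (by rw [hρ]; exact ht))
      (by rw [hρ]; exact min_le_left _ _)) (fun ξ hξ => hsupp ξ fun hc => hξ
        ⟨by linarith [hc.1], by linarith [hc.2]⟩) x).trans ?_
    rw [Real.rpow_natCast]
    gcongr
    linarith [show 0 ≤ 4 * (2 * (d:ℝ)) ^ d by positivity]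
  · intro hX
    set X : ℝ := latNorm x + 1 with hXdef
    have hn0 : 0 ≤ latNorm x := Real.sqrt_nonneg _
    have hX1 : 1 ≤ X := by linarith
    obtain ⟨j, hj⟩ := exists_large_coordinate hd x
    rw [threshold] at hX
    -- As r ≤ 4d, the threshold forces |x| + 1 ≥ 16d. The largest coordinate of x is then at least
    -- X/(2d), and π/|x_j| is at most both 1 and r/8.
    have hX16 : 16 * d ≤ X := by
      have : 64 * (d:ℝ) ^ 2 ≤ 4 * d * X := hX.trans (by gcongr)
      nlinarith
    have hxj : X / (2 * d) ≤ |(x j : ℝ)| := by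
      rw [div_le_iff₀ (by positivity)]
      nlinarith
    have hxj0 : 0 < |(x j : ℝ)| := lt_of_lt_of_le (by positivity) hxj
    have hne : x j ≠ 0 := by rintro h0; simp [h0] at hxj0
    set ρ : Freq d := EuclideanSpace.single j (Real.pi / x j) with hρ
    have hnρ : ‖ρ‖ = Real.pi / |(x j : ℝ)| := by
      rw [hρ, PiLp.norm_single, Real.norm_eq_abs, abs_div, abs_of_pos Real.pi_pos]
    have hpi4 := Real.pi_le_four
    have hρ1 : ‖ρ‖ ≤ 1 := by
      rw [hnρ, div_le_one hxj0]
      refine hpi4.trans (le_trans ?_ hxj)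
      rw [le_div_iff₀ (by positivity)]; linarith
    have hρr : ‖ρ‖ ≤ r / 8 := by
      rw [hnρ, div_le_iff₀ hxj0]
      have : r / 8 * (X / (2 * d)) ≤ r / 8 * |(x j : ℝ)| := by gcongr
      refine le_trans ?_ this
      rw [div_mul_div_comm, le_div_iff₀ (by positivity)]
      nlinarith
    have hs : IsScale d r ρ δ := ⟨hd, hr, hr4, hρr, hδ, hδ1⟩
    have hρ0 : ρ ≠ 0 := norm_pos_iff.1 (by rw [hnρ]; exact div_pos Real.pi_pos hxj0)
    refine (norm_setIntegral_shell_le_of_shift hne hs hB (hf ρ hs hρ0 hρ1) hsupp).trans ?_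
    have hdδ : 0 ≤ (d:ℝ) - δ := by linarith
    have h1 : |(x j : ℝ)| ^ (-((d : ℝ) - δ)) ≤ (2 * d) ^ d * X ^ (-((d : ℝ) - δ)) := by
      calc |(x j : ℝ)| ^ (-((d : ℝ) - δ)) ≤ (X / (2 * d)) ^ (-((d : ℝ) - δ)) :=
            Real.rpow_le_rpow_of_nonpos (by positivity) hxj (by linarith)
        _ = (2 * d) ^ ((d : ℝ) - δ) * X ^ (-((d : ℝ) - δ)) := by
            rw [Real.div_rpow (by positivity) (by positivity), Real.rpow_neg (x := 2 * (d:ℝ)) (by positivity),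
              div_inv_eq_mul, mul_comm]
        _ ≤ _ := by
            gcongr
            rw [← Real.rpow_natCast]
            exact Real.rpow_le_rpow_of_exponent_le (by linarith) (by linarith)
    calc 4 * (B * (r ^ δ * |(x j : ℝ)| ^ (-((d : ℝ) - δ))))
        ≤ 4 * (B * (r ^ δ * ((2 * d) ^ d * X ^ (-((d : ℝ) - δ))))) := by gcongr
      _ = 4 * (2 * d) ^ d * (B * (r ^ δ * X ^ (-((d : ℝ) - δ)))) := by ring
      _ ≤ _ := by gcongr; linarith

end Symbol

/-! ### Summation over dyadic scales -/

section Dyadic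

/-- `∑_k min((u 2^{-k})^A, (u 2^{-k})^{-B})` is bounded uniformly in `u`. -/
lemma exists_sum_min_rpow_le {A B : ℝ} (hA : 0 < A) (hB : 0 < B) :
    ∃ L : ℝ, 0 ≤ L ∧ ∀ (K : ℕ) (u : ℝ), 0 < u →
      ∑ k ∈ Finset.range K, min ((u / 2 ^ k) ^ A) ((u / 2 ^ k) ^ (-B)) ≤ L := by
  have h2A : (2:ℝ) ^ (-A) < 1 := Real.rpow_lt_one_of_one_lt_of_neg (by norm_num) (by linarith)
  have h2B : 1 < (2:ℝ) ^ B := Real.one_lt_rpow (by norm_num) hB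
  set a : ℝ := (1 - 2 ^ (-A))⁻¹ with ha
  set b : ℝ := ((2:ℝ) ^ B - 1)⁻¹ with hb
  have ha0 : 0 < a := inv_pos.2 (by linarith)
  have hb0 : 0 < b := inv_pos.2 (by linarith)
  have haa : 1 + a * 2 ^ (-A) = a := by
    have : a * (1 - 2 ^ (-A)) = 1 := inv_mul_cancel₀ (by linarith)
    linarith
  have hbb : b * 2 ^ B = 1 + b := by
    have : b * ((2:ℝ) ^ B - 1) = 1 := inv_mul_cancel₀ (by linarith)
    linarith
  -- Removing the first term replaces u by u/2, so the claim is strengthened to an explicit majorant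
  -- stable under this step. The constants satisfy a = 1 + a 2^{-A} and b 2^B = 1 + b; the term -b
  -- u^{-B} absorbs the new summand when u is large.
  have key : ∀ (K : ℕ) (u : ℝ), 0 < u →
      ∑ k ∈ Finset.range K, min ((u / 2 ^ k) ^ A) ((u / 2 ^ k) ^ (-B)) ≤
        if u ≤ 1 then a * u ^ A else 1 + a + b - b * u ^ (-B) := by
    intro K
    induction K with
    | zero =>
      intro u hu
      rw [Finset.sum_range_zero]
      split_ifs with h
      · positivity
      · have : u ^ (-B) ≤ 1 := Real.rpow_le_one_of_one_le_of_nonpos (not_le.1 h).le (by linarith)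
        nlinarith
    | succ K ih =>
      intro u hu
      rw [Finset.sum_range_succ']
      have h1 := ih (u / 2) (by positivity)
      have e : ∀ k : ℕ, u / 2 ^ (k + 1) = u / 2 / 2 ^ k := fun k => by
        rw [pow_succ, div_div, mul_comm]
      simp only [e, pow_zero, div_one]
      have hhalfA : (u / 2) ^ A = u ^ A * 2 ^ (-A) := by
        rw [Real.div_rpow hu.le (by norm_num), Real.rpow_neg (by norm_num), div_eq_mul_inv]
      have hhalfB : (u / 2) ^ (-B) = u ^ (-B) * 2 ^ B := by
        rw [Real.div_rpow hu.le (by norm_num), Real.rpow_neg (x := 2) (by norm_num), div_inv_eq_mul]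
      by_cases h : u ≤ 1
      · rw [if_pos (by linarith), hhalfA] at h1
        rw [if_pos h]
        have h2 := min_le_left (u ^ A) (u ^ (-B))
        calc _ ≤ a * (u ^ A * 2 ^ (-A)) + u ^ A := add_le_add h1 h2
          _ = (1 + a * 2 ^ (-A)) * u ^ A := by ring
          _ = _ := by rw [haa]
      · rw [if_neg h]
        have h2 := min_le_right (u ^ A) (u ^ (-B))
        have h3 : u ^ (-B) ≤ 1 := Real.rpow_le_one_of_one_le_of_nonpos (not_le.1 h).le (by linarith)
        by_cases h4 : u / 2 ≤ 1
        · rw [if_pos h4] at h1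
          have h5 : (u / 2) ^ A ≤ 1 := Real.rpow_le_one (by positivity) h4 hA.le
          nlinarith
        · rw [if_neg h4, hhalfB] at h1
          have : b * (u ^ (-B) * 2 ^ B) = (1 + b) * u ^ (-B) := by rw [← hbb]; ring
          linarith
  refine ⟨1 + a + b, by positivity, fun K u hu => (key K u hu).trans ?_⟩
  split_ifs with h
  · have : u ^ A ≤ 1 := Real.rpow_le_one hu.le h hA.le
    nlinarith
  · have : 0 ≤ b * u ^ (-B) := by positivity
    linarith

/-- In the variable u = rX the two bounds are G X^{-A} u^A and G X^{-A} u^{-B}, so the sum is of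
order G X^{-A}. When u < T only the first is assumed, but there u^A ≤ T^{A+B} u^{-B}. -/
lemma exists_dyadic_sum_le {A B T : ℝ} (hA : 0 < A) (hB : 0 < B) (hT : 1 ≤ T) :
    ∃ L : ℝ, 0 ≤ L ∧ ∀ (G X r₀ : ℝ) (t : ℝ → ℝ), 0 ≤ G → 0 < X → 0 < r₀ →
      (∀ r, 0 < r → r ≤ r₀ → t r ≤ G * r ^ A ∧
        (T ≤ r * X → t r ≤ G * (X ^ (-(A + B)) * r ^ (-B)))) →
      ∀ K : ℕ, ∑ k ∈ Finset.range K, t (r₀ / 2 ^ k) ≤ L * (G * X ^ (-A)) := by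
  obtain ⟨L, hL, h⟩ := exists_sum_min_rpow_le hA hB
  have hT0 : 0 < T := by linarith
  refine ⟨T ^ (A + B) * L, by positivity, fun G X r₀ t hG hX hr₀ ht K => ?_⟩
  have key : ∀ k : ℕ, t (r₀ / 2 ^ k) ≤ T ^ (A + B) * (G * X ^ (-A)) *
      min ((r₀ * X / 2 ^ k) ^ A) ((r₀ * X / 2 ^ k) ^ (-B)) := by
    intro k
    have h2 : (1:ℝ) ≤ 2 ^ k := one_le_pow₀ (by norm_num)
    set r := r₀ / 2 ^ k with hr
    have hr0 : 0 < r := by positivity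
    have e : r₀ * X / 2 ^ k = r * X := by rw [hr]; ring
    obtain ⟨h3, h4⟩ := ht r hr0 (div_le_self hr₀.le h2)
    rw [e]
    have hTp : 1 ≤ T ^ (A + B) := Real.one_le_rpow hT (by linarith)
    have hGX : 0 ≤ G * X ^ (-A) := by positivity
    have hXA : X ^ (-A) * X ^ A = 1 := by rw [← Real.rpow_add hX]; simp
    have h5 : t r ≤ T ^ (A + B) * (G * X ^ (-A)) * (r * X) ^ A := by
      calc t r ≤ G * r ^ A := h3
        _ = 1 * (G * r ^ A) * (X ^ (-A) * X ^ A) := by rw [hXA]; ring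
        _ ≤ T ^ (A + B) * (G * r ^ A) * (X ^ (-A) * X ^ A) := by gcongr
        _ = _ := by rw [Real.mul_rpow hr0.le hX.le]; ring
    have h6 : t r ≤ T ^ (A + B) * (G * X ^ (-A)) * (r * X) ^ (-B) := by
      by_cases hc : T ≤ r * X
      · calc t r ≤ 1 * (G * (X ^ (-(A + B)) * r ^ (-B))) := by rw [one_mul]; exact h4 hc
          _ ≤ T ^ (A + B) * (G * (X ^ (-(A + B)) * r ^ (-B))) := by gcongr
          _ = _ := by
            rw [Real.mul_rpow hr0.le hX.le, show -(A + B) = -A + -B by ring, Real.rpow_add hX]; ring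
      · have hrX : 0 < r * X := by positivity
        calc t r ≤ G * r ^ A := h3
          _ = (G * X ^ (-A)) * (r * X) ^ A := by
            rw [Real.mul_rpow hr0.le hX.le]
            calc _ = G * r ^ A * (X ^ (-A) * X ^ A) := by rw [hXA, mul_one]
              _ = _ := by ring
          _ = (G * X ^ (-A)) * ((r * X) ^ (A + B) * (r * X) ^ (-B)) := by
            rw [← Real.rpow_add hrX]; congr 2; ring
          _ ≤ (G * X ^ (-A)) * (T ^ (A + B) * (r * X) ^ (-B)) := by
            gcongr
            exact (not_le.1 hc).le
          _ = _ := by ring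
    rcases min_choice ((r * X) ^ A) ((r * X) ^ (-B)) with hm | hm <;> rw [hm] <;> assumption
  calc ∑ k ∈ Finset.range K, t (r₀ / 2 ^ k) ≤ ∑ k ∈ Finset.range K, T ^ (A + B) * (G * X ^ (-A)) *
      min ((r₀ * X / 2 ^ k) ^ A) ((r₀ * X / 2 ^ k) ^ (-B)) := Finset.sum_le_sum fun k _ => key k
    _ = T ^ (A + B) * (G * X ^ (-A)) * ∑ k ∈ Finset.range K,
      min ((r₀ * X / 2 ^ k) ^ A) ((r₀ * X / 2 ^ k) ^ (-B)) := by rw [Finset.mul_sum]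
    _ ≤ T ^ (A + B) * (G * X ^ (-A)) * L := by gcongr; exact h K _ (by positivity)
    _ = _ := by ring

end Dyadic

/-! ### Decomposition of a cube integral into dyadic shells. -/

section Shells

variable {d : ℕ}

/-- The shell cutoffs telescope. The top scale is 4d because |e(ξ)| ≤ 2d, so the cutoff of radius 8d
is identically one. -/
lemma one_sub_ballCutoff_eq_sum (hd : d ≠ 0) (K : ℕ) (ξ : Freq d) :
    ∑ k ∈ Finset.range K, shellCutoff d (4 * d / 2 ^ k) ξ = 1 - ballCutoff d (8 * d / 2 ^ K) ξ := by
  have hd1 : (1:ℝ) ≤ d := by exact_mod_cast Nat.one_le_iff_ne_zero.2 hd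
  induction K with
  | zero =>
    rw [Finset.sum_range_zero, pow_zero, div_one, ballCutoff_eq_one (by positivity), sub_self]
    exact (norm_eVecL_le ξ).trans (by linarith)
  | succ K ih =>
    have e1 : 2 * (4 * (d:ℝ) / 2 ^ K) = 8 * d / 2 ^ K := by ring
    have e2 : 4 * (d:ℝ) / 2 ^ K = 8 * d / 2 ^ (K + 1) := by rw [pow_succ]; field_simp; norm_num
    rw [Finset.sum_range_succ, ih, shellCutoff, e1, e2]
    ring

lemma continuous_character (x : Lattice d) : Continuous (character x : Freq d → ℂ) :=
  (contDiff_character (n := 0) x).continuous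

/-- A bound for all partial sums over the shells bounds the full integral. -/
lemma norm_setIntegral_le_of_sum_shells (hd : d ≠ 0) {F : Freq d → ℂ} (hF : Continuous F)
    {x : Lattice d} {S : ℝ}
    (h : ∀ K : ℕ, ∑ k ∈ Finset.range K,
      ‖∫ ξ in cube d, character x ξ * (shellCutoff d (4 * d / 2 ^ k) ξ * F ξ)‖ ≤ S) :
    ‖∫ ξ in cube d, character x ξ * F ξ‖ ≤ S := by
  have hd1 : (1:ℝ) ≤ d := by exact_mod_cast Nat.one_le_iff_ne_zero.2 hd
  have hV := one_le_shellVol (d := d)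
  obtain ⟨M, hM⟩ := (isCompact_cube d).exists_bound_of_continuousOn hF.continuousOn
  have hchar := continuous_character x
  have hball : ∀ R, Continuous (ballCutoff d R) := fun R => (contDiff_ballCutoff R).continuous
  have hshell : ∀ r, Continuous (shellCutoff d r) := fun r => (hball _).sub (hball _)
  -- What the first K shells leave out is a bounded function on a set whose volume tends to zero.
  have hsmall : ∀ K : ℕ, ‖∫ ξ in cube d, character x ξ * (ballCutoff d (8 * d / 2 ^ K) ξ * F ξ)‖ ≤
      |M| * (shellVol d * (d / 2 ^ K) ^ d) := by
    intro K
    set r : ℝ := d / 2 ^ K with hr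
    have hr0 : 0 < r := by positivity
    have e8 : 8 * (d:ℝ) / 2 ^ K = 8 * r := by rw [hr]; ring
    rw [e8]
    have hvol := volume_eVecL_le (d := d) r hr0.le
    have := setIntegral_eq_of_subset_of_forall_sdiff_eq_zero (μ := volume)
      (f := fun ξ => character x ξ * (ballCutoff d (8 * r) ξ * F ξ)) (measurableSet_cube d)
      (Set.inter_subset_left (t := {ξ | ‖eVecL ξ‖ ≤ 8 * r})) fun ξ hξ => by
        rw [ballCutoff_eq_zero (by positivity), zero_mul, mul_zero]
        by_contra hc
        exact hξ.2 ⟨hξ.1, (not_le.1 hc).le⟩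
    rw [this]
    refine (norm_setIntegral_le_of_norm_le_const (C := |M|)
      (hvol.trans_lt ENNReal.ofReal_lt_top) fun ξ hξ => ?_).trans ?_
    · rw [norm_mul, norm_mul, norm_character, one_mul]
      calc _ ≤ 1 * |M| := by
            gcongr
            · exact norm_ballCutoff_le _ _
            · exact (hM ξ hξ.1).trans (le_abs_self M)
        _ = _ := one_mul _
    · gcongr
      rw [measureReal_def]
      exact ENNReal.toReal_le_of_le_ofReal (by positivity) hvol
  have hlim : Tendsto (fun K : ℕ => S + |M| * (shellVol d * ((d:ℝ) / 2 ^ K) ^ d)) atTop (𝓝 S) := by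
    have h1 : Tendsto (fun K : ℕ => (d:ℝ) / 2 ^ K) atTop (𝓝 0) :=
      tendsto_const_nhds.div_atTop (tendsto_pow_atTop_atTop_of_one_lt (by norm_num))
    have h2 := ((h1.pow d).const_mul (shellVol d)).const_mul |M|
    rw [zero_pow hd, mul_zero, mul_zero] at h2
    simpa using h2.const_add S
  refine ge_of_tendsto' hlim fun K => ?_
  have hi : ∀ G : Freq d → ℂ, Continuous G →
      IntegrableOn (fun ξ => character x ξ * (G ξ * F ξ)) (cube d) := fun G hG =>
    integrableOn_cube (hchar.mul (hG.mul hF))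
  have e : ∫ ξ in cube d, character x ξ * F ξ =
      ∑ k ∈ Finset.range K, (∫ ξ in cube d, character x ξ * (shellCutoff d (4 * d / 2 ^ k) ξ * F ξ)) +
      ∫ ξ in cube d, character x ξ * (ballCutoff d (8 * d / 2 ^ K) ξ * F ξ) := by
    rw [← integral_finsetSum _ fun k _ => hi _ (hshell _), ← integral_add
      (integrable_finsetSum _ fun k _ => hi _ (hshell _)) (hi _ (hball _))]
    refine integral_congr_ae (Eventually.of_forall fun ξ => ?_)
    simp only
    rw [← Finset.mul_sum, ← Finset.sum_mul, one_sub_ballCutoff_eq_sum hd]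
    ring
  rw [e]
  exact (norm_add_le _ _).trans (add_le_add ((norm_sum_le _ _).trans (h K)) (hsmall K))

/-- Shell by shell bounds sum up to power decay. -/
theorem exists_norm_setIntegral_le (hd : d ≠ 0) {A B T : ℝ} (hA : 0 < A) (hB : 0 < B) (hT : 1 ≤ T) :
    ∃ L : ℝ, 0 ≤ L ∧ ∀ (F : Freq d → ℂ) (x : Lattice d) (G : ℝ), Continuous F → 0 ≤ G →
      (∀ r : ℝ, 0 < r → r ≤ 4 * d →
        ‖∫ ξ in cube d, character x ξ * (shellCutoff d r ξ * F ξ)‖ ≤ G * r ^ A ∧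
        (T ≤ r * (latNorm x + 1) → ‖∫ ξ in cube d, character x ξ * (shellCutoff d r ξ * F ξ)‖ ≤
          G * ((latNorm x + 1) ^ (-(A + B)) * r ^ (-B)))) →
      ‖∫ ξ in cube d, character x ξ * F ξ‖ ≤ L * (G * (latNorm x + 1) ^ (-A)) := by
  have hd1 : (1:ℝ) ≤ d := by exact_mod_cast Nat.one_le_iff_ne_zero.2 hd
  obtain ⟨L, hL, h⟩ := exists_dyadic_sum_le hA hB hT
  refine ⟨L, hL, fun F x G hF hG ht => norm_setIntegral_le_of_sum_shells hd hF ?_⟩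
  have hX : 0 < latNorm x + 1 := by have : 0 ≤ latNorm x := Real.sqrt_nonneg _; linarith
  exact h G _ (4 * d) (fun r => ‖∫ ξ in cube d, character x ξ * (shellCutoff d r ξ * F ξ)‖) hG hX
    (by positivity) ht

end Shells

/-! ### Decay of the Fourier integrals -/

section Decay

variable {d : ℕ} {α α₀ δ αd C₀ C₁ Cd c₁ B : ℝ}

/-- Admissible exponents and constants for `SymbolData`. -/
structure Admissible (α α₀ δ αd C₀ C₁ Cd c₁ B : ℝ) : Prop where
  pos : 0 < α
  le : α ≤ α₀
  le' : α ≤ αd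
  add_lt : δ + α < 1
  nonneg : 0 ≤ δ
  C₀_pos : 0 < C₀
  C₁_pos : 0 < C₁
  Cd_pos : 0 < Cd
  c₁_pos : 0 < c₁
  B_nonneg : 0 ≤ B

lemma one_le_threshold (hd : d ≠ 0) : 1 ≤ threshold d := by
  have hd1 : (1:ℝ) ≤ d := by exact_mod_cast Nat.one_le_iff_ne_zero.2 hd
  rw [threshold]; nlinarith

theorem exists_goodAt_shell (hd : d ≠ 0) (hc : Admissible α α₀ δ αd C₀ C₁ Cd c₁ B) :
    ∃ C : ℝ, 0 ≤ C ∧ ∀ (κ r : ℝ) (ρ b : Freq d) (Q : Freq d → Matrix (Fin d) (Fin d) ℂ)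
      (A : Matrix (Fin d) (Fin d) ℂ), SymbolData α α₀ δ αd C₀ C₁ Cd c₁ B κ b Q A →
      IsScale d r ρ δ → ρ ≠ 0 → ‖ρ‖ ≤ 1 →
      GoodAt r ρ δ (C * (r + κ) ^ (α - 2))
        (fun ξ => shellCutoff d r ξ * resolventDiff κ b Q A ξ) := by
  obtain ⟨C1, hC1, h1⟩ := exists_goodAt_resolventDiff hd hc.pos hc.le hc.le' hc.add_lt hc.nonneg
    hc.C₀_pos hc.C₁_pos hc.Cd_pos hc.c₁_pos hc.B_nonneg
  obtain ⟨C2, hC2, h2⟩ := exists_goodAt_shellCutoff d hd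
  refine ⟨2 ^ d * C2 * C1, by positivity, fun κ r ρ b Q A hQ hs hρ hρ1 => ?_⟩
  refine ((h2 r δ ρ hs).mul hs (h1 κ r ρ b Q A hQ hs hρ hρ1) hC2).mono (le_of_eq (by ring))

/-- The gradient factor is a plane wave minus one, which gains one power of r + κ. -/
theorem exists_goodAt_shell_fst (hd : d ≠ 0) (hc : Admissible α α₀ δ αd C₀ C₁ Cd c₁ B) :
    ∃ C : ℝ, 0 ≤ C ∧ ∀ (κ r : ℝ) (ρ b : Freq d) (Q : Freq d → Matrix (Fin d) (Fin d) ℂ)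
      (A : Matrix (Fin d) (Fin d) ℂ), SymbolData α α₀ δ αd C₀ C₁ Cd c₁ B κ b Q A →
      IsScale d r ρ δ → ρ ≠ 0 → ‖ρ‖ ≤ 1 → ∀ j,
      GoodAt r ρ δ (C * (r + κ) ^ (α - 1))
        (fun ξ => shellCutoff d r ξ *
          ((planeWave b (unitVec j) ξ - 1) * resolventDiff κ b Q A ξ)) := by
  have hd1 : (1:ℝ) ≤ d := by exact_mod_cast Nat.one_le_iff_ne_zero.2 hd
  have hV := one_le_shellVol (d := d)
  obtain ⟨C1, hC1, h1⟩ := exists_goodAt_shell hd hc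
  refine ⟨2 ^ d * (shellVol d * (13 * (4 * d) ^ d)) * C1, by positivity,
    fun κ r ρ b Q A hQ hs hρ hρ1 j => ?_⟩
  have hκ := hQ.κ_pos
  have hr := hs.pos
  have hb : ‖b‖ * latNorm (unitVec j) ≤ 1 := by
    rw [latNorm_unitVec, mul_one]; exact hQ.norm_b.trans hQ.κ_le
  have h2 := goodAt_planeWave_sub_one hs (y := unitVec j) hQ.norm_b hb
    (R := 4 * d) (by linarith) (by rw [latNorm_unitVec, one_mul]; exact hs.le)
  rw [latNorm_unitVec, one_mul] at h2
  have e : (fun ξ => shellCutoff d r ξ * ((planeWave b (unitVec j) ξ - 1) * resolventDiff κ b Q A ξ)) =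
      fun ξ => (planeWave b (unitVec j) ξ - 1) * (shellCutoff d r ξ * resolventDiff κ b Q A ξ) := by
    funext ξ; ring
  rw [e]
  refine (h2.mul hs (h1 κ r ρ b Q A hQ hs hρ hρ1) (by positivity)).mono (le_of_eq ?_)
  rw [show α - 1 = 1 + (α - 2) by ring, Real.rpow_add (by positivity), Real.rpow_one]
  ring

/-- A second difference gains a further |y|(r + κ), but only while the plane wave of frequency y
does not oscillate on the shell, that is |y| r ≤ 1. -/
theorem exists_goodAt_shell_snd (hd : d ≠ 0) (hc : Admissible α α₀ δ αd C₀ C₁ Cd c₁ B) :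
    ∃ C : ℝ, 0 ≤ C ∧ ∀ (κ r : ℝ) (ρ b : Freq d) (Q : Freq d → Matrix (Fin d) (Fin d) ℂ)
      (A : Matrix (Fin d) (Fin d) ℂ), SymbolData α α₀ δ αd C₀ C₁ Cd c₁ B κ b Q A →
      IsScale d r ρ δ → ρ ≠ 0 → ‖ρ‖ ≤ 1 → ∀ j y, latNorm y * r ≤ 1 → κ * latNorm y ≤ 1 →
      GoodAt r ρ δ (C * (latNorm y * (r + κ) ^ α))
        (fun ξ => shellCutoff d r ξ * ((planeWave b y ξ - 1) *
          ((planeWave b (unitVec j) ξ - 1) * resolventDiff κ b Q A ξ))) := by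
  have hV := one_le_shellVol (d := d)
  obtain ⟨C1, hC1, h1⟩ := exists_goodAt_shell_fst hd hc
  refine ⟨2 ^ d * (shellVol d * (13 * 1 ^ d)) * C1, by positivity,
    fun κ r ρ b Q A hQ hs hρ hρ1 j y hy hκy => ?_⟩
  have hκ := hQ.κ_pos
  have hr := hs.pos
  have hy0 : 0 ≤ latNorm y := Real.sqrt_nonneg _
  have hb : ‖b‖ * latNorm y ≤ 1 := le_trans (by gcongr; exact hQ.norm_b) hκy
  have h2 := goodAt_planeWave_sub_one hs (y := y) hQ.norm_b hb (R := 1) le_rfl hy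
  have e : (fun ξ => shellCutoff d r ξ * ((planeWave b y ξ - 1) *
      ((planeWave b (unitVec j) ξ - 1) * resolventDiff κ b Q A ξ))) =
      fun ξ => (planeWave b y ξ - 1) * (shellCutoff d r ξ *
        ((planeWave b (unitVec j) ξ - 1) * resolventDiff κ b Q A ξ)) := by
    funext ξ; ring
  rw [e]
  refine (h2.mul hs (h1 κ r ρ b Q A hQ hs hρ hρ1 j) (by positivity)).mono (le_of_eq ?_)
  rw [show (r + κ) ^ α = (r + κ) * (r + κ) ^ (α - 1) by
    rw [← Real.rpow_one_add' (by positivity) (by linarith [hc.pos]), add_sub_cancel]]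
  ring

/-- From here on κ is dropped: all remaining powers of r + κ have nonpositive exponent. -/
lemma add_rpow_le {r κ β : ℝ} (hr : 0 < r) (hκ : 0 < κ) (hβ : β ≤ 0) : (r + κ) ^ β ≤ r ^ β :=
  Real.rpow_le_rpow_of_nonpos hr (by linarith) hβ

/-- Smoothness is part of `GoodAt`, so continuity is read off at one arbitrary admissible scale. -/
lemma continuous_resolventDiff (hd : d ≠ 0) (hc : Admissible α α₀ δ αd C₀ C₁ Cd c₁ B) {κ : ℝ}
    {b : Freq d} {Q : Freq d → Matrix (Fin d) (Fin d) ℂ} {A : Matrix (Fin d) (Fin d) ℂ}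
    (hQ : SymbolData α α₀ δ αd C₀ C₁ Cd c₁ B κ b Q A) : Continuous (resolventDiff κ b Q A) := by
  obtain ⟨C, hC, h⟩ := exists_goodAt_resolventDiff hd hc.pos hc.le hc.le' hc.add_lt hc.nonneg
    hc.C₀_pos hc.C₁_pos hc.Cd_pos hc.c₁_pos hc.B_nonneg
  have hd1 : (1:ℝ) ≤ d := by exact_mod_cast Nat.one_le_iff_ne_zero.2 hd
  set ρ : Freq d := EuclideanSpace.single ⟨0, Nat.pos_of_ne_zero hd⟩ (1 / 8)
  have hρ : ‖ρ‖ = 1 / 8 := by simp only [ρ]; rw [PiLp.norm_single]; norm_num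
  have hs : IsScale d 1 ρ δ := ⟨hd, one_pos, by linarith, by rw [hρ], hc.nonneg,
    by linarith [hc.add_lt, hc.pos]⟩
  exact (h κ 1 ρ b Q A hQ hs (norm_pos_iff.1 (by rw [hρ]; norm_num)) (by rw [hρ]; norm_num)).smooth.continuous

lemma continuous_planeWave (b : Freq d) (y : Lattice d) : Continuous (planeWave b y) :=
  (contDiff_planeWave (n := 0) b y).continuous

lemma character_add_left (x y : Lattice d) (ξ : Freq d) :
    character (x + y) ξ = character x ξ * character y ξ := by
  simp only [character]
  rw [← Complex.exp_add, ← mul_add, ← Finset.sum_add_distrib]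
  congr 2
  refine Finset.sum_congr rfl fun j _ => ?_
  simp only [Pi.add_apply]; push_cast; ring

/-- The constant in `shell_bounds`. -/
lemma shellConst_nonneg : 0 ≤ shellVol d + 4 * (2 * (d:ℝ)) ^ d := by
  have hV := one_le_shellVol (d := d)
  positivity

/-- A shell has strength r^{α-2}, hence the bounds r^{d-2+α} by volume and |x|^{-(d-δ)} r^{-(2-α-δ)}
by oscillation. Both exponents have the right sign, the first because d ≥ 2, so the sum is governed
by r ~ 1/|x|. -/
theorem exists_decay (hd : 2 ≤ d) (hc : Admissible α α₀ δ αd C₀ C₁ Cd c₁ B) :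
    ∃ C : ℝ, 0 ≤ C ∧ ∀ (κ : ℝ) (b : Freq d) (Q : Freq d → Matrix (Fin d) (Fin d) ℂ)
      (A : Matrix (Fin d) (Fin d) ℂ), SymbolData α α₀ δ αd C₀ C₁ Cd c₁ B κ b Q A → ∀ x,
      ‖∫ ξ in cube d, character x ξ * resolventDiff κ b Q A ξ‖ ≤
        C * (latNorm x + 1) ^ (-((d : ℝ) - 2 + α)) := by
  have hd0 : d ≠ 0 := by omega
  have hd2 : (2:ℝ) ≤ d := by exact_mod_cast hd
  obtain ⟨C, hC, h⟩ := exists_goodAt_shell hd0 hc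
  have := hc.pos; have := hc.add_lt; have := hc.nonneg
  obtain ⟨L, hL, hsum⟩ := exists_norm_setIntegral_le (d := d) hd0 (A := d - 2 + α) (B := 2 - α - δ)
    (T := threshold d) (by linarith) (by linarith) (one_le_threshold hd0)
  have hV := shellConst_nonneg (d := d)
  refine ⟨L * ((shellVol d + 4 * (2 * d) ^ d) * C), by positivity, fun κ b Q A hQ x => ?_⟩
  have hn0 : 0 ≤ latNorm x := Real.sqrt_nonneg _
  rw [mul_assoc]
  refine hsum _ x ((shellVol d + 4 * (2 * d) ^ d) * C) (continuous_resolventDiff hd0 hc hQ)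
    (by positivity) fun r hr hr4 => ?_
  obtain ⟨h1, h2⟩ := shell_bounds hd0 hr hr4 hc.nonneg (by linarith) (B := C * r ^ (α - 2))
    (by positivity) (f := fun ξ => shellCutoff d r ξ * resolventDiff κ b Q A ξ)
    (fun ρ hs hρ hρ1 => (h κ r ρ b Q A hQ hs hρ hρ1).mono 
      (mul_le_mul_of_nonneg_left (add_rpow_le hr hQ.κ_pos (by linarith)) hC))
    (fun ξ hξ => by rw [shellCutoff_eq_zero hr hξ, zero_mul]) x
  refine ⟨h1.trans (le_of_eq ?_), fun hT => (h2 hT).trans (le_of_eq ?_)⟩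
  · rw [show (d:ℝ) - 2 + α = (α - 2) + d by ring, Real.rpow_add hr]; ring
  · rw [show -((2:ℝ) - α - δ) = (α - 2) + δ by ring, Real.rpow_add hr,
      show (d:ℝ) - 2 + α + (2 - α - δ) = d - δ by ring]; ring

/-- Shell bounds for the integral defining a gradient component. -/
theorem exists_shell_bounds_fst (hd0 : d ≠ 0) (hc : Admissible α α₀ δ αd C₀ C₁ Cd c₁ B) :
    ∃ C : ℝ, 0 ≤ C ∧ ∀ (κ : ℝ) (b : Freq d) (Q : Freq d → Matrix (Fin d) (Fin d) ℂ)
      (A : Matrix (Fin d) (Fin d) ℂ), SymbolData α α₀ δ αd C₀ C₁ Cd c₁ B κ b Q A → ∀ j x,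
      ∀ r : ℝ, 0 < r → r ≤ 4 * d →
        ‖∫ ξ in cube d, character x ξ * (shellCutoff d r ξ *
          ((planeWave b (unitVec j) ξ - 1) * resolventDiff κ b Q A ξ))‖ ≤ C * r ^ ((d : ℝ) - 1 + α) ∧
        (threshold d ≤ r * (latNorm x + 1) → ‖∫ ξ in cube d, character x ξ * (shellCutoff d r ξ *
          ((planeWave b (unitVec j) ξ - 1) * resolventDiff κ b Q A ξ))‖ ≤
            C * ((latNorm x + 1) ^ (-((d : ℝ) - δ)) * r ^ (-(1 - α - δ)))) := by
  obtain ⟨C, hC, h⟩ := exists_goodAt_shell_fst hd0 hc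
  have := hc.pos; have := hc.add_lt; have := hc.nonneg
  have hV := shellConst_nonneg (d := d)
  refine ⟨(shellVol d + 4 * (2 * d) ^ d) * C, by positivity, fun κ b Q A hQ j x r hr hr4 => ?_⟩
  obtain ⟨h1, h2⟩ := shell_bounds hd0 hr hr4 hc.nonneg (by linarith) (B := C * r ^ (α - 1))
    (by positivity) (f := fun ξ => shellCutoff d r ξ *
      ((planeWave b (unitVec j) ξ - 1) * resolventDiff κ b Q A ξ))
    (fun ρ hs hρ hρ1 => (h κ r ρ b Q A hQ hs hρ hρ1 j).mono 
      (mul_le_mul_of_nonneg_left (add_rpow_le hr hQ.κ_pos (by linarith)) hC))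
    (fun ξ hξ => by rw [shellCutoff_eq_zero hr hξ, zero_mul]) x
  refine ⟨h1.trans (le_of_eq ?_), fun hT => (h2 hT).trans (le_of_eq ?_)⟩
  · rw [show (d:ℝ) - 1 + α = (α - 1) + d by ring, Real.rpow_add hr]; ring
  · rw [show -((1:ℝ) - α - δ) = (α - 1) + δ by ring, Real.rpow_add hr]; ring

/-- The strength is now r^{α-1}, and the volume exponent d - 1 + α is positive in every dimension, d
= 1 included. -/
theorem exists_decay_fst (hd0 : d ≠ 0) (hc : Admissible α α₀ δ αd C₀ C₁ Cd c₁ B) :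
    ∃ C : ℝ, 0 ≤ C ∧ ∀ (κ : ℝ) (b : Freq d) (Q : Freq d → Matrix (Fin d) (Fin d) ℂ)
      (A : Matrix (Fin d) (Fin d) ℂ), SymbolData α α₀ δ αd C₀ C₁ Cd c₁ B κ b Q A → ∀ j x,
      ‖∫ ξ in cube d, character x ξ *
          ((planeWave b (unitVec j) ξ - 1) * resolventDiff κ b Q A ξ)‖ ≤
        C * (latNorm x + 1) ^ (-((d : ℝ) - 1 + α)) := by
  have hd1 : (1:ℝ) ≤ d := by exact_mod_cast Nat.one_le_iff_ne_zero.2 hd0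
  obtain ⟨C, hC, h⟩ := exists_shell_bounds_fst hd0 hc
  have := hc.pos; have := hc.add_lt; have := hc.nonneg
  obtain ⟨L, hL, hsum⟩ := exists_norm_setIntegral_le (d := d) hd0 (A := d - 1 + α) (B := 1 - α - δ)
    (T := threshold d) (by linarith) (by linarith) (one_le_threshold hd0)
  refine ⟨L * C, by positivity, fun κ b Q A hQ j x => ?_⟩
  rw [mul_assoc]
  refine hsum _ x C (((continuous_planeWave b _).sub continuous_const).mul
    (continuous_resolventDiff hd0 hc hQ)) hC fun r hr hr4 => ?_
  rw [show (d:ℝ) - 1 + α + (1 - α - δ) = d - δ by ring]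
  exact h κ b Q A hQ j x r hr hr4

/-- The coefficients are used with Hölder parameter δ/2, although the claim is for δ. This leaves
room for α < δ/2, which makes the exponent -(δ/2 - α) of the oscillation bound negative, so that the
small shells dominate. -/
theorem exists_decay_snd (hd0 : d ≠ 0) (hc : Admissible α α₀ (δ / 2) αd C₀ C₁ Cd c₁ B)
    (hδ : 0 < δ) (hδ1 : δ ≤ 1) (hα : α < δ / 2) :
    ∃ C : ℝ, 0 ≤ C ∧ ∀ (κ : ℝ) (b : Freq d) (Q : Freq d → Matrix (Fin d) (Fin d) ℂ)
      (A : Matrix (Fin d) (Fin d) ℂ), SymbolData α α₀ (δ / 2) αd C₀ C₁ Cd c₁ B κ b Q A → ∀ j x y,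
      latNorm x + 1 ≤ 2 * (latNorm (x + y) + 1) → κ * latNorm y ≤ 1 → y ≠ 0 →
      ‖∫ ξ in cube d, character x ξ * ((planeWave b y ξ - 1) *
          ((planeWave b (unitVec j) ξ - 1) * resolventDiff κ b Q A ξ))‖ ≤
        C * (latNorm y ^ (1 - δ) * (latNorm x + 1) ^ (-((d : ℝ) - δ + α))) := by
  have hd1 : (1:ℝ) ≤ d := by exact_mod_cast Nat.one_le_iff_ne_zero.2 hd0
  have hα0 := hc.pos
  obtain ⟨C1, hC1, h1⟩ := exists_shell_bounds_fst hd0 hc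
  obtain ⟨C2, hC2, h2⟩ := exists_goodAt_shell_snd hd0 hc
  obtain ⟨L, hL, hsum⟩ := exists_norm_setIntegral_le (d := d) hd0 (A := d - δ + α) (B := δ / 2 - α)
    (T := 2 * threshold d) (by linarith) (by linarith) (by linarith [one_le_threshold hd0])
  have hV := shellConst_nonneg (d := d)
  have hT := one_le_threshold hd0
  set V := shellVol d + 4 * (2 * (d:ℝ)) ^ d with hVdef
  set C3 : ℝ := 3 * C1 * 2 ^ d + C1 + V * (2 * C2) with hC3
  refine ⟨L * C3, by positivity, fun κ b Q A hQ j x y hxy hκy hy => ?_⟩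
  have hy1 : 0 < latNorm y := by
    obtain ⟨i, hi⟩ := Function.ne_iff.1 hy
    refine Real.sqrt_pos.2 (Finset.sum_pos' (fun _ _ => sq_nonneg _) ⟨i, Finset.mem_univ _, ?_⟩)
    have : (y i : ℝ) ≠ 0 := by exact_mod_cast hi
    positivity
  have hn0 : 0 ≤ latNorm x := Real.sqrt_nonneg _
  have hn1 : 0 ≤ latNorm (x + y) := Real.sqrt_nonneg _
  have hκ := hQ.κ_pos
  rw [mul_assoc, ← mul_assoc C3]
  have hcont : Continuous fun ξ => (planeWave b (unitVec j) ξ - 1) * resolventDiff κ b Q A ξ :=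
    ((continuous_planeWave b _).sub continuous_const).mul (continuous_resolventDiff hd0 hc hQ)
  refine hsum _ x (C3 * latNorm y ^ (1 - δ)) (((continuous_planeWave b _).sub continuous_const).mul hcont)
    (by positivity) fun r hr hr4 => ?_
  rw [show (d:ℝ) - δ + α + (δ / 2 - α) = d - δ / 2 by ring]
  by_cases hry : latNorm y * r ≤ 1
  -- Write |y| s^α = (|y| s)^δ |y|^{1-δ} s^{α-δ} with s = r + κ. Here |y| s ≤ 2, since |y| r ≤ 1 and
  -- κ|y| ≤ 1, and the last power is monotone because α < δ.
  · have hle : latNorm y * (r + κ) ^ α ≤ 2 * latNorm y ^ (1 - δ) * r ^ (α - δ) := by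
      have h3 : latNorm y * (r + κ) ≤ 2 := by linarith
      have hs : 0 < r + κ := by positivity
      have hp : 0 < latNorm y * (r + κ) := by positivity
      have h4 : (latNorm y * (r + κ)) ^ δ ≤ 2 := by
        calc (latNorm y * (r + κ)) ^ δ ≤ 2 ^ δ := by gcongr
          _ ≤ 2 ^ (1:ℝ) := Real.rpow_le_rpow_of_exponent_le (by norm_num) hδ1
          _ = 2 := Real.rpow_one _
      calc latNorm y * (r + κ) ^ α =
          (latNorm y * (r + κ)) ^ δ * latNorm y ^ (1 - δ) * (r + κ) ^ (α - δ) := by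
            rw [Real.mul_rpow hy1.le hs.le]
            have e1 : latNorm y ^ δ * latNorm y ^ (1 - δ) = latNorm y := by
              rw [← Real.rpow_add hy1, add_sub_cancel, Real.rpow_one]
            have e2 : (r + κ) ^ δ * (r + κ) ^ (α - δ) = (r + κ) ^ α := by
              rw [← Real.rpow_add hs, add_sub_cancel]
            rw [← e2]
            calc _ = (latNorm y ^ δ * latNorm y ^ (1 - δ)) * ((r + κ) ^ δ * (r + κ) ^ (α - δ)) := by
                  rw [e1]
              _ = _ := by ring
        _ ≤ 2 * latNorm y ^ (1 - δ) * r ^ (α - δ) := by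
            exact mul_le_mul (by gcongr) (add_rpow_le hr hκ (by linarith)) (by positivity) (by positivity)
    obtain ⟨h5, h6⟩ := shell_bounds hd0 hr hr4 hc.nonneg (by linarith)
      (B := C2 * (2 * latNorm y ^ (1 - δ) * r ^ (α - δ)))
      (by positivity) (f := fun ξ => shellCutoff d r ξ * ((planeWave b y ξ - 1) *
      ((planeWave b (unitVec j) ξ - 1) * resolventDiff κ b Q A ξ)))
      (fun ρ hs hρ hρ1 => (h2 κ r ρ b Q A hQ hs hρ hρ1 j y hry hκy).mono (by gcongr))
      (fun ξ hξ => by rw [shellCutoff_eq_zero hr hξ, zero_mul]) x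
    have hC3' : V * (2 * C2) ≤ C3 := by
      have : 0 ≤ 3 * C1 * 2 ^ d + C1 := by positivity
      linarith
    refine ⟨h5.trans ?_, fun hT' => (h6 (by linarith)).trans ?_⟩
    · calc _ = V * (2 * C2) * latNorm y ^ (1 - δ) * r ^ ((d:ℝ) - δ + α) := by
            rw [show (d:ℝ) - δ + α = (α - δ) + d by ring, Real.rpow_add hr]; ring
        _ ≤ _ := by gcongr
    · calc _ = V * (2 * C2) * latNorm y ^ (1 - δ) *
            ((latNorm x + 1) ^ (-((d:ℝ) - δ / 2)) * r ^ (-(δ / 2 - α))) := by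
            rw [show -(δ / 2 - α) = (α - δ) + δ / 2 by ring, Real.rpow_add hr]; ring
        _ ≤ _ := by gcongr
  -- On shells with |y| r > 1 the difference gives nothing. The integrals at x and at x + y are
  -- bounded separately, and the factor (|y| r)^{1-δ} ≥ 1 is inserted for free.
  · have hry' : 1 ≤ (latNorm y * r) ^ (1 - δ) := Real.one_le_rpow (not_le.1 hry).le (by linarith)
    rw [Real.mul_rpow hy1.le hr.le] at hry'
    set H : Freq d → ℂ := fun ξ => shellCutoff d r ξ *
      ((planeWave b (unitVec j) ξ - 1) * resolventDiff κ b Q A ξ) with hH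
    have hHc : Continuous H :=
      ((contDiff_ballCutoff _).continuous.sub (contDiff_ballCutoff _).continuous).mul hcont
    have hi : ∀ z, IntegrableOn (fun ξ => character z ξ * H ξ) (cube d) := fun z =>
      integrableOn_cube ((continuous_character z).mul hHc)
    have e : ∫ ξ in cube d, character x ξ * (shellCutoff d r ξ * ((planeWave b y ξ - 1) *
        ((planeWave b (unitVec j) ξ - 1) * resolventDiff κ b Q A ξ))) =
        Complex.exp ((inner ℝ (latVec y) b : ℝ) : ℂ) * (∫ ξ in cube d, character (x + y) ξ * H ξ)
        - ∫ ξ in cube d, character x ξ * H ξ := by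
      rw [← integral_const_mul, ← integral_sub ((hi _).const_mul _) (hi _)]
      refine integral_congr_ae (Eventually.of_forall fun ξ => ?_)
      simp only [hH]
      rw [planeWave_eq b y, character_add_left]
      ring
    -- The shift b affects the two points differently by e^{y·b}, which is harmless because κ|y| ≤
    -- 1.
    have hexp : ‖Complex.exp ((inner ℝ (latVec y) b : ℝ) : ℂ)‖ ≤ 3 := by
      rw [Complex.norm_exp, Complex.ofReal_re]
      have : inner ℝ (latVec y) b ≤ 1 := by
        refine (real_inner_le_norm _ _).trans ?_
        rw [norm_latVec, mul_comm]
        exact le_trans (by gcongr; exact hQ.norm_b) hκy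
      exact (Real.exp_le_exp.2 this).trans (by linarith [Real.exp_one_lt_d9])
    have hbound : ∀ M : ℝ, ‖∫ ξ in cube d, character (x + y) ξ * H ξ‖ ≤ C1 * (2 ^ d * M) →
        ‖∫ ξ in cube d, character x ξ * H ξ‖ ≤ C1 * M → 0 ≤ M →
        ‖∫ ξ in cube d, character x ξ * (shellCutoff d r ξ * ((planeWave b y ξ - 1) *
        ((planeWave b (unitVec j) ξ - 1) * resolventDiff κ b Q A ξ)))‖ ≤ C3 * M := by
      intro M hM1 hM2 hM0
      rw [e]
      refine (norm_sub_le _ _).trans ?_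
      rw [norm_mul]
      calc _ ≤ 3 * (C1 * (2 ^ d * M)) + C1 * M := by gcongr
        _ = (3 * C1 * 2 ^ d + C1) * M := by ring
        _ ≤ _ := by
          gcongr
          have : 0 ≤ V * (2 * C2) := by positivity
          linarith
    obtain ⟨h3, h4⟩ := h1 κ b Q A hQ j x r hr hr4
    obtain ⟨h5, h6⟩ := h1 κ b Q A hQ j (x + y) r hr hr4
    constructor
    · have h7 : r ^ ((d:ℝ) - 1 + α) ≤ latNorm y ^ (1 - δ) * r ^ ((d:ℝ) - δ + α) := by
        rw [show (d:ℝ) - δ + α = (1 - δ) + (d - 1 + α) by ring, Real.rpow_add hr (1 - δ), ← mul_assoc]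
        exact le_mul_of_one_le_left (by positivity) hry'
      have h2d : (1:ℝ) ≤ 2 ^ d := one_le_pow₀ (by norm_num)
      refine (hbound (latNorm y ^ (1 - δ) * r ^ ((d:ℝ) - δ + α)) (h5.trans ?_) (h3.trans ?_)
        (by positivity)).trans (le_of_eq (by ring))
      · gcongr
        exact h7.trans (le_mul_of_one_le_left (by positivity) h2d)
      · gcongr
    · intro hX
      have h7 : r ^ (-(1 - α - δ / 2)) ≤ latNorm y ^ (1 - δ) * r ^ (-(δ / 2 - α)) := by
        rw [show -(δ / 2 - α) = (1 - δ) + -(1 - α - δ / 2) by ring, Real.rpow_add hr (1 - δ), ← mul_assoc]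
        exact le_mul_of_one_le_left (by positivity) hry'
      have h8 : (latNorm (x + y) + 1) ^ (-((d:ℝ) - δ / 2)) ≤
          2 ^ d * (latNorm x + 1) ^ (-((d:ℝ) - δ / 2)) := by
        calc (latNorm (x + y) + 1) ^ (-((d:ℝ) - δ / 2)) ≤
            ((latNorm x + 1) / 2) ^ (-((d:ℝ) - δ / 2)) :=
              Real.rpow_le_rpow_of_nonpos (by positivity) (by linarith) (by linarith)
          _ = 2 ^ ((d:ℝ) - δ / 2) * (latNorm x + 1) ^ (-((d:ℝ) - δ / 2)) := by
            rw [Real.div_rpow (by positivity) (by positivity), Real.rpow_neg (x := 2) (by positivity),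
              div_inv_eq_mul, mul_comm]
          _ ≤ _ := by
            gcongr
            rw [← Real.rpow_natCast]
            exact Real.rpow_le_rpow_of_exponent_le (by norm_num) (by linarith)
      refine (hbound ((latNorm x + 1) ^ (-((d:ℝ) - δ / 2)) *
        (latNorm y ^ (1 - δ) * r ^ (-(δ / 2 - α)))) ((h6 ?_).trans ?_) ((h4 ?_).trans ?_)
        (by positivity)).trans (le_of_eq (by ring))
      · have : r * (latNorm x + 1) ≤ r * (2 * (latNorm (x + y) + 1)) := by gcongr
        linarith
      · rw [← mul_assoc (2 ^ d)]
        gcongr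
      · linarith
      · gcongr

end Decay

/-! ### Coercive operators on a Hilbert space -/

section Coercive

variable {H : Type*} [NormedAddCommGroup H] [InnerProductSpace ℂ H]

/-- The contraction rate of the Richardson iteration for an operator of norm at most `m` whose
real part is at least `c`. -/
noncomputable def richardsonRate (c m : ℝ) : ℝ := Real.sqrt (1 - (c / m) ^ 2)

lemma richardsonRate_nonneg (c m : ℝ) : 0 ≤ richardsonRate c m := Real.sqrt_nonneg _

lemma richardsonRate_lt_one {c m : ℝ} (hc : 0 < c) (hcm : c ≤ m) : richardsonRate c m < 1 := by
  have : 0 < c / m := div_pos hc (hc.trans_le hcm)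
  rw [richardsonRate, Real.sqrt_lt' one_pos]
  nlinarith

/-- Expanding the square, ‖v - sNv‖² ≤ (1 - 2sc + s²m²)‖v‖²; the step s = c/m² minimizes this and
gives 1 - (c/m)². -/
lemma norm_sub_smul_le {N : H →L[ℂ] H} {c m : ℝ} (hc : 0 < c) (hcm : c ≤ m)
    (hN : ∀ v, c * ‖v‖ ^ 2 ≤ (inner ℂ v (N v)).re) (hm : ∀ v, ‖N v‖ ≤ m * ‖v‖) (v : H) :
    ‖v - ((c / m ^ 2 : ℝ) : ℂ) • N v‖ ≤ richardsonRate c m * ‖v‖ := by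
  have hm0 : 0 < m := hc.trans_le hcm
  have hcm1 : c / m ≤ 1 := (div_le_one hm0).2 hcm
  have hcm0 : 0 < c / m := div_pos hc hm0
  have hr : 0 ≤ 1 - (c / m) ^ 2 := by nlinarith
  refine le_of_sq_le_sq ?_ (mul_nonneg (richardsonRate_nonneg c m) (norm_nonneg v))
  rw [mul_pow, richardsonRate, Real.sq_sqrt hr, norm_sub_sq (𝕜 := ℂ), inner_smul_right, norm_smul,
    Complex.norm_real, Real.norm_of_nonneg (by positivity)]
  have e : RCLike.re (((c / m ^ 2 : ℝ) : ℂ) * inner ℂ v (N v)) = c / m ^ 2 * (inner ℂ v (N v)).re :=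
    Complex.re_ofReal_mul _ _
  rw [e]
  have h1 : c / m ^ 2 * (c * ‖v‖ ^ 2) ≤ c / m ^ 2 * (inner ℂ v (N v)).re := by gcongr; exact hN v
  have h2 : (c / m ^ 2 * ‖N v‖) ^ 2 ≤ (c / m ^ 2 * (m * ‖v‖)) ^ 2 := by gcongr; exact hm v
  have e1 : c / m ^ 2 * (c * ‖v‖ ^ 2) = (c / m) ^ 2 * ‖v‖ ^ 2 := by field_simp
  have e2 : (c / m ^ 2 * (m * ‖v‖)) ^ 2 = (c / m) ^ 2 * ‖v‖ ^ 2 := by field_simp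
  rw [e1] at h1; rw [e2] at h2
  linarith

/-- A multiple of N is within distance less than one of the identity, so a Neumann series inverts
it. -/
lemma isUnit_of_coercive [CompleteSpace H] {N : H →L[ℂ] H} {c m : ℝ} (hc : 0 < c) (hcm : c ≤ m)
    (hN : ∀ v, c * ‖v‖ ^ 2 ≤ (inner ℂ v (N v)).re) (hm : ∀ v, ‖N v‖ ≤ m * ‖v‖) : IsUnit N := by
  have hm0 : 0 < m := hc.trans_le hcm
  set s : ℂ := ((c / m ^ 2 : ℝ) : ℂ) with hs
  have hs0 : s ≠ 0 := by
    rw [hs, Complex.ofReal_ne_zero]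
    positivity
  have h1 : ‖(1 : H →L[ℂ] H) - s • N‖ < 1 :=
    (ContinuousLinearMap.opNorm_le_bound _ (richardsonRate_nonneg c m)
      (norm_sub_smul_le hc hcm hN hm)).trans_lt (richardsonRate_lt_one hc hcm)
  have h2 := isUnit_one_sub_of_norm_lt_one h1
  rw [sub_sub_cancel] at h2
  obtain ⟨B, hB1, hB2⟩ := isUnit_iff_exists.1 h2
  refine isUnit_iff_exists.2 ⟨s • B, ?_, ?_⟩
  · rw [← hB1, mul_smul_comm, smul_mul_assoc]
  · rw [← hB2, mul_smul_comm, smul_mul_assoc]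

lemma norm_le_of_coercive {N : H →L[ℂ] H} {c : ℝ} (hc : 0 < c)
    (hN : ∀ v, c * ‖v‖ ^ 2 ≤ (inner ℂ v (N v)).re) (v : H) : ‖v‖ ≤ c⁻¹ * ‖N v‖ := by
  have h1 : c * ‖v‖ ^ 2 ≤ ‖v‖ * ‖N v‖ :=
    (hN v).trans ((Complex.re_le_norm _).trans (norm_inner_le_norm _ _))
  rw [le_inv_mul_iff₀ hc]
  rcases (norm_nonneg v).eq_or_lt with h | h
  · rw [← h, mul_zero]; positivity
  · nlinarith

/-- Richardson iteration for `N v = f`. -/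
noncomputable def richardson (N : H →L[ℂ] H) (s : ℝ) (f : H) : ℕ → H
  | 0 => 0
  | n + 1 => richardson N s f n - (s : ℂ) • (N (richardson N s f n) - f)

/-- The rate depends only on c and m. Convergence is therefore uniform over all operators with these
bounds, while the iterates stay explicit in the data. -/
lemma norm_richardson_sub_le {N : H →L[ℂ] H} {c m : ℝ} (hc : 0 < c) (hcm : c ≤ m)
    (hN : ∀ v, c * ‖v‖ ^ 2 ≤ (inner ℂ v (N v)).re) (hm : ∀ v, ‖N v‖ ≤ m * ‖v‖) (v : H) (n : ℕ) :
    ‖richardson N (c / m ^ 2) (N v) n - v‖ ≤ richardsonRate c m ^ n * ‖v‖ := by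
  induction n with
  | zero => simp [richardson]
  | succ n ih =>
    have e : richardson N (c / m ^ 2) (N v) (n + 1) - v =
        (richardson N (c / m ^ 2) (N v) n - v) -
          ((c / m ^ 2 : ℝ) : ℂ) • N (richardson N (c / m ^ 2) (N v) n - v) := by
      rw [richardson, map_sub]; abel
    rw [e]
    refine (norm_sub_smul_le hc hcm hN hm _).trans ?_
    rw [pow_succ' (richardsonRate c m), mul_assoc]
    exact mul_le_mul_of_nonneg_left ih (richardsonRate_nonneg c m)

end Coercive

/-! ### Elliptic difference operators on a Hilbert space -/

/-- Unitary lattice translations `T j` with inverses `S j`, and an elliptic matrix of bounded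
operators. -/
structure Medium (d : ℕ) (H : Type*) [NormedAddCommGroup H] [InnerProductSpace ℂ H] where
  T : Fin d → H →L[ℂ] H
  S : Fin d → H →L[ℂ] H
  A : Fin d → Fin d → H →L[ℂ] H
  lam : ℝ
  M : ℝ
  lam_pos : 0 < lam
  lam_le : lam ≤ M
  inner_S : ∀ j f g, inner ℂ (S j f) g = inner ℂ f (T j g)
  norm_T : ∀ j f, ‖T j f‖ ≤ ‖f‖
  norm_S : ∀ j f, ‖S j f‖ ≤ ‖f‖
  norm_A : ∀ i j f, ‖A i j f‖ ≤ M * ‖f‖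
  elliptic : ∀ p : Fin d → H, lam * ∑ j, ‖p j‖ ^ 2 ≤ (∑ i, ∑ j, inner ℂ (p i) (A i j (p j))).re

/-- The phases `w`, `w'` are close to a unitary phase and its inverse. -/
def NearUnitary {d : ℕ} (β : ℝ) (w w' : Fin d → ℂ) : Prop :=
  ∃ u : Fin d → ℂ, ∀ j, ‖u j‖ = 1 ∧ ‖w j - u j‖ ≤ β ∧ ‖starRingEnd ℂ (w' j) - u j‖ ≤ β

namespace Medium

variable {d : ℕ} {H : Type*} [NormedAddCommGroup H] [InnerProductSpace ℂ H] (m : Medium d H)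

/-- The twisted forward difference. -/
noncomputable def grad (w : Fin d → ℂ) (j : Fin d) : H →L[ℂ] H := w j • m.T j - 1

/-- The twisted backward difference. -/
noncomputable def gradStar (w' : Fin d → ℂ) (i : Fin d) : H →L[ℂ] H := w' i • m.S i - 1

/-- The twisted operator `∂^* A ∂`. -/
noncomputable def ellOp (w w' : Fin d → ℂ) : H →L[ℂ] H :=
  ∑ i, m.gradStar w' i * ∑ j, m.A i j * m.grad w j

lemma ellOp_apply (w w' : Fin d → ℂ) (v : H) :
    m.ellOp w w' v = ∑ i, m.gradStar w' i (∑ j, m.A i j (m.grad w j v)) := by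
  simp [ellOp]

/-- The adjoint of the forward difference with phase w is the backward difference with phase conj w.
For complex frequencies w' differs from conj w, and the form loses its sign only through this
mismatch. -/
lemma inner_gradStar (w' : Fin d → ℂ) (i : Fin d) (v f : H) :
    inner ℂ v (m.gradStar w' i f) = inner ℂ (m.grad (fun j => starRingEnd ℂ (w' j)) i v) f := by
  have h : inner ℂ v (m.S i f) = inner ℂ (m.T i v) f := by
    rw [← inner_conj_symm, m.inner_S, inner_conj_symm]
  simp [gradStar, grad, h, mul_comm]

lemma inner_ellOp (w w' : Fin d → ℂ) (v : H) :
    inner ℂ v (m.ellOp w w' v) = ∑ i, ∑ j,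
      inner ℂ (m.grad (fun j => starRingEnd ℂ (w' j)) i v) (m.A i j (m.grad w j v)) := by
  rw [ellOp_apply, inner_sum]
  refine Finset.sum_congr rfl fun i _ => ?_
  rw [inner_gradStar, inner_sum]

lemma M_pos : 0 < m.M := m.lam_pos.trans_le m.lam_le

/-- At exactly unitary phases the form is nonnegative by ellipticity. Replacing w and conj w' by the
unitary u costs terms of order Mβ‖v‖‖p‖ and Mβ²‖v‖². The first is absorbed in λ‖p‖², and the
remainder in (η/2)‖v‖² when β² is at most a small multiple of λη/M². This fixes the width √(λη)/Λ of
the strip. -/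
lemma neg_le_re_inner_ellOp {β η : ℝ} {w w' : Fin d → ℂ} (hw : NearUnitary β w w') (hβ0 : 0 ≤ β)
    (hβ : 4 * m.M ^ 2 * d ^ 3 * β ^ 2 ≤ m.lam * η) (v : H) :
    -(η / 2) * ‖v‖ ^ 2 ≤ (inner ℂ v (m.ellOp w w' v)).re := by
  obtain ⟨u, hu⟩ := hw
  set n := ‖v‖ with hn
  have hM := m.M_pos
  have hlam := m.lam_pos
  set p : Fin d → H := fun j => m.grad u j v
  set e : Fin d → H := fun j => m.grad w j v - p j with he
  set e' : Fin d → H := fun j => m.grad (fun j => starRingEnd ℂ (w' j)) j v - p j with he'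
  have hen : ∀ j, ‖e j‖ ≤ β * n := fun j => by
    have : e j = (w j - u j) • m.T j v := by simp [e, p, grad, sub_smul]
    rw [this, norm_smul]
    gcongr
    · exact (hu j).2.1
    · exact m.norm_T j v
  have hen' : ∀ j, ‖e' j‖ ≤ β * n := fun j => by
    have : e' j = (starRingEnd ℂ (w' j) - u j) • m.T j v := by simp [e', p, grad, sub_smul]
    rw [this, norm_smul]
    gcongr
    · exact (hu j).2.2
    · exact m.norm_T j v
  have hterm : ∀ i j, (inner ℂ (p i) (m.A i j (p j))).re - m.M * (β * n) * (‖p i‖ + ‖p j‖)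
      - m.M * (β * n) ^ 2 ≤ (inner ℂ (m.grad (fun j => starRingEnd ℂ (w' j)) i v)
        (m.A i j (m.grad w j v))).re := by
    intro i j
    have e1 : m.grad w j v = p j + e j := by simp [e]
    have e2 : m.grad (fun j => starRingEnd ℂ (w' j)) i v = p i + e' i := by simp [e']
    rw [e1, e2, map_add, inner_add_right, inner_add_left]
    have h1 : ‖inner ℂ (e' i) (m.A i j (p j))‖ ≤ (β * n) * (m.M * ‖p j‖) :=
      (norm_inner_le_norm _ _).trans (mul_le_mul (hen' i) (m.norm_A i j _) (norm_nonneg _)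
        (by positivity))
    have h2 : ‖inner ℂ (p i + e' i) (m.A i j (e j))‖ ≤ (‖p i‖ + β * n) * (m.M * (β * n)) :=
      (norm_inner_le_norm _ _).trans (mul_le_mul ((norm_add_le _ _).trans (by gcongr; exact hen' i))
        ((m.norm_A i j _).trans (by gcongr; exact hen j)) (norm_nonneg _) (by positivity))
    have h3 := Complex.abs_re_le_norm (inner ℂ (e' i) (m.A i j (p j)))
    have h4 := Complex.abs_re_le_norm (inner ℂ (p i + e' i) (m.A i j (e j)))
    have h5 := neg_abs_le (inner ℂ (e' i) (m.A i j (p j))).re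
    have h6 := neg_abs_le (inner ℂ (p i + e' i) (m.A i j (e j))).re
    simp only [Complex.add_re]
    nlinarith
  rw [inner_ellOp, Complex.re_sum]
  simp only [Complex.re_sum]
  have hsum := Finset.sum_le_sum fun i (_ : i ∈ Finset.univ) =>
    Finset.sum_le_sum fun j (_ : j ∈ Finset.univ) => hterm i j
  refine le_trans ?_ hsum
  have hell := m.elliptic p
  rw [Complex.re_sum] at hell
  simp only [Complex.re_sum] at hell
  simp only [Finset.sum_sub_distrib, ← Finset.mul_sum, Finset.sum_add_distrib, Finset.sum_const,
    Finset.card_univ, Fintype.card_fin, nsmul_eq_mul]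
  -- Completing the square in ‖p_j‖.
  have hj : ∀ j, -((d * m.M * (β * n)) ^ 2 / m.lam) ≤ m.lam * ‖p j‖ ^ 2 - 2 * (d * m.M * (β * n)) * ‖p j‖ := by
    intro j
    have : 0 ≤ (m.lam * ‖p j‖ - d * m.M * (β * n)) ^ 2 / m.lam := by positivity
    have e3 : (m.lam * ‖p j‖ - d * m.M * (β * n)) ^ 2 / m.lam =
      m.lam * ‖p j‖ ^ 2 - 2 * (d * m.M * (β * n)) * ‖p j‖ + (d * m.M * (β * n)) ^ 2 / m.lam := by
      field_simp
      ring
    linarith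
  have hs := Finset.sum_le_sum fun j (_ : j ∈ Finset.univ) => hj j
  simp only [Finset.sum_const, Finset.card_univ, Fintype.card_fin, nsmul_eq_mul,
    Finset.sum_sub_distrib, ← Finset.mul_sum] at hs
  have h7 : d * ((d * m.M * (β * n)) ^ 2 / m.lam) + d * (d * (m.M * (β * n) ^ 2)) ≤ η / 2 * n ^ 2 := by
    have h8 : d * (d * (m.M * (β * n) ^ 2)) ≤ d * ((d * m.M * (β * n)) ^ 2 / m.lam) := by
      rw [← mul_div_assoc, le_div_iff₀ hlam]
      rcases Nat.eq_zero_or_pos d with h0 | h0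
      · subst h0; simp
      have hd1 : (1:ℝ) ≤ d := by exact_mod_cast h0
      calc d * (d * (m.M * (β * n) ^ 2)) * m.lam = d * (d * m.M * (β * n) ^ 2) * (1 * m.lam) := by ring
        _ ≤ d * (d * m.M * (β * n) ^ 2) * (d * m.M) := by gcongr; exact m.lam_le
        _ = _ := by ring
    have h9 : 2 * (d * ((d * m.M * (β * n)) ^ 2 / m.lam)) ≤ η / 2 * n ^ 2 := by
      rw [← mul_div_assoc, ← mul_div_assoc, div_le_iff₀ hlam]
      calc 2 * (d * (d * m.M * (β * n)) ^ 2) = 1 / 2 * n ^ 2 * (4 * m.M ^ 2 * d ^ 3 * β ^ 2) := by ring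
        _ ≤ 1 / 2 * n ^ 2 * (m.lam * η) := by gcongr
        _ = _ := by ring
    linarith
  nlinarith

lemma norm_grad_le {β : ℝ} {w w' : Fin d → ℂ} (hw : NearUnitary β w w') (hβ : β ≤ 1) (j : Fin d) (v : H) :
    ‖m.grad w j v‖ ≤ 3 * ‖v‖ := by
  obtain ⟨u, hu⟩ := hw
  have h1 : ‖w j‖ ≤ 2 := by
    have := norm_add_le (w j - u j) (u j)
    rw [sub_add_cancel] at this
    linarith [(hu j).1, (hu j).2.1]
  simp only [grad, sub_apply, smul_apply, one_apply_eq_self]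
  refine (norm_sub_le _ _).trans ?_
  rw [norm_smul]
  have : ‖w j‖ * ‖m.T j v‖ ≤ 2 * ‖v‖ := by gcongr; exact m.norm_T j v
  linarith

lemma norm_gradStar_le {β : ℝ} {w w' : Fin d → ℂ} (hw : NearUnitary β w w') (hβ : β ≤ 1) (j : Fin d) (v : H) :
    ‖m.gradStar w' j v‖ ≤ 3 * ‖v‖ := by
  obtain ⟨u, hu⟩ := hw
  have h1 : ‖w' j‖ ≤ 2 := by
    have := norm_add_le (starRingEnd ℂ (w' j) - u j) (u j)
    rw [sub_add_cancel, RCLike.norm_conj] at this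
    linarith [(hu j).1, (hu j).2.2]
  simp only [gradStar, sub_apply, smul_apply, one_apply_eq_self]
  refine (norm_sub_le _ _).trans ?_
  rw [norm_smul]
  have : ‖w' j‖ * ‖m.S j v‖ ≤ 2 * ‖v‖ := by gcongr; exact m.norm_S j v
  linarith

lemma norm_ellOp_le {β : ℝ} {w w' : Fin d → ℂ} (hw : NearUnitary β w w') (hβ : β ≤ 1) (v : H) :
    ‖m.ellOp w w' v‖ ≤ 9 * d ^ 2 * m.M * ‖v‖ := by
  have hM := m.M_pos
  rw [ellOp_apply]
  calc _ ≤ ∑ i : Fin d, 3 * ∑ j : Fin d, m.M * (3 * ‖v‖) := by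
        refine norm_sum_le_of_le _ fun i _ => ?_
        refine (m.norm_gradStar_le hw hβ _ _).trans ?_
        gcongr
        refine norm_sum_le_of_le _ fun j _ => ?_
        refine (m.norm_A i j _).trans ?_
        gcongr
        exact m.norm_grad_le hw hβ j v
    _ = _ := by simp; ring

/-- The operator `η + ∂^* A ∂`. -/
noncomputable def fullOp (η : ℝ) (w w' : Fin d → ℂ) : H →L[ℂ] H := (η : ℂ) • 1 + m.ellOp w w'

/-- The norm bound for `fullOp`. -/
noncomputable def opBound (η : ℝ) : ℝ := η + 9 * d ^ 2 * m.M

lemma half_le_opBound {η : ℝ} (hη : 0 < η) : η / 2 ≤ m.opBound η := by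
  have := m.M_pos
  have : 0 ≤ 9 * (d:ℝ) ^ 2 * m.M := by positivity
  rw [opBound]; linarith

lemma norm_fullOp_le {β η : ℝ} {w w' : Fin d → ℂ} (hw : NearUnitary β w w') (hβ : β ≤ 1)
    (hη : 0 < η) (v : H) : ‖m.fullOp η w w' v‖ ≤ m.opBound η * ‖v‖ := by
  have h := m.norm_ellOp_le hw hβ v
  simp only [fullOp, add_apply, smul_apply, one_apply_eq_self]
  refine (norm_add_le _ _).trans ?_
  rw [norm_smul, Complex.norm_real, Real.norm_of_nonneg hη.le, opBound]
  linarith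

lemma le_re_inner_fullOp {β η : ℝ} {w w' : Fin d → ℂ} (hw : NearUnitary β w w') (hβ0 : 0 ≤ β)
    (hβ : 4 * m.M ^ 2 * d ^ 3 * β ^ 2 ≤ m.lam * η) (v : H) :
    η / 2 * ‖v‖ ^ 2 ≤ (inner ℂ v (m.fullOp η w w' v)).re := by
  have h := m.neg_le_re_inner_ellOp hw hβ0 hβ v
  simp only [fullOp, add_apply, smul_apply, one_apply_eq_self, inner_add_right,
    inner_smul_right, Complex.add_re]
  rw [inner_self_eq_norm_sq_to_K, Complex.re_ofReal_mul]
  have : (((‖v‖ : ℂ)) ^ 2).re = ‖v‖ ^ 2 := by rw [← Complex.ofReal_pow, Complex.ofReal_re]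
  change _ ≤ η * (((‖v‖ : ℂ)) ^ 2).re + _
  rw [this]; linarith

end Medium

namespace Medium

variable {d : ℕ} {H : Type*} [NormedAddCommGroup H] [InnerProductSpace ℂ H] (m : Medium d H)

/-! ### Correctors and the homogenized symbol -/

/-- The projection orthogonal to `e`. -/
noncomputable def centered (e : H) : H →L[ℂ] H := 1 - (innerSL ℂ e).smulRight e

lemma centered_apply (e v : H) : centered e v = v - inner ℂ e v • e := by
  simp [centered]

lemma inner_centered_self {e : H} (he : ‖e‖ = 1) (v : H) : inner ℂ e (centered e v) = 0 := by
  rw [centered_apply, inner_sub_right, inner_smul_right, inner_self_eq_norm_sq_to_K, he]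
  simp

lemma inner_centered_left (e v w : H) : inner ℂ (centered e v) w = inner ℂ v (centered e w) := by
  rw [centered_apply, centered_apply, inner_sub_left, inner_sub_right, inner_smul_left,
    inner_smul_right, inner_conj_symm]
  ring

lemma centered_self {e : H} (he : ‖e‖ = 1) : centered e e = 0 := by
  rw [centered_apply, inner_self_eq_norm_sq_to_K, he]; simp

lemma centered_of_inner_eq_zero {e v : H} (h : inner ℂ e v = 0) : centered e v = v := by
  rw [centered_apply, h, zero_smul, sub_zero]

lemma norm_centered_le {e : H} (he : ‖e‖ = 1) (v : H) : ‖centered e v‖ ≤ ‖v‖ := by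
  have h1 : inner ℂ (inner ℂ e v • e) (centered e v) = 0 := by
    rw [inner_smul_left, inner_centered_self he, mul_zero]
  have h2 := norm_add_sq_eq_norm_sq_add_norm_sq_of_inner_eq_zero _ _ h1
  have e1 : inner ℂ e v • e + centered e v = v := by rw [centered_apply]; abel
  rw [e1] at h2
  nlinarith [norm_nonneg v, norm_nonneg (centered e v), norm_nonneg (inner ℂ e v • e)]

/-- The operator `η + P ∂^* A ∂ P`. -/
noncomputable def corrOp (e : H) (η : ℝ) (w w' : Fin d → ℂ) : H →L[ℂ] H :=
  (η : ℂ) • 1 + centered e * m.ellOp w w' * centered e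

/-- The right hand side `-P ∂^* A e_k`. -/
noncomputable def corrRhs (e : H) (w' : Fin d → ℂ) (k : Fin d) : H :=
  -centered e (∑ i, m.gradStar w' i (m.A i k e))

/-- The corrector. -/
noncomputable def corrVec (e : H) (η : ℝ) (w w' : Fin d → ℂ) (k : Fin d) : H :=
  Ring.inverse (m.corrOp e η w w') (m.corrRhs e w' k)

/-- The homogenized symbol. -/
noncomputable def homMat (e : H) (η : ℝ) (w w' : Fin d → ℂ) : Matrix (Fin d) (Fin d) ℂ :=
  fun k k' => inner ℂ e (m.A k k' e + ∑ j, m.A k j (m.grad w j (m.corrVec e η w w' k')))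

variable {e : H} {β η : ℝ} {w w' : Fin d → ℂ}

lemma le_re_inner_corrOp (he : ‖e‖ = 1) (hw : NearUnitary β w w') (hβ0 : 0 ≤ β) (hη : 0 < η)
    (hβ : 4 * m.M ^ 2 * d ^ 3 * β ^ 2 ≤ m.lam * η) (v : H) :
    η / 2 * ‖v‖ ^ 2 ≤ (inner ℂ v (m.corrOp e η w w' v)).re := by
  have h := m.neg_le_re_inner_ellOp hw hβ0 hβ (centered e v)
  have h2 := norm_centered_le he v
  simp only [corrOp, add_apply, smul_apply, one_apply_eq_self, inner_add_right,
    inner_smul_right, Complex.add_re, mul_apply_eq_comp]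
  rw [inner_self_eq_norm_sq_to_K, Complex.re_ofReal_mul, ← inner_centered_left]
  have h3 : (((‖v‖ : ℂ)) ^ 2).re = ‖v‖ ^ 2 := by rw [← Complex.ofReal_pow, Complex.ofReal_re]
  change _ ≤ η * (((‖v‖ : ℂ)) ^ 2).re + _
  rw [h3]
  have h4 : η / 2 * ‖centered e v‖ ^ 2 ≤ η / 2 * ‖v‖ ^ 2 := by gcongr
  linarith

lemma norm_corrOp_le (he : ‖e‖ = 1) (hw : NearUnitary β w w') (hβ : β ≤ 1) (hη : 0 < η) (v : H) :
    ‖m.corrOp e η w w' v‖ ≤ m.opBound η * ‖v‖ := by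
  have hM := m.M_pos
  have h := m.norm_ellOp_le hw hβ (centered e v)
  have h1 := norm_centered_le he (m.ellOp w w' (centered e v))
  have h2 := norm_centered_le he v
  simp only [corrOp, add_apply, smul_apply, one_apply_eq_self, mul_apply_eq_comp]
  refine (norm_add_le _ _).trans ?_
  rw [norm_smul, Complex.norm_real, Real.norm_of_nonneg hη.le, opBound, add_mul]
  gcongr
  calc _ ≤ _ := h1
    _ ≤ _ := h
    _ ≤ _ := by gcongr

lemma isUnit_corrOp [CompleteSpace H] (he : ‖e‖ = 1) (hw : NearUnitary β w w') (hβ0 : 0 ≤ β)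
    (hβ1 : β ≤ 1) (hη : 0 < η) (hβ : 4 * m.M ^ 2 * d ^ 3 * β ^ 2 ≤ m.lam * η) :
    IsUnit (m.corrOp e η w w') :=
  isUnit_of_coercive (half_pos hη) (m.half_le_opBound hη)
    (m.le_re_inner_corrOp he hw hβ0 hη hβ) (m.norm_corrOp_le he hw hβ1 hη)

/-- Uniqueness for the corrector equation. -/
lemma corr_unique (he : ‖e‖ = 1) (hw : NearUnitary β w w') (hβ0 : 0 ≤ β) (hη : 0 < η)
    (hβ : 4 * m.M ^ 2 * d ^ 3 * β ^ 2 ≤ m.lam * η) {φ ψ : H}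
    (h : (η : ℂ) • φ + centered e (m.ellOp w w' φ) = (η : ℂ) • ψ + centered e (m.ellOp w w' ψ)) :
    φ = ψ := by
  have hη' : (η : ℂ) ≠ 0 := by exact_mod_cast hη.ne'
  set χ := φ - ψ with hχ
  have h1 : (η : ℂ) • χ + centered e (m.ellOp w w' χ) = 0 := by
    rw [hχ, map_sub, map_sub, smul_sub, ← sub_eq_zero.2 h]; abel
  have h2 : inner ℂ e χ = 0 := by
    have := congrArg (inner ℂ e) h1
    rw [inner_add_right, inner_smul_right, inner_centered_self he, add_zero, inner_zero_right] at this
    exact (mul_eq_zero.1 this).resolve_left hη'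
  have h3 : m.corrOp e η w w' χ = 0 := by
    simp only [corrOp, add_apply, smul_apply, one_apply_eq_self, mul_apply_eq_comp]
    rw [centered_of_inner_eq_zero h2, h1]
  have h4 := norm_le_of_coercive (half_pos hη) (m.le_re_inner_corrOp he hw hβ0 hη hβ) χ
  rw [h3, norm_zero, mul_zero] at h4
  exact sub_eq_zero.1 (norm_le_zero_iff.1 h4)

lemma corrOp_corrVec [CompleteSpace H] (hu : IsUnit (m.corrOp e η w w')) (k : Fin d) :
    m.corrOp e η w w' (m.corrVec e η w w' k) = m.corrRhs e w' k := by
  rw [corrVec, ← mul_apply_eq_comp, Ring.mul_inverse_cancel _ hu, one_apply_eq_self]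

/-- Pairing with e annihilates every projected term, so the solution has mean zero. The inner
projection in `corrOp`, present only for coercivity, then acts as the identity. -/
lemma corrVec_eq [CompleteSpace H] (he : ‖e‖ = 1) (hη : 0 < η) (hu : IsUnit (m.corrOp e η w w'))
    (k : Fin d) :
    inner ℂ e (m.corrVec e η w w' k) = 0 ∧
    (η : ℂ) • m.corrVec e η w w' k + centered e (m.ellOp w w' (m.corrVec e η w w' k)) =
      m.corrRhs e w' k := by
  have hη' : (η : ℂ) ≠ 0 := by exact_mod_cast hη.ne'
  have h := m.corrOp_corrVec hu k
  simp only [corrOp, add_apply, smul_apply, one_apply_eq_self, mul_apply_eq_comp] at h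
  have h2 : inner ℂ e (m.corrVec e η w w' k) = 0 := by
    have := congrArg (inner ℂ e) h
    rw [inner_add_right, inner_smul_right, inner_centered_self he, add_zero, corrRhs, inner_neg_right,
      inner_centered_self he, neg_zero] at this
    exact (mul_eq_zero.1 this).resolve_left hη'
  refine ⟨h2, ?_⟩
  rw [centered_of_inner_eq_zero h2] at h
  exact h

lemma inner_gradStar_unit (hT : ∀ j, m.T j e = e) (w' : Fin d → ℂ) (i : Fin d) (f : H) :
    inner ℂ e (m.gradStar w' i f) = (w' i - 1) * inner ℂ e f := by
  rw [inner_gradStar]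
  simp only [grad, sub_apply, smul_apply, one_apply_eq_self, hT, inner_sub_left, inner_smul_left,
    Complex.conj_conj]
  ring

lemma grad_unit (hT : ∀ j, m.T j e = e) (w : Fin d → ℂ) (j : Fin d) :
    m.grad w j e = (w j - 1) • e := by
  simp [grad, hT, sub_smul]

/-- The mean of the solution of `η v + ∂^* A ∂ v = e` is the inverse of the homogenized symbol. -/
theorem inner_mul_symbol_eq_one [CompleteSpace H] (he : ‖e‖ = 1) (hT : ∀ j, m.T j e = e)
    (hw : NearUnitary β w w') (hβ0 : 0 ≤ β) (hβ1 : β ≤ 1) (hη : 0 < η)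
    (hβ : 4 * m.M ^ 2 * d ^ 3 * β ^ 2 ≤ m.lam * η) {v : H} (hv : m.fullOp η w w' v = e) :
    inner ℂ e v * (η + ∑ k, ∑ k', (w' k - 1) * (m.homMat e η w w' k k' * (w k' - 1))) = 1 := by
  have hu := m.isUnit_corrOp he hw hβ0 hβ1 hη hβ
  set Φ := m.corrVec e η w w'
  set t := inner ℂ e v with ht
  set S : H := ∑ k, (w k - 1) • Φ k with hS
  have hv' : (η : ℂ) • v + m.ellOp w w' v = e := by
    simpa [fullOp] using hv
  have hsplit : t • e + centered e v = v := by rw [centered_apply]; abel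
  have hLe : m.ellOp w w' e = ∑ k, (w k - 1) • ∑ i, m.gradStar w' i (m.A i k e) := by
    rw [ellOp_apply]
    simp only [grad_unit m hT, map_smul, map_sum, Finset.smul_sum]
    exact Finset.sum_comm
  -- The fluctuation of v solves the corrector equation with mean gradient t(w - 1), so uniqueness
  -- makes it t times the corresponding combination of correctors.
  have h1 : centered e v = t • S := by
    refine m.corr_unique he hw hβ0 hη hβ ?_
    have hA : (η : ℂ) • centered e v + centered e (m.ellOp w w' (centered e v)) =
        -(t • centered e (m.ellOp w w' e)) := by
      have h2 := congrArg (centered e) hv'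
      rw [centered_self he, map_add, map_smul] at h2
      have h3 : m.ellOp w w' v = t • m.ellOp w w' e + m.ellOp w w' (centered e v) := by
        rw [← map_smul, ← map_add, hsplit]
      rw [h3, map_add, map_smul] at h2
      rw [eq_neg_iff_add_eq_zero, ← h2]; abel
    have hB : (η : ℂ) • S + centered e (m.ellOp w w' S) = -centered e (m.ellOp w w' e) := by
      have h4 : ∀ k, (w k - 1) • ((η : ℂ) • Φ k + centered e (m.ellOp w w' (Φ k))) =
          (w k - 1) • m.corrRhs e w' k := fun k => by rw [(m.corrVec_eq he hη hu k).2]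
      have h5 := Finset.sum_congr rfl fun k (_ : k ∈ Finset.univ) => h4 k
      have e1 : ∑ k, (w k - 1) • ((η : ℂ) • Φ k + centered e (m.ellOp w w' (Φ k))) =
          (η : ℂ) • S + centered e (m.ellOp w w' S) := by
        simp only [hS, map_sum, map_smul, smul_add, Finset.sum_add_distrib, Finset.smul_sum]
        congr 1
        exact Finset.sum_congr rfl fun k _ => smul_comm _ _ _
      rw [e1] at h5
      rw [h5, hLe, map_sum, ← Finset.sum_neg_distrib]
      refine Finset.sum_congr rfl fun k _ => ?_
      rw [corrRhs, smul_neg, map_smul]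
    rw [hA, map_smul, map_smul, ← smul_neg, ← hB, smul_add, smul_comm]
  have hgrad : ∀ i, ∑ j, m.A i j (m.grad w j v) = t • ∑ k, (w k - 1) •
      (m.A i k e + ∑ j, m.A i j (m.grad w j (Φ k))) := by
    intro i
    have e2 : v = t • (e + S) := by rw [smul_add, ← h1, hsplit]
    rw [e2]
    simp only [map_smul, map_add, ← Finset.smul_sum]
    congr 1
    simp only [smul_add, Finset.sum_add_distrib, grad_unit m hT, map_smul, hS, map_sum, Finset.smul_sum]
    congr 1
    exact Finset.sum_comm
  -- Averaging the equation turns each backward difference into w' - 1 and the averaged flux into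
  -- the homogenized matrix.
  have h6 := congrArg (inner ℂ e) hv'
  rw [inner_add_right, inner_smul_right, ← ht, ellOp_apply, inner_sum, inner_self_eq_norm_sq_to_K, he] at h6
  simp only [inner_gradStar_unit m hT, hgrad, inner_smul_right, inner_sum] at h6
  rw [mul_add, Finset.mul_sum]
  refine Eq.trans ?_ (h6.trans (by simp))
  rw [mul_comm t]
  congr 1
  refine Finset.sum_congr rfl fun k _ => ?_
  rw [Finset.mul_sum, Finset.mul_sum, Finset.mul_sum]
  refine Finset.sum_congr rfl fun k' _ => ?_
  rw [homMat]; ring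

/-- The energy of the corrector field with mean gradient `v` controls the homogenized form. -/
lemma energy_le [CompleteSpace H] (he : ‖e‖ = 1)
    (hw : ∀ j, w' j = starRingEnd ℂ (w j)) (hη : 0 < η) (hu : IsUnit (m.corrOp e η w w')) (v : Fin d → ℂ) :
    m.lam * ∑ j, ‖v j • e + m.grad w j (∑ k, v k • m.corrVec e η w w' k)‖ ^ 2 ≤
      (∑ k, ∑ k', starRingEnd ℂ (v k) * (m.homMat e η w w' k k' * v k')).re := by
  set Φ := m.corrVec e η w w'
  set φ : H := ∑ k, v k • Φ k with hφ
  set p : Fin d → H := fun j => v j • e + m.grad w j φ with hp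
  have hφe : inner ℂ e φ = 0 := by
    rw [hφ, inner_sum]
    exact Finset.sum_eq_zero fun k _ => by rw [inner_smul_right, (m.corrVec_eq he hη hu k).1, mul_zero]
  have hF : ∀ k, ∑ j, m.A k j (p j) = ∑ k', v k' • (m.A k k' e + ∑ j, m.A k j (m.grad w j (Φ k'))) := by
    intro k
    simp only [hp, map_add, map_smul, Finset.sum_add_distrib, hφ, map_sum, smul_add, Finset.smul_sum]
    congr 1
    exact Finset.sum_comm
  have hq : ∑ k, ∑ k', starRingEnd ℂ (v k) * (m.homMat e η w w' k k' * v k') =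
      ∑ k, inner ℂ (v k • e) (∑ j, m.A k j (p j)) := by
    refine Finset.sum_congr rfl fun k _ => ?_
    rw [hF, inner_sum]
    refine Finset.sum_congr rfl fun k' _ => ?_
    rw [inner_smul_left, inner_smul_right, homMat]; ring
  have hw'' : (fun j => starRingEnd ℂ (w' j)) = w := by funext j; rw [hw, Complex.conj_conj]
  -- Testing the corrector equation with φ itself: the gradient part of the form equals -η‖φ‖², and
  -- discarding this term yields the inequality.
  have hcorr : ∑ k, inner ℂ (m.grad w k φ) (∑ j, m.A k j (p j)) = -((η : ℂ) * (‖φ‖ : ℂ) ^ 2) := by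
    have h1 : ∑ k, inner ℂ (m.grad w k φ) (∑ j, m.A k j (p j)) =
        inner ℂ φ (∑ k, m.gradStar w' k (∑ j, m.A k j (p j))) := by
      rw [inner_sum]
      exact Finset.sum_congr rfl fun k _ => by rw [inner_gradStar, hw'']
    have h2 : ∑ k, m.gradStar w' k (∑ j, m.A k j (p j)) =
        (∑ k', v k' • ∑ i, m.gradStar w' i (m.A i k' e)) + m.ellOp w w' φ := by
      rw [ellOp_apply, Finset.sum_congr rfl fun k' _ => Finset.smul_sum, Finset.sum_comm,
        ← Finset.sum_add_distrib]
      refine Finset.sum_congr rfl fun i _ => ?_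
      simp only [hp, map_add, Finset.sum_add_distrib, map_smul, map_sum]
    have h3 : (η : ℂ) • φ + centered e (m.ellOp w w' φ) =
        -centered e (∑ k', v k' • ∑ i, m.gradStar w' i (m.A i k' e)) := by
      have h5 := Finset.sum_congr rfl fun k (_ : k ∈ Finset.univ) =>
        congrArg (v k • ·) (m.corrVec_eq he hη hu k).2
      simp only [smul_add, Finset.sum_add_distrib] at h5
      rw [hφ, map_sum, map_sum, map_sum, ← Finset.sum_neg_distrib, Finset.smul_sum]
      simp only [map_smul]
      rw [← Finset.sum_congr rfl fun k (_ : k ∈ Finset.univ) => smul_comm (v k) (η : ℂ) (Φ k), h5]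
      exact Finset.sum_congr rfl fun k _ => by rw [corrRhs, smul_neg]
    rw [h1, h2]
    have h6 : ∀ f, inner ℂ φ f = inner ℂ φ (centered e f) := fun f => by
      rw [← inner_centered_left, centered_of_inner_eq_zero hφe]
    rw [h6, map_add]
    have h7 : centered e (∑ k', v k' • ∑ i, m.gradStar w' i (m.A i k' e)) +
        centered e (m.ellOp w w' φ) = -((η : ℂ) • φ) := by
      rw [eq_neg_iff_add_eq_zero, ← neg_eq_iff_eq_neg.2 h3]; abel
    rw [h7, inner_neg_right, inner_smul_right, inner_self_eq_norm_sq_to_K]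
    rfl
  have htot : ∑ k, ∑ j, inner ℂ (p k) (m.A k j (p j)) =
      ∑ k, inner ℂ (v k • e) (∑ j, m.A k j (p j)) + ∑ k, inner ℂ (m.grad w k φ) (∑ j, m.A k j (p j)) := by
    rw [← Finset.sum_add_distrib]
    refine Finset.sum_congr rfl fun k _ => ?_
    rw [← inner_add_left, inner_sum]
  have hell := m.elliptic p
  rw [htot, hcorr, Complex.add_re, Complex.neg_re, Complex.re_ofReal_mul, ← Complex.ofReal_pow,
    Complex.ofReal_re] at hell
  rw [hq]
  have : 0 ≤ η * ‖φ‖ ^ 2 := by positivity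
  linarith

/-- Lower bound for the homogenized form at unitary phases. -/
theorem le_re_homMat [CompleteSpace H] (he : ‖e‖ = 1) (hT : ∀ j, m.T j e = e)
    (hw : ∀ j, w' j = starRingEnd ℂ (w j)) (hη : 0 < η) (hu : IsUnit (m.corrOp e η w w')) (v : Fin d → ℂ) :
    m.lam * ∑ j, ‖v j‖ ^ 2 ≤
      (∑ k, ∑ k', starRingEnd ℂ (v k) * (m.homMat e η w w' k k' * v k')).re := by
  refine le_trans ?_ (m.energy_le he hw hη hu v)
  have := m.lam_pos
  gcongr with j
  set φ : H := ∑ k, v k • m.corrVec e η w w' k with hφ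
  have hφe : inner ℂ e φ = 0 := by
    rw [hφ, inner_sum]
    exact Finset.sum_eq_zero fun k _ => by rw [inner_smul_right, (m.corrVec_eq he hη hu k).1, mul_zero]
  have h1 : inner ℂ e (m.grad w j φ) = 0 := by
    have h2 : inner ℂ e (m.T j φ) = 0 := by
      -- Since S is a contraction and ⟨Se, e⟩ = ⟨e, Te⟩ = 1, equality in Cauchy–Schwarz gives Se =
      -- e. Translations thus preserve means, and gradients of mean-zero vectors have mean zero.
      have h3 : ‖m.S j e - e‖ ^ 2 ≤ 0 := by
        rw [norm_sub_sq (𝕜 := ℂ), m.inner_S, hT, inner_self_eq_norm_sq_to_K, he]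
        have := m.norm_S j e
        rw [he] at this
        have h4 : RCLike.re (((1:ℝ) : ℂ) ^ 2) = (1:ℝ) := by simp
        have h5 : ‖m.S j e‖ ^ 2 ≤ 1 := by nlinarith [norm_nonneg (m.S j e)]
        change ‖m.S j e‖ ^ 2 - 2 * RCLike.re (((1:ℝ) : ℂ) ^ 2) + 1 ^ 2 ≤ 0
        rw [h4]; linarith
      have h6 : m.S j e = e := by
        have : ‖m.S j e - e‖ = 0 := by
          have := sq_nonneg ‖m.S j e - e‖
          exact pow_eq_zero_iff (two_ne_zero) |>.1 (le_antisymm h3 this)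
        exact sub_eq_zero.1 (norm_eq_zero.1 this)
      rw [← m.inner_S, h6, hφe]
    simp only [grad, sub_apply, smul_apply, one_apply_eq_self, inner_sub_right, inner_smul_right, h2, hφe]
    simp
  have h2 : inner ℂ e (v j • e + m.grad w j φ) = v j := by
    rw [inner_add_right, h1, inner_smul_right, inner_self_eq_norm_sq_to_K, he]; simp
  calc ‖v j‖ = ‖inner ℂ e (v j • e + m.grad w j φ)‖ := by rw [h2]
    _ ≤ _ := by
      refine (norm_inner_le_norm _ _).trans ?_
      rw [he, one_mul]

/-- Upper bound for the homogenized matrix at unitary phases. -/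
theorem norm_homMat_le [CompleteSpace H] (he : ‖e‖ = 1)
    (hw : ∀ j, w' j = starRingEnd ℂ (w j)) (hη : 0 < η) (hu : IsUnit (m.corrOp e η w w')) (k l : Fin d) :
    ‖m.homMat e η w w' k l‖ ≤ d * m.M ^ 2 / m.lam := by
  have hlam := m.lam_pos
  have hM := m.M_pos
  set v : Fin d → ℂ := Pi.single l 1
  set p : Fin d → H := fun j => v j • e + m.grad w j (∑ k, v k • m.corrVec e η w w' k) with hp
  have hφ : ∑ k, v k • m.corrVec e η w w' k = m.corrVec e η w w' l := by
    rw [Finset.sum_eq_single l]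
    · simp [v]
    · intro k _ hk; simp [v, hk]
    · simp
  have hq : ∀ k, m.homMat e η w w' k l = inner ℂ e (∑ j, m.A k j (p j)) := by
    intro k
    rw [homMat]
    congr 1
    simp only [hp, hφ, map_add, Finset.sum_add_distrib]
    congr 1
    rw [Finset.sum_eq_single l]
    · simp [v]
    · intro j _ hj; simp [v, hj]
    · simp
  have hbound : ∀ k, ‖m.homMat e η w w' k l‖ ≤ m.M * ∑ j, ‖p j‖ := by
    intro k
    rw [hq]
    refine (norm_inner_le_norm _ _).trans ?_
    rw [he, one_mul, Finset.mul_sum]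
    exact norm_sum_le_of_le _ fun j _ => m.norm_A k j _
  have hen := m.energy_le he hw hη hu v
  have e1 : ∑ k, ∑ k', starRingEnd ℂ (v k) * (m.homMat e η w w' k k' * v k') = m.homMat e η w w' l l := by
    rw [Finset.sum_eq_single l]
    · rw [Finset.sum_eq_single l]
      · simp [v]
      · intro j _ hj; simp [v, hj]
      · simp
    · intro j _ hj; simp [v, hj]
    · simp
  rw [e1] at hen
  set s := ∑ j, ‖p j‖ with hs
  have hs0 : 0 ≤ s := Finset.sum_nonneg fun _ _ => norm_nonneg _
  have hcs : s ^ 2 ≤ d * ∑ j, ‖p j‖ ^ 2 := by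
    have := sq_sum_le_card_mul_sum_sq (s := (Finset.univ : Finset (Fin d))) (f := fun j => ‖p j‖)
    simpa using this
  -- With s the sum of the ‖p_j‖, the energy is at most the diagonal entry, itself at most M s.
  -- Cauchy–Schwarz then gives λs² ≤ dMs, hence s ≤ dM/λ.
  have h1 : m.lam * s ^ 2 ≤ d * (m.M * s) := by
    calc m.lam * s ^ 2 ≤ m.lam * (d * ∑ j, ‖p j‖ ^ 2) := by gcongr
      _ = d * (m.lam * ∑ j, ‖p j‖ ^ 2) := by ring
      _ ≤ d * (m.M * s) := by
        exact mul_le_mul_of_nonneg_left (hen.trans ((Complex.re_le_norm _).trans (hbound l)))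
          (Nat.cast_nonneg d)
  have h2 : m.lam * s ≤ d * m.M := by
    rcases hs0.eq_or_lt with h | h
    · rw [← h, mul_zero]; positivity
    · nlinarith
  refine (hbound k).trans ?_
  rw [le_div_iff₀ hlam]
  calc m.M * s * m.lam = m.M * (m.lam * s) := by ring
    _ ≤ m.M * (d * m.M) := by gcongr
    _ = _ := by ring

/-- The homogenized matrix is a smooth function of the phases. -/
theorem contDiffAt_homMat [CompleteSpace H] {n : WithTop ℕ∞} (p : (Fin d → ℂ) × (Fin d → ℂ))
    (hu : IsUnit (m.corrOp e η p.1 p.2)) (k k' : Fin d) :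
    ContDiffAt ℂ n (fun p : (Fin d → ℂ) × (Fin d → ℂ) => m.homMat e η p.1 p.2 k k') p := by
  have hw : ∀ j, ContDiff ℂ n fun p : (Fin d → ℂ) × (Fin d → ℂ) => p.1 j := fun j => by fun_prop
  have hw' : ∀ j, ContDiff ℂ n fun p : (Fin d → ℂ) × (Fin d → ℂ) => p.2 j := fun j => by fun_prop
  have hgrad : ∀ j, ContDiff ℂ n fun p : (Fin d → ℂ) × (Fin d → ℂ) => m.grad p.1 j := fun j =>
    ((hw j).smul contDiff_const).sub contDiff_const
  have hgradStar : ∀ j, ContDiff ℂ n fun p : (Fin d → ℂ) × (Fin d → ℂ) => m.gradStar p.2 j := fun j =>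
    ((hw' j).smul contDiff_const).sub contDiff_const
  have hell : ContDiff ℂ n fun p : (Fin d → ℂ) × (Fin d → ℂ) => m.ellOp p.1 p.2 := by
    unfold ellOp
    exact ContDiff.sum fun i _ => (hgradStar i).mul (ContDiff.sum fun j _ => contDiff_const.mul (hgrad j))
  have hop : ContDiff ℂ n fun p : (Fin d → ℂ) × (Fin d → ℂ) => m.corrOp e η p.1 p.2 :=
    contDiff_const.add ((contDiff_const.mul hell).mul contDiff_const)
  have hrhs : ContDiff ℂ n fun p : (Fin d → ℂ) × (Fin d → ℂ) => m.corrRhs e p.2 k' := by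
    unfold corrRhs
    exact ((centered e).contDiff.comp (ContDiff.sum fun i _ =>
      (hgradStar i).clm_apply contDiff_const)).neg
  -- The phases and their inverses are treated as independent complex variables; the matrix is built
  -- from affine functions of them and one operator inversion, which is smooth at units.
  obtain ⟨u, hu'⟩ := hu
  have hinv : ContDiffAt ℂ n (fun p : (Fin d → ℂ) × (Fin d → ℂ) => Ring.inverse (m.corrOp e η p.1 p.2)) p := by
    have h1 := contDiffAt_ringInverse ℂ (n := n) u
    rw [hu'] at h1
    exact h1.comp p hop.contDiffAt
  have hΦ : ContDiffAt ℂ n (fun p : (Fin d → ℂ) × (Fin d → ℂ) => m.corrVec e η p.1 p.2 k') p :=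
    hinv.clm_apply hrhs.contDiffAt
  unfold homMat
  refine (innerSL ℂ e).contDiff.contDiffAt.comp p (contDiffAt_const.add (ContDiffAt.sum fun j _ => ?_))
  exact (m.A k j).contDiff.contDiffAt.comp p ((hgrad j).contDiffAt.clm_apply hΦ)

end Medium

/-! ### Stationary coefficient fields over a measure space -/

lemma memLp_mul {X : Type*} [MeasurableSpace X] {μ : Measure X} {g : X → ℂ} (hg : Measurable g)
    {C : ℝ} (hC : ∀ x, ‖g x‖ ≤ C) (f : Lp ℂ 2 μ) : MemLp (fun x => g x * f x) 2 μ :=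
  (Lp.memLp f).of_le_mul (c := C) (hg.aestronglyMeasurable.mul (Lp.memLp f).1)
    (Eventually.of_forall fun x => by rw [norm_mul]; gcongr; exact hC x)

/-- Multiplication by a bounded measurable function on `L²`. -/
noncomputable def mulLp {X : Type*} [MeasurableSpace X] {μ : Measure X} (g : X → ℂ) (hg : Measurable g)
    (C : ℝ) (hC : ∀ x, ‖g x‖ ≤ C) : Lp ℂ 2 μ →L[ℂ] Lp ℂ 2 μ :=
  have hm := memLp_mul (μ := μ) hg hC
  LinearMap.mkContinuous
    { toFun := fun f => (hm f).toLp _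
      map_add' := fun f h => by
        ext1
        filter_upwards [(hm (f + h)).coeFn_toLp, Lp.coeFn_add ((hm f).toLp _) ((hm h).toLp _),
          (hm f).coeFn_toLp, (hm h).coeFn_toLp, Lp.coeFn_add f h] with x h1 h2 h3 h4 h5
        rw [h1, h2, Pi.add_apply, h3, h4, h5, Pi.add_apply, mul_add]
      map_smul' := fun c f => by
        ext1
        filter_upwards [(hm (c • f)).coeFn_toLp, Lp.coeFn_smul c ((hm f).toLp _),
          (hm f).coeFn_toLp, Lp.coeFn_smul c f] with x h1 h2 h3 h5
        rw [h1, RingHom.id_apply, h2, Pi.smul_apply, h3, h5, Pi.smul_apply, smul_eq_mul, smul_eq_mul]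
        ring }
    C fun f => Lp.norm_le_mul_norm_of_ae_le_mul (by
      filter_upwards [(hm f).coeFn_toLp] with x hx
      change ‖((hm f).toLp _ : X → ℂ) x‖ ≤ _
      rw [hx, norm_mul]; gcongr; exact hC x)

lemma coeFn_mulLp {X : Type*} [MeasurableSpace X] {μ : Measure X} (g : X → ℂ) (hg : Measurable g)
    (C : ℝ) (hC : ∀ x, ‖g x‖ ≤ C) (f : Lp ℂ 2 μ) :
    mulLp g hg C hC f =ᵐ[μ] fun x => g x * f x :=
  (memLp_mul hg hC f).coeFn_toLp

/-- A bounded elliptic complex coefficient matrix on a measure space with a measure preserving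
action of the lattice. -/
structure StationaryField (d : ℕ) (X : Type*) [MeasurableSpace X] (μ : Measure X) where
  τ : Lattice d → X → X
  mp : ∀ x, MeasurePreserving (τ x) μ μ
  τ_zero : ∀ x, τ 0 x = x
  τ_add : ∀ y z x, τ (y + z) x = τ y (τ z x)
  a : X → Matrix (Fin d) (Fin d) ℂ
  meas : ∀ i j, Measurable fun x => a x i j
  lam : ℝ
  M : ℝ
  lam_pos : 0 < lam
  lam_le : lam ≤ M
  bound : ∀ x i j, ‖a x i j‖ ≤ M
  elliptic : ∀ x (v : Fin d → ℂ),
    lam * ∑ j, ‖v j‖ ^ 2 ≤ (∑ i, ∑ j, starRingEnd ℂ (v i) * (a x i j * v j)).re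

namespace StationaryField

variable {d : ℕ} {X : Type*} [MeasurableSpace X] {μ : Measure X} (F : StationaryField d X μ)

/-- The twisted forward difference of a function. -/
def gradFun (w : Fin d → ℂ) (j : Fin d) (ψ : X → ℂ) (x : X) : ℂ :=
  w j * ψ (F.τ (unitVec j) x) - ψ x

/-- The twisted backward difference of a function. -/
def gradStarFun (w' : Fin d → ℂ) (i : Fin d) (ψ : X → ℂ) (x : X) : ℂ :=
  w' i * ψ (F.τ (-unitVec i) x) - ψ x

/-- The twisted operator `∂^* a ∂` on functions. -/
def ellFun (w w' : Fin d → ℂ) (ψ : X → ℂ) (x : X) : ℂ :=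
  ∑ i, F.gradStarFun w' i (fun y => ∑ j, F.a y i j * F.gradFun w j ψ y) x

/-- Richardson iterates for `η ψ + ∂^* a ∂ ψ = f`. -/
def iter (η s : ℝ) (w w' : Fin d → ℂ) (f : X → ℂ) : ℕ → X → ℂ
  | 0 => 0
  | n + 1 => fun x => iter η s w w' f n x -
      s * (η * iter η s w w' f n x + F.ellFun w w' (iter η s w w' f n) x - f x)

/-- The translation operators on `L²`. -/
noncomputable def shift (y : Lattice d) : Lp ℂ 2 μ →ₗᵢ[ℂ] Lp ℂ 2 μ :=
  Lp.compMeasurePreservingₗᵢ ℂ (F.τ y) (F.mp y)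

lemma coeFn_shift (y : Lattice d) (f : Lp ℂ 2 μ) : F.shift y f =ᵐ[μ] fun x => f (F.τ y x) :=
  Lp.coeFn_compMeasurePreserving f (F.mp y)

lemma shift_shift_neg (y : Lattice d) (f : Lp ℂ 2 μ) : F.shift y (F.shift (-y) f) = f := by
  ext1
  filter_upwards [F.coeFn_shift y (F.shift (-y) f),
    (F.mp y).quasiMeasurePreserving.ae_eq_comp (F.coeFn_shift (-y) f)] with x h1 h2
  rw [h1]
  simp only [Function.comp_apply] at h2
  rw [h2, ← F.τ_add, neg_add_cancel, F.τ_zero]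

/-- The operators on `L²` defined by a stationary field. -/
noncomputable def medium : Medium d (Lp ℂ 2 μ) where
  T j := (F.shift (unitVec j)).toContinuousLinearMap
  S j := (F.shift (-unitVec j)).toContinuousLinearMap
  A i j := mulLp (fun x => F.a x i j) (F.meas i j) F.M fun x => F.bound x i j
  lam := F.lam
  M := F.M
  lam_pos := F.lam_pos
  lam_le := F.lam_le
  inner_S j f g := by
    change inner ℂ (F.shift (-unitVec j) f) g = inner ℂ f (F.shift (unitVec j) g)
    rw [← (F.shift (unitVec j)).inner_map_map, shift_shift_neg]
  norm_T j f := ((F.shift (unitVec j)).norm_map f).le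
  norm_S j f := ((F.shift (-unitVec j)).norm_map f).le
  norm_A i j f := Lp.norm_le_mul_norm_of_ae_le_mul (by
    filter_upwards [coeFn_mulLp (fun x => F.a x i j) (F.meas i j) F.M (fun x => F.bound x i j) f]
      with x hx
    rw [hx, norm_mul]; gcongr; exact F.bound x i j)
  elliptic p := by
    set A : Fin d → Fin d → Lp ℂ 2 μ →L[ℂ] Lp ℂ 2 μ := fun i j =>
      mulLp (fun x => F.a x i j) (F.meas i j) F.M fun x => F.bound x i j
    have hi : ∀ f g : Lp ℂ 2 μ, Integrable (fun x => inner ℂ (f x) (g x)) μ := fun f g =>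
      L2.integrable_inner f g
    have e : ∑ i, ∑ j, inner ℂ (p i) (A i j (p j)) - F.lam * ∑ j, inner ℂ (p j) (p j) =
        ∫ x, (∑ i, ∑ j, inner ℂ (p i x) (A i j (p j) x) - F.lam * ∑ j, inner ℂ (p j x) (p j x)) ∂μ := by
      rw [integral_sub (integrable_finsetSum _ fun i _ => integrable_finsetSum _ fun j _ => hi _ _)
        ((integrable_finsetSum _ fun j _ => hi _ _).const_mul _), integral_const_mul,
        integral_finsetSum _ fun j _ => hi _ _,
        integral_finsetSum _ fun i _ => integrable_finsetSum _ fun j _ => hi _ _]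
      simp only [L2.inner_def]
      congr 1
      exact Finset.sum_congr rfl fun i _ => by rw [integral_finsetSum _ fun j _ => hi _ _]
    have hae : ∀ᵐ x ∂μ, ∀ i j, A i j (p j) x = F.a x i j * p j x := by
      rw [ae_all_iff]; intro i
      rw [ae_all_iff]; intro j
      exact coeFn_mulLp _ _ _ _ _
    have hre : 0 ≤ (∫ x, (∑ i, ∑ j, inner ℂ (p i x) (A i j (p j) x) -
        F.lam * ∑ j, inner ℂ (p j x) (p j x)) ∂μ).re := by
      have hint : Integrable (fun x => ∑ i, ∑ j, inner ℂ (p i x) (A i j (p j) x) -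
          F.lam * ∑ j, inner ℂ (p j x) (p j x)) μ :=
        (integrable_finsetSum _ fun i _ => integrable_finsetSum _ fun j _ => hi _ _).sub
          ((integrable_finsetSum _ fun j _ => hi _ _).const_mul _)
      have := integral_re hint
      refine le_of_le_of_eq ?_ this
      refine integral_nonneg_of_ae ?_
      filter_upwards [hae] with x hx
      have h := F.elliptic x fun j => p j x
      have e2 : ∑ j, inner ℂ (p j x) (p j x) = ((∑ j, ‖p j x‖ ^ 2 : ℝ) : ℂ) := by
        push_cast
        exact Finset.sum_congr rfl fun j _ => inner_self_eq_norm_sq_to_K _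
      rw [e2, ← Complex.ofReal_mul]
      change 0 ≤ (_ - _ : ℂ).re
      rw [Complex.sub_re, Complex.ofReal_re, sub_nonneg]
      refine h.trans (le_of_eq ?_)
      congr 1
      refine Finset.sum_congr rfl fun i _ => Finset.sum_congr rfl fun j _ => ?_
      rw [hx, RCLike.inner_apply, mul_comm]
    rw [← e, Complex.sub_re, sub_nonneg, Complex.re_ofReal_mul, Complex.re_sum] at hre
    refine le_trans (le_of_eq ?_) hre
    congr 1
    refine Finset.sum_congr rfl fun j _ => ?_
    rw [inner_self_eq_norm_sq_to_K]
    change _ = ((‖p j‖ : ℂ) ^ 2).re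
    rw [← Complex.ofReal_pow, Complex.ofReal_re]

variable {F}

lemma coeFn_T {ψ : Lp ℂ 2 μ} {f : X → ℂ} (h : ψ =ᵐ[μ] f) (j : Fin d) :
    F.medium.T j ψ =ᵐ[μ] fun x => f (F.τ (unitVec j) x) := by
  filter_upwards [F.coeFn_shift (unitVec j) ψ,
    (F.mp (unitVec j)).quasiMeasurePreserving.ae_eq_comp h] with x h1 h2
  exact h1.trans h2

lemma coeFn_S {ψ : Lp ℂ 2 μ} {f : X → ℂ} (h : ψ =ᵐ[μ] f) (j : Fin d) :
    F.medium.S j ψ =ᵐ[μ] fun x => f (F.τ (-unitVec j) x) := by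
  filter_upwards [F.coeFn_shift (-unitVec j) ψ,
    (F.mp (-unitVec j)).quasiMeasurePreserving.ae_eq_comp h] with x h1 h2
  exact h1.trans h2

lemma coeFn_A {ψ : Lp ℂ 2 μ} {f : X → ℂ} (h : ψ =ᵐ[μ] f) (i j : Fin d) :
    F.medium.A i j ψ =ᵐ[μ] fun x => F.a x i j * f x := by
  filter_upwards [coeFn_mulLp (fun x => F.a x i j) (F.meas i j) F.M (fun x => F.bound x i j) ψ, h]
    with x h1 h2
  rw [← h2]; exact h1

lemma coeFn_sum {ι : Type*} (s : Finset ι) {ψ : ι → Lp ℂ 2 μ} {f : ι → X → ℂ}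
    (h : ∀ i ∈ s, ψ i =ᵐ[μ] f i) : (∑ i ∈ s, ψ i : Lp ℂ 2 μ) =ᵐ[μ] fun x => ∑ i ∈ s, f i x := by
  classical
  induction s using Finset.induction_on with
  | empty =>
    simp only [Finset.sum_empty]
    exact Lp.coeFn_zero ℂ 2 μ
  | insert i s hi ih =>
    rw [Finset.sum_insert hi]
    filter_upwards [Lp.coeFn_add (ψ i) (∑ i ∈ s, ψ i), h i (Finset.mem_insert_self _ _),
      ih fun j hj => h j (Finset.mem_insert_of_mem hj)] with x h1 h2 h3
    rw [h1, Pi.add_apply, h2, h3, Finset.sum_insert hi]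

lemma coeFn_smul_sub {c : ℂ} {ψ φ : Lp ℂ 2 μ} {f g : X → ℂ} (h : ψ =ᵐ[μ] f) (h' : φ =ᵐ[μ] g) :
    (c • ψ - φ : Lp ℂ 2 μ) =ᵐ[μ] fun x => c * f x - g x := by
  filter_upwards [Lp.coeFn_sub (c • ψ) φ, Lp.coeFn_smul c ψ, h, h'] with x h1 h2 h3 h4
  rw [h1, Pi.sub_apply, h2, Pi.smul_apply, h3, h4, smul_eq_mul]

lemma coeFn_grad {ψ : Lp ℂ 2 μ} {f : X → ℂ} (h : ψ =ᵐ[μ] f) (w : Fin d → ℂ) (j : Fin d) :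
    F.medium.grad w j ψ =ᵐ[μ] F.gradFun w j f :=
  coeFn_smul_sub (coeFn_T h j) h

lemma coeFn_gradStar {ψ : Lp ℂ 2 μ} {f : X → ℂ} (h : ψ =ᵐ[μ] f) (w' : Fin d → ℂ) (j : Fin d) :
    F.medium.gradStar w' j ψ =ᵐ[μ] F.gradStarFun w' j f :=
  coeFn_smul_sub (coeFn_S h j) h

lemma coeFn_ellOp {ψ : Lp ℂ 2 μ} {f : X → ℂ} (h : ψ =ᵐ[μ] f) (w w' : Fin d → ℂ) :
    F.medium.ellOp w w' ψ =ᵐ[μ] F.ellFun w w' f := by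
  rw [Medium.ellOp_apply]
  exact coeFn_sum _ fun i _ => coeFn_gradStar (coeFn_sum _ fun j _ => coeFn_A (coeFn_grad h w j) i j) w' i

lemma coeFn_fullOp {ψ : Lp ℂ 2 μ} {f : X → ℂ} (h : ψ =ᵐ[μ] f) (η : ℝ) (w w' : Fin d → ℂ) :
    F.medium.fullOp η w w' ψ =ᵐ[μ] fun x => η * f x + F.ellFun w w' f x := by
  filter_upwards [Lp.coeFn_add ((η : ℂ) • ψ) (F.medium.ellOp w w' ψ), Lp.coeFn_smul (η : ℂ) ψ, h,
    coeFn_ellOp h w w'] with x h1 h2 h3 h4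
  have : F.medium.fullOp η w w' ψ = (η : ℂ) • ψ + F.medium.ellOp w w' ψ := rfl
  rw [this, h1, Pi.add_apply, h2, Pi.smul_apply, h3, h4, smul_eq_mul]

/-- The L² iterates are represented by functions defined everywhere. Such representatives are needed
because the Fourier transform evaluates them along individual orbits, which may be null sets. -/
lemma coeFn_richardson (η s : ℝ) (w w' : Fin d → ℂ) {ψ : Lp ℂ 2 μ} {f : X → ℂ} (h : ψ =ᵐ[μ] f) (n : ℕ) :
    (richardson (F.medium.fullOp η w w') s ψ n : Lp ℂ 2 μ) =ᵐ[μ] F.iter η s w w' f n := by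
  induction n with
  | zero => exact Lp.coeFn_zero ℂ 2 μ
  | succ n ih =>
    rw [richardson]
    set v := richardson (F.medium.fullOp η w w') s ψ n
    filter_upwards [Lp.coeFn_sub v ((s : ℂ) • (F.medium.fullOp η w w' v - ψ)),
      Lp.coeFn_smul (s : ℂ) (F.medium.fullOp η w w' v - ψ), Lp.coeFn_sub (F.medium.fullOp η w w' v) ψ,
      ih, h, coeFn_fullOp ih η w w'] with x h1 h2 h3 h4 h5 h6
    rw [h1, Pi.sub_apply, h2, Pi.smul_apply, h3, Pi.sub_apply, h4, h5, h6, smul_eq_mul, iter]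

end StationaryField

/-! ### Fourier representation of the averaged Green's function -/

section Phases

variable {d : ℕ}

/-- The phases `e^{-iζ_j}`, `ζ = ξ + i b`. -/
noncomputable def phase (b ξ : Freq d) (j : Fin d) : ℂ := planeWave b (unitVec j) ξ

/-- The phases `e^{iζ_j}`, `ζ = ξ + i b`. -/
noncomputable def phaseInv (b ξ : Freq d) (j : Fin d) : ℂ := planeWave b (-unitVec j) ξ

lemma planeWave_unitVec (b ξ : Freq d) (j : Fin d) :
    planeWave b (unitVec j) ξ = Complex.exp (-Complex.I * cplx ξ b j) := by
  rw [planeWave, Finset.sum_eq_single j]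
  · simp [unitVec]
  · intro i _ hi; simp [unitVec, hi]
  · simp

lemma planeWave_neg_unitVec (b ξ : Freq d) (j : Fin d) :
    planeWave b (-unitVec j) ξ = Complex.exp (Complex.I * cplx ξ b j) := by
  rw [planeWave, Finset.sum_eq_single j]
  · simp [unitVec]
  · intro i _ hi; simp [unitVec, hi]
  · simp

lemma norm_coord_le (b : Freq d) (j : Fin d) : |b j| ≤ ‖b‖ := by
  have := PiLp.norm_apply_le b j
  rwa [Real.norm_eq_abs] at this

/-- The unitary phase is e^{-iξ_j}. The phase and the conjugate of its inverse are this number times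
e^{b_j} and e^{-b_j}, each within 2|b| of one. -/
lemma nearUnitary_phase {b : Freq d} (hb : ‖b‖ ≤ 1) (ξ : Freq d) :
    NearUnitary (2 * ‖b‖) (phase b ξ) (phaseInv b ξ) := by
  have key : ∀ t : ℝ, |t| ≤ ‖b‖ → ‖Complex.exp (t : ℂ) - 1‖ ≤ 2 * ‖b‖ := by
    intro t ht
    have h1 : ‖((t : ℝ) : ℂ)‖ ≤ 1 := by
      rw [Complex.norm_real, Real.norm_eq_abs]; exact ht.trans hb
    refine (Complex.norm_exp_sub_one_le h1).trans ?_
    rw [Complex.norm_real, Real.norm_eq_abs]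
    gcongr
  refine ⟨fun j => Complex.exp (-Complex.I * (ξ j : ℂ)), fun j => ⟨?_, ?_, ?_⟩⟩
  · rw [Complex.norm_exp]; simp
  · have e : phase b ξ j = Complex.exp (-Complex.I * (ξ j : ℂ)) * Complex.exp ((b j : ℝ) : ℂ) := by
      rw [phase, planeWave_unitVec, ← Complex.exp_add]
      congr 1
      simp only [cplx]
      linear_combination (-(b j : ℂ)) * Complex.I_mul_I
    rw [e, ← mul_sub_one, norm_mul, Complex.norm_exp (-Complex.I * (ξ j : ℂ))]
    simpa using key _ (norm_coord_le b j)
  · have e : starRingEnd ℂ (phaseInv b ξ j) =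
        Complex.exp (-Complex.I * (ξ j : ℂ)) * Complex.exp ((-(b j) : ℝ) : ℂ) := by
      rw [phaseInv, planeWave_neg_unitVec, ← Complex.exp_conj, ← Complex.exp_add]
      congr 1
      simp only [cplx, map_mul, map_add, Complex.conj_I, Complex.conj_ofReal]
      push_cast
      linear_combination ((b j : ℂ)) * Complex.I_mul_I
    rw [e, ← mul_sub_one, norm_mul, Complex.norm_exp (-Complex.I * (ξ j : ℂ))]
    simpa using key (-(b j)) (by rw [abs_neg]; exact norm_coord_le b j)

lemma phaseInv_zero (ξ : Freq d) (j : Fin d) : phaseInv 0 ξ j = starRingEnd ℂ (phase 0 ξ j) := by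
  rw [phase, phaseInv, planeWave_unitVec, planeWave_neg_unitVec, ← Complex.exp_conj]
  simp [cplx]

lemma nearUnitary_one : NearUnitary 0 (1 : Fin d → ℂ) 1 :=
  ⟨1, fun j => by simp⟩

end Phases

namespace StationaryField

variable {d : ℕ} {X : Type*} [MeasurableSpace X] {μ : Measure X} (F : StationaryField d X μ)

/-- The coefficient field along an orbit, as a field over the lattice. -/
def orbit (x₀ : X) : StationaryField d (Lattice d) Measure.count where
  τ y z := y + z
  mp y := measurePreserving_add_left _ y
  τ_zero z := zero_add z
  τ_add y z t := add_assoc y z t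
  a z := F.a (F.τ z x₀)
  meas _ _ := Measurable.of_discrete
  lam := F.lam
  M := F.M
  lam_pos := F.lam_pos
  lam_le := F.lam_le
  bound _ := F.bound _
  elliptic _ := F.elliptic _

/-- Bounded functions of frequency and environment, continuous in the frequency. -/
structure IsTest (g : Freq d → X → ℂ) : Prop where
  cont : ∀ y, Continuous fun ξ => g ξ y
  meas : Measurable fun p : Freq d × X => g p.1 p.2
  bdd : ∃ C, ∀ ξ y, ‖g ξ y‖ ≤ C

variable {F}

lemma IsTest.const (c : ℂ) : IsTest fun (_ : Freq d) (_ : X) => c :=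
  ⟨fun _ => continuous_const, measurable_const, ‖c‖, fun _ _ => le_rfl⟩

lemma IsTest.sub {g h : Freq d → X → ℂ} (hg : IsTest g) (hh : IsTest h) :
    IsTest fun ξ y => g ξ y - h ξ y := by
  obtain ⟨C, hC⟩ := hg.bdd
  obtain ⟨D, hD⟩ := hh.bdd
  exact ⟨fun y => (hg.cont y).sub (hh.cont y), hg.meas.sub hh.meas, C + D,
    fun ξ y => (norm_sub_le _ _).trans (add_le_add (hC ξ y) (hD ξ y))⟩

lemma IsTest.add {g h : Freq d → X → ℂ} (hg : IsTest g) (hh : IsTest h) :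
    IsTest fun ξ y => g ξ y + h ξ y := by
  obtain ⟨C, hC⟩ := hg.bdd
  obtain ⟨D, hD⟩ := hh.bdd
  exact ⟨fun y => (hg.cont y).add (hh.cont y), hg.meas.add hh.meas, C + D,
    fun ξ y => (norm_add_le _ _).trans (add_le_add (hC ξ y) (hD ξ y))⟩

lemma IsTest.mul {g h : Freq d → X → ℂ} (hg : IsTest g) (hh : IsTest h) :
    IsTest fun ξ y => g ξ y * h ξ y := by
  obtain ⟨C, hC⟩ := hg.bdd
  obtain ⟨D, hD⟩ := hh.bdd
  refine ⟨fun y => (hg.cont y).mul (hh.cont y), hg.meas.mul hh.meas, C * D, fun ξ y => ?_⟩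
  rw [norm_mul]
  exact mul_le_mul (hC ξ y) (hD ξ y) (norm_nonneg _) ((norm_nonneg _).trans (hC ξ y))

lemma IsTest.sum {ι : Type*} (s : Finset ι) {g : ι → Freq d → X → ℂ} (hg : ∀ i, IsTest (g i)) :
    IsTest fun ξ y => ∑ i ∈ s, g i ξ y := by
  classical
  induction s using Finset.induction_on with
  | empty => simpa using IsTest.const 0
  | insert i s hi ih => simpa only [Finset.sum_insert hi] using (hg i).add ih

lemma isTest_planeWave (b : Freq d) (y : Lattice d) : IsTest fun (ξ : Freq d) (_ : X) => planeWave b y ξ :=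
  ⟨fun _ => continuous_planeWave b y, (continuous_planeWave b y).measurable.comp measurable_fst, _,
    fun ξ _ => (norm_planeWave b y ξ).le⟩

variable (F) in
lemma isTest_coeff (i j : Fin d) : IsTest fun (_ : Freq d) (y : X) => F.a y i j :=
  ⟨fun _ => continuous_const, (F.meas i j).comp measurable_snd, _, fun _ y => F.bound y i j⟩

variable (F) in
lemma IsTest.translate {g : Freq d → X → ℂ} (hg : IsTest g) (z : Lattice d) :
    IsTest fun ξ y => g ξ (F.τ z y) := by
  obtain ⟨C, hC⟩ := hg.bdd
  exact ⟨fun y => hg.cont _, hg.meas.comp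
    (measurable_fst.prodMk ((F.mp z).measurable.comp measurable_snd)), C, fun ξ y => hC _ _⟩

variable (F) in
lemma IsTest.grad {g : Freq d → X → ℂ} (hg : IsTest g) (b : Freq d) (j : Fin d) :
    IsTest fun ξ => F.gradFun (phase b ξ) j (g ξ) :=
  ((isTest_planeWave b (unitVec j)).mul (hg.translate F (unitVec j))).sub hg

variable (F) in
lemma IsTest.gradStar {g : Freq d → X → ℂ} (hg : IsTest g) (b : Freq d) (j : Fin d) :
    IsTest fun ξ => F.gradStarFun (phaseInv b ξ) j (g ξ) :=
  ((isTest_planeWave b (-unitVec j)).mul (hg.translate F (-unitVec j))).sub hg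

variable (F) in
lemma IsTest.flux {g : Freq d → X → ℂ} (hg : IsTest g) (b : Freq d) (i : Fin d) :
    IsTest fun ξ y => ∑ j, F.a y i j * F.gradFun (phase b ξ) j (g ξ) y :=
  IsTest.sum _ fun j => (isTest_coeff F i j).mul (hg.grad F b j)

variable (F) in
lemma IsTest.ell {g : Freq d → X → ℂ} (hg : IsTest g) (b : Freq d) :
    IsTest fun ξ => F.ellFun (phase b ξ) (phaseInv b ξ) (g ξ) :=
  IsTest.sum _ fun i => (hg.flux F b i).gradStar F b i

variable (F) in
lemma isTest_iter (b : Freq d) (η s : ℝ) (n : ℕ) :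
    IsTest fun ξ => F.iter η s (phase b ξ) (phaseInv b ξ) 1 n := by
  induction n with
  | zero => exact IsTest.const 0
  | succ n ih => exact ih.sub ((IsTest.const (s : ℂ)).mul
      ((((IsTest.const (η : ℂ)).mul ih).add (ih.ell F b)).sub (IsTest.const 1)))

variable (F) in
/-- The Fourier transform along the orbit of `x₀`. -/
noncomputable def orbitFourier (b : Freq d) (x₀ : X) (g : Freq d → X → ℂ) (x : Lattice d) : ℂ :=
  (((2 * Real.pi : ℝ) ^ d : ℂ))⁻¹ * ∫ ξ in cube d, planeWave b x ξ * g ξ (F.τ x x₀)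

lemma IsTest.integrableOn {g : Freq d → X → ℂ} (hg : IsTest g) (b : Freq d) (x : Lattice d) (y : X) :
    IntegrableOn (fun ξ => planeWave b x ξ * g ξ y) (cube d) :=
  integrableOn_cube ((continuous_planeWave b x).mul (hg.cont y))

lemma orbitFourier_sub {g h : Freq d → X → ℂ} (hg : IsTest g) (hh : IsTest h) (b : Freq d) (x₀ : X)
    (x : Lattice d) : F.orbitFourier b x₀ (fun ξ y => g ξ y - h ξ y) x =
      F.orbitFourier b x₀ g x - F.orbitFourier b x₀ h x := by
  simp only [orbitFourier]
  rw [← mul_sub, ← integral_sub (hg.integrableOn _ _ _) (hh.integrableOn _ _ _)]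
  simp only [mul_sub]

lemma orbitFourier_add {g h : Freq d → X → ℂ} (hg : IsTest g) (hh : IsTest h) (b : Freq d) (x₀ : X)
    (x : Lattice d) : F.orbitFourier b x₀ (fun ξ y => g ξ y + h ξ y) x =
      F.orbitFourier b x₀ g x + F.orbitFourier b x₀ h x := by
  simp only [orbitFourier]
  rw [← mul_add, ← integral_add (hg.integrableOn _ _ _) (hh.integrableOn _ _ _)]
  simp only [mul_add]

lemma orbitFourier_sum {ι : Type*} (s : Finset ι) {g : ι → Freq d → X → ℂ} (hg : ∀ i, IsTest (g i))
    (b : Freq d) (x₀ : X) (x : Lattice d) :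
    F.orbitFourier b x₀ (fun ξ y => ∑ i ∈ s, g i ξ y) x = ∑ i ∈ s, F.orbitFourier b x₀ (g i) x := by
  simp only [orbitFourier]
  rw [← Finset.mul_sum, ← integral_finsetSum _ fun i _ => (hg i).integrableOn _ _ _]
  simp only [Finset.mul_sum]

lemma orbitFourier_mul (c : X → ℂ) (g : Freq d → X → ℂ) (b : Freq d) (x₀ : X) (x : Lattice d) :
    F.orbitFourier b x₀ (fun ξ y => c y * g ξ y) x = c (F.τ x x₀) * F.orbitFourier b x₀ g x := by
  simp only [orbitFourier]
  rw [mul_left_comm]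
  congr 1
  rw [← integral_const_mul]
  refine integral_congr_ae (Eventually.of_forall fun ξ => ?_)
  simp only; ring

/-- Because τ_z τ_x = τ_{z+x} and plane waves are multiplicative, a twisted translation of the
environment becomes a plain translation in the lattice variable. -/
lemma orbitFourier_translate (g : Freq d → X → ℂ) (b : Freq d) (x₀ : X) (x z : Lattice d) :
    F.orbitFourier b x₀ (fun ξ y => planeWave b z ξ * g ξ (F.τ z y)) x =
      F.orbitFourier b x₀ g (z + x) := by
  simp only [orbitFourier]
  congr 1
  refine integral_congr_ae (Eventually.of_forall fun ξ => ?_)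
  simp only [F.τ_add, planeWave_add]
  ring

lemma orbitFourier_grad {g : Freq d → X → ℂ} (hg : IsTest g) (b : Freq d) (x₀ : X) (j : Fin d) :
    F.orbitFourier b x₀ (fun ξ => F.gradFun (phase b ξ) j (g ξ)) =
      (F.orbit x₀).gradFun 1 j (F.orbitFourier b x₀ g) := by
  funext x
  have := orbitFourier_sub (F := F)
    ((isTest_planeWave b (unitVec j)).mul (hg.translate F (unitVec j))) hg b x₀ x
  rw [orbitFourier_translate] at this
  simp only [gradFun, Pi.one_apply, one_mul]
  exact this

lemma orbitFourier_gradStar {g : Freq d → X → ℂ} (hg : IsTest g) (b : Freq d) (x₀ : X) (j : Fin d) :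
    F.orbitFourier b x₀ (fun ξ => F.gradStarFun (phaseInv b ξ) j (g ξ)) =
      (F.orbit x₀).gradStarFun 1 j (F.orbitFourier b x₀ g) := by
  funext x
  have := orbitFourier_sub (F := F)
    ((isTest_planeWave b (-unitVec j)).mul (hg.translate F (-unitVec j))) hg b x₀ x
  rw [orbitFourier_translate] at this
  simp only [gradStarFun, Pi.one_apply, one_mul]
  exact this

/-- For every b the transform intertwines the twisted operator on Ω with the untwisted operator
along the orbit; the dependence on ξ and b disappears. -/
lemma orbitFourier_ell {g : Freq d → X → ℂ} (hg : IsTest g) (b : Freq d) (x₀ : X) :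
    F.orbitFourier b x₀ (fun ξ => F.ellFun (phase b ξ) (phaseInv b ξ) (g ξ)) =
      (F.orbit x₀).ellFun 1 1 (F.orbitFourier b x₀ g) := by
  funext x
  refine (orbitFourier_sum (F := F) Finset.univ
    (fun i => (hg.flux F b i).gradStar F b i) b x₀ x).trans ?_
  rw [ellFun]
  refine Finset.sum_congr rfl fun i _ => ?_
  rw [orbitFourier_gradStar (hg.flux F b i)]
  congr 1
  funext z
  refine (orbitFourier_sum (F := F) Finset.univ
    (fun j => (isTest_coeff F i j).mul (hg.grad F b j)) b x₀ z).trans ?_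
  refine Finset.sum_congr rfl fun j _ => ?_
  rw [orbitFourier_mul (fun y => F.a y i j), orbitFourier_grad hg]
  rfl

/-- By orthogonality only x = 0 survives, and there the factor e^{x·b} equals one. The source term
thus does not see b, which replaces a deformation of contours. -/
lemma orbitFourier_one (b : Freq d) (x₀ : X) (x : Lattice d) :
    F.orbitFourier b x₀ (fun _ _ => 1) x = Set.indicator {0} (fun _ => (1:ℂ)) x := by
  have hpi : (((2 * Real.pi : ℝ) ^ d : ℂ)) ≠ 0 := by
    have := Real.pi_pos
    exact pow_ne_zero _ (by exact_mod_cast (by positivity : (2 * Real.pi) ≠ 0))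
  have h : ∀ ξ, planeWave b x ξ * 1 =
      Complex.exp ((inner ℝ (latVec x) b : ℝ) : ℂ) * character x ξ := fun ξ => by
    rw [mul_one, planeWave_eq]
  simp only [orbitFourier, h]
  rw [integral_const_mul, setIntegral_character]
  by_cases hx : x = 0
  · subst hx
    have : inner ℝ (latVec (0 : Lattice d)) b = 0 := by rw [inner_latVec]; simp
    rw [if_pos rfl, this, Set.indicator_of_mem (Set.mem_singleton _)]
    simp only [Complex.ofReal_zero, Complex.exp_zero, one_mul]
    exact inv_mul_cancel₀ hpi
  · rw [if_neg hx, Set.indicator_of_notMem (by simpa using hx)]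
    simp

/-- The Fourier transform of the Richardson iterates. -/
theorem orbitFourier_iter (b : Freq d) (x₀ : X) (η s : ℝ) (n : ℕ) :
    F.orbitFourier b x₀ (fun ξ => F.iter η s (phase b ξ) (phaseInv b ξ) 1 n) =
      (F.orbit x₀).iter η s 1 1 (Set.indicator {0} fun _ => 1) n := by
  induction n with
  | zero => funext x; simp [orbitFourier, iter]
  | succ n ih =>
    funext x
    have hv := isTest_iter F b η s n
    have h1 := ((IsTest.const (X := X) (d := d) (η : ℂ)).mul hv).add (hv.ell F b)
    have h2 := h1.sub (IsTest.const 1)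
    have e := orbitFourier_sub (F := F) hv ((IsTest.const (s : ℂ)).mul h2) b x₀ x
    rw [orbitFourier_mul (fun _ => (s : ℂ)), orbitFourier_sub h1 (IsTest.const 1),
      orbitFourier_add ((IsTest.const (η : ℂ)).mul hv) (hv.ell F b),
      orbitFourier_mul (fun _ => (η : ℂ)), orbitFourier_ell hv, orbitFourier_one, ih] at e
    exact e

/-- Averages of the lattice iterates are Fourier integrals of the means of the iterates. -/
theorem integral_orbit_iter [IsProbabilityMeasure μ] (b : Freq d) (η s : ℝ) (n : ℕ) (x : Lattice d) :
    ∫ x₀, (F.orbit x₀).iter η s 1 1 (Set.indicator {0} fun _ => 1) n x ∂μ =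
      (((2 * Real.pi : ℝ) ^ d : ℂ))⁻¹ * ∫ ξ in cube d, planeWave b x ξ *
        ∫ x₀, F.iter η s (phase b ξ) (phaseInv b ξ) 1 n x₀ ∂μ := by
  have hv := isTest_iter F b η s n
  have hg := (isTest_planeWave (X := X) b x).mul (hv.translate F x)
  obtain ⟨C, hC⟩ := hg.bdd
  have hint : Integrable (Function.uncurry fun (x₀ : X) (ξ : Freq d) =>
      planeWave b x ξ * F.iter η s (phase b ξ) (phaseInv b ξ) 1 n (F.τ x x₀))
      (μ.prod (volume.restrict (cube d))) :=
    Integrable.of_bound (hg.meas.comp measurable_swap).aestronglyMeasurable C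
      (Eventually.of_forall fun p => hC p.2 p.1)
  simp only [← orbitFourier_iter b]
  simp only [orbitFourier]
  rw [integral_const_mul, integral_integral_swap hint]
  congr 1
  refine integral_congr_ae (Eventually.of_forall fun ξ => ?_)
  simp only
  rw [integral_const_mul]
  congr 1
  have hm : AEStronglyMeasurable (F.iter η s (phase b ξ) (phaseInv b ξ) 1 n) (μ.map (F.τ x)) :=
    (hv.meas.comp (measurable_const.prodMk measurable_id)).aestronglyMeasurable
  -- Invariance of the measure removes the translation τ_x from the mean.
  have := integral_map (F.mp x).measurable.aemeasurable hm
  rw [(F.mp x).map_eq] at this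
  exact this.symm

end StationaryField

/-! ### Point masses in the ℓ² space of the lattice. -/

section Count

variable {d : ℕ}

/-- The unit mass at a lattice point as an element of `ℓ²`. -/
noncomputable def latDelta (x : Lattice d) : Lp ℂ 2 (Measure.count : Measure (Lattice d)) :=
  indicatorConstLp 2 (measurableSet_singleton x) (by simp) 1

lemma ae_count_iff {p : Lattice d → Prop} :
    (∀ᵐ x ∂(Measure.count : Measure (Lattice d)), p x) ↔ ∀ x, p x := by
  rw [ae_iff, Measure.count_eq_zero_iff, Set.eq_empty_iff_forall_notMem]
  simp

lemma latDelta_coe (x : Lattice d) : (latDelta x : Lattice d → ℂ) = Set.indicator {x} fun _ => 1 :=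
  funext (ae_count_iff.1 indicatorConstLp_coeFn)

lemma inner_latDelta (x : Lattice d) (f : Lp ℂ 2 (Measure.count : Measure (Lattice d))) :
    inner ℂ (latDelta x) f = f x := by
  rw [latDelta, L2.inner_indicatorConstLp_one]; simp

lemma norm_latDelta (x : Lattice d) : ‖latDelta x‖ = 1 := by
  rw [latDelta, norm_indicatorConstLp (by norm_num) (by norm_num)]; simp

end Count

/-! ### The solution operator and convergence of matrix elements of the iterates. -/

namespace Medium

variable {d : ℕ} {H : Type*} [NormedAddCommGroup H] [InnerProductSpace ℂ H] [CompleteSpace H]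
  (m : Medium d H) {β η : ℝ} {w w' : Fin d → ℂ}

/-- The solution of `η v + ∂^* A ∂ v = f`. -/
noncomputable def solve (η : ℝ) (w w' : Fin d → ℂ) (f : H) : H := Ring.inverse (m.fullOp η w w') f

lemma fullOp_solve (hw : NearUnitary β w w') (hβ0 : 0 ≤ β) (hβ1 : β ≤ 1) (hη : 0 < η)
    (hβ : 4 * m.M ^ 2 * d ^ 3 * β ^ 2 ≤ m.lam * η) (f : H) :
    m.fullOp η w w' (m.solve η w w' f) = f := by
  have hu : IsUnit (m.fullOp η w w') := isUnit_of_coercive (half_pos hη) (m.half_le_opBound hη)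
    (m.le_re_inner_fullOp hw hβ0 hβ) (m.norm_fullOp_le hw hβ1 hη)
  rw [solve, ← mul_apply_eq_comp, Ring.mul_inverse_cancel _ hu, one_apply_eq_self]

lemma norm_solve_le (hw : NearUnitary β w w') (hβ0 : 0 ≤ β) (hβ1 : β ≤ 1) (hη : 0 < η)
    (hβ : 4 * m.M ^ 2 * d ^ 3 * β ^ 2 ≤ m.lam * η) (f : H) :
    ‖m.solve η w w' f‖ ≤ (η / 2)⁻¹ * ‖f‖ := by
  have := norm_le_of_coercive (half_pos hη) (m.le_re_inner_fullOp hw hβ0 hβ) (m.solve η w w' f)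
  rwa [m.fullOp_solve hw hβ0 hβ1 hη hβ] at this

/-- The step of the Richardson iteration. -/
noncomputable def step (η : ℝ) : ℝ := η / 2 / m.opBound η ^ 2

/-- The rate involves only η, d and M, so the error is uniform in the frequency and in the
environment. This is what makes dominated convergence possible on both sides of the Fourier
identity. -/
lemma norm_inner_richardson_sub_le (hw : NearUnitary β w w') (hβ0 : 0 ≤ β) (hβ1 : β ≤ 1) (hη : 0 < η)
    (hβ : 4 * m.M ^ 2 * d ^ 3 * β ^ 2 ≤ m.lam * η) {f g : H} (hf : ‖f‖ = 1) (hg : ‖g‖ = 1) (n : ℕ) :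
    ‖inner ℂ g (richardson (m.fullOp η w w') (m.step η) f n) - inner ℂ g (m.solve η w w' f)‖ ≤
      richardsonRate (η / 2) (m.opBound η) ^ n * (η / 2)⁻¹ := by
  have h1 := norm_richardson_sub_le (half_pos hη) (m.half_le_opBound hη)
    (m.le_re_inner_fullOp hw hβ0 hβ) (m.norm_fullOp_le hw hβ1 hη) (m.solve η w w' f) n
  rw [m.fullOp_solve hw hβ0 hβ1 hη hβ] at h1
  have h2 := m.norm_solve_le hw hβ0 hβ1 hη hβ f
  rw [hf, mul_one] at h2
  have hr := richardsonRate_nonneg (η / 2) (m.opBound η)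
  rw [← inner_sub_right]
  refine (norm_inner_le_norm _ _).trans ?_
  rw [hg, one_mul]
  exact h1.trans (by gcongr)

lemma norm_inner_richardson_le (hw : NearUnitary β w w') (hβ0 : 0 ≤ β) (hβ1 : β ≤ 1) (hη : 0 < η)
    (hβ : 4 * m.M ^ 2 * d ^ 3 * β ^ 2 ≤ m.lam * η) {f g : H} (hf : ‖f‖ = 1) (hg : ‖g‖ = 1) (n : ℕ) :
    ‖inner ℂ g (richardson (m.fullOp η w w') (m.step η) f n)‖ ≤ 2 * (η / 2)⁻¹ := by
  have h1 := m.norm_inner_richardson_sub_le hw hβ0 hβ1 hη hβ hf hg n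
  have h2 := m.norm_solve_le hw hβ0 hβ1 hη hβ f
  have h3 := norm_inner_le_norm (𝕜 := ℂ) g (m.solve η w w' f)
  rw [hf, mul_one] at h2
  rw [hg, one_mul] at h3
  have h4 : richardsonRate (η / 2) (m.opBound η) ^ n * (η / 2)⁻¹ ≤ 1 * (η / 2)⁻¹ := by
    gcongr
    exact pow_le_one₀ (richardsonRate_nonneg _ _)
      (richardsonRate_lt_one (half_pos hη) (m.half_le_opBound hη)).le
  have h5 := norm_add_le (inner ℂ g (richardson (m.fullOp η w w') (m.step η) f n) -
    inner ℂ g (m.solve η w w' f)) (inner ℂ g (m.solve η w w' f))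
  rw [sub_add_cancel] at h5
  linarith

lemma tendsto_inner_richardson (hw : NearUnitary β w w') (hβ0 : 0 ≤ β) (hβ1 : β ≤ 1) (hη : 0 < η)
    (hβ : 4 * m.M ^ 2 * d ^ 3 * β ^ 2 ≤ m.lam * η) {f g : H} (hf : ‖f‖ = 1) (hg : ‖g‖ = 1) :
    Tendsto (fun n => inner ℂ g (richardson (m.fullOp η w w') (m.step η) f n)) atTop
      (𝓝 (inner ℂ g (m.solve η w w' f))) := by
  rw [tendsto_iff_norm_sub_tendsto_zero]
  refine squeeze_zero (fun _ => norm_nonneg _)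
    (m.norm_inner_richardson_sub_le hw hβ0 hβ1 hη hβ hf hg) ?_
  simpa using (tendsto_pow_atTop_nhds_zero_of_lt_one (richardsonRate_nonneg _ _)
    (richardsonRate_lt_one (half_pos hη) (m.half_le_opBound hη))).mul_const (η / 2)⁻¹

end Medium

/-! ### Passage to the limit in the Fourier representation. -/

namespace StationaryField

variable {d : ℕ} {X : Type*} [MeasurableSpace X] {μ : Measure X} (F : StationaryField d X μ)

/-- The Green's function along the orbit of `x₀`. -/
noncomputable def green (η : ℝ) (x₀ : X) : Lp ℂ 2 (Measure.count : Measure (Lattice d)) :=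
  (F.orbit x₀).medium.solve η 1 1 (latDelta 0)

variable [IsProbabilityMeasure μ]

/-- The constant function `1` in `L²`. -/
noncomputable def unit (μ : Measure X) [IsProbabilityMeasure μ] : Lp ℂ 2 μ :=
  indicatorConstLp 2 MeasurableSet.univ (by simp) 1

lemma coeFn_unit (μ : Measure X) [IsProbabilityMeasure μ] : unit μ =ᵐ[μ] 1 := by
  filter_upwards [indicatorConstLp_coeFn (p := 2) (μ := μ) (s := Set.univ)
    (hs := MeasurableSet.univ) (hμs := by simp) (c := (1:ℂ))] with x hx
  rw [unit, hx]; simp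

lemma norm_unit : ‖unit μ‖ = 1 := by
  rw [unit, norm_indicatorConstLp (by norm_num) (by norm_num)]; simp

lemma inner_unit {ψ : Lp ℂ 2 μ} {f : X → ℂ} (h : ψ =ᵐ[μ] f) : inner ℂ (unit μ) ψ = ∫ x, f x ∂μ := by
  rw [unit, L2.inner_indicatorConstLp_one, Measure.restrict_univ]
  exact integral_congr_ae h

lemma T_unit (j : Fin d) : F.medium.T j (unit μ) = unit μ := by
  ext1
  filter_upwards [coeFn_T (F := F) (coeFn_unit μ) j, coeFn_unit μ] with x h1 h2
  rw [h1, h2]; rfl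

/-- The homogenized matrix at frequency `ξ + i b`. -/
noncomputable def hom (η : ℝ) (b ξ : Freq d) : Matrix (Fin d) (Fin d) ℂ :=
  F.medium.homMat (unit μ) η (phase b ξ) (phaseInv b ξ)

/-- Smallness of the imaginary part of the frequency. -/
def Small (η : ℝ) (b : Freq d) : Prop :=
  2 * ‖b‖ ≤ 1 ∧ 4 * F.M ^ 2 * d ^ 3 * (2 * ‖b‖) ^ 2 ≤ F.lam * η

/-- The Fourier representation of the averaged Green's function. -/
theorem integral_green {η : ℝ} (hη : 0 < η) {b : Freq d} (hb : F.Small η b) (x : Lattice d) :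
    ∫ x₀, (F.green η x₀ : Lattice d → ℂ) x ∂μ = (((2 * Real.pi : ℝ) ^ d : ℂ))⁻¹ *
      ∫ ξ in cube d, planeWave b x ξ *
        (η + ∑ k, ∑ k', (phaseInv b ξ k - 1) * (F.hom η b ξ k k' * (phase b ξ k' - 1)))⁻¹ := by
  have hb0 : 0 ≤ 2 * ‖b‖ := by positivity
  have hw := fun ξ => nearUnitary_phase (b := b) (by linarith [hb.1, norm_nonneg b]) ξ
  -- The step depends only on η, d and M, which every orbit field shares with F, so one iteration
  -- serves both sides.
  set s := F.medium.step η with hs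
  set I : ℕ → Freq d → ℂ := fun n ξ => ∫ x₀, F.iter η s (phase b ξ) (phaseInv b ξ) 1 n x₀ ∂μ with hI
  have hI' : ∀ n ξ, I n ξ = inner ℂ (unit μ)
      (richardson (F.medium.fullOp η (phase b ξ) (phaseInv b ξ)) s (unit μ) n) := fun n ξ =>
    (inner_unit (coeFn_richardson η s _ _ (coeFn_unit μ) n)).symm
  have hIm : ∀ n, Measurable (I n) := fun n =>
    ((isTest_iter F b η s n).meas.stronglyMeasurable.integral_prod_right').measurable
  have hlim : ∀ ξ, Tendsto (fun n => I n ξ) atTop (𝓝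
      (η + ∑ k, ∑ k', (phaseInv b ξ k - 1) * (F.hom η b ξ k k' * (phase b ξ k' - 1)))⁻¹) := by
    intro ξ
    have h1 := F.medium.tendsto_inner_richardson (hw ξ) hb0 hb.1 hη hb.2 (norm_unit (μ := μ))
      (norm_unit (μ := μ))
    have h2 := F.medium.inner_mul_symbol_eq_one (norm_unit (μ := μ)) F.T_unit (hw ξ) hb0 hb.1 hη hb.2
      (F.medium.fullOp_solve (hw ξ) hb0 hb.1 hη hb.2 (unit μ))
    rw [eq_inv_of_mul_eq_one_left h2] at h1
    simp only [hI']
    exact h1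
  -- On the frequency side the iterates are dominated by a constant times e^{x·b}, and converge
  -- pointwise to the inverse symbol.
  have hR : Tendsto (fun n => ∫ ξ in cube d, planeWave b x ξ * I n ξ) atTop (𝓝
      (∫ ξ in cube d, planeWave b x ξ *
        (η + ∑ k, ∑ k', (phaseInv b ξ k - 1) * (F.hom η b ξ k k' * (phase b ξ k' - 1)))⁻¹)) := by
    refine tendsto_integral_of_dominated_convergence
      (fun _ => Real.exp (inner ℝ (latVec x) b) * (2 * (η / 2)⁻¹))
      (fun n => ((continuous_planeWave b x).measurable.mul (hIm n)).aestronglyMeasurable)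
      (integrable_const _) (fun n => Eventually.of_forall fun ξ => ?_)
      (Eventually.of_forall fun ξ => (hlim ξ).const_mul _)
    rw [norm_mul, norm_planeWave, hI']
    gcongr
    exact F.medium.norm_inner_richardson_le (hw ξ) hb0 hb.1 hη hb.2 norm_unit norm_unit n
  -- The operator on the lattice is untwisted, so its coercivity is the case β = 0.
  have hsmall : 4 * F.M ^ 2 * d ^ 3 * (0:ℝ) ^ 2 ≤ F.lam * η := by
    have := F.lam_pos
    simp only [ne_eq, OfNat.ofNat_ne_zero, not_false_eq_true, zero_pow, mul_zero]; positivity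
  have hU : ∀ x₀ n, (F.orbit x₀).iter η s 1 1 (Set.indicator {0} fun _ => 1) n x = inner ℂ (latDelta x)
      (richardson ((F.orbit x₀).medium.fullOp η 1 1) s (latDelta 0) n) := by
    intro x₀ n
    rw [inner_latDelta]
    have h0 : (latDelta (0 : Lattice d)) =ᵐ[Measure.count] Set.indicator {0} fun _ => (1:ℂ) :=
      Eventually.of_forall fun z => congrFun (latDelta_coe 0) z
    exact (ae_count_iff.1 (coeFn_richardson (F := F.orbit x₀) η s 1 1 h0 n) x).symm
  have hUm : ∀ n, Measurable fun x₀ => (F.orbit x₀).iter η s 1 1 (Set.indicator {0} fun _ => 1) n x := by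
    intro n
    simp only [← orbitFourier_iter b]
    simp only [orbitFourier]
    have hg := (isTest_planeWave (X := X) b x).mul ((isTest_iter F b η s n).translate F x)
    exact measurable_const.mul
      ((hg.meas.comp measurable_swap).stronglyMeasurable.integral_prod_right').measurable
  have hL : Tendsto (fun n => ∫ x₀, (F.orbit x₀).iter η s 1 1 (Set.indicator {0} fun _ => 1) n x ∂μ)
      atTop (𝓝 (∫ x₀, (F.green η x₀ : Lattice d → ℂ) x ∂μ)) := by
    refine tendsto_integral_of_dominated_convergence (fun _ => 2 * (η / 2)⁻¹)
      (fun n => (hUm n).aestronglyMeasurable) (integrable_const _)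
      (fun n => Eventually.of_forall fun x₀ => ?_) (Eventually.of_forall fun x₀ => ?_)
    · rw [hU]
      exact (F.orbit x₀).medium.norm_inner_richardson_le nearUnitary_one le_rfl zero_le_one hη hsmall
        (norm_latDelta 0) (norm_latDelta x) n
    · simp only [hU]
      rw [green, ← inner_latDelta]
      exact (F.orbit x₀).medium.tendsto_inner_richardson nearUnitary_one le_rfl zero_le_one hη hsmall
        (norm_latDelta 0) (norm_latDelta x)
  refine tendsto_nhds_unique hL ?_
  simp only [integral_orbit_iter b]
  exact hR.const_mul _

end StationaryField

/-! ### Random environments as stationary fields -/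

namespace Medium

lemma eq_solve {d : ℕ} {H : Type*} [NormedAddCommGroup H] [InnerProductSpace ℂ H] [CompleteSpace H]
    (m : Medium d H) {β η : ℝ} {w w' : Fin d → ℂ} (hw : NearUnitary β w w') (hβ0 : 0 ≤ β) (hβ1 : β ≤ 1)
    (hη : 0 < η) (hβ : 4 * m.M ^ 2 * d ^ 3 * β ^ 2 ≤ m.lam * η) {v f : H} (h : m.fullOp η w w' v = f) :
    v = m.solve η w w' f := by
  have h1 := norm_le_of_coercive (half_pos hη) (m.le_re_inner_fullOp hw hβ0 hβ) (v - m.solve η w w' f)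
  rw [map_sub, h, m.fullOp_solve hw hβ0 hβ1 hη hβ, sub_self, norm_zero, mul_zero] at h1
  exact sub_eq_zero.1 (norm_le_zero_iff.1 h1)

end Medium

namespace StationaryField

variable {d : ℕ} {X : Type*} [MeasurableSpace X] {μ : Measure X} [IsProbabilityMeasure μ]
  (F : StationaryField d X μ)

lemma coeFn_centered {ψ : Lp ℂ 2 μ} {f : X → ℂ} (h : ψ =ᵐ[μ] f) :
    Medium.centered (unit μ) ψ =ᵐ[μ] fun x => f x - ∫ y, f y ∂μ := by
  rw [Medium.centered_apply, inner_unit h]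
  filter_upwards [Lp.coeFn_sub ψ ((∫ y, f y ∂μ) • unit μ), Lp.coeFn_smul (∫ y, f y ∂μ) (unit μ),
    coeFn_unit μ, h] with x h1 h2 h3 h4
  rw [h1, Pi.sub_apply, h2, Pi.smul_apply, h3, h4]
  simp

variable {F}

lemma coeFn_A_unit (i j : Fin d) : F.medium.A i j (unit μ) =ᵐ[μ] fun x => F.a x i j := by
  filter_upwards [coeFn_A (F := F) (coeFn_unit μ) i j] with x hx
  rw [hx, Pi.one_apply, mul_one]

lemma coeFn_corrRhs (w' : Fin d → ℂ) (k : Fin d) :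
    F.medium.corrRhs (unit μ) w' k =ᵐ[μ] fun x =>
      -((∑ i, F.gradStarFun w' i (fun y => F.a y i k) x) -
        ∫ y, ∑ i, F.gradStarFun w' i (fun y => F.a y i k) y ∂μ) := by
  rw [Medium.corrRhs]
  filter_upwards [Lp.coeFn_neg (Medium.centered (unit μ)
      (∑ i, F.medium.gradStar w' i (F.medium.A i k (unit μ)))),
    coeFn_centered (coeFn_sum Finset.univ fun i _ => coeFn_gradStar (coeFn_A_unit (F := F) i k) w' i)]
    with x h1 h2
  rw [h1, Pi.neg_apply, h2]

/-- The corrector equation pointwise and in `L²`. -/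
lemma corr_eq_iff {η : ℝ} {w w' : Fin d → ℂ} {k : Fin d} {ψ : Lp ℂ 2 μ} {f : X → ℂ} (h : ψ =ᵐ[μ] f) :
    (η : ℂ) • ψ + Medium.centered (unit μ) (F.medium.ellOp w w' ψ) = F.medium.corrRhs (unit μ) w' k ↔
    ∀ᵐ x ∂μ, (η : ℂ) * f x + (F.ellFun w w' f x - ∫ y, F.ellFun w w' f y ∂μ) =
      -((∑ i, F.gradStarFun w' i (fun y => F.a y i k) x) -
        ∫ y, ∑ i, F.gradStarFun w' i (fun y => F.a y i k) y ∂μ) := by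
  have h1 : ((η : ℂ) • ψ + Medium.centered (unit μ) (F.medium.ellOp w w' ψ) : Lp ℂ 2 μ) =ᵐ[μ]
      fun x => (η : ℂ) * f x + (F.ellFun w w' f x - ∫ y, F.ellFun w w' f y ∂μ) := by
    filter_upwards [Lp.coeFn_add ((η : ℂ) • ψ) (Medium.centered (unit μ) (F.medium.ellOp w w' ψ)),
      Lp.coeFn_smul (η : ℂ) ψ, h, coeFn_centered (coeFn_ellOp (F := F) h w w')] with x h1 h2 h3 h4
    rw [h1, Pi.add_apply, h2, Pi.smul_apply, h3, h4, smul_eq_mul]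
  have h2 := coeFn_corrRhs (F := F) w' k
  rw [Lp.ext_iff]
  constructor
  · intro h3
    filter_upwards [h1, h2, h3] with x e1 e2 e3
    rw [← e1, ← e2, e3]
  · intro h3
    filter_upwards [h1, h2, h3] with x e1 e2 e3
    rw [e1, e2, e3]

lemma hom_eq_integral {η : ℝ} {b ξ : Freq d} {k k' : Fin d} {f : X → ℂ}
    (h : F.medium.corrVec (unit μ) η (phase b ξ) (phaseInv b ξ) k' =ᵐ[μ] f) :
    F.hom η b ξ k k' = (∫ x, F.a x k k' ∂μ) +
      ∫ x, ∑ j, F.a x k j * F.gradFun (phase b ξ) j f x ∂μ := by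
  rw [hom, Medium.homMat, inner_add_right, inner_unit (coeFn_A_unit (F := F) k k'),
    inner_unit (coeFn_sum Finset.univ fun j _ => coeFn_A (F := F) (coeFn_grad h (phase b ξ) j) k j)]

end StationaryField

namespace Environment

variable {d : ℕ} (E : Environment.{u} d)

lemma nonempty_Ω : Nonempty E.Ω := by
  by_contra h
  have : IsEmpty E.Ω := not_nonempty_iff.1 h
  have h1 := measure_univ (μ := E.P)
  rw [Set.eq_empty_of_isEmpty (Set.univ : Set E.Ω), measure_empty] at h1
  exact zero_ne_one h1

lemma quadForm_single (ω : E.Ω) (i : Fin d) :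
    (Pi.single i 1 : Fin d → ℝ) ⬝ᵥ (E.a ω *ᵥ Pi.single i 1) = E.a ω i i := by
  simp

lemma lam_le_Lam (hd : 0 < d) : E.lam ≤ E.Lam := by
  obtain ⟨ω⟩ := E.nonempty_Ω
  have h1 := E.a_lower ω (Pi.single ⟨0, hd⟩ 1)
  have h2 := E.a_upper ω (Pi.single ⟨0, hd⟩ 1)
  simp only [single_dotProduct, Pi.single_eq_same, mul_one] at h1 h2
  linarith

/-- Off the diagonal, test the form with e_i + e_j and e_i - e_j. The two values lie in [2λ, 2Λ] and
differ by 4a_ij. -/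
lemma abs_a_le (ω : E.Ω) (i j : Fin d) : |E.a ω i j| ≤ E.Lam := by
  have hl := E.lam_pos
  have hL := E.Lam_pos
  by_cases hij : i = j
  · subst hij
    have h1 := E.a_lower ω (Pi.single i 1)
    have h2 := E.a_upper ω (Pi.single i 1)
    rw [quadForm_single] at h1 h2
    simp only [single_dotProduct, Pi.single_eq_same, mul_one] at h1 h2
    rw [abs_le]; constructor <;> linarith
  · have hs : E.a ω j i = E.a ω i j := (E.a_symm ω).apply i j
    have key : ∀ t : ℝ, (Pi.single i 1 + t • Pi.single j 1 : Fin d → ℝ) ⬝ᵥ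
        (E.a ω *ᵥ (Pi.single i 1 + t • Pi.single j 1)) =
        E.a ω i i + 2 * t * E.a ω i j + t ^ 2 * E.a ω j j := by
      intro t
      simp only [Matrix.mulVec_add, Matrix.mulVec_smul, dotProduct_add, add_dotProduct, smul_dotProduct,
        dotProduct_smul, single_dotProduct, Matrix.mulVec_single_one, Matrix.col_apply, smul_eq_mul, hs]
      ring
    have key2 : ∀ t : ℝ, (Pi.single i 1 + t • Pi.single j 1 : Fin d → ℝ) ⬝ᵥ
        (Pi.single i 1 + t • Pi.single j 1) = 1 + t ^ 2 := by
      intro t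
      have hji : j ≠ i := fun h => hij h.symm
      simp [hij, hji]
      ring
    have h1 := E.a_lower ω (Pi.single i 1 + (1:ℝ) • Pi.single j 1)
    have h2 := E.a_upper ω (Pi.single i 1 + (1:ℝ) • Pi.single j 1)
    have h3 := E.a_lower ω (Pi.single i 1 + (-1:ℝ) • Pi.single j 1)
    have h4 := E.a_upper ω (Pi.single i 1 + (-1:ℝ) • Pi.single j 1)
    rw [key, key2] at h1 h2 h3 h4
    rw [abs_le]; constructor <;> linarith

/-- An environment as a stationary field. -/
def field (hd : 0 < d) : StationaryField d E.Ω E.P where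
  τ := E.τ
  mp := E.τ_measurePreserving
  τ_zero := E.τ_zero
  τ_add := E.τ_add
  a ω i j := (E.a ω i j : ℂ)
  meas i j := Complex.measurable_ofReal.comp (E.a_measurable i j)
  lam := E.lam
  M := E.Lam
  lam_pos := E.lam_pos
  lam_le := E.lam_le_Lam hd
  bound ω i j := by
    rw [Complex.norm_real, Real.norm_eq_abs]; exact E.abs_a_le ω i j
  elliptic ω v := by
    have h1 := E.a_lower ω fun j => (v j).re
    have h2 := E.a_lower ω fun j => (v j).im
    have e : (∑ i, ∑ j, starRingEnd ℂ (v i) * ((E.a ω i j : ℂ) * v j)).re =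
        (fun j => (v j).re) ⬝ᵥ (E.a ω *ᵥ fun j => (v j).re) +
        (fun j => (v j).im) ⬝ᵥ (E.a ω *ᵥ fun j => (v j).im) := by
      simp only [Complex.re_sum, dotProduct, Matrix.mulVec, Finset.mul_sum]
      rw [← Finset.sum_add_distrib]
      refine Finset.sum_congr rfl fun i _ => ?_
      rw [← Finset.sum_add_distrib]
      refine Finset.sum_congr rfl fun j _ => ?_
      simp
    have e2 : ∑ j, ‖v j‖ ^ 2 = (fun j => (v j).re) ⬝ᵥ (fun j => (v j).re) +
        (fun j => (v j).im) ⬝ᵥ (fun j => (v j).im) := by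
      simp only [dotProduct]
      rw [← Finset.sum_add_distrib]
      refine Finset.sum_congr rfl fun j _ => ?_
      rw [Complex.sq_norm, Complex.normSq_apply]
    rw [e, e2, mul_add]
    exact add_le_add h1 h2

variable (hd : 0 < d)

lemma xiDeriv_eq (b ξ : Freq d) (j : Fin d) (φ : E.Ω → ℂ) :
    E.xiDeriv (cplx ξ b) j φ = (E.field hd).gradFun (phase b ξ) j φ := by
  funext ω
  rw [xiDeriv, StationaryField.gradFun, phase, planeWave_unitVec]
  rfl

lemma xiDerivStar_eq (b ξ : Freq d) (j : Fin d) (φ : E.Ω → ℂ) :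
    E.xiDerivStar (cplx ξ b) j φ = (E.field hd).gradStarFun (phaseInv b ξ) j φ := by
  funext ω
  rw [xiDerivStar, StationaryField.gradStarFun, phaseInv, planeWave_neg_unitVec]
  rfl

lemma isCorrector_iff {b ξ : Freq d} {η : ℝ} {k : Fin d} {ψ : Lp ℂ 2 E.P} {f : E.Ω → ℂ}
    (h : ψ =ᵐ[E.P] f) : E.IsCorrector (cplx ξ b) η k f ↔
      (η : ℂ) • ψ + Medium.centered (StationaryField.unit E.P)
        ((E.field hd).medium.ellOp (phase b ξ) (phaseInv b ξ) ψ) =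
      (E.field hd).medium.corrRhs (StationaryField.unit E.P) (phaseInv b ξ) k := by
  rw [StationaryField.corr_eq_iff h, IsCorrector,
    and_iff_right ((memLp_congr_ae h).1 (Lp.memLp ψ))]
  simp only [xiDerivStar_eq E hd, xiDeriv_eq E hd, proj]
  rfl

/-- The Fourier multiplier of an environment in terms of its stationary field. -/
theorem q_eq_hom {η : ℝ} (hη : 0 < η) {b : Freq d} (hb : (E.field hd).Small η b) (ξ : Freq d) :
    E.q (cplx ξ b) η = (E.field hd).hom η b ξ := by
  set F := E.field hd
  set e := StationaryField.unit E.P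
  have he : ‖e‖ = 1 := StationaryField.norm_unit
  have hb0 : 0 ≤ 2 * ‖b‖ := by positivity
  have hw := nearUnitary_phase (b := b) (by linarith [hb.1, norm_nonneg b]) ξ
  have hu := F.medium.isUnit_corrOp he hw hb0 hb.1 hη hb.2
  funext k k'
  have hsol := (F.medium.corrVec_eq he hη hu k').2
  have hex : ∃ φ, E.IsCorrector (cplx ξ b) η k' φ :=
    ⟨_, (E.isCorrector_iff hd (EventuallyEq.refl _ _)).2 hsol⟩
  have hcorr : E.IsCorrector (cplx ξ b) η k' (E.corrector (cplx ξ b) η k') := by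
    rw [corrector, dif_pos hex]; exact hex.choose_spec
  set φ := E.corrector (cplx ξ b) η k'
  have hφ : hcorr.1.toLp φ =ᵐ[E.P] φ := hcorr.1.coeFn_toLp
  have h1 := (E.isCorrector_iff hd hφ).1 hcorr
  -- The corrector in the definition of q is an arbitrary choice; uniqueness identifies it in L²
  -- with the one given by operator inversion.
  have h2 := F.medium.corr_unique he hw hb0 hη hb.2 (h1.trans hsol.symm)
  rw [h2] at hφ
  rw [StationaryField.hom_eq_integral (F := F) hφ, q]
  simp only [xiDeriv_eq E hd]
  rfl

/-- The coefficients are real, so the real part of the Hilbert space solution solves the lattice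
equation; hence a solution exists to be chosen. The chosen one is square summable, and uniqueness in
ℓ² identifies the two. -/
lemma latticeGreen_eq {η : ℝ} (hη : 0 < η) (ω : E.Ω) (x : Lattice d) :
    (latticeGreen (fun y => E.a (E.τ y ω)) η x : ℂ) = ((E.field hd).green η ω : Lattice d → ℂ) x := by
  set F := E.field hd
  set m := (F.orbit ω).medium
  have hsmall : 4 * m.M ^ 2 * d ^ 3 * (0:ℝ) ^ 2 ≤ m.lam * η := by
    have := m.lam_pos
    simp only [ne_eq, OfNat.ofNat_ne_zero, not_false_eq_true, zero_pow, mul_zero]; positivity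
  have hpt : ∀ (v : Lp ℂ 2 (Measure.count : Measure (Lattice d))) (x : Lattice d),
      m.fullOp η 1 1 v x = η * v x + (F.orbit ω).ellFun 1 1 v x := fun v =>
    ae_count_iff.1 (StationaryField.coeFn_fullOp (F := F.orbit ω) (EventuallyEq.refl _ (v : Lattice d → ℂ)) η 1 1)
  have hell : ∀ (v : Lattice d → ℂ) (x : Lattice d), (F.orbit ω).ellFun 1 1 v x =
      ∑ i, bwdDiff i (fun y => ∑ j, (E.a (E.τ y ω) i j : ℂ) * fwdDiff j v y) x := by
    intro v x
    refine Finset.sum_congr rfl fun i _ => ?_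
    simp only [StationaryField.gradStarFun, bwdDiff, StationaryField.gradFun, fwdDiff, Pi.one_apply, one_mul]
    change (∑ j, (E.a (E.τ (-unitVec i + x) ω) i j : ℂ) *
      (v (unitVec j + (-unitVec i + x)) - v (-unitVec i + x))) -
      (∑ j, (E.a (E.τ x ω) i j : ℂ) * (v (unitVec j + x) - v x)) = _
    rw [neg_add_eq_sub]
    simp only [add_comm (unitVec _)]
  set v := F.green η ω with hv
  have hveq : ∀ x, η * v x + ∑ i, bwdDiff i (fun y => ∑ j, (E.a (E.τ y ω) i j : ℂ) * fwdDiff j v y) x =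
      Set.indicator {0} (fun _ => (1:ℂ)) x := by
    intro x
    rw [← hell, ← hpt, hv, StationaryField.green, m.fullOp_solve nearUnitary_one le_rfl zero_le_one hη hsmall,
      latDelta_coe]
  have hex : ∃ u, IsLatticeGreen (fun y => E.a (E.τ y ω)) η u := by
    refine ⟨fun x => (v x).re, ?_, fun x => ?_⟩
    · have h1 := (memLp_two_iff_integrable_sq_norm (Lp.memLp v).1).1 (Lp.memLp v)
      rw [integrable_count_iff] at h1
      refine Summable.of_nonneg_of_le (fun _ => sq_nonneg _) (fun x => ?_) h1
      rw [norm_pow, norm_norm, ← sq_abs]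
      gcongr
      exact Complex.abs_re_le_norm _
    · have h1 := congrArg Complex.re (hveq x)
      simp only [Complex.add_re, Complex.re_ofReal_mul, Complex.re_sum, bwdDiff, fwdDiff, Complex.sub_re] at h1
      simp only [bwdDiff, fwdDiff]
      rw [h1]
      by_cases hx : x = 0
      · subst hx; simp
      · simp [hx]
  have hgr : IsLatticeGreen (fun y => E.a (E.τ y ω)) η (latticeGreen (fun y => E.a (E.τ y ω)) η) := by
    rw [latticeGreen, dif_pos hex]; exact hex.choose_spec
  set g := latticeGreen (fun y => E.a (E.τ y ω)) η
  have hmem : MemLp (fun x => (g x : ℂ)) 2 (Measure.count : Measure (Lattice d)) := by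
    rw [memLp_two_iff_integrable_sq_norm (Measurable.of_discrete.aestronglyMeasurable), integrable_count_iff]
    refine hgr.1.congr fun x => ?_
    rw [norm_pow, norm_norm, Complex.norm_real, Real.norm_eq_abs, sq_abs]
  have hcoe : ∀ x, hmem.toLp _ x = (g x : ℂ) := ae_count_iff.1 hmem.coeFn_toLp
  have hfull : m.fullOp η 1 1 (hmem.toLp _) = latDelta 0 := by
    ext1
    refine Eventually.of_forall fun x => ?_
    rw [hpt, hell, latDelta_coe]
    have h1 := congrArg (fun t : ℝ => (t : ℂ)) (hgr.2 x)
    simp only [bwdDiff, fwdDiff, hcoe]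
    simp only [bwdDiff, fwdDiff] at h1
    push_cast at h1
    rw [h1]
    by_cases hx : x = 0
    · subst hx; simp
    · simp [hx]
  have := m.eq_solve nearUnitary_one le_rfl zero_le_one hη hsmall hfull
  rw [← hcoe, this]; rfl

/-- The Fourier representation of `G_{a,η}`. -/
theorem greenAvg_eq {η : ℝ} (hη : 0 < η) {b : Freq d} (hb : (E.field hd).Small η b) (x : Lattice d) :
    (E.greenAvg η x : ℂ) = (((2 * Real.pi : ℝ) ^ d : ℂ))⁻¹ *
      ∫ ξ in cube d, planeWave b x ξ *
        (η + ∑ k, ∑ k', (phaseInv b ξ k - 1) * (E.q (cplx ξ b) η k k' * (phase b ξ k' - 1)))⁻¹ := by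
  simp only [E.q_eq_hom hd hη hb]
  rw [← StationaryField.integral_green (E.field hd) hη hb, greenAvg]
  refine integral_complex_ofReal.symm.trans ?_
  exact integral_congr_ae (Eventually.of_forall fun ω => E.latticeGreen_eq hd hη ω x)

end Environment

/-! ### Constant coefficients -/

section Constant

variable {d : ℕ}

/-- A constant coefficient matrix as a field over a point. -/
noncomputable def constField (A : Matrix (Fin d) (Fin d) ℂ) (lam M : ℝ) (h0 : 0 < lam) (h1 : lam ≤ M)
    (hM : ∀ i j, ‖A i j‖ ≤ M)
    (hA : ∀ v : Fin d → ℂ, lam * ∑ j, ‖v j‖ ^ 2 ≤ (∑ i, ∑ j, starRingEnd ℂ (v i) * (A i j * v j)).re) :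
    StationaryField d PUnit.{1} (Measure.dirac PUnit.unit) where
  τ _ x := x
  mp _ := MeasurePreserving.id _
  τ_zero _ := rfl
  τ_add _ _ _ := rfl
  a _ := A
  meas _ _ := measurable_const
  lam := lam
  M := M
  lam_pos := h0
  lam_le := h1
  bound _ := hM
  elliptic _ := hA

/-- On a one-point space every function is constant, so P annihilates the right-hand side, the
corrector vanishes and q is the coefficient matrix. -/
lemma hom_constField {A : Matrix (Fin d) (Fin d) ℂ} {lam M : ℝ} (h0 : 0 < lam) (h1 : lam ≤ M)
    (hM : ∀ i j, ‖A i j‖ ≤ M)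
    (hA : ∀ v : Fin d → ℂ, lam * ∑ j, ‖v j‖ ^ 2 ≤ (∑ i, ∑ j, starRingEnd ℂ (v i) * (A i j * v j)).re)
    (η : ℝ) (b ξ : Freq d) : (constField A lam M h0 h1 hM hA).hom η b ξ = A := by
  set F := constField A lam M h0 h1 hM hA
  have hrhs : ∀ k, F.medium.corrRhs (StationaryField.unit _) (phaseInv b ξ) k = 0 := by
    intro k
    ext1
    filter_upwards [StationaryField.coeFn_corrRhs (F := F) (phaseInv b ξ) k,
      Lp.coeFn_zero ℂ 2 (Measure.dirac PUnit.unit)] with x h2 h3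
    rw [h2, h3, integral_dirac]
    simp
  have hvec : ∀ k, F.medium.corrVec (StationaryField.unit _) η (phase b ξ) (phaseInv b ξ) k = 0 := by
    intro k
    rw [Medium.corrVec, hrhs, map_zero]
  funext k k'
  rw [StationaryField.hom, Medium.homMat, hvec]
  simp only [map_zero, Finset.sum_const_zero, add_zero]
  rw [StationaryField.inner_unit (StationaryField.coeFn_A_unit (F := F) k k'), integral_dirac]
  rfl

/-- The Fourier representation of the constant coefficient Green's function, with shifted contour. -/
theorem constGreen_eq {A : Matrix (Fin d) (Fin d) ℂ} {lam M : ℝ} (h0 : 0 < lam) (h1 : lam ≤ M)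
    (hM : ∀ i j, ‖A i j‖ ≤ M)
    (hA : ∀ v : Fin d → ℂ, lam * ∑ j, ‖v j‖ ^ 2 ≤ (∑ i, ∑ j, starRingEnd ℂ (v i) * (A i j * v j)).re)
    {η : ℝ} (hη : 0 < η) {b : Freq d} (hb : 2 * ‖b‖ ≤ 1)
    (hb' : 4 * M ^ 2 * d ^ 3 * (2 * ‖b‖) ^ 2 ≤ lam * η) (x : Lattice d) :
    constGreen A η x = (((2 * Real.pi : ℝ) ^ d : ℂ))⁻¹ *
      ∫ ξ in cube d, planeWave b x ξ *
        (η + ∑ k, ∑ k', (phaseInv b ξ k - 1) * (A k k' * (phase b ξ k' - 1)))⁻¹ := by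
  set F := constField A lam M h0 h1 hM hA with hF
  have hs0 : F.Small η 0 := ⟨by simp, by
    simp only [norm_zero, mul_zero, ne_eq, OfNat.ofNat_ne_zero, not_false_eq_true, zero_pow]
    exact (mul_pos F.lam_pos hη).le⟩
  -- The representations with shift b and with shift 0 have the same left-hand side; the latter is
  -- the definition of the constant coefficient Green's function.
  have e1 := F.integral_green hη (b := b) ⟨hb, hb'⟩ x
  have e0 := F.integral_green hη hs0 x
  rw [e0] at e1
  simp only [hF, hom_constField h0 h1 hM hA] at e1
  rw [← e1, constGreen, one_div]
  have e2 : (2 * (Real.pi : ℂ)) ^ d = ((2 * Real.pi : ℝ) ^ d : ℂ) := by push_cast; rfl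
  rw [e2]
  congr 1
  refine integral_congr_ae (Eventually.of_forall fun ξ => ?_)
  simp only
  rw [div_eq_mul_inv]
  have hphase : ∀ j, phase 0 ξ j - 1 = eVec ξ j := fun j => by
    rw [phase, planeWave_unitVec, eVec]; simp [cplx]
  congr 2
  · simp [cplx]
  · simp only [dotProduct, Matrix.mulVec, Finset.mul_sum, phaseInv_zero, ← hphase, Pi.star_apply,
      star_sub, star_one]
    rfl

end Constant

/-! ### Lower bounds for symbols -/

section Lower

variable {d : ℕ}

lemma norm_eVec_le (ξ : Freq d) (j : Fin d) : ‖eVec ξ j‖ ≤ ‖eVecL ξ‖ := PiLp.norm_apply_le (eVecL ξ) j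

lemma norm_eVecL_sq (ξ : Freq d) : ‖eVecL ξ‖ ^ 2 = ∑ j, ‖eVec ξ j‖ ^ 2 := by
  rw [EuclideanSpace.norm_sq_eq]; rfl

lemma norm_phase_sub_le {b : Freq d} (hb : ‖b‖ ≤ 1) (ξ : Freq d) (j : Fin d) :
    ‖planeWave b (unitVec j) ξ - 1 - eVec ξ j‖ ≤ 2 * ‖b‖ ∧
    ‖planeWave b (-unitVec j) ξ - 1 - starRingEnd ℂ (eVec ξ j)‖ ≤ 2 * ‖b‖ := by
  have key : ∀ t : ℝ, |t| ≤ ‖b‖ → ‖Complex.exp (t : ℂ) - 1‖ ≤ 2 * ‖b‖ := by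
    intro t ht
    have h1 : ‖((t : ℝ) : ℂ)‖ ≤ 1 := by
      rw [Complex.norm_real, Real.norm_eq_abs]; exact ht.trans hb
    refine (Complex.norm_exp_sub_one_le h1).trans ?_
    rw [Complex.norm_real, Real.norm_eq_abs]
    gcongr
  have hexp : ‖Complex.exp (-Complex.I * (ξ j : ℂ))‖ = 1 := by rw [Complex.norm_exp]; simp
  constructor
  · have e : planeWave b (unitVec j) ξ - 1 - eVec ξ j =
        Complex.exp (-Complex.I * (ξ j : ℂ)) * (Complex.exp ((b j : ℝ) : ℂ) - 1) := by
      rw [planeWave_unitVec, eVec, mul_sub, ← Complex.exp_add, mul_one]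
      have : -Complex.I * cplx ξ b j = -Complex.I * (ξ j : ℂ) + ((b j : ℝ) : ℂ) := by
        simp only [cplx]
        linear_combination (-(b j : ℂ)) * Complex.I_mul_I
      rw [this]; ring
    rw [e, norm_mul, hexp, one_mul]
    exact key _ (norm_coord_le b j)
  · have e : planeWave b (-unitVec j) ξ - 1 - starRingEnd ℂ (eVec ξ j) =
        starRingEnd ℂ (Complex.exp (-Complex.I * (ξ j : ℂ))) * (Complex.exp ((-(b j) : ℝ) : ℂ) - 1) := by
      rw [planeWave_neg_unitVec, eVec, mul_sub, map_sub, ← Complex.exp_conj, ← Complex.exp_add, mul_one]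
      have : Complex.I * cplx ξ b j =
          starRingEnd ℂ (-Complex.I * (ξ j : ℂ)) + ((-(b j) : ℝ) : ℂ) := by
        simp only [cplx, map_mul, map_neg, Complex.conj_I, Complex.conj_ofReal]
        push_cast
        linear_combination ((b j : ℂ)) * Complex.I_mul_I
      rw [this, map_one]; ring
    rw [e, norm_mul, RCLike.norm_conj, hexp, one_mul]
    exact key (-(b j)) (by rw [abs_neg]; exact norm_coord_le b j)

/-- Symbols near elliptic ones are bounded below. -/
theorem le_norm_symbol {κ ℓ B ε γ : ℝ} {b : Freq d} {M : Freq d → Matrix (Fin d) (Fin d) ℂ}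
    {M₀ : Matrix (Fin d) (Fin d) ℂ} {ξ : Freq d} (hκ : 0 < κ) (hκ1 : κ ≤ 1) (hℓ : 0 < ℓ) (hℓ1 : ℓ ≤ 1)
    (hform : ∀ v : Fin d → ℂ, ℓ * ∑ j, ‖v j‖ ^ 2 ≤
      (∑ k, ∑ k', starRingEnd ℂ (v k) * (M₀ k k' * v k')).re)
    (hB : ∀ k k', ‖M ξ k k'‖ ≤ B) (hB0 : 0 ≤ B) (hε : ∀ k k', ‖M ξ k k' - M₀ k k'‖ ≤ ε) (hε0 : 0 ≤ ε)
    (hb : ‖b‖ ≤ γ * κ) (hγ0 : 0 ≤ γ) (hγ : γ ≤ 1 / 2) (hsmall : d ^ 2 * (4 * B * γ + ε) ≤ ℓ / 4) :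
    ℓ / 4 * (‖eVecL ξ‖ + κ) ^ 2 ≤ ‖symbol κ b M ξ‖ := by
  set t := ‖eVecL ξ‖ with ht
  have ht0 : 0 ≤ t := norm_nonneg _
  have hbκ : 2 * ‖b‖ ≤ κ := by nlinarith
  have hb1 : ‖b‖ ≤ 1 := by linarith [norm_nonneg b]
  have hb2 : 2 * ‖b‖ ≤ 2 * γ * (t + κ) := by nlinarith
  -- Three replacements: each of the two phases by its value at real frequency, with error 2|b| ≤
  -- 2γκ, and M by M₀, with error ε.
  have hterm : ∀ k k', ‖(planeWave b (-unitVec k) ξ - 1) * (M ξ k k' * (planeWave b (unitVec k') ξ - 1)) -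
      starRingEnd ℂ (eVec ξ k) * (M₀ k k' * eVec ξ k')‖ ≤ (4 * B * γ + ε) * (t + κ) ^ 2 := by
    intro k k'
    set p := planeWave b (unitVec k') ξ - 1
    set p' := planeWave b (-unitVec k) ξ - 1
    have h1 : ‖p - eVec ξ k'‖ ≤ 2 * ‖b‖ := (norm_phase_sub_le hb1 ξ k').1
    have h2 : ‖p' - starRingEnd ℂ (eVec ξ k)‖ ≤ 2 * ‖b‖ := (norm_phase_sub_le hb1 ξ k).2
    have h3 := norm_eVec_le ξ k
    have h4 := norm_eVec_le ξ k'
    have h5 : ‖p‖ ≤ t + κ := by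
      have := norm_add_le (p - eVec ξ k') (eVec ξ k')
      rw [sub_add_cancel] at this
      linarith
    have e : p' * (M ξ k k' * p) - starRingEnd ℂ (eVec ξ k) * (M₀ k k' * eVec ξ k') =
        (p' - starRingEnd ℂ (eVec ξ k)) * (M ξ k k' * p) +
        starRingEnd ℂ (eVec ξ k) * (M ξ k k' * (p - eVec ξ k')) +
        starRingEnd ℂ (eVec ξ k) * ((M ξ k k' - M₀ k k') * eVec ξ k') := by ring
    rw [e]
    refine (norm_add₃_le).trans ?_
    simp only [norm_mul, RCLike.norm_conj]
    have htκ : 0 ≤ t + κ := by positivity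
    have g1 : ‖p' - starRingEnd ℂ (eVec ξ k)‖ * (‖M ξ k k'‖ * ‖p‖) ≤ (2 * γ * (t + κ)) * (B * (t + κ)) := by
      gcongr
      · exact h2.trans hb2
      · exact hB k k'
    have g2 : ‖eVec ξ k‖ * (‖M ξ k k'‖ * ‖p - eVec ξ k'‖) ≤ (t + κ) * (B * (2 * γ * (t + κ))) := by
      gcongr
      · linarith
      · exact hB k k'
      · exact h1.trans hb2
    have g3 : ‖eVec ξ k‖ * (‖M ξ k k' - M₀ k k'‖ * ‖eVec ξ k'‖) ≤ (t + κ) * (ε * (t + κ)) := by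
      gcongr
      · linarith
      · exact hε k k'
      · linarith
    linarith
  set Z : ℂ := ((κ ^ 2 : ℝ) : ℂ) + ∑ k, ∑ k', starRingEnd ℂ (eVec ξ k) * (M₀ k k' * eVec ξ k') with hZ
  -- This is (t + κ)² ≤ 2(t² + κ²) together with ℓ ≤ 1. The perturbation then costs at most half of
  -- the bound.
  have hZlow : ℓ / 2 * (t + κ) ^ 2 ≤ ‖Z‖ := by
    have h1 := hform (eVec ξ)
    rw [← norm_eVecL_sq, ← ht] at h1
    refine le_trans ?_ (Complex.re_le_norm Z)
    rw [hZ, Complex.add_re, Complex.ofReal_re]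
    nlinarith [sq_nonneg (t - κ), mul_nonneg (sub_nonneg.2 hℓ1) (sq_nonneg κ)]
  have hdiff : ‖symbol κ b M ξ - Z‖ ≤ ℓ / 4 * (t + κ) ^ 2 := by
    rw [hZ, symbol, add_sub_add_left_eq_sub, ← Finset.sum_sub_distrib]
    simp only [← Finset.sum_sub_distrib]
    calc _ ≤ ∑ _k : Fin d, ∑ _k' : Fin d, (4 * B * γ + ε) * (t + κ) ^ 2 :=
          norm_sum_le_of_le _ fun k _ => norm_sum_le_of_le _ fun k' _ => hterm k k'
      _ = d ^ 2 * (4 * B * γ + ε) * (t + κ) ^ 2 := by simp; ring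
      _ ≤ _ := by gcongr
  have h6 := norm_sub_norm_le Z (symbol κ b M ξ)
  rw [norm_sub_rev] at h6
  linarith

end Lower

/-! ### Scaling of weak norms and reduction to the cube -/

section Scaling

variable {d : ℕ}

lemma WeakLpLE.const_mul {p : ℝ≥0∞} {B c : ℝ} {f : Freq d → ℂ} (hf : WeakLpLE p B f) (hc : 0 < c)
    (hB : 0 ≤ B) : WeakLpLE p (c * B) fun ξ => (c : ℂ) * f ξ := by
  refine ⟨hf.1.const_mul _, ?_⟩
  have hn : ∀ ξ, ‖(c : ℂ) * f ξ‖ = c * ‖f ξ‖ := fun ξ => by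
    rw [norm_mul, Complex.norm_real, Real.norm_of_nonneg hc.le]
  have h2 := hf.2
  simp only [hn]
  split_ifs with hp
  · rw [if_pos hp] at h2
    filter_upwards [h2] with ξ hξ
    gcongr
  · rw [if_neg hp] at h2
    intro μ hμ
    have h3 := h2 (μ / c) (by positivity)
    have e1 : {ξ | ξ ∈ cube d ∧ μ < c * ‖f ξ‖} = {ξ | ξ ∈ cube d ∧ μ / c < ‖f ξ‖} := by
      ext ξ
      simp only [Set.mem_ofPred_eq, div_lt_iff₀' hc]
    have e2 : (c * B) ^ p.toReal / μ ^ p.toReal = B ^ p.toReal / (μ / c) ^ p.toReal := by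
      rw [Real.mul_rpow hc.le hB, Real.div_rpow hμ.le hc.le, div_div_eq_mul_div, mul_comm]
    rw [e1, e2]
    exact h3

lemma partialDeriv_const_mul {n : ℕ} (j : Fin n → Fin d) {f : Freq d → ℂ}
    (hf : ContDiff ℝ (⊤ : ℕ∞) f) (c : ℂ) (ξ : Freq d) :
    partialDeriv j (fun ξ => c * f ξ) ξ = c * partialDeriv j f ξ := by
  have h : ContDiffAt ℝ n f ξ := (hf.of_le (by exact_mod_cast le_top)).contDiffAt
  have := iteratedFDeriv_const_smul_apply' (a := c) h
  simp only [smul_eq_mul] at this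
  simp only [partialDeriv]
  rw [this]; rfl

/-- Every frequency is congruent to one in the cube. -/
lemma exists_mem_cube (ξ : Freq d) : ∃ ξ' ∈ cube d, ∀ {E : Type} (f : Freq d → E), IsPeriodic f → f ξ = f ξ' := by
  have hpi := Real.pi_pos
  set n : Fin d → ℤ := fun j => round (ξ j / (2 * Real.pi))
  have key : ∀ s : Finset (Fin d), ∃ ξ' : Freq d,
      (∀ j ∈ s, ξ' j = ξ j - 2 * Real.pi * n j) ∧ (∀ j ∉ s, ξ' j = ξ j) ∧
      ∀ {E : Type} (f : Freq d → E), IsPeriodic f → f ξ = f ξ' := by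
    intro s
    induction s using Finset.induction_on with
    | empty => exact ⟨ξ, by simp, by simp, fun _ _ => rfl⟩
    | insert i s hi ih =>
      obtain ⟨ξ₁, h1, h2, h3⟩ := ih
      have hper : ∀ (m : ℤ) (ζ : Freq d) {E : Type} (f : Freq d → E), IsPeriodic f →
          f (ζ + EuclideanSpace.single i (2 * Real.pi * m)) = f ζ := by
        intro m
        have hnat : ∀ (m : ℕ) (ζ : Freq d) {E : Type} (f : Freq d → E), IsPeriodic f →
            f (ζ + EuclideanSpace.single i (2 * Real.pi * m)) = f ζ := by
          intro m
          induction m with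
          | zero =>
            intro ζ E f hf
            congr 1
            ext j; simp [PiLp.single_apply]
          | succ m ihm =>
            intro ζ E f hf
            have : ζ + EuclideanSpace.single i (2 * Real.pi * ((m + 1 : ℕ) : ℝ)) =
                (ζ + EuclideanSpace.single i (2 * Real.pi * m)) + EuclideanSpace.single i (2 * Real.pi) := by
              ext j
              simp only [PiLp.add_apply, PiLp.single_apply]
              split_ifs <;> push_cast <;> ring
            rw [this, hf, ihm ζ f hf]
        intro ζ E f hf
        obtain ⟨k, rfl | rfl⟩ := m.eq_nat_or_neg
        · exact_mod_cast hnat k ζ f hf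
        · have := hnat k (ζ + EuclideanSpace.single i (2 * Real.pi * ((-(k:ℤ) : ℤ) : ℝ))) f hf
          rw [← this]
          congr 1
          ext j
          simp only [PiLp.add_apply, PiLp.single_apply]
          split_ifs <;> push_cast <;> ring
      refine ⟨ξ₁ + EuclideanSpace.single i (2 * Real.pi * ((-(n i) : ℤ) : ℝ)), fun j hj => ?_,
        fun j hj => ?_, fun f hf => ?_⟩
      · simp only [PiLp.add_apply, PiLp.single_apply]
        rcases Finset.mem_insert.1 hj with rfl | hj
        · rw [if_pos rfl, h2 _ hi]; push_cast; ring
        · have : j ≠ i := fun h => hi (h ▸ hj)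
          rw [if_neg this, h1 j hj, add_zero]
      · simp only [PiLp.add_apply, PiLp.single_apply]
        rw [Finset.mem_insert, not_or] at hj
        rw [if_neg hj.1, h2 j hj.2, add_zero]
      · rw [h3 f hf, hper _ _ f hf]
  obtain ⟨ξ', h1, -, h3⟩ := key Finset.univ
  refine ⟨ξ', fun j => ?_, h3⟩
  rw [h1 j (Finset.mem_univ _)]
  have h4 := abs_sub_round (ξ j / (2 * Real.pi))
  have h5 : ξ j - 2 * Real.pi * n j = 2 * Real.pi * (ξ j / (2 * Real.pi) - round (ξ j / (2 * Real.pi))) := by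
    rw [mul_sub, mul_div_cancel₀ _ (by positivity)]
  rw [h5]
  obtain ⟨h6, h7⟩ := abs_le.1 h4
  constructor <;> nlinarith

end Scaling

/-! ### Consequences of the Fourier-space estimates -/

section Norms

variable {d : ℕ}

lemma norm_entry_le_matNorm (M : Matrix (Fin d) (Fin d) ℂ) (k k' : Fin d) : ‖M k k'‖ ≤ matNorm M := by
  have h1 := (Matrix.toEuclideanCLM (𝕜 := ℂ) M).le_opNorm (EuclideanSpace.single k' 1)
  rw [PiLp.norm_single, norm_one, mul_one] at h1
  have h2 := PiLp.norm_apply_le (Matrix.toEuclideanCLM (𝕜 := ℂ) M (EuclideanSpace.single k' 1)) k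
  have e : (Matrix.toEuclideanCLM (𝕜 := ℂ) M (EuclideanSpace.single k' 1)) k = M k k' := by
    rw [Matrix.ofLp_toEuclideanCLM]
    simp [Matrix.mulVec, dotProduct]
  rw [e] at h2
  exact h2.trans h1

lemma imNorm_cplx (ξ b : Freq d) : imNorm (cplx ξ b) = ‖b‖ := by
  rw [imNorm, EuclideanSpace.norm_eq]
  congr 1
  refine Finset.sum_congr rfl fun j _ => ?_
  simp [cplx]

lemma norm_cplx_sub_real (ξ ξ' : Freq d) : ‖cplx ξ' 0 - cplx ξ 0‖ = ‖ξ' - ξ‖ := by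
  rw [EuclideanSpace.norm_eq, EuclideanSpace.norm_eq]
  congr 1
  refine Finset.sum_congr rfl fun j _ => ?_
  simp only [cplx, PiLp.sub_apply, PiLp.zero_apply, Complex.ofReal_zero, mul_zero, add_zero,
    ← Complex.ofReal_sub, Complex.norm_real]

lemma norm_cplx_sub_imag (ξ b : Freq d) : ‖cplx ξ b - cplx ξ 0‖ = ‖b‖ := by
  rw [EuclideanSpace.norm_eq, EuclideanSpace.norm_eq]
  congr 1
  refine Finset.sum_congr rfl fun j _ => ?_
  simp [cplx]

end Norms

/-! ### Hölder continuity up to zero and the limit `q(0,0)`. -/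

section Limit

variable {d : ℕ} {E : Environment.{u} d} {α₀ C₁ C₂ c C₀ : ℝ} {αd Cd : ℝ → ℝ}

lemma FourierEstimates.real_holder (h : FourierEstimates E α₀ C₁ C₂ c C₀ αd Cd) (hC₂ : 0 < C₂)
    {η η' : ℝ} (h0 : 0 < η) (h1 : η ≤ η') (h2 : η' ≤ E.Lam) (ξ ξ' : Freq d) (k k' : Fin d) :
    ‖E.q (cplx ξ' 0) η' k k' - E.q (cplx ξ 0) η k k'‖ ≤
      C₁ * E.Lam * (‖ξ' - ξ‖ ^ α₀ + |(η' - η) / E.Lam| ^ (α₀ / 2)) := by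
  have h3 := h.holder η η' h0 h1 h2 (cplx ξ 0) (cplx ξ' 0)
    (by rw [imNorm_cplx, imNorm_cplx, norm_zero, add_zero]; positivity)
  rw [norm_cplx_sub_real] at h3
  exact (norm_entry_le_matNorm (E.q (cplx ξ' 0) η' - E.q (cplx ξ 0) η) k k').trans h3

lemma FourierEstimates.imag_holder (h : FourierEstimates E α₀ C₁ C₂ c C₀ αd Cd) (hα₀ : 0 < α₀)
    {η : ℝ} (h0 : 0 < η) (h2 : η ≤ E.Lam) (ξ : Freq d) {b : Freq d}
    (hb : ‖b‖ ≤ C₂ * Real.sqrt (η / E.Lam)) (k k' : Fin d) :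
    ‖E.q (cplx ξ b) η k k' - E.q (cplx ξ 0) η k k'‖ ≤ C₁ * E.Lam * ‖b‖ ^ α₀ := by
  have h3 := h.holder η η h0 le_rfl h2 (cplx ξ 0) (cplx ξ b)
    (by rw [imNorm_cplx, imNorm_cplx, norm_zero, zero_add]; exact hb)
  rw [norm_cplx_sub_imag, sub_self, zero_div, abs_zero, Real.zero_rpow (by positivity), add_zero] at h3
  exact (norm_entry_le_matNorm (E.q (cplx ξ b) η - E.q (cplx ξ 0) η) k k').trans h3

/-- The limit `q(0,0)` exists. -/
theorem FourierEstimates.exists_tendsto (h : FourierEstimates E α₀ C₁ C₂ c C₀ αd Cd) (hα₀ : 0 < α₀)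
    (hC₁ : 0 < C₁) (hC₂ : 0 < C₂) :
    ∃ aHom : Matrix (Fin d) (Fin d) ℂ,
      Tendsto (fun z : Freq d × ℝ => E.q (cplx z.1 0) z.2) (𝓝 0 ×ˢ 𝓝[>] 0) (𝓝 aHom) := by
  have hL := E.Lam_pos
  have key : ∀ k k', ∃ a : ℂ,
      Tendsto (fun z : Freq d × ℝ => E.q (cplx z.1 0) z.2 k k') (𝓝 0 ×ˢ 𝓝[>] 0) (𝓝 a) := by
    intro k k'
    rw [← cauchy_map_iff_exists_tendsto, Metric.cauchy_iff]
    refine ⟨inferInstance, fun ε hε => ?_⟩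
    have hlim : Tendsto (fun r : ℝ => C₁ * E.Lam * ((2 * r) ^ α₀ + (r / E.Lam) ^ (α₀ / 2))) (𝓝[>] 0) (𝓝 0) := by
      have hcont : ContinuousAt (fun r : ℝ => C₁ * E.Lam * ((2 * r) ^ α₀ + (r / E.Lam) ^ (α₀ / 2))) 0 := by
        refine continuousAt_const.mul (ContinuousAt.add ?_ ?_)
        · exact (continuousAt_const.mul continuousAt_id).rpow_const (Or.inr hα₀.le)
        · exact (continuousAt_id.div_const _).rpow_const (Or.inr (by positivity))
      have := hcont.tendsto
      rw [mul_zero, zero_div, Real.zero_rpow hα₀.ne', Real.zero_rpow (by positivity), add_zero, mul_zero] at this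
      exact this.mono_left nhdsWithin_le_nhds
    obtain ⟨r, hr1, hr2, hr3⟩ := ((hlim.eventually (gt_mem_nhds hε)).and
      (Ioo_mem_nhdsGT hL : Set.Ioo 0 E.Lam ∈ 𝓝[>] (0:ℝ))).exists
    refine ⟨_, image_mem_map (prod_mem_prod (Metric.ball_mem_nhds 0 hr2) (Ioo_mem_nhdsGT hr2)), ?_⟩
    -- The Hölder hypothesis compares only η ≤ η', so the Cauchy property is proved for pairs
    -- ordered by their second component and then extended by symmetry.
    have main : ∀ z z' : Freq d × ℝ, z ∈ Metric.ball (0 : Freq d) r ×ˢ Set.Ioo 0 r →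
        z' ∈ Metric.ball (0 : Freq d) r ×ˢ Set.Ioo 0 r → z.2 ≤ z'.2 →
        ‖E.q (cplx z'.1 0) z'.2 k k' - E.q (cplx z.1 0) z.2 k k'‖ < ε := by
      rintro ⟨ξ, η⟩ ⟨ξ', η'⟩ ⟨a1, a2, a3⟩ ⟨b1, b2, b3⟩ hle
      simp only [mem_ball_zero_iff] at a1 a2 a3 b1 b2 b3 hle
      refine lt_of_le_of_lt ?_ hr1
      refine (h.real_holder hC₂ a2 hle (by linarith) ξ ξ' k k').trans ?_
      have hr : |(η' - η) / E.Lam| ≤ r / E.Lam := by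
        rw [abs_of_nonneg (div_nonneg (by linarith) hL.le)]
        exact div_le_div_of_nonneg_right (by linarith) hL.le
      refine mul_le_mul_of_nonneg_left (add_le_add ?_ ?_) (by positivity)
      · exact Real.rpow_le_rpow (norm_nonneg _) ((_root_.norm_sub_le _ _).trans (by linarith)) hα₀.le
      · exact Real.rpow_le_rpow (abs_nonneg _) hr (by positivity)
    rintro _ ⟨z, hz, rfl⟩ _ ⟨z', hz', rfl⟩
    rcases le_total z.2 z'.2 with hle | hle
    · rw [dist_comm, dist_eq_norm]; exact main z z' hz hz' hle
    · rw [dist_eq_norm]; exact main z' z hz' hz hle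
  choose a ha using key
  exact ⟨fun k k' => a k k', tendsto_pi_nhds.2 fun k => tendsto_pi_nhds.2 fun k' => ha k k'⟩

lemma sqrt_rpow_eq {t α : ℝ} (ht : 0 ≤ t) : t ^ (α / 2) = Real.sqrt t ^ α := by
  rw [Real.sqrt_eq_rpow, ← Real.rpow_mul ht]; congr 1; ring

/-- Let the second point of the Hölder estimate tend to (0,0); the term (η/Λ)^{α₀/2} is κ^{α₀}. -/
lemma FourierEstimates.norm_sub_le (h : FourierEstimates E α₀ C₁ C₂ c C₀ αd Cd) (hα₀ : 0 < α₀)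
    (hC₂ : 0 < C₂) {aHom : Matrix (Fin d) (Fin d) ℂ}
    (hlim : Tendsto (fun z : Freq d × ℝ => E.q (cplx z.1 0) z.2) (𝓝 0 ×ˢ 𝓝[>] 0) (𝓝 aHom))
    {η : ℝ} (h0 : 0 < η) (h2 : η ≤ E.Lam) (ξ : Freq d) (k k' : Fin d) :
    ‖E.q (cplx ξ 0) η k k' - aHom k k'‖ ≤
      C₁ * E.Lam * (‖ξ‖ ^ α₀ + Real.sqrt (η / E.Lam) ^ α₀) := by
  have hL := E.Lam_pos
  have h3 : Tendsto (fun z : Freq d × ℝ => ‖E.q (cplx ξ 0) η k k' - E.q (cplx z.1 0) z.2 k k'‖)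
      (𝓝 0 ×ˢ 𝓝[>] 0) (𝓝 ‖E.q (cplx ξ 0) η k k' - aHom k k'‖) :=
    (((tendsto_pi_nhds.1 (tendsto_pi_nhds.1 hlim k)) k').const_sub _).norm
  have h4 : Tendsto (fun z : Freq d × ℝ =>
      C₁ * E.Lam * (‖ξ - z.1‖ ^ α₀ + |(η - z.2) / E.Lam| ^ (α₀ / 2)))
      (𝓝 0 ×ˢ 𝓝[>] 0) (𝓝 (C₁ * E.Lam * (‖ξ‖ ^ α₀ + Real.sqrt (η / E.Lam) ^ α₀))) := by
    have hc : Continuous fun z : Freq d × ℝ =>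
        C₁ * E.Lam * (‖ξ - z.1‖ ^ α₀ + |(η - z.2) / E.Lam| ^ (α₀ / 2)) := by
      refine continuous_const.mul (Continuous.add ?_ ?_)
      · exact (continuous_const.sub continuous_fst).norm.rpow_const fun _ => Or.inr hα₀.le
      · exact ((continuous_const.sub continuous_snd).div_const _).abs.rpow_const
          fun _ => Or.inr (by positivity)
    have h5 := hc.tendsto (0, 0)
    simp only [sub_zero] at h5
    rw [abs_of_pos (by positivity), sqrt_rpow_eq (by positivity)] at h5
    refine h5.mono_left ?_
    rw [nhds_prod_eq]
    exact Filter.prod_mono le_rfl nhdsWithin_le_nhds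
  refine le_of_tendsto_of_tendsto h3 h4 ?_
  have hev : ∀ᶠ z : Freq d × ℝ in 𝓝 0 ×ˢ 𝓝[>] 0, z.2 ∈ Set.Ioo 0 η :=
    tendsto_snd.eventually (Ioo_mem_nhdsGT h0)
  filter_upwards [hev] with z hz
  exact h.real_holder hC₂ hz.1 hz.2.le h2 z.1 ξ k k'

end Limit

/-! ### Regularity of the Fourier multiplier -/

namespace Environment

variable {d : ℕ} (E : Environment.{u} d)

/-- At fixed b the multiplier depends on ξ only through the phases, which are smooth in ξ, and it is
a smooth function of the phases wherever the corrector operator is invertible. -/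
lemma contDiff_q (hd : 0 < d) {η : ℝ} (hη : 0 < η) {b : Freq d} (hb : (E.field hd).Small η b) (k k' : Fin d) :
    ContDiff ℝ (⊤ : ℕ∞) fun ξ => E.q (cplx ξ b) η k k' := by
  simp only [E.q_eq_hom hd hη hb]
  rw [contDiff_iff_contDiffAt]
  intro ξ
  have hb0 : 0 ≤ 2 * ‖b‖ := by positivity
  have hw := nearUnitary_phase (b := b) (by linarith [hb.1, norm_nonneg b]) ξ
  have hu := (E.field hd).medium.isUnit_corrOp StationaryField.norm_unit hw hb0 hb.1 hη hb.2
  have h1 := ((E.field hd).medium.contDiffAt_homMat (n := ((⊤ : ℕ∞) : WithTop ℕ∞))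
    (phase b ξ, phaseInv b ξ) hu k k').restrict_scalars ℝ
  have h2 : ContDiff ℝ ((⊤ : ℕ∞) : WithTop ℕ∞) fun ξ : Freq d => (phase b ξ, phaseInv b ξ) :=
    (contDiff_pi.2 fun j => contDiff_planeWave b (unitVec j)).prodMk
      (contDiff_pi.2 fun j => contDiff_planeWave b (-unitVec j))
  have h3 := ContDiffAt.comp (g := fun p : (Fin d → ℂ) × (Fin d → ℂ) =>
    (E.field hd).medium.homMat (StationaryField.unit E.P) η p.1 p.2 k k')
    (f := fun ξ => (phase b ξ, phaseInv b ξ)) ξ h1 h2.contDiffAt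
  exact h3

lemma isPeriodic_q (hd : 0 < d) {η : ℝ} (hη : 0 < η) {b : Freq d} (hb : (E.field hd).Small η b) :
    IsPeriodic fun ξ => E.q (cplx ξ b) η := by
  intro j ξ
  simp only [E.q_eq_hom hd hη hb, StationaryField.hom]
  have h1 : ∀ y, planeWave b y (ξ + EuclideanSpace.single j (2 * Real.pi)) = planeWave b y ξ :=
    fun y => isPeriodic_planeWave b y j ξ
  have h2 : phase b (ξ + EuclideanSpace.single j (2 * Real.pi)) = phase b ξ := funext fun i => h1 _
  have h3 : phaseInv b (ξ + EuclideanSpace.single j (2 * Real.pi)) = phaseInv b ξ := funext fun i => h1 _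
  rw [h2, h3]

lemma small_zero (hd : 0 < d) {η : ℝ} (hη : 0 < η) : (E.field hd).Small η 0 :=
  ⟨by simp, by
    simp only [norm_zero, mul_zero, ne_eq, OfNat.ofNat_ne_zero, not_false_eq_true, zero_pow]
    exact (mul_pos (E.field hd).lam_pos hη).le⟩

lemma le_re_q (hd : 0 < d) {η : ℝ} (hη : 0 < η) (ξ : Freq d) (v : Fin d → ℂ) : E.lam * ∑ j, ‖v j‖ ^ 2 ≤
    (∑ k, ∑ k', starRingEnd ℂ (v k) * (E.q (cplx ξ 0) η k k' * v k')).re := by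
  have hb := E.small_zero hd hη
  rw [E.q_eq_hom hd hη hb]
  have hw := nearUnitary_phase (b := (0 : Freq d)) (by simp) ξ
  exact (E.field hd).medium.le_re_homMat StationaryField.norm_unit (E.field hd).T_unit (phaseInv_zero ξ) hη
    ((E.field hd).medium.isUnit_corrOp StationaryField.norm_unit hw (by simp) hb.1 hη hb.2) v

lemma norm_q_le (hd : 0 < d) {η : ℝ} (hη : 0 < η) (ξ : Freq d) (k k' : Fin d) :
    ‖E.q (cplx ξ 0) η k k'‖ ≤ d * E.Lam ^ 2 / E.lam := by
  have hb := E.small_zero hd hη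
  rw [E.q_eq_hom hd hη hb]
  have hw := nearUnitary_phase (b := (0 : Freq d)) (by simp) ξ
  exact (E.field hd).medium.norm_homMat_le StationaryField.norm_unit (phaseInv_zero ξ) hη
    ((E.field hd).medium.isUnit_corrOp StationaryField.norm_unit hw (by simp) hb.1 hη hb.2) k k'

lemma le_re_limit (hd : 0 < d) {aHom : Matrix (Fin d) (Fin d) ℂ}
    (hlim : Tendsto (fun z : Freq d × ℝ => E.q (cplx z.1 0) z.2) (𝓝 0 ×ˢ 𝓝[>] 0) (𝓝 aHom))
    (v : Fin d → ℂ) : E.lam * ∑ j, ‖v j‖ ^ 2 ≤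
    (∑ k, ∑ k', starRingEnd ℂ (v k) * (aHom k k' * v k')).re := by
  have h1 : Tendsto (fun z : Freq d × ℝ =>
      (∑ k, ∑ k', starRingEnd ℂ (v k) * (E.q (cplx z.1 0) z.2 k k' * v k')).re) (𝓝 0 ×ˢ 𝓝[>] 0)
      (𝓝 (∑ k, ∑ k', starRingEnd ℂ (v k) * (aHom k k' * v k')).re) := by
    refine (Complex.continuous_re.tendsto _).comp ?_
    exact tendsto_finsetSum _ fun k _ => tendsto_finsetSum _ fun k' _ =>
      (((tendsto_pi_nhds.1 (tendsto_pi_nhds.1 hlim k)) k').mul_const _).const_mul _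
  refine ge_of_tendsto h1 ?_
  have hev : ∀ᶠ z : Freq d × ℝ in 𝓝 0 ×ˢ 𝓝[>] 0, z.2 ∈ Set.Ioi (0:ℝ) :=
    tendsto_snd.eventually self_mem_nhdsWithin
  filter_upwards [hev] with z hz
  exact E.le_re_q hd hz z.1 v

lemma norm_limit_le (hd : 0 < d) {aHom : Matrix (Fin d) (Fin d) ℂ}
    (hlim : Tendsto (fun z : Freq d × ℝ => E.q (cplx z.1 0) z.2) (𝓝 0 ×ˢ 𝓝[>] 0) (𝓝 aHom))
    (k k' : Fin d) : ‖aHom k k'‖ ≤ d * E.Lam ^ 2 / E.lam := by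
  refine le_of_tendsto ((tendsto_pi_nhds.1 (tendsto_pi_nhds.1 hlim k)) k').norm ?_
  have hev : ∀ᶠ z : Freq d × ℝ in 𝓝 0 ×ˢ 𝓝[>] 0, z.2 ∈ Set.Ioi (0:ℝ) :=
    tendsto_snd.eventually self_mem_nhdsWithin
  filter_upwards [hev] with z hz
  exact E.norm_q_le hd hz z.1 k k'

end Environment

/-! ### The normalized symbols of an environment -/

section Strip

/-- Relative widths `γ` of strips `|Im ξ| ≤ γ κ` on which the symbols stay elliptic. -/
structure IsStripWidth (d : ℕ) (K α₀ C₁ C₂ c γ : ℝ) : Prop where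
  pos : 0 < γ
  le_half : γ ≤ 1 / 2
  le_C₂ : γ ≤ C₂
  le_c : γ * Real.sqrt K ≤ c
  small : 16 * d ^ 5 * K ^ 3 * γ ^ 2 ≤ 1
  coercive : d ^ 2 * (4 * (d * K + C₁) * γ + C₁ * γ ^ α₀) ≤ 1 / K / 4

/-- Each condition bounds by a positive constant a function of γ that is continuous and zero at γ =
0. -/
lemma exists_isStripWidth (d : ℕ) {K α₀ C₁ C₂ c : ℝ} (hK : 0 < K) (hα₀ : 0 < α₀) (hC₂ : 0 < C₂)
    (hc : 0 < c) : ∃ γ, IsStripWidth d K α₀ C₁ C₂ c γ := by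
  have key : ∀ (f : ℝ → ℝ) (t : ℝ), ContinuousAt f 0 → f 0 = 0 → 0 < t → ∀ᶠ γ in 𝓝[>] (0:ℝ), f γ ≤ t := by
    intro f t hf h0 ht
    have h1 := hf.tendsto
    rw [h0] at h1
    exact ((h1.mono_left nhdsWithin_le_nhds).eventually (gt_mem_nhds ht)).mono fun _ => le_of_lt
  have hid : ContinuousAt (fun γ : ℝ => γ) 0 := continuousAt_id
  have e1 := key _ (1 / 2) hid rfl (by norm_num)
  have e2 := key _ C₂ hid rfl hC₂
  have e3 := key (fun γ => γ * Real.sqrt K) c (hid.mul continuousAt_const) (zero_mul _) hc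
  have e4 := key (fun γ => 16 * d ^ 5 * K ^ 3 * γ ^ 2) 1 (continuousAt_const.mul (hid.pow 2))
    (by simp) one_pos
  have e5 := key (fun γ => d ^ 2 * (4 * (d * K + C₁) * γ + C₁ * γ ^ α₀)) (1 / K / 4)
    (continuousAt_const.mul ((continuousAt_const.mul hid).add
      (continuousAt_const.mul (hid.rpow_const (Or.inr hα₀.le)))))
    (by rw [Real.zero_rpow hα₀.ne']; ring) (by positivity)
  obtain ⟨γ, h1, h2, h3, h4, h5, h6⟩ :=
    (e1.and (e2.and (e3.and (e4.and (e5.and self_mem_nhdsWithin))))).exists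
  exact ⟨γ, h6, h1, h2, h3, h4, h5⟩

end Strip

section Package

variable {d : ℕ} {E : Environment.{u} d} {K α₀ C₁ C₂ c C₀ : ℝ} {αd Cd : ℝ → ℝ}

/-- The multiplier `q(ξ + i b, η) / Λ`. -/
noncomputable def Environment.relSymbol (E : Environment.{u} d) (η : ℝ) (b ξ : Freq d) :
    Matrix (Fin d) (Fin d) ℂ := fun k k' => ((E.Lam⁻¹ : ℝ) : ℂ) * E.q (cplx ξ b) η k k'

/-- The homogenized matrix divided by `Λ`. -/
noncomputable def Environment.relMatrix (E : Environment.{u} d) (A : Matrix (Fin d) (Fin d) ℂ) :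
    Matrix (Fin d) (Fin d) ℂ := fun k k' => ((E.Lam⁻¹ : ℝ) : ℂ) * A k k'

lemma Environment.norm_relSymbol_sub (η η' : ℝ) (b b' ξ ξ' : Freq d) (k k' : Fin d) :
    ‖E.relSymbol η b ξ k k' - E.relSymbol η' b' ξ' k k'‖ =
      E.Lam⁻¹ * ‖E.q (cplx ξ b) η k k' - E.q (cplx ξ' b') η' k k'‖ := by
  rw [relSymbol, relSymbol, ← mul_sub, norm_mul, Complex.norm_real,
    Real.norm_of_nonneg (inv_pos.2 E.Lam_pos).le]

lemma Environment.one_le_ratio (hd : 0 < d) (hE : E.Lam / E.lam = K) : 1 ≤ K := by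
  rw [← hE, one_le_div E.lam_pos]; exact E.lam_le_Lam hd

/-- Coercivity is needed twice: for the environment, with entries bounded by Λ, and for the
homogenized matrix, whose entries are only known to be bounded by dKΛ. The second condition implies
the first. -/
lemma Environment.small_of_norm_le (hd : 0 < d) (hE : E.Lam / E.lam = K) {γ : ℝ}
    (hγ : IsStripWidth d K α₀ C₁ C₂ c γ) {η : ℝ} (hη : 0 < η) (hη1 : η ≤ E.Lam) {b : Freq d}
    (hb : ‖b‖ ≤ γ * Real.sqrt (η / E.Lam)) :
    2 * ‖b‖ ≤ 1 ∧ 4 * (d * K * E.Lam) ^ 2 * d ^ 3 * (2 * ‖b‖) ^ 2 ≤ E.lam * η ∧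
      4 * E.Lam ^ 2 * d ^ 3 * (2 * ‖b‖) ^ 2 ≤ E.lam * η := by
  have hL := E.Lam_pos
  have hl := E.lam_pos
  have hK := E.one_le_ratio hd hE
  have hd1 : (1:ℝ) ≤ d := by exact_mod_cast hd
  have hγ0 := hγ.pos
  have hs : Real.sqrt (η / E.Lam) ≤ 1 := Real.sqrt_le_one.2 ((div_le_one hL).2 hη1)
  have hLam : E.Lam = K * E.lam := by rw [← hE]; field_simp
  have hsq : ‖b‖ ^ 2 ≤ γ ^ 2 * (η / E.Lam) := by
    have := pow_le_pow_left₀ (norm_nonneg b) hb 2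
    rwa [mul_pow, Real.sq_sqrt (by positivity)] at this
  have h2 : 4 * (d * K * E.Lam) ^ 2 * d ^ 3 * (2 * ‖b‖) ^ 2 ≤ E.lam * η := by
    calc 4 * (d * K * E.Lam) ^ 2 * d ^ 3 * (2 * ‖b‖) ^ 2
        = 16 * d ^ 5 * K ^ 2 * E.Lam ^ 2 * ‖b‖ ^ 2 := by ring
      _ ≤ 16 * d ^ 5 * K ^ 2 * E.Lam ^ 2 * (γ ^ 2 * (η / E.Lam)) := by gcongr
      _ = 16 * d ^ 5 * K ^ 3 * γ ^ 2 * (E.lam * η) := by rw [hLam]; field_simp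
      _ ≤ 1 * (E.lam * η) := mul_le_mul_of_nonneg_right hγ.small (by positivity)
      _ = _ := one_mul _
  refine ⟨?_, h2, le_trans ?_ h2⟩
  · have := hγ.le_half
    have := mul_le_mul this hs (Real.sqrt_nonneg _) (by norm_num)
    linarith
  · have hone : 1 ≤ (d : ℝ) * K := by nlinarith
    have h3 : E.Lam ≤ d * K * E.Lam := by nlinarith
    have h4 : E.Lam ^ 2 ≤ (d * K * E.Lam) ^ 2 := pow_le_pow_left₀ hL.le h3 2
    gcongr

lemma FourierEstimates.norm_relSymbol_sub_real (h : FourierEstimates E α₀ C₁ C₂ c C₀ αd Cd)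
    (hα₀ : 0 < α₀) (hC₁ : 0 ≤ C₁) {γ : ℝ} (hγ : IsStripWidth d K α₀ C₁ C₂ c γ) {η : ℝ} (hη : 0 < η)
    (hη1 : η ≤ E.Lam) {b : Freq d} (hb : ‖b‖ ≤ γ * Real.sqrt (η / E.Lam)) (ξ : Freq d) (k k' : Fin d) :
    ‖E.relSymbol η b ξ k k' - E.relSymbol η 0 ξ k k'‖ ≤ C₁ * (γ * Real.sqrt (η / E.Lam)) ^ α₀ := by
  have hL := E.Lam_pos
  rw [E.norm_relSymbol_sub]
  have h1 := h.imag_holder hα₀ hη hη1 ξ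
    (hb.trans (mul_le_mul_of_nonneg_right hγ.le_C₂ (Real.sqrt_nonneg _))) k k'
  calc _ ≤ E.Lam⁻¹ * (C₁ * E.Lam * ‖b‖ ^ α₀) := by gcongr
    _ = C₁ * ‖b‖ ^ α₀ := by field_simp
    _ ≤ _ := by gcongr

variable {aHom : Matrix (Fin d) (Fin d) ℂ}

/-- By periodicity ξ may be moved into the cube, where |ξ| ≤ 2|e(ξ)|. Then compare q(ξ+ib,η) with
q(ξ,η), and q(ξ,η) with the limit. The exponent drops from α₀ to α at the cost of a constant because
|e(ξ)| + κ ≤ 2d + 1. -/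
lemma FourierEstimates.norm_relSymbol_sub_le (hd : 0 < d) (hE : E.Lam / E.lam = K)
    (h : FourierEstimates E α₀ C₁ C₂ c C₀ αd Cd) (hα₀ : 0 < α₀) (hα₀' : α₀ ≤ 1) (hC₁ : 0 < C₁)
    (hC₂ : 0 < C₂)
    (hlim : Tendsto (fun z : Freq d × ℝ => E.q (cplx z.1 0) z.2) (𝓝 0 ×ˢ 𝓝[>] 0) (𝓝 aHom))
    {γ : ℝ} (hγ : IsStripWidth d K α₀ C₁ C₂ c γ) {η : ℝ} (hη : 0 < η)
    (hη1 : η ≤ E.Lam) {b : Freq d} (hb : ‖b‖ ≤ γ * Real.sqrt (η / E.Lam)) {α : ℝ}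
    (hα : 0 < α) (hα' : α ≤ α₀) (k k' : Fin d) (ξ : Freq d) :
    ‖E.relSymbol η b ξ k k' - E.relMatrix aHom k k'‖ ≤
      4 * C₁ * (2 * d + 1) * (‖eVecL ξ‖ + Real.sqrt (η / E.Lam)) ^ α := by
  have hL := E.Lam_pos
  set κ := Real.sqrt (η / E.Lam) with hκ
  have hκ0 : 0 ≤ κ := Real.sqrt_nonneg _
  have hκ1 : κ ≤ 1 := Real.sqrt_le_one.2 ((div_le_one hL).2 hη1)
  obtain ⟨hb1, -, hb2⟩ := E.small_of_norm_le hd hE hγ hη hη1 hb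
  have hper := E.isPeriodic_q hd hη (b := b) ⟨hb1, hb2⟩
  obtain ⟨ξ', hξ', hrep⟩ := exists_mem_cube ξ
  have e1 : E.relSymbol η b ξ = E.relSymbol η b ξ' := by
    unfold Environment.relSymbol
    rw [hrep _ hper]
  rw [e1, hrep _ isPeriodic_eVecL]
  set s := ‖eVecL ξ'‖ + κ with hs
  have hs0 : 0 < s := by
    have : 0 < κ := Real.sqrt_pos.2 (by positivity)
    positivity
  have hsle : s ≤ 2 * d + 1 := add_le_add (norm_eVecL_le ξ') hκ1
  have hn : ‖ξ'‖ ≤ 2 * s := by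
    have h1 := norm_le_of_mem_cube hξ'
    have h2 : Real.pi / 2 * ‖eVecL ξ'‖ ≤ 2 * ‖eVecL ξ'‖ :=
      mul_le_mul_of_nonneg_right (by linarith [Real.pi_le_four]) (norm_nonneg _)
    simp only [hs]; linarith
  have hκs : κ ≤ s := by simp only [hs]; linarith [norm_nonneg (eVecL ξ')]
  have t1 := h.norm_relSymbol_sub_real hα₀ hC₁.le hγ hη hη1 hb ξ' k k'
  have t2 : ‖E.relSymbol η 0 ξ' k k' - E.relMatrix aHom k k'‖ ≤ C₁ * (‖ξ'‖ ^ α₀ + κ ^ α₀) := by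
    rw [Environment.relSymbol, Environment.relMatrix, ← mul_sub, norm_mul, Complex.norm_real,
      Real.norm_of_nonneg (inv_pos.2 hL).le]
    calc _ ≤ E.Lam⁻¹ * (C₁ * E.Lam * (‖ξ'‖ ^ α₀ + κ ^ α₀)) :=
          mul_le_mul_of_nonneg_left (h.norm_sub_le hα₀ hC₂ hlim hη hη1 ξ' k k') (inv_pos.2 hL).le
      _ = _ := by field_simp
  have hγκ : γ * κ ≤ s := by nlinarith [hγ.le_half, hγ.pos]
  have p1 : (γ * κ) ^ α₀ ≤ s ^ α₀ := Real.rpow_le_rpow (mul_nonneg hγ.pos.le hκ0) hγκ hα₀.le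
  have p2 : κ ^ α₀ ≤ s ^ α₀ := Real.rpow_le_rpow hκ0 hκs hα₀.le
  have p3 : ‖ξ'‖ ^ α₀ ≤ 2 * s ^ α₀ := by
    refine (Real.rpow_le_rpow (norm_nonneg _) hn hα₀.le).trans ?_
    rw [Real.mul_rpow (by norm_num) hs0.le]
    refine mul_le_mul_of_nonneg_right ?_ (by positivity)
    calc (2:ℝ) ^ α₀ ≤ 2 ^ (1:ℝ) := Real.rpow_le_rpow_of_exponent_le (by norm_num) hα₀'
      _ = 2 := Real.rpow_one 2
  have p4 : s ^ α₀ ≤ (2 * d + 1) * s ^ α := by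
    have hd0 : (1:ℝ) ≤ 2 * d + 1 := by linarith [show (0:ℝ) ≤ d by positivity]
    calc s ^ α₀ = s ^ (α₀ - α) * s ^ α := by rw [← Real.rpow_add hs0]; congr 1; ring
      _ ≤ (2 * d + 1) * s ^ α := by
        refine mul_le_mul_of_nonneg_right ?_ (by positivity)
        calc s ^ (α₀ - α) ≤ (2 * d + 1 : ℝ) ^ (α₀ - α) :=
              Real.rpow_le_rpow hs0.le hsle (by linarith)
          _ ≤ (2 * d + 1 : ℝ) ^ (1:ℝ) := Real.rpow_le_rpow_of_exponent_le hd0 (by linarith)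
          _ = _ := Real.rpow_one _
  calc ‖E.relSymbol η b ξ' k k' - E.relMatrix aHom k k'‖
      ≤ ‖E.relSymbol η b ξ' k k' - E.relSymbol η 0 ξ' k k'‖ +
        ‖E.relSymbol η 0 ξ' k k' - E.relMatrix aHom k k'‖ := norm_sub_le_norm_sub_add_norm_sub _ _ _
    _ ≤ C₁ * s ^ α₀ + C₁ * (2 * s ^ α₀ + s ^ α₀) := by
        refine add_le_add (t1.trans (mul_le_mul_of_nonneg_left p1 hC₁.le)) (t2.trans ?_)
        exact mul_le_mul_of_nonneg_left (add_le_add p3 p2) hC₁.le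
    _ = 4 * C₁ * s ^ α₀ := by ring
    _ ≤ 4 * C₁ * ((2 * d + 1) * s ^ α) := by gcongr
    _ = _ := by ring

/-- Ellipticity is inherited after division by `Λ`. -/
lemma le_re_scaled {M : Matrix (Fin d) (Fin d) ℂ} (hE : E.Lam / E.lam = K)
    (hM : ∀ v : Fin d → ℂ, E.lam * ∑ j, ‖v j‖ ^ 2 ≤
      (∑ k, ∑ k', starRingEnd ℂ (v k) * (M k k' * v k')).re) (v : Fin d → ℂ) :
    1 / K * ∑ j, ‖v j‖ ^ 2 ≤
      (∑ k, ∑ k', starRingEnd ℂ (v k) * (((E.Lam⁻¹ : ℝ) : ℂ) * M k k' * v k')).re := by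
  have hL := E.Lam_pos
  have hl := E.lam_pos
  have e : ∑ k, ∑ k', starRingEnd ℂ (v k) * (((E.Lam⁻¹ : ℝ) : ℂ) * M k k' * v k') =
      ((E.Lam⁻¹ : ℝ) : ℂ) * ∑ k, ∑ k', starRingEnd ℂ (v k) * (M k k' * v k') := by
    simp only [Finset.mul_sum]
    exact Finset.sum_congr rfl fun k _ => Finset.sum_congr rfl fun k' _ => by ring
  rw [e, Complex.re_ofReal_mul, ← hE, one_div_div]
  calc E.lam / E.Lam * ∑ j, ‖v j‖ ^ 2 = E.Lam⁻¹ * (E.lam * ∑ j, ‖v j‖ ^ 2) := by field_simp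
    _ ≤ _ := mul_le_mul_of_nonneg_left (hM v) (inv_pos.2 hL).le

lemma norm_scaled_le (hE : E.Lam / E.lam = K) {z : ℂ} (hz : ‖z‖ ≤ d * E.Lam ^ 2 / E.lam) :
    ‖((E.Lam⁻¹ : ℝ) : ℂ) * z‖ ≤ d * K := by
  have hL := E.Lam_pos
  have hl := E.lam_pos
  rw [norm_mul, Complex.norm_real, Real.norm_of_nonneg (inv_pos.2 hL).le]
  calc E.Lam⁻¹ * ‖z‖ ≤ E.Lam⁻¹ * (d * E.Lam ^ 2 / E.lam) :=
        mul_le_mul_of_nonneg_left hz (inv_pos.2 hL).le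
    _ = d * K := by rw [← hE]; field_simp

/-- The symbols of an environment satisfying the Fourier-space estimates. -/
theorem FourierEstimates.symbolData (hd : 0 < d) (hE : E.Lam / E.lam = K)
    (h : FourierEstimates E α₀ C₁ C₂ c C₀ αd Cd) (hα₀ : 0 < α₀) (hα₀' : α₀ ≤ 1) (hC₁ : 0 < C₁)
    (hC₂ : 0 < C₂) (hC₀ : 0 < C₀) (hCd : ∀ δ : ℝ, 0 < δ → δ ≤ 1 → 0 < Cd δ)
    (hlim : Tendsto (fun z : Freq d × ℝ => E.q (cplx z.1 0) z.2) (𝓝 0 ×ˢ 𝓝[>] 0) (𝓝 aHom))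
    {γ : ℝ} (hγ : IsStripWidth d K α₀ C₁ C₂ c γ) {η : ℝ} (hη : 0 < η)
    (hη1 : η ≤ E.Lam) {b : Freq d} (hb : ‖b‖ ≤ γ * Real.sqrt (η / E.Lam)) {α δ : ℝ}
    (hα : 0 < α) (hα' : α ≤ α₀) (hδ : 0 < δ) (hδ1 : δ ≤ 1) :
    SymbolData α α₀ δ (αd δ) C₀ (4 * C₁ * (2 * d + 1)) (Cd δ) (1 / K / 4) (d * K + C₁)
      (Real.sqrt (η / E.Lam)) b (E.relSymbol η b) (E.relMatrix aHom) := by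
  have hL := E.Lam_pos
  have hl := E.lam_pos
  have hK := E.one_le_ratio hd hE
  have hd1 : (1:ℝ) ≤ d := by exact_mod_cast hd
  set κ := Real.sqrt (η / E.Lam) with hκ
  have hκ0 : 0 < κ := Real.sqrt_pos.2 (by positivity)
  have hκ1 : κ ≤ 1 := Real.sqrt_le_one.2 ((div_le_one hL).2 hη1)
  obtain ⟨hb1, -, hb2⟩ := E.small_of_norm_le hd hE hγ hη hη1 hb
  have hq := fun k k' => E.contDiff_q hd hη (b := b) ⟨hb1, hb2⟩ k k'
  have hper := E.isPeriodic_q hd hη (b := b) ⟨hb1, hb2⟩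
  have hbc : ‖b‖ ≤ c * Real.sqrt (E.lam * η / E.Lam ^ 2) := by
    -- The width allowed by the derivative estimates is c√(λη)/Λ = cκ/√K, which explains the
    -- condition γ√K ≤ c.
    have e1 : E.lam * η / E.Lam ^ 2 = (η / E.Lam) / K := by rw [← hE]; field_simp
    have hsK : 0 < Real.sqrt K := Real.sqrt_pos.2 (by linarith)
    rw [e1, Real.sqrt_div (by positivity), ← hκ, ← mul_div_assoc, le_div_iff₀ hsK]
    calc ‖b‖ * Real.sqrt K ≤ γ * κ * Real.sqrt K := mul_le_mul_of_nonneg_right hb hsK.le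
      _ = γ * Real.sqrt K * κ := by ring
      _ ≤ c * κ := mul_le_mul_of_nonneg_right hγ.le_c hκ0.le
  have hcancel : ∀ t : ℝ, E.Lam⁻¹ * (t * E.Lam) = t := fun t => by field_simp
  have hBA : ∀ k k', ‖E.relMatrix aHom k k'‖ ≤ d * K + C₁ := fun k k' =>
    (norm_scaled_le hE (E.norm_limit_le hd hlim k k')).trans (by linarith)
  have hγα : 0 ≤ γ ^ α₀ := Real.rpow_nonneg hγ.pos.le _
  have hγ1 : γ ^ α₀ ≤ 1 := Real.rpow_le_one hγ.pos.le (by linarith [hγ.le_half]) hα₀.le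
  have hsub : ∀ ξ k k', ‖E.relSymbol η b ξ k k' - E.relSymbol η 0 ξ k k'‖ ≤ C₁ * γ ^ α₀ := by
    intro ξ k k'
    refine (h.norm_relSymbol_sub_real hα₀ hC₁.le hγ hη hη1 hb ξ k k').trans ?_
    refine mul_le_mul_of_nonneg_left ?_ hC₁.le
    refine Real.rpow_le_rpow (mul_nonneg hγ.pos.le hκ0.le) ?_ hα₀.le
    exact mul_le_of_le_one_right hγ.pos.le hκ1
  have hBQ : ∀ ξ k k', ‖E.relSymbol η b ξ k k'‖ ≤ d * K + C₁ := by
    intro ξ k k'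
    have h1 : ‖E.relSymbol η 0 ξ k k'‖ ≤ d * K := norm_scaled_le hE (E.norm_q_le hd hη ξ k k')
    have h2 := norm_sub_norm_le (E.relSymbol η b ξ k k') (E.relSymbol η 0 ξ k k')
    have h3 : C₁ * γ ^ α₀ ≤ C₁ := mul_le_of_le_one_right hC₁.le hγ1
    linarith [hsub ξ k k']
  have hB0 : 0 ≤ d * K + C₁ := by positivity
  have hl0 : 0 < 1 / K := by positivity
  have hl1 : 1 / K ≤ 1 := by rw [div_le_one (by linarith)]; exact hK
  refine ⟨hκ0, hκ1, ?_, ?_, ?_, ?_, ?_, ?_, ?_, ?_, hBA⟩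
  · refine hb.trans (mul_le_of_le_one_left hκ0.le (by linarith [hγ.le_half]))
  · exact fun k k' => contDiff_const.mul (hq k k')
  · intro k k' j ξ
    simp only [Environment.relSymbol]
    rw [show E.q (cplx (ξ + EuclideanSpace.single j (2 * Real.pi)) b) η = E.q (cplx ξ b) η from hper j ξ]
  · exact fun k k' ξ => h.norm_relSymbol_sub_le hd hE hα₀ hα₀' hC₁ hC₂ hlim hγ hη hη1 hb hα hα' k k' ξ
  · intro k k' n hn hn' j
    have h1 := (h.deriv η hη hη1 k k' b hbc n hn hn' j).const_mul (inv_pos.2 hL) (by positivity)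
    rw [hcancel] at h1
    have e : (partialDeriv j fun ξ => E.relSymbol η b ξ k k') = fun ξ =>
        ((E.Lam⁻¹ : ℝ) : ℂ) * partialDeriv j (fun ξ => E.q (cplx ξ b) η k k') ξ :=
      funext fun ξ => partialDeriv_const_mul j (hq k k') _ ξ
    rw [e]; exact h1
  · intro k k' ρ hρ j
    have hCδ := hCd δ hδ hδ1
    have h1 := (h.diff η hη hη1 k k' b hbc δ hδ hδ1 ρ hρ j).const_mul (inv_pos.2 hL) (by positivity)
    rw [hcancel] at h1
    have hsm : ContDiff ℝ (⊤ : ℕ∞) fun ζ => E.q (cplx (ζ + ρ) b) η k k' - E.q (cplx ζ b) η k k' :=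
      ((hq k k').comp (contDiff_id.add contDiff_const)).sub (hq k k')
    have e : (fun ξ => partialDeriv j (fun ζ => E.relSymbol η b (ζ + ρ) k k' - E.relSymbol η b ζ k k') ξ /
        ((‖ρ‖ ^ (1 - δ) : ℝ) : ℂ)) = fun ξ => ((E.Lam⁻¹ : ℝ) : ℂ) *
        (partialDeriv j (fun ζ => E.q (cplx (ζ + ρ) b) η k k' - E.q (cplx ζ b) η k k') ξ /
          ((‖ρ‖ ^ (1 - δ) : ℝ) : ℂ)) := by
      funext ξ
      simp only [Environment.relSymbol, ← mul_sub]
      rw [partialDeriv_const_mul j hsm, mul_div_assoc]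
    rw [e]; exact h1
  · intro ξ
    refine le_norm_symbol (M₀ := E.relSymbol η 0 ξ) (γ := γ) (ε := C₁ * γ ^ α₀) hκ0 hκ1 hl0 hl1
      (le_re_scaled hE (E.le_re_q hd hη ξ)) (hBQ ξ) hB0 (hsub ξ) (by positivity) hb hγ.pos.le
      hγ.le_half hγ.coercive
  · intro ξ
    refine le_norm_symbol (M₀ := E.relMatrix aHom) (γ := γ) (ε := 0) hκ0 hκ1 hl0 hl1
      (le_re_scaled hE (E.le_re_limit hd hlim)) hBA hB0 (fun k k' => by simp) le_rfl hb hγ.pos.le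
      hγ.le_half (le_trans ?_ hγ.coercive)
    refine mul_le_mul_of_nonneg_left ?_ (by positivity)
    have : 0 ≤ C₁ * γ ^ α₀ := by positivity
    linarith

lemma continuous_symbol {κ : ℝ} {b : Freq d} {M : Freq d → Matrix (Fin d) (Fin d) ℂ}
    (hM : ∀ k k', Continuous fun ξ => M ξ k k') : Continuous (symbol κ b M) := by
  unfold symbol
  refine continuous_const.add (continuous_finsetSum _ fun k _ => continuous_finsetSum _ fun k' _ => ?_)
  exact ((continuous_planeWave b _).sub continuous_const).mul
    ((hM k k').mul ((continuous_planeWave b _).sub continuous_const))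

lemma inv_add_sum_eq {η : ℝ} (hη : 0 < η) (b ξ : Freq d) (M : Freq d → Matrix (Fin d) (Fin d) ℂ) :
    ((η : ℂ) + ∑ k, ∑ k', (phaseInv b ξ k - 1) * (M ξ k k' * (phase b ξ k' - 1)))⁻¹ =
      ((E.Lam⁻¹ : ℝ) : ℂ) * (symbol (Real.sqrt (η / E.Lam)) b
        (fun ξ k k' => ((E.Lam⁻¹ : ℝ) : ℂ) * M ξ k k') ξ)⁻¹ := by
  have hL := E.Lam_pos
  unfold symbol
  rw [Real.sq_sqrt (by positivity), Complex.ofReal_inv, ← mul_inv]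
  congr 1
  have hL' : (E.Lam : ℂ) ≠ 0 := by exact_mod_cast hL.ne'
  rw [mul_add, Complex.ofReal_div, mul_div_cancel₀ _ hL', Finset.mul_sum]
  congr 1
  refine Finset.sum_congr rfl fun k _ => ?_
  rw [Finset.mul_sum]
  refine Finset.sum_congr rfl fun k' _ => ?_
  rw [phase, phaseInv]
  field_simp

/-- The Fourier representation of the discrepancy, with shifted contour. -/
theorem FourierEstimates.discrepancy_eq (hd : 0 < d) (hE : E.Lam / E.lam = K)
    (h : FourierEstimates E α₀ C₁ C₂ c C₀ αd Cd) (hα₀ : 0 < α₀) (hα₀' : α₀ ≤ 1) (hC₁ : 0 < C₁)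
    (hC₂ : 0 < C₂) (hC₀ : 0 < C₀) (hCd : ∀ δ : ℝ, 0 < δ → δ ≤ 1 → 0 < Cd δ)
    (hlim : Tendsto (fun z : Freq d × ℝ => E.q (cplx z.1 0) z.2) (𝓝 0 ×ˢ 𝓝[>] 0) (𝓝 aHom))
    {γ : ℝ} (hγ : IsStripWidth d K α₀ C₁ C₂ c γ) {η : ℝ} (hη : 0 < η)
    (hη1 : η ≤ E.Lam) {b : Freq d} (hb : ‖b‖ ≤ γ * Real.sqrt (η / E.Lam)) (x : Lattice d) :
    discrepancy E aHom η x = (((2 * Real.pi : ℝ) ^ d : ℂ))⁻¹ * ((E.Lam⁻¹ : ℝ) : ℂ) *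
      ∫ ξ in cube d, planeWave b x ξ *
        resolventDiff (Real.sqrt (η / E.Lam)) b (E.relSymbol η b) (E.relMatrix aHom) ξ := by
  have hL := E.Lam_pos
  have hl := E.lam_pos
  have hK := E.one_le_ratio hd hE
  have hd1 : (1:ℝ) ≤ d := by exact_mod_cast hd
  obtain ⟨hb1, hb3, hb2⟩ := E.small_of_norm_le hd hE hγ hη hη1 hb
  have hS := h.symbolData hd hE hα₀ hα₀' hC₁ hC₂ hC₀ hCd hlim hγ hη hη1 hb hα₀ le_rfl one_pos le_rfl
  have hκ := hS.κ_pos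
  have hne : ∀ {S : Freq d → ℂ}, (∀ ξ, 1 / K / 4 * (‖eVecL ξ‖ + Real.sqrt (η / E.Lam)) ^ 2 ≤ ‖S ξ‖) →
      ∀ ξ, S ξ ≠ 0 := fun hS' ξ => norm_pos_iff.1 (lt_of_lt_of_le (by positivity) (hS' ξ))
  -- The homogenized matrix is a constant field with ellipticity λ and entry bound dKΛ.
  have hlamM : E.lam ≤ d * K * E.Lam := by
    have := E.lam_le_Lam hd
    have hone : 1 ≤ (d : ℝ) * K := by nlinarith
    nlinarith
  have hMb : ∀ k k', ‖aHom k k'‖ ≤ d * K * E.Lam := fun k k' => by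
    refine (E.norm_limit_le hd hlim k k').trans (le_of_eq ?_)
    rw [← hE]; field_simp
  rw [discrepancy, E.greenAvg_eq hd hη ⟨hb1, hb2⟩ x,
    constGreen_eq hl hlamM hMb (E.le_re_limit hd hlim) hη hb1 hb3 x, ← mul_sub, mul_assoc]
  congr 1
  simp only [inv_add_sum_eq (E := E) hη b _ fun ξ => E.q (cplx ξ b) η,
    inv_add_sum_eq (E := E) hη b _ fun _ => aHom]
  rw [← integral_sub, ← integral_const_mul]
  · refine integral_congr_ae (Eventually.of_forall fun ξ => ?_)
    simp only [resolventDiff]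
    unfold Environment.relSymbol Environment.relMatrix
    ring
  · refine integrableOn_cube ((continuous_planeWave b x).mul (continuous_const.mul (Continuous.inv₀ ?_ ?_)))
    · exact continuous_symbol fun k k' => (hS.smooth k k').continuous
    · exact hne hS.lower
  · refine integrableOn_cube ((continuous_planeWave b x).mul (continuous_const.mul (Continuous.inv₀ ?_ ?_)))
    · exact continuous_symbol fun k k' => continuous_const
    · exact hne hS.lower_const

end Package

/-! ### Decay of lattice functions with a symbol representation -/

section Decay

variable {d : ℕ}

lemma latNorm_nonneg (x : Lattice d) : 0 ≤ latNorm x := Real.sqrt_nonneg _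

/-- Take b opposite to x, of length r; at x = 0 division by zero gives b = 0, which also works. -/
lemma exists_shift {r : ℝ} (hr : 0 ≤ r) (x : Lattice d) :
    ∃ b : Freq d, ‖b‖ ≤ r ∧ inner ℝ (latVec x) b = -r * latNorm x := by
  refine ⟨-((r / latNorm x) • latVec x), ?_, ?_⟩
  · rw [norm_neg, norm_smul, norm_latVec, Real.norm_of_nonneg (div_nonneg hr (latNorm_nonneg x))]
    rcases eq_or_ne (latNorm x) 0 with h | h
    · rw [h, mul_zero]; exact hr
    · rw [div_mul_cancel₀ _ h]
  · rw [inner_neg_right, inner_smul_right, real_inner_self_eq_norm_sq, norm_latVec]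
    rcases eq_or_ne (latNorm x) 0 with h | h
    · rw [h]; ring
    · field_simp

lemma norm_integral_planeWave_mul (b : Freq d) (x : Lattice d) (g : Freq d → ℂ) :
    ‖∫ ξ in cube d, planeWave b x ξ * g ξ‖ =
      Real.exp (inner ℝ (latVec x) b) * ‖∫ ξ in cube d, character x ξ * g ξ‖ := by
  simp only [planeWave_eq, mul_assoc]
  rw [integral_const_mul, norm_mul, Complex.norm_exp_ofReal]

lemma sub_eq_integral {D : Lattice d → ℂ} {b : Freq d} {c : ℂ} {g : Freq d → ℂ} (hg : Continuous g)
    (hD : ∀ x, D x = c * ∫ ξ in cube d, planeWave b x ξ * g ξ) (x y : Lattice d) :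
    D (x + y) - D x = c * ∫ ξ in cube d, planeWave b x ξ * ((planeWave b y ξ - 1) * g ξ) := by
  rw [hD, hD, ← mul_sub, ← integral_sub]
  · congr 2
    funext ξ
    rw [planeWave_add]; ring
  · exact integrableOn_cube ((continuous_planeWave b _).mul hg)
  · exact integrableOn_cube ((continuous_planeWave b _).mul hg)

lemma norm_le_mul_of_forall_le {v : EuclideanSpace ℂ (Fin d)} {B : ℝ} (hB : 0 ≤ B)
    (h : ∀ i, ‖v i‖ ≤ B) : ‖v‖ ≤ d * B := by
  rw [EuclideanSpace.norm_eq]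
  refine Real.sqrt_le_iff.2 ⟨by positivity, ?_⟩
  calc ∑ i, ‖v i‖ ^ 2 ≤ ∑ _i : Fin d, B ^ 2 :=
        Finset.sum_le_sum fun i _ => pow_le_pow_left₀ (norm_nonneg _) (h i) 2
    _ = d * B ^ 2 := by simp
    _ ≤ (d * B) ^ 2 := by
      rcases Nat.eq_zero_or_pos d with h0 | h0
      · simp [h0]
      · have hd1 : (1:ℝ) ≤ d := by exact_mod_cast h0
        rw [mul_pow]
        exact mul_le_mul_of_nonneg_right (by nlinarith) (by positivity)

/-- `D` has, on the strip of relative width `γ`, a representation as Fourier integral of the difference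
of two resolvents. -/
structure IsSymbolRep (γ α₀ C₀ C₁ c₁ B : ℝ) (αd Cd : ℝ → ℝ) (κ : ℝ) (c : ℂ)
    (Q : Freq d → Freq d → Matrix (Fin d) (Fin d) ℂ) (A : Matrix (Fin d) (Fin d) ℂ)
    (D : Lattice d → ℂ) : Prop where
  κ_pos : 0 < κ
  κ_le : κ ≤ 1
  data : ∀ b : Freq d, ‖b‖ ≤ γ * κ → ∀ α δ : ℝ, 0 < α → α ≤ α₀ → 0 < δ → δ ≤ 1 →
    SymbolData α α₀ δ (αd δ) C₀ C₁ (Cd δ) c₁ B κ b (Q b) A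
  rep : ∀ b : Freq d, ‖b‖ ≤ γ * κ → ∀ x, D x = c * ∫ ξ in cube d, planeWave b x ξ *
    resolventDiff κ b (Q b) A ξ

/-- The gain in the decay exponent. -/
noncomputable def decayGain (α₀ : ℝ) (αd : ℝ → ℝ) (δ : ℝ) : ℝ := min (min α₀ (αd (δ / 2))) (δ / 4)

variable {γ α₀ C₀ C₁ c₁ B : ℝ} {αd Cd : ℝ → ℝ}

lemma decayGain_pos (hα₀ : 0 < α₀) (hαd : ∀ δ : ℝ, 0 < δ → δ ≤ 1 → 0 < αd δ) {δ : ℝ} (hδ : 0 < δ)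
    (hδ1 : δ ≤ 1) : 0 < decayGain α₀ αd δ :=
  lt_min (lt_min hα₀ (hαd _ (by linarith) (by linarith))) (by linarith)

lemma decayGain_le (δ : ℝ) : decayGain α₀ αd δ ≤ δ / 4 := min_le_right _ _

lemma decayGain_le_left (δ : ℝ) : decayGain α₀ αd δ ≤ α₀ := (min_le_left _ _).trans (min_le_left _ _)

/-- The constants in `IsSymbolRep` are positive. -/
structure RepConstants (γ α₀ C₀ C₁ c₁ B : ℝ) (αd Cd : ℝ → ℝ) : Prop where
  γ_pos : 0 < γ
  γ_le : γ ≤ 1 / 2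
  α₀_pos : 0 < α₀
  C₀_pos : 0 < C₀
  C₁_pos : 0 < C₁
  c₁_pos : 0 < c₁
  B_nonneg : 0 ≤ B
  αd_pos : ∀ δ : ℝ, 0 < δ → δ ≤ 1 → 0 < αd δ
  Cd_pos : ∀ δ : ℝ, 0 < δ → δ ≤ 1 → 0 < Cd δ

/-- The data are taken at δ/2. A gain of at most δ/4 satisfies both α < δ/2 and δ/2 + α < 1 for all
δ ≤ 1. -/
lemma RepConstants.admissible (hc : RepConstants γ α₀ C₀ C₁ c₁ B αd Cd) {δ : ℝ} (hδ : 0 < δ)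
    (hδ1 : δ ≤ 1) :
    Admissible (decayGain α₀ αd δ) α₀ (δ / 2) (αd (δ / 2)) C₀ C₁ (Cd (δ / 2)) c₁ B where
  pos := decayGain_pos hc.α₀_pos hc.αd_pos hδ hδ1
  le := decayGain_le_left δ
  le' := (min_le_left _ _).trans (min_le_right _ _)
  add_lt := by linarith [decayGain_le (α₀ := α₀) (αd := αd) δ]
  nonneg := by linarith
  C₀_pos := hc.C₀_pos
  C₁_pos := hc.C₁_pos
  Cd_pos := hc.Cd_pos _ (by linarith) (by linarith)
  c₁_pos := hc.c₁_pos
  B_nonneg := hc.B_nonneg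

variable {κ : ℝ} {c : ℂ} {Q : Freq d → Freq d → Matrix (Fin d) (Fin d) ℂ}
  {A : Matrix (Fin d) (Fin d) ℂ} {D : Lattice d → ℂ}

lemma IsSymbolRep.data_gain (h : IsSymbolRep γ α₀ C₀ C₁ c₁ B αd Cd κ c Q A D)
    (hc : RepConstants γ α₀ C₀ C₁ c₁ B αd Cd) {δ : ℝ} (hδ : 0 < δ) (hδ1 : δ ≤ 1) {b : Freq d}
    (hb : ‖b‖ ≤ γ * κ) :
    SymbolData (decayGain α₀ αd δ) α₀ (δ / 2) (αd (δ / 2)) C₀ C₁ (Cd (δ / 2)) c₁ B κ b (Q b) A :=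
  h.data b hb _ _ (decayGain_pos hc.α₀_pos hc.αd_pos hδ hδ1) (decayGain_le_left δ) (by linarith)
    (by linarith)

lemma IsSymbolRep.fwdDiff_eq (h : IsSymbolRep γ α₀ C₀ C₁ c₁ B αd Cd κ c Q A D) (hd : d ≠ 0)
    (hc : RepConstants γ α₀ C₀ C₁ c₁ B αd Cd) {b : Freq d} (hb : ‖b‖ ≤ γ * κ) (j : Fin d)
    (x : Lattice d) :
    fwdDiff j D x = c * ∫ ξ in cube d, planeWave b x ξ *
      ((planeWave b (unitVec j) ξ - 1) * resolventDiff κ b (Q b) A ξ) :=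
  sub_eq_integral (continuous_resolventDiff hd (hc.admissible one_pos le_rfl)
    (h.data_gain hc one_pos le_rfl hb)) (h.rep b hb) x (unitVec j)

/-- The representation may use a different b for each x, while the decay constant is uniform in b;
so b is chosen opposite to x with the full length γκ. -/
theorem exists_norm_le_of_isSymbolRep (hd : 2 ≤ d) (hc : RepConstants γ α₀ C₀ C₁ c₁ B αd Cd) {δ : ℝ}
    (hδ : 0 < δ) (hδ1 : δ ≤ 1) :
    ∃ C : ℝ, 0 ≤ C ∧ ∀ (κ : ℝ) (c : ℂ) (Q : Freq d → Freq d → Matrix (Fin d) (Fin d) ℂ)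
      (A : Matrix (Fin d) (Fin d) ℂ) (D : Lattice d → ℂ),
      IsSymbolRep γ α₀ C₀ C₁ c₁ B αd Cd κ c Q A D → ∀ x,
      ‖D x‖ ≤ ‖c‖ * (C * (latNorm x + 1) ^ (-((d : ℝ) - 2 + decayGain α₀ αd δ))) *
        Real.exp (-γ * κ * latNorm x) := by
  obtain ⟨C, hC, h⟩ := exists_decay hd (hc.admissible hδ hδ1)
  refine ⟨C, hC, fun κ c Q A D hD x => ?_⟩
  obtain ⟨b, hb, hbx⟩ := exists_shift (mul_nonneg hc.γ_pos.le hD.κ_pos.le) x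
  rw [hD.rep b hb x, norm_mul, norm_integral_planeWave_mul, hbx, mul_comm (Real.exp _), ← mul_assoc,
    ← neg_mul]
  gcongr
  exact h κ b (Q b) A (hD.data_gain hc hδ hδ1 hb) x

theorem exists_norm_fwdDiff_le_of_isSymbolRep (hd : d ≠ 0) (hc : RepConstants γ α₀ C₀ C₁ c₁ B αd Cd)
    {δ : ℝ} (hδ : 0 < δ) (hδ1 : δ ≤ 1) :
    ∃ C : ℝ, 0 ≤ C ∧ ∀ (κ : ℝ) (c : ℂ) (Q : Freq d → Freq d → Matrix (Fin d) (Fin d) ℂ)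
      (A : Matrix (Fin d) (Fin d) ℂ) (D : Lattice d → ℂ),
      IsSymbolRep γ α₀ C₀ C₁ c₁ B αd Cd κ c Q A D → ∀ j x,
      ‖fwdDiff j D x‖ ≤ ‖c‖ * (C * (latNorm x + 1) ^ (-((d : ℝ) - 1 + decayGain α₀ αd δ))) *
        Real.exp (-γ * κ * latNorm x) := by
  obtain ⟨C, hC, h⟩ := exists_decay_fst hd (hc.admissible hδ hδ1)
  refine ⟨C, hC, fun κ c Q A D hD j x => ?_⟩
  obtain ⟨b, hb, hbx⟩ := exists_shift (mul_nonneg hc.γ_pos.le hD.κ_pos.le) x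
  rw [hD.fwdDiff_eq hd hc hb j x, norm_mul, norm_integral_planeWave_mul, hbx, mul_comm (Real.exp _),
    ← mul_assoc, ← neg_mul]
  gcongr
  exact h κ b (Q b) A (hD.data_gain hc hδ hδ1 hb) j x

theorem exists_norm_fwdDiff_sub_le_near (hd : d ≠ 0) (hc : RepConstants γ α₀ C₀ C₁ c₁ B αd Cd)
    {δ : ℝ} (hδ : 0 < δ) (hδ1 : δ ≤ 1) :
    ∃ C : ℝ, 0 ≤ C ∧ ∀ (κ : ℝ) (c : ℂ) (Q : Freq d → Freq d → Matrix (Fin d) (Fin d) ℂ)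
      (A : Matrix (Fin d) (Fin d) ℂ) (D : Lattice d → ℂ),
      IsSymbolRep γ α₀ C₀ C₁ c₁ B αd Cd κ c Q A D → ∀ j x y,
      latNorm x + 1 ≤ 2 * (latNorm (x + y) + 1) → κ * latNorm y ≤ 1 → y ≠ 0 →
      ‖fwdDiff j D (x + y) - fwdDiff j D x‖ ≤
        ‖c‖ * (C * (latNorm y ^ (1 - δ) * (latNorm x + 1) ^ (-((d : ℝ) - δ + decayGain α₀ αd δ)))) *
        Real.exp (-γ * κ * latNorm x) := by
  have hlt : decayGain α₀ αd δ < δ / 2 := by linarith [decayGain_le (α₀ := α₀) (αd := αd) δ]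
  obtain ⟨C, hC, h⟩ := exists_decay_snd hd (hc.admissible hδ hδ1) hδ hδ1 hlt
  refine ⟨C, hC, fun κ c Q A D hD j x y hxy hy hy0 => ?_⟩
  obtain ⟨b, hb, hbx⟩ := exists_shift (mul_nonneg hc.γ_pos.le hD.κ_pos.le) x
  have hcont := continuous_resolventDiff hd (hc.admissible hδ hδ1) (hD.data_gain hc hδ hδ1 hb)
  rw [sub_eq_integral (((continuous_planeWave b (unitVec j)).sub continuous_const).mul hcont)
    (hD.fwdDiff_eq hd hc hb j) x y, norm_mul, norm_integral_planeWave_mul, hbx,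
    mul_comm (Real.exp _), ← mul_assoc, ← neg_mul]
  gcongr
  exact h κ b (Q b) A (hD.data_gain hc hδ hδ1 hb) j x y hxy hy hy0

lemma mul_exp_neg_le {γ t : ℝ} (hγ : 0 < γ) : t * Real.exp (-(γ / 4 * t)) ≤ 4 / γ := by
  have h1 := Real.add_one_le_exp (γ / 4 * t)
  rw [Real.exp_neg, ← div_eq_mul_inv, div_le_iff₀ (Real.exp_pos _), div_mul_eq_mul_div, le_div_iff₀ hγ]
  linarith

lemma one_le_mul_rpow {t δ : ℝ} (ht : 0 ≤ t) (hδ : 0 ≤ δ) (hδ1 : δ ≤ 1) : t ^ (1 - δ) ≤ 1 + t := by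
  rcases le_total t 1 with h | h
  · linarith [Real.rpow_le_one ht h (sub_nonneg.2 hδ1)]
  · calc t ^ (1 - δ) ≤ t ^ (1:ℝ) := Real.rpow_le_rpow_of_exponent_le h (by linarith)
      _ = t := Real.rpow_one t
      _ ≤ 1 + t := by linarith

/-- Widely separated points: the exponential decay on the scale `κ⁻¹` compensates the missing
regularity. -/
lemma rpow_mul_exp_le {γ κ n m w p a δ : ℝ} (hγ : 0 < γ) (hγ1 : γ ≤ 1 / 2) (hκ : 0 < κ) (hκ1 : κ ≤ 1)
    (hn : 0 ≤ n) (hnm : n + 1 ≤ 2 * (m + 1)) (hw : 1 ≤ κ * w) (hp : 0 ≤ p) (hδ : 0 ≤ δ)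
    (hδ1 : δ ≤ 1) (ha : -p = 1 - δ + -a) :
    (n + 1) ^ (-p) * Real.exp (-γ * κ * n) + (m + 1) ^ (-p) * Real.exp (-γ * κ * m) ≤
      (1 + 2 ^ p * Real.exp 1) * (2 + 4 / γ) * (w ^ (1 - δ) * (n + 1) ^ (-a)) *
        Real.exp (-(γ / 4) * κ * n) := by
  have hn1 : 0 < n + 1 := by linarith
  have hw0 : 0 < w := pos_of_mul_pos_right (by linarith) hκ.le
  have hκn : 0 ≤ κ * n := mul_nonneg hκ.le hn
  set e := Real.exp (-(γ / 2) * κ * n) with he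
  have e1 : Real.exp (-γ * κ * n) ≤ e := by
    refine Real.exp_le_exp.2 ?_
    nlinarith [mul_nonneg hγ.le hκn]
  -- Here m ≥ (n - 1)/2 and γκ ≤ 1/2, so half of the rate survives at the cost of a constant factor.
  have e2 : Real.exp (-γ * κ * m) ≤ Real.exp 1 * e := by
    rw [he, ← Real.exp_add]
    refine Real.exp_le_exp.2 ?_
    have h1 : γ * κ * (n + 1) ≤ γ * κ * (2 * (m + 1)) :=
      mul_le_mul_of_nonneg_left hnm (mul_nonneg hγ.le hκ.le)
    have h2 : γ * κ ≤ 1 / 2 := by nlinarith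
    nlinarith
  have r2 : (m + 1) ^ (-p) ≤ 2 ^ p * (n + 1) ^ (-p) := by
    have h1 : (n + 1) / 2 ≤ m + 1 := by linarith
    have h2 := Real.rpow_le_rpow_of_nonpos (by linarith : 0 < (n + 1) / 2) h1 (by linarith : -p ≤ 0)
    refine h2.trans (le_of_eq ?_)
    rw [Real.div_rpow hn1.le (by norm_num), Real.rpow_neg (by norm_num : (0:ℝ) ≤ 2), div_inv_eq_mul, mul_comm]
  have s1 : (n + 1) ^ (-p) * Real.exp (-γ * κ * n) + (m + 1) ^ (-p) * Real.exp (-γ * κ * m) ≤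
      (1 + 2 ^ p * Real.exp 1) * ((n + 1) ^ (-p) * e) := by
    have t1 : (n + 1) ^ (-p) * Real.exp (-γ * κ * n) ≤ (n + 1) ^ (-p) * e :=
      mul_le_mul_of_nonneg_left e1 (Real.rpow_nonneg hn1.le _)
    have t2 : (m + 1) ^ (-p) * Real.exp (-γ * κ * m) ≤ 2 ^ p * (n + 1) ^ (-p) * (Real.exp 1 * e) :=
      mul_le_mul r2 e2 (Real.exp_pos _).le (by positivity)
    linarith
  -- The missing power (n+1)^{1-δ} is at most (κ(n+1)w)^{1-δ} since κw ≥ 1. The growth of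
  -- (κ(n+1))^{1-δ} is at most linear in κn, and is absorbed by another part of the exponential.
  have s2 : (n + 1) ^ (-p) ≤ (2 + κ * n) * (w ^ (1 - δ) * (n + 1) ^ (-a)) := by
    rw [ha, Real.rpow_add hn1]
    have h1 : (n + 1) ^ (1 - δ) ≤ (2 + κ * n) * w ^ (1 - δ) := by
      calc (n + 1) ^ (1 - δ) ≤ (κ * (n + 1) * w) ^ (1 - δ) := by
            refine Real.rpow_le_rpow hn1.le ?_ (by linarith)
            nlinarith
        _ = (κ * (n + 1)) ^ (1 - δ) * w ^ (1 - δ) := Real.mul_rpow (by positivity) hw0.le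
        _ ≤ (1 + κ * (n + 1)) * w ^ (1 - δ) :=
            mul_le_mul_of_nonneg_right (one_le_mul_rpow (by positivity) hδ hδ1) (by positivity)
        _ ≤ _ := mul_le_mul_of_nonneg_right (by linarith) (by positivity)
    calc (n + 1) ^ (1 - δ) * (n + 1) ^ (-a) ≤ (2 + κ * n) * w ^ (1 - δ) * (n + 1) ^ (-a) :=
          mul_le_mul_of_nonneg_right h1 (by positivity)
      _ = _ := by ring
  have s3 : (2 + κ * n) * e ≤ (2 + 4 / γ) * Real.exp (-(γ / 4) * κ * n) := by
    have h0 : e = Real.exp (-(γ / 4 * (κ * n))) * Real.exp (-(γ / 4) * κ * n) := by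
      rw [he, ← Real.exp_add]; congr 1; ring
    rw [h0, ← mul_assoc]
    refine mul_le_mul_of_nonneg_right ?_ (Real.exp_pos _).le
    have h1 := mul_exp_neg_le (t := κ * n) hγ
    have h2 : Real.exp (-(γ / 4 * (κ * n))) ≤ 1 := Real.exp_le_one_iff.2 (by
      have : 0 ≤ γ / 4 * (κ * n) := by positivity
      linarith)
    linarith
  calc _ ≤ (1 + 2 ^ p * Real.exp 1) * ((n + 1) ^ (-p) * e) := s1
    _ ≤ (1 + 2 ^ p * Real.exp 1) * ((2 + κ * n) * (w ^ (1 - δ) * (n + 1) ^ (-a)) * e) := by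
        refine mul_le_mul_of_nonneg_left ?_ (by positivity)
        exact mul_le_mul_of_nonneg_right s2 (Real.exp_pos _).le
    _ = (1 + 2 ^ p * Real.exp 1) * (w ^ (1 - δ) * (n + 1) ^ (-a)) * ((2 + κ * n) * e) := by ring
    _ ≤ (1 + 2 ^ p * Real.exp 1) * (w ^ (1 - δ) * (n + 1) ^ (-a)) *
          ((2 + 4 / γ) * Real.exp (-(γ / 4) * κ * n)) := mul_le_mul_of_nonneg_left s3 (by positivity)
    _ = _ := by ring

/-- If κ|y| ≤ 1, the oscillatory estimate applies with one common shift b. Otherwise the two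
gradients are bounded separately, and the exponential on scale κ⁻¹ < |y| supplies the factor
|y|^{1-δ}; this lowers the rate from γ to γ/4. -/
theorem exists_norm_fwdDiff_sub_le (hd : d ≠ 0) (hc : RepConstants γ α₀ C₀ C₁ c₁ B αd Cd)
    {δ : ℝ} (hδ : 0 < δ) (hδ1 : δ ≤ 1) :
    ∃ C : ℝ, 0 ≤ C ∧ ∀ (κ : ℝ) (c : ℂ) (Q : Freq d → Freq d → Matrix (Fin d) (Fin d) ℂ)
      (A : Matrix (Fin d) (Fin d) ℂ) (D : Lattice d → ℂ),
      IsSymbolRep γ α₀ C₀ C₁ c₁ B αd Cd κ c Q A D → ∀ j x y,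
      latNorm x + 1 ≤ 2 * (latNorm (x + y) + 1) →
      ‖fwdDiff j D (x + y) - fwdDiff j D x‖ ≤
        ‖c‖ * (C * (latNorm y ^ (1 - δ) * (latNorm x + 1) ^ (-((d : ℝ) - δ + decayGain α₀ αd δ)))) *
        Real.exp (-(γ / 4) * κ * latNorm x) := by
  obtain ⟨Cn, hCn, hn⟩ := exists_norm_fwdDiff_sub_le_near hd hc hδ hδ1
  obtain ⟨Cf, hCf, hf⟩ := exists_norm_fwdDiff_le_of_isSymbolRep hd hc hδ hδ1
  have hγ := hc.γ_pos
  have hd1 : (1:ℝ) ≤ d := by exact_mod_cast Nat.one_le_iff_ne_zero.2 hd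
  have hg := decayGain_pos hc.α₀_pos hc.αd_pos hδ hδ1
  set p : ℝ := (d : ℝ) - 1 + decayGain α₀ αd δ with hp
  set a : ℝ := (d : ℝ) - δ + decayGain α₀ αd δ with ha
  set Cw : ℝ := (1 + 2 ^ p * Real.exp 1) * (2 + 4 / γ) with hCw
  have hCw0 : 0 ≤ Cw := by positivity
  refine ⟨Cn + Cf * Cw, by positivity, fun κ c Q A D hD j x y hxy => ?_⟩
  have hκ := hD.κ_pos
  have hx := latNorm_nonneg x
  have hy := latNorm_nonneg y
  set R : ℝ := latNorm y ^ (1 - δ) * (latNorm x + 1) ^ (-a) with hR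
  have hR0 : 0 ≤ R := by positivity
  rcases eq_or_ne y 0 with hy0 | hy0
  · rw [hy0, add_zero, sub_self, norm_zero]; positivity
  rcases le_total (κ * latNorm y) 1 with hle | hge
  · refine (hn κ c Q A D hD j x y hxy hle hy0).trans ?_
    refine mul_le_mul (mul_le_mul_of_nonneg_left ?_ (norm_nonneg c)) ?_ (Real.exp_pos _).le
      (by positivity)
    · exact mul_le_mul_of_nonneg_right (by linarith [mul_nonneg hCf hCw0]) hR0
    · refine Real.exp_le_exp.2 ?_
      have : 0 ≤ γ * (κ * latNorm x) := by positivity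
      nlinarith
  · have h1 := hf κ c Q A D hD j x
    have h2 := hf κ c Q A D hD j (x + y)
    have h3 := rpow_mul_exp_le (p := p) (a := a) hγ hc.γ_le hκ hD.κ_le hx hxy
      hge (by simp only [hp]; linarith) hδ.le hδ1 (by simp only [hp, ha]; ring)
    calc ‖fwdDiff j D (x + y) - fwdDiff j D x‖ ≤ ‖fwdDiff j D (x + y)‖ + ‖fwdDiff j D x‖ :=
          norm_sub_le _ _
      _ ≤ ‖c‖ * Cf * ((latNorm x + 1) ^ (-p) * Real.exp (-γ * κ * latNorm x) +
            (latNorm (x + y) + 1) ^ (-p) * Real.exp (-γ * κ * latNorm (x + y))) := by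
          linarith
      _ ≤ ‖c‖ * Cf * (Cw * R * Real.exp (-(γ / 4) * κ * latNorm x)) :=
          mul_le_mul_of_nonneg_left h3 (by positivity)
      _ = ‖c‖ * (Cf * Cw * R) * Real.exp (-(γ / 4) * κ * latNorm x) := by ring
      _ ≤ _ := by
          refine mul_le_mul_of_nonneg_right (mul_le_mul_of_nonneg_left ?_ (norm_nonneg c))
            (Real.exp_pos _).le
          exact mul_le_mul_of_nonneg_right (by linarith) hR0

end Decay

/-! ### The decay estimates for an environment -/

section Main

variable {d : ℕ} {E : Environment.{u} d} {K α₀ C₁ C₂ c C₀ : ℝ} {αd Cd : ℝ → ℝ}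
  {aHom : Matrix (Fin d) (Fin d) ℂ}

/-- The prefactor of the Fourier representation. -/
noncomputable def Environment.prefactor (E : Environment.{u} d) : ℂ :=
  (((2 * Real.pi : ℝ) ^ d : ℂ))⁻¹ * ((E.Lam⁻¹ : ℝ) : ℂ)

lemma Environment.norm_prefactor_le (E : Environment.{u} d) : ‖E.prefactor‖ ≤ E.Lam⁻¹ := by
  have hL := inv_pos.2 E.Lam_pos
  have hpi : (1:ℝ) ≤ (2 * Real.pi) ^ d := one_le_pow₀ (by linarith [Real.pi_gt_three])
  rw [prefactor, norm_mul, Complex.norm_real, Real.norm_of_nonneg hL.le, norm_inv, norm_pow,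
    Complex.norm_real, Real.norm_of_nonneg (by positivity)]
  exact mul_le_of_le_one_left hL.le (inv_le_one_of_one_le₀ hpi)

theorem FourierEstimates.isSymbolRep (hd : 0 < d) (hE : E.Lam / E.lam = K)
    (h : FourierEstimates E α₀ C₁ C₂ c C₀ αd Cd) (hα₀ : 0 < α₀) (hα₀' : α₀ ≤ 1) (hC₁ : 0 < C₁)
    (hC₂ : 0 < C₂) (hC₀ : 0 < C₀) (hCd : ∀ δ : ℝ, 0 < δ → δ ≤ 1 → 0 < Cd δ)
    (hlim : Tendsto (fun z : Freq d × ℝ => E.q (cplx z.1 0) z.2) (𝓝 0 ×ˢ 𝓝[>] 0) (𝓝 aHom))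
    {γ : ℝ} (hγ : IsStripWidth d K α₀ C₁ C₂ c γ) {η : ℝ} (hη : 0 < η) (hη1 : η ≤ E.Lam) :
    IsSymbolRep γ α₀ C₀ (4 * C₁ * (2 * d + 1)) (1 / K / 4) (d * K + C₁) αd Cd (Real.sqrt (η / E.Lam))
      E.prefactor (fun b => E.relSymbol η b) (E.relMatrix aHom) (discrepancy E aHom η) where
  κ_pos := Real.sqrt_pos.2 (div_pos hη E.Lam_pos)
  κ_le := Real.sqrt_le_one.2 ((div_le_one E.Lam_pos).2 hη1)
  data _ hb _ _ hα hα' hδ hδ1 :=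
    h.symbolData hd hE hα₀ hα₀' hC₁ hC₂ hC₀ hCd hlim hγ hη hη1 hb hα hα' hδ hδ1
  rep _ hb := h.discrepancy_eq hd hE hα₀ hα₀' hC₁ hC₂ hC₀ hCd hlim hγ hη hη1 hb

lemma mul_rpow_neg_le {n L t C C' p e : ℝ} (hn : 0 ≤ n) (hL : 0 < L) (ht : t ≤ L⁻¹)
    (hC : 0 ≤ C) (hC' : C ≤ C') (he : 0 ≤ e) :
    t * (C * (n + 1) ^ (-p)) * e ≤ C' / (L * (n + 1) ^ p) * e := by
  refine mul_le_mul_of_nonneg_right ?_ he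
  have hp : 0 < (n + 1) ^ p := Real.rpow_pos_of_pos (by linarith) _
  rw [Real.rpow_neg (by linarith)]
  calc t * (C * ((n + 1) ^ p)⁻¹) ≤ L⁻¹ * (C' * ((n + 1) ^ p)⁻¹) := by gcongr
    _ = _ := by field_simp

end Main

end LatticeHomog

theorem theorem3p2 (d : ℕ) (hd : 1 ≤ d)
    -- the ellipticity ratio and the constants in the Fourier-space estimates
    (K α₀ C₁ C₂ c C₀ : ℝ) (αd Cd : ℝ → ℝ)
    (hα₀ : 0 < α₀) (hα₀' : α₀ ≤ 1) (hC₁ : 0 < C₁) (hC₂ : 0 < C₂) (hc : 0 < c) (hC₀ : 0 < C₀)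
    (hαd : ∀ δ : ℝ, 0 < δ → δ ≤ 1 → 0 < αd δ) (hCd : ∀ δ : ℝ, 0 < δ → δ ≤ 1 → 0 < Cd δ) :
    ∃ (α γ C : ℝ) (αH CH : ℝ → ℝ),
      0 < α ∧ α ≤ 1 ∧ 0 < γ ∧ 0 < C ∧
      (∀ δ : ℝ, 0 < δ → δ ≤ 1 → 0 < αH δ ∧ αH δ < δ ∧ 0 < CH δ) ∧
      ∀ E : LatticeHomog.Environment.{u} d, E.Lam / E.lam = K →
        LatticeHomog.FourierEstimates E α₀ C₁ C₂ c C₀ αd Cd →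
        ∃ aHom : Matrix (Fin d) (Fin d) ℂ,
          -- `aHom = q(0,0)`, the limit of `q(ξ,η)` as `(ξ,η) → (0,0)`, `ξ` real, `η > 0`
          Tendsto (fun z : EuclideanSpace ℝ (Fin d) × ℝ => E.q (LatticeHomog.cplx z.1 0) z.2)
            (𝓝 0 ×ˢ 𝓝[>] 0) (𝓝 aHom) ∧
          ∀ η : ℝ, 0 < η → η ≤ E.Lam →
            (2 ≤ d → ∀ x : LatticeHomog.Lattice d,
              ‖LatticeHomog.discrepancy E aHom η x‖
                ≤ C / (E.Lam * (LatticeHomog.latNorm x + 1) ^ ((d : ℝ) - 2 + α))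
                  * Real.exp (-γ * Real.sqrt (η / E.Lam) * LatticeHomog.latNorm x)) ∧
            (∀ x : LatticeHomog.Lattice d,
              ‖LatticeHomog.latGrad (LatticeHomog.discrepancy E aHom η) x‖
                ≤ C / (E.Lam * (LatticeHomog.latNorm x + 1) ^ ((d : ℝ) - 1 + α))
                  * Real.exp (-γ * Real.sqrt (η / E.Lam) * LatticeHomog.latNorm x)) ∧
            (∀ δ : ℝ, 0 < δ → δ ≤ 1 → ∀ x x' : LatticeHomog.Lattice d,
              1 / 2 ≤ (LatticeHomog.latNorm x' + 1) / (LatticeHomog.latNorm x + 1) →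
              (LatticeHomog.latNorm x' + 1) / (LatticeHomog.latNorm x + 1) ≤ 2 →
              ‖LatticeHomog.latGrad (LatticeHomog.discrepancy E aHom η) x'
                  - LatticeHomog.latGrad (LatticeHomog.discrepancy E aHom η) x‖
                ≤ LatticeHomog.latNorm (x' - x) ^ (1 - δ)
                  * (CH δ / (E.Lam * (LatticeHomog.latNorm x + 1) ^ ((d : ℝ) - δ + αH δ)))
                  * Real.exp (-γ * Real.sqrt (η / E.Lam) * LatticeHomog.latNorm x)) := by
  -- All constants are fixed before any environment is given, so K may be an impossible ratio. Every
  -- environment has ratio at least one, and then K' = K.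
  set K' : ℝ := max K 1 with hK'
  have hK'1 : 1 ≤ K' := le_max_right _ _
  have hd0 : d ≠ 0 := by omega
  have hd1 : (1:ℝ) ≤ d := by exact_mod_cast hd
  obtain ⟨γ, hγ⟩ := LatticeHomog.exists_isStripWidth d (K := K') (C₁ := C₁) (by linarith) hα₀ hC₂ hc
  have hγ0 := hγ.pos
  have hrc : LatticeHomog.RepConstants γ α₀ C₀ (4 * C₁ * (2 * d + 1)) (1 / K' / 4) (d * K' + C₁) αd Cd :=
    ⟨hγ.pos, hγ.le_half, hα₀, hC₀, by positivity, by positivity, by positivity, hαd, hCd⟩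
  -- One constant must be named for every d, although the estimate of the function itself is
  -- available only for d ≥ 2.
  have hval : ∃ Cv : ℝ, 0 ≤ Cv ∧ (2 ≤ d → ∀ (κ : ℝ) (c : ℂ)
      (Q : LatticeHomog.Freq d → LatticeHomog.Freq d → Matrix (Fin d) (Fin d) ℂ)
      (A : Matrix (Fin d) (Fin d) ℂ) (D : LatticeHomog.Lattice d → ℂ),
      LatticeHomog.IsSymbolRep γ α₀ C₀ (4 * C₁ * (2 * d + 1)) (1 / K' / 4) (d * K' + C₁) αd Cd
        κ c Q A D → ∀ x,
      ‖D x‖ ≤ ‖c‖ * (Cv * (LatticeHomog.latNorm x + 1) ^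
        (-((d : ℝ) - 2 + LatticeHomog.decayGain α₀ αd 1))) *
        Real.exp (-γ * κ * LatticeHomog.latNorm x)) := by
    by_cases h2 : 2 ≤ d
    · obtain ⟨Cv, h0, h1⟩ := LatticeHomog.exists_norm_le_of_isSymbolRep h2 hrc one_pos le_rfl
      exact ⟨Cv, h0, fun _ => h1⟩
    · exact ⟨0, le_rfl, fun h => absurd h h2⟩
  obtain ⟨Cv, hCv, hv⟩ := hval
  obtain ⟨Cf, hCf, hf⟩ := LatticeHomog.exists_norm_fwdDiff_le_of_isSymbolRep hd0 hrc one_pos le_rfl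
  have hsnd : ∀ δ : ℝ, ∃ C : ℝ, 0 < δ → δ ≤ 1 → 0 ≤ C ∧ ∀ (κ : ℝ) (c : ℂ)
      (Q : LatticeHomog.Freq d → LatticeHomog.Freq d → Matrix (Fin d) (Fin d) ℂ)
      (A : Matrix (Fin d) (Fin d) ℂ) (D : LatticeHomog.Lattice d → ℂ),
      LatticeHomog.IsSymbolRep γ α₀ C₀ (4 * C₁ * (2 * d + 1)) (1 / K' / 4) (d * K' + C₁) αd Cd
        κ c Q A D → ∀ j x y,
      LatticeHomog.latNorm x + 1 ≤ 2 * (LatticeHomog.latNorm (x + y) + 1) →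
      ‖LatticeHomog.fwdDiff j D (x + y) - LatticeHomog.fwdDiff j D x‖ ≤
        ‖c‖ * (C * (LatticeHomog.latNorm y ^ (1 - δ) * (LatticeHomog.latNorm x + 1) ^
          (-((d : ℝ) - δ + LatticeHomog.decayGain α₀ αd δ)))) *
        Real.exp (-(γ / 4) * κ * LatticeHomog.latNorm x) := by
    -- The constant is chosen as a function on all of ℝ, with the default 0 outside (0, 1].
    intro δ
    by_cases h : 0 < δ ∧ δ ≤ 1
    · obtain ⟨C, h0, h1⟩ := LatticeHomog.exists_norm_fwdDiff_sub_le hd0 hrc h.1 h.2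
      exact ⟨C, fun _ _ => ⟨h0, h1⟩⟩
    · exact ⟨0, fun h0 h1 => absurd ⟨h0, h1⟩ h⟩
  choose Cs hs using hsnd
  -- The first two estimates use the gain at δ = 1. The rate γ/4 is imposed by the third, the factor
  -- d comes from bounding a vector by its components, and adding 1 makes the constants strictly
  -- positive.
  refine ⟨LatticeHomog.decayGain α₀ αd 1, γ / 4, Cv + d * Cf + 1, LatticeHomog.decayGain α₀ αd,
    fun δ => d * Cs δ + 1, LatticeHomog.decayGain_pos hα₀ hαd one_pos le_rfl,
    (LatticeHomog.decayGain_le_left 1).trans hα₀', by positivity, by positivity, ?_, ?_⟩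
  · intro δ h0 h1
    have hC := (hs δ h0 h1).1
    refine ⟨LatticeHomog.decayGain_pos hα₀ hαd h0 h1, ?_, by positivity⟩
    linarith [LatticeHomog.decayGain_le (α₀ := α₀) (αd := αd) δ]
  intro E hE hF
  have hEK : E.Lam / E.lam = K' := by
    rw [hE, hK', max_eq_left (E.one_le_ratio (by omega) hE)]
  obtain ⟨aHom, hlim⟩ := hF.exists_tendsto hα₀ hC₁ hC₂
  refine ⟨aHom, hlim, fun η hη hη1 => ?_⟩
  have hrep := hF.isSymbolRep (by omega) hEK hα₀ hα₀' hC₁ hC₂ hC₀ hCd hlim hγ hη hη1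
  have hL := E.Lam_pos
  have hpre := E.norm_prefactor_le
  set κ := Real.sqrt (η / E.Lam) with hκ
  have hκ0 : 0 ≤ κ := Real.sqrt_nonneg _
  have hexp : ∀ x : LatticeHomog.Lattice d, Real.exp (-γ * κ * LatticeHomog.latNorm x) ≤
      Real.exp (-(γ / 4) * κ * LatticeHomog.latNorm x) := fun x => by
    refine Real.exp_le_exp.2 ?_
    have : 0 ≤ γ * (κ * LatticeHomog.latNorm x) :=
      mul_nonneg hγ0.le (mul_nonneg hκ0 (LatticeHomog.latNorm_nonneg x))
    nlinarith
  refine ⟨fun h2 x => ?_, fun x => ?_, fun δ hδ hδ1 x x' hx1 _ => ?_⟩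
  · have hx := LatticeHomog.latNorm_nonneg x
    refine (hv h2 _ _ _ _ _ hrep x).trans ?_
    refine le_trans (mul_le_mul_of_nonneg_left (hexp x) (by positivity)) ?_
    exact LatticeHomog.mul_rpow_neg_le hx hL hpre hCv
      (by linarith [mul_nonneg (by linarith : (0:ℝ) ≤ d) hCf]) (Real.exp_pos _).le
  · have hx := LatticeHomog.latNorm_nonneg x
    refine (LatticeHomog.norm_le_mul_of_forall_le (by positivity)
      fun j => (hf _ _ _ _ _ hrep j x).trans
        (mul_le_mul_of_nonneg_left (hexp x) (by positivity))).trans ?_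
    refine le_trans (le_of_eq ?_) (LatticeHomog.mul_rpow_neg_le (C := d * Cf) hx hL hpre
      (by positivity) (by linarith) (Real.exp_pos _).le)
    ring
  · have hx := LatticeHomog.latNorm_nonneg x
    obtain ⟨hC, hb⟩ := hs δ hδ hδ1
    have hy := LatticeHomog.latNorm_nonneg (x' - x)
    have hxx : x + (x' - x) = x' := by abel
    have hx2 : LatticeHomog.latNorm x + 1 ≤ 2 * (LatticeHomog.latNorm (x + (x' - x)) + 1) := by
      rw [hxx]
      rw [le_div_iff₀ (by linarith)] at hx1
      linarith
    refine (LatticeHomog.norm_le_mul_of_forall_le (by positivity) fun j => ?_).trans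
      (b := d * (‖E.prefactor‖ * (Cs δ * (LatticeHomog.latNorm (x' - x) ^ (1 - δ) *
        (LatticeHomog.latNorm x + 1) ^ (-((d : ℝ) - δ + LatticeHomog.decayGain α₀ αd δ)))) *
        Real.exp (-(γ / 4) * κ * LatticeHomog.latNorm x))) ?_
    · have := hb _ _ _ _ _ hrep j x (x' - x) hx2
      rw [hxx] at this
      exact this
    · have := LatticeHomog.mul_rpow_neg_le (C := d * Cs δ) (C' := d * Cs δ + 1)
        (p := (d : ℝ) - δ + LatticeHomog.decayGain α₀ αd δ) hx hL hpre
        (by positivity) (by linarith) (Real.exp_pos (-(γ / 4) * κ * LatticeHomog.latNorm x)).le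
      have h2 := mul_le_mul_of_nonneg_left this (Real.rpow_nonneg hy (1 - δ))
      refine le_trans (le_of_eq ?_) (h2.trans (le_of_eq ?_)) <;> ring
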